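/- Let $\mathcal S$ be a finite set of sorts, $\Gamma$ a fixed finite $\mathcal S$-sorted signature (each symbol $f$ has a type $p_1\cdots p_n q$ with $p_i,q\in\mathcal S$, $n\ge 0$), and $\mathcal A=((A_p)_{p\in\mathcal S},(f^{\mathcal A})_{f\in\Gamma})$ a fixed $\Gamma$-algebra with non-empty carriers. A context of sort $(p,q)$ over a finite set $\mathcal Y$ of sorted auxiliary variables is a term $s\neq x$ of sort $q$ over $\Gamma$ and $\mathcal Y\cup\{x\}$, in which the main variable $x\notin\mathcal Y$, of sort $p$, occurs exactly once. Two such contexts $s,t$ over the same $\mathcal Y$ are equivalent in $\mathcal A$ if for every substitution $\eta$ of ground terms for the variables in $\mathcal Y$ the terms $\eta(s)$ and $\eta(t)$ define the same function $A_p\to A_q$ of $x$. A context $t$ over $\mathcal Z$ subsumes a context $s$ over $\mathcal Y$ of the same sort if there is a substitution $\zeta$ of terms over $\Gamma$ and $\mathcal Y$ for the variables in $\mathcal Z$ such that $s$ and $\zeta(t)$ are equivalent in $\mathcal A$. A subsumption base of $\mathcal A$ is a set $C$ of contexts such that every context is subsumed by a member of $C$. Assume that $\mathcal A$ has a finite subsumption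 base. A $\Gamma$-SLP $\mathcal G=(\mathcal V,\rho,S)$ consists of a finite set $\mathcal V$ of sorted variables, a start variable $S\in\mathcal V$, and a right-hand side $\rho(X)$ for every $X\in\mathcal V$, which is a term over $\Gamma$ and $\mathcal V$ of the same sort as $X$, such that the relation "$Y$ occurs in $\rho(X)$" is acyclic. Its derivation tree $[\![\mathcal G]\!]$ is the ground term obtained from $S$ by replacing variables by their right-hand sides as long as possible, and $[\![\mathcal G]\!]^{\mathcal A}$ is the value of this term in $\mathcal A$. The size $|t|$ of a term is the number of edges of its tree, $|\mathcal G|=\sum_{X\in\mathcal V}|\rho(X)|$, and $\mathrm{depth}(\mathcal G)$ is the depth of the tree $[\![\mathcal G]\!]$. Then there are a program for a random access machine and a constant $c$, depending only on $\Gamma$ (with a numbering of its symbols) and $\mathcal A$, such that for every $\Gamma$-SLP $\mathcal G=(\mathcal V,\rho,S)$ with derivation tree $t$ the program computes from $\mathcal G$ a $\Gamma$-SLP $\mathcal H$ with $$[\![\mathcal H]\!]^{\mathcal A}=[\![\mathcal G]\!]^{\mathcal A},\qquad |\mathcal H|\le c\,|\mathcal G|,\qquad \mathrm{depth}(\mathcal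 H)\le c\,\lfloor\log_2(|t|+2)\rfloor$$ in at most $c\,(|\mathcal G|+|\mathcal V|)$ steps, i.e. in linear time. (If every variable is reachable from $S$ and no right-hand side is a single variable, then $|\mathcal V|\le|\mathcal G|+1$, and the time is $\mathcal O(|\mathcal G|+1)$.) Here an SLP is given as the sequence of numbers that consists of $|\mathcal V|$, the number of $S$, and the right-hand sides of all variables in prefix notation; one step of the machine is an arithmetic operation ($+,-,\cdot,\div$), comparison, or memory access on natural numbers, and all numbers that occur in the computation are at most $c\,(|t|+|\mathcal G|+|\mathcal V|)$. -/

import Mathlib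

namespace CircuitBalancing

universe u v w

/-! ### Multi-sorted signatures, terms and algebras -/

/-- A signature with set of sorts `S`: the symbol `f` has rank `rank f` and type
`dom f 0, …, dom f (rank f - 1), cod f`. -/
structure Signature (S : Type u) where
  Symb : Type v
  rank : Symb → ℕ
  dom : (f : Symb) → Fin (rank f) → S
  cod : Symb → S

/-- Terms over `Γ` with variables `ι`, the variable `i` having sort `σ i`; the index of the
family is the sort of the term. -/
inductive Term {S : Type u} (Γ : Signature.{u, v} S) {ι : Type} (σ : ι → S) : S → Type (max u v)
  | var (i : ι) : Term Γ σ (σ i)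
  | op (f : Γ.Symb) (args : (j : Fin (Γ.rank f)) → Term Γ σ (Γ.dom f j)) : Term Γ σ (Γ.cod f)

/-- The empty set of variables. -/
abbrev noVars (S : Type u) : Fin 0 → S := fun i => i.elim0

/-- Ground terms of sort `p`. -/
abbrev GroundTerm {S : Type u} (Γ : Signature.{u, v} S) (p : S) : Type (max u v) :=
  Term Γ (noVars S) p

/-- A `Γ`-algebra. -/
structure SortedAlgebra {S : Type u} (Γ : Signature.{u, v} S) where
  carrier : S → Type w
  nonempty : ∀ p, Nonempty (carrier p)
  op : (f : Γ.Symb) → ((j : Fin (Γ.rank f)) → carrier (Γ.dom f j)) → carrier (Γ.cod f)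

namespace Term

variable {S : Type u} {Γ : Signature.{u, v} S} {ι κ : Type} {σ : ι → S} {τ : κ → S}

/-- The size of a term: the number of edges of the tree. -/
def size : {p : S} → Term Γ σ p → ℕ
  | _, var _ => 0
  | _, op f args => Γ.rank f + ∑ j, (args j).size

/-- The depth of a term: the maximal number of edges on a path from the root to a leaf. -/
def depth : {p : S} → Term Γ σ p → ℕ
  | _, var _ => 0
  | _, op _ args => Finset.univ.sup fun j => 1 + (args j).depth

/-- The number of occurrences of the variable `i`. -/
def count [DecidableEq ι] (i : ι) : {p : S} → Term Γ σ p → ℕ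
  | _, var k => if i = k then 1 else 0
  | _, op _ args => ∑ j, (args j).count i

/-- The variable `i` occurs in the term. -/
def Occurs (i : ι) : {p : S} → Term Γ σ p → Prop
  | _, var k => i = k
  | _, op _ args => ∃ j, (args j).Occurs i

/-- The term is a variable. -/
def IsVar : {p : S} → Term Γ σ p → Prop
  | _, var _ => True
  | _, op _ _ => False

/-- The simultaneous substitution of `η i` for every variable `i`. -/
def subst (η : (i : ι) → Term Γ τ (σ i)) : {p : S} → Term Γ σ p → Term Γ τ p
  | _, var i => η i
  | _, op f args => op f fun j => (args j).subst η

/-- Substitution, where the image `η i` is needed only for the variables that occur. -/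
def substOn : {p : S} → (t : Term Γ σ p) → ((i : ι) → t.Occurs i → Term Γ τ (σ i)) → Term Γ τ p
  | _, var i, η => η i rfl
  | _, op f args, η => op f fun j => (args j).substOn fun i hi => η i ⟨j, hi⟩

theorem substOn_eq_subst (η : (i : ι) → Term Γ τ (σ i)) {p : S} (t : Term Γ σ p) :
    (t.substOn fun i _ => η i) = t.subst η := by
  induction t with
  | var i => rfl
  | op f args ih => simp only [substOn, subst, ih]

/-- The value of a term in an algebra under an assignment of its variables. -/
def eval (A : SortedAlgebra.{u, v, w} Γ) (a : (i : ι) → A.carrier (σ i)) :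
    {p : S} → Term Γ σ p → A.carrier p
  | _, var i => a i
  | _, op f args => A.op f fun j => (args j).eval A a

/-- The value of a ground term in an algebra. -/
def groundEval (A : SortedAlgebra.{u, v, w} Γ) {p : S} (t : GroundTerm Γ p) : A.carrier p :=
  t.eval A fun i => i.elim0

/-- Serialization in Polish (prefix) notation over the natural numbers; the symbols are numbered
from `0` to `k - 1`, and the variable number `i` is written as `k + i`. -/
def tokens {n k : ℕ} {ρ : Fin n → S} (code : Γ.Symb ≃ Fin k) :
    {p : S} → Term Γ ρ p → List ℕ
  | _, var i => [k + (i : ℕ)]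
  | _, op f args => (code f : ℕ) :: (List.ofFn fun j => (args j).tokens code).flatten

end Term

/-! ### Contexts and subsumption -/

section Contexts

variable {S : Type u} {Γ : Signature.{u, v} S}

/-- The variables `σ` together with a fresh variable `none` of sort `p`. -/
abbrev extend {ι : Type} (σ : ι → S) (p : S) : Option ι → S
  | none => p
  | some i => σ i

/-- Contexts with auxiliary variables `σ` and main variable `none`, which has sort `p`: terms of
sort `q` that differ from the main variable and contain it exactly once. -/
structure Context (Γ : Signature.{u, v} S) {ι : Type} [DecidableEq ι] (σ : ι → S) (p q : S) where
  term : Term Γ (extend σ p) q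
  not_var : ¬ term.IsVar
  linear : term.count none = 1

/-- A substitution of the auxiliary variables, extended to the main variable by the identity. -/
def liftSubst {ι κ : Type} {σ : ι → S} {τ : κ → S} (p : S) (η : (i : ι) → Term Γ τ (σ i)) :
    (o : Option ι) → Term Γ (extend τ p) (extend σ p o)
  | none => Term.var (σ := extend τ p) none
  | some i => (η i).subst fun k => Term.var (σ := extend τ p) (some k)

/-- The function `A_p → A_q` that is defined by a term whose only variable is the main variable
(the unary linear term function, if the term is a ground context). -/
def termFun (A : SortedAlgebra.{u, v, w} Γ) {p q : S} (t : Term Γ (extend (noVars S) p) q) :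
    A.carrier p → A.carrier q :=
  fun a => t.eval A fun
    | none => a
    | some i => i.elim0

/-- Equivalence in `A`: the same function under every ground substitution of the auxiliary
variables. -/
def EquivIn (A : SortedAlgebra.{u, v, w} Γ) {ι : Type} {σ : ι → S} {p q : S}
    (s t : Term Γ (extend σ p) q) : Prop :=
  ∀ η : (i : ι) → GroundTerm Γ (σ i),
    termFun A (s.subst (liftSubst p η)) = termFun A (t.subst (liftSubst p η))

/-- The context `t` subsumes the context `s` in `A`: some substitution of the auxiliary variables
of `t` by terms in the auxiliary variables of `s` makes `t` equivalent to `s`. -/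
def Subsumes (A : SortedAlgebra.{u, v, w} Γ) {ι κ : Type} [DecidableEq ι] [DecidableEq κ]
    {σ : ι → S} {τ : κ → S} {p q : S} (t : Context Γ τ p q) (s : Context Γ σ p q) : Prop :=
  ∃ ζ : (k : κ) → Term Γ σ (τ k), EquivIn A s.term (t.term.subst (liftSubst p ζ))

/-- A context together with its finite set of sorted auxiliary variables. -/
structure AnyContext (Γ : Signature.{u, v} S) (p q : S) where
  numVars : ℕ
  sort : Fin numVars → S
  context : Context Γ sort p q

/-- `C p q` collects the members of sort `(p, q)` of a set of contexts; this set is a subsumption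
base of `A` if every context is subsumed by a member. -/
def IsSubsumptionBase (A : SortedAlgebra.{u, v, w} Γ) (C : (p q : S) → Set (AnyContext Γ p q)) :
    Prop :=
  ∀ (p q : S) (s : AnyContext Γ p q), ∃ t ∈ C p q, Subsumes A t.context s.context

/-- There is a finite subsumption base (the set of sorts being finite). -/
def HasFiniteSubsumptionBase (A : SortedAlgebra.{u, v, w} Γ) : Prop :=
  ∃ C : (p q : S) → Set (AnyContext Γ p q), (∀ p q, (C p q).Finite) ∧ IsSubsumptionBase A C

end Contexts

/-! ### Straight-line programs -/

/-- A `Γ`-SLP with variables `0, …, card - 1`; right-hand sides are arbitrary terms of the right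
sort. -/
structure SLP {S : Type u} (Γ : Signature.{u, v} S) where
  card : ℕ
  sort : Fin card → S
  rhs : (X : Fin card) → Term Γ sort (sort X)
  start : Fin card
  acyclic : ∀ X, ¬ Relation.TransGen (fun Y Z => (rhs Y).Occurs Z) X X

namespace SLP

variable {S : Type u} {Γ : Signature.{u, v} S} (G : SLP Γ)

theorem wellFounded : WellFounded fun Z Y => (G.rhs Y).Occurs Z := by
  let R : Fin G.card → Fin G.card → Prop :=
    fun Z Y => Relation.TransGen (fun Y Z => (G.rhs Y).Occurs Z) Y Z
  have : IsTrans _ R := ⟨fun _ _ _ h₁ h₂ => Relation.TransGen.trans h₂ h₁⟩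
  have : Std.Irrefl R := ⟨G.acyclic⟩
  exact Subrelation.wf (fun h => Relation.TransGen.single h)
    (Finite.wellFounded_of_trans_of_irrefl R)

/-- The ground term derived from a variable. -/
def val : (X : Fin G.card) → GroundTerm Γ (G.sort X) :=
  G.wellFounded.fix fun X ih => (G.rhs X).substOn ih

theorem val_eq (X : Fin G.card) : G.val X = (G.rhs X).subst G.val := by
  rw [val, WellFounded.fix_eq, Term.substOn_eq_subst]

/-- The derivation tree: the ground term derived from the start variable. -/
def derivationTree : GroundTerm Γ (G.sort G.start) := G.val G.start

/-- The size: the sum of the sizes of the right-hand sides. -/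
def size : ℕ := ∑ X, (G.rhs X).size

/-- The depth: the depth of the derivation tree. -/
def depth : ℕ := G.derivationTree.depth

/-- The element of `A`, with its sort, to which the program evaluates. -/
def value (A : SortedAlgebra.{u, v, w} Γ) : Σ p, A.carrier p :=
  ⟨G.sort G.start, G.derivationTree.groundEval A⟩

/-- The program as a sequence of numbers: the number of variables, the start variable, and the
right-hand sides of all variables, one after the other. -/
def encode {k : ℕ} (code : Γ.Symb ≃ Fin k) : List ℕ :=
  G.card :: (G.start : ℕ) :: (List.ofFn fun X => (G.rhs X).tokens code).flatten

end SLP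

/-! ### Random access machines

Programs work on registers and on finitely many random access memories ("arrays"), all of them
holding natural numbers up to a bound `B`, the largest machine word. Every operation on words
takes one unit of time. Several arrays can be interleaved in a single memory at the cost of a
constant factor. -/

namespace RAM

/-- The contents of the registers, and of the cells of the arrays. -/
structure State where
  reg : ℕ → ℕ
  mem : ℕ → ℕ → ℕ

/-- The arithmetic operations on words (subtraction is truncated, and division rounds down). -/
inductive Arith
  | add | sub | mul | div

def Arith.apply : Arith → ℕ → ℕ → ℕ
  | add, x, y => x + y
  | sub, x, y => x - y
  | mul, x, y => x * y
  | div, x, y => x / y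

/-- Expressions: constants, registers, the cell of array `a` whose address is the value of an
expression, and arithmetic operations. -/
inductive Expr
  | const (c : ℕ)
  | reg (r : ℕ)
  | load (a : ℕ) (addr : Expr)
  | arith (o : Arith) (e₁ e₂ : Expr)

namespace Expr

def eval (s : State) : Expr → ℕ
  | const c => c
  | reg r => s.reg r
  | load a e => s.mem a (e.eval s)
  | arith o e₁ e₂ => o.apply (e₁.eval s) (e₂.eval s)

/-- The number of steps of the evaluation. -/
def cost : Expr → ℕ
  | const _ => 1
  | reg _ => 1
  | load _ e => e.cost + 1
  | arith _ e₁ e₂ => e₁.cost + e₂.cost + 1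

/-- All values that arise in the evaluation are at most `B`. -/
def Fits (B : ℕ) (s : State) : Expr → Prop
  | const c => c ≤ B
  | reg r => s.reg r ≤ B
  | load a e => e.Fits B s ∧ s.mem a (e.eval s) ≤ B
  | arith o e₁ e₂ => e₁.Fits B s ∧ e₂.Fits B s ∧ o.apply (e₁.eval s) (e₂.eval s) ≤ B

end Expr

/-- Programs. The tests of `branch` and `loop` ask whether the first expression is smaller than
the second one. -/
inductive Program
  | skip
  | assign (r : ℕ) (e : Expr)
  | store (a : ℕ) (addr e : Expr)
  | seq (P Q : Program)
  | branch (e₁ e₂ : Expr) (P Q : Program)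
  | loop (e₁ e₂ : Expr) (P : Program)

/-- `Exec B P s T s'`: the program `P`, started in state `s`, halts after `T` steps in state `s'`,
and all numbers that it handles are at most `B`. -/
inductive Exec (B : ℕ) : Program → State → ℕ → State → Prop
  | skip (s : State) : Exec B .skip s 1 s
  | assign (s : State) (r : ℕ) (e : Expr) (h : e.Fits B s) :
      Exec B (.assign r e) s (e.cost + 1) ⟨Function.update s.reg r (e.eval s), s.mem⟩
  | store (s : State) (a : ℕ) (addr e : Expr) (h₁ : addr.Fits B s) (h₂ : e.Fits B s) :
      Exec B (.store a addr e) s (addr.cost + e.cost + 1)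
        ⟨s.reg, Function.update s.mem a (Function.update (s.mem a) (addr.eval s) (e.eval s))⟩
  | seq {P Q : Program} {s₀ s₁ s₂ : State} {T₁ T₂ : ℕ}
      (hP : Exec B P s₀ T₁ s₁) (hQ : Exec B Q s₁ T₂ s₂) : Exec B (.seq P Q) s₀ (T₁ + T₂) s₂
  | branch_true {P Q : Program} {s s' : State} {T : ℕ} {e₁ e₂ : Expr}
      (h₁ : e₁.Fits B s) (h₂ : e₂.Fits B s) (h : e₁.eval s < e₂.eval s) (hP : Exec B P s T s') :
      Exec B (.branch e₁ e₂ P Q) s (e₁.cost + e₂.cost + 1 + T) s'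
  | branch_false {P Q : Program} {s s' : State} {T : ℕ} {e₁ e₂ : Expr}
      (h₁ : e₁.Fits B s) (h₂ : e₂.Fits B s) (h : ¬ e₁.eval s < e₂.eval s) (hQ : Exec B Q s T s') :
      Exec B (.branch e₁ e₂ P Q) s (e₁.cost + e₂.cost + 1 + T) s'
  | loop_true {P : Program} {s₀ s₁ s₂ : State} {T₁ T₂ : ℕ} {e₁ e₂ : Expr}
      (h₁ : e₁.Fits B s₀) (h₂ : e₂.Fits B s₀) (h : e₁.eval s₀ < e₂.eval s₀)
      (hP : Exec B P s₀ T₁ s₁) (hL : Exec B (.loop e₁ e₂ P) s₁ T₂ s₂) :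
      Exec B (.loop e₁ e₂ P) s₀ (e₁.cost + e₂.cost + 1 + T₁ + T₂) s₂
  | loop_false {P : Program} {s : State} {e₁ e₂ : Expr}
      (h₁ : e₁.Fits B s) (h₂ : e₂.Fits B s) (h : ¬ e₁.eval s < e₂.eval s) :
      Exec B (.loop e₁ e₂ P) s (e₁.cost + e₂.cost + 1) s

/-- The initial state: the input is in array `0`, and everything else is `0`. -/
def State.init (input : List ℕ) : State where
  reg _ := 0
  mem a i := if a = 0 then input.getD i 0 else 0

/-- The sequence `output` is in array `1`, from cell `0` on. -/
def State.Outputs (s : State) (output : List ℕ) : Prop :=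
  ∀ (i : ℕ) (h : i < output.length), s.mem 1 i = output[i]

end RAM

end CircuitBalancing

open CircuitBalancing

/-!
# Balancing straight-line programs in linear time

*The graph.* The input is parsed in linear time. Its nodes are the occurrences of subterms in the
right-hand sides, i.e. the positions of the token sequence (`SLP.source`). A variable is linked to
its right-hand side, the nodes are sorted topologically, and from the leaves upwards every variable
is replaced by the symbol that it stands for. The result is an acyclic graph with ordered edges that
unfolds into the derivation tree `t` (`SLP.IsResolved.dag`).

*The decomposition.* Let `μ u` be the size of the unfolding from the node `u`, and `paths u` the
number of occurrences of `u` in `t`, with binary logarithms `nl u` and `pl u` (rounded down). From a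
node to a child, `nl` cannot increase and `pl` cannot decrease. An edge is *central* if both stay
the same (`Dag.SC`). A node has at most one central child, since two of them would together be
larger than the node, and, for the dual reason, at most one central parent. So the central edges
form disjoint paths. Since `nl` and `log |t| - pl` lie between `0` and `log |t|`, there are at most
`2 * log |t|` other edges on every branch of `t`.

*Balancing a path.* A path of central edges composes unary contexts, one for each node, and can be
evaluated by a binary tree whose leaves are these contexts (`MTree`). A leaf should have small depth
if the context of its node `u` is deep, which depends on the children of `u` outside the path, or if
the value of `u` is used from outside the path. So `u` gets the weight `max (E u * 2 ^ nl u) (X u *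
2 ^ pl u)`, where `E u` is the maximum of `2 ^ pl` over the non-central parents of `u`, and `X u`
the maximum of `2 ^ nl` over its non-central children. Along a path, `E` adds up to at most the
number of occurrences of its last node, and `X` to at most the size of its first node, so that the
total weight is `O(2 ^ (nl + pl))` with the common values of `nl` and `pl` (`MTree.lev_lt`). A tree
in which a leaf with weight `2 ^ i` has depth `3 * (nl + pl - i) + O(1)` is therefore possible, and
the depths in successive paths telescope to `O(log |t|)` (`Plan.DepthLe.value_le`).

*The merging.* Such a tree is found by a stack of trees, in which the levels increase towards the
bottom (`MTree.Merging`). Two trees of the same level are merged into one of the next level, as in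
a binary counter, and trees of smaller level are merged before a leaf of larger level is pushed.
Every merge creates the instruction for a slot that was empty before, so the running time is linear
by amortization (`RAM.amort_mergeLoop`, `RAM.amort_mergePaths`). The machine needs no logarithms:
it stores powers of two, which are maintained by comparisons and additions (`Dag.fl_add`).

*Contexts and the subsumption base.* A straight-line program cannot name contexts. But every context
arises from a member of the finite base by a substitution of ground terms for its at most `m + 1`
auxiliary variables, and so it is represented by the name of this member together with a *bundle* of
`m + 1` ground terms. If two represented contexts are composed, then the composition of the two
members of the base is subsumed by a third one, and the bundle for it is given by terms in the
variables of the given bundles. Hence finitely many *templates* (`Template`) suffice for building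
contexts from symbols, composing them, and applying them to values. An instruction consists of the
number of a template and of the slots of its arguments, and each slot becomes `m + 1` variables of
the balanced program (`Labelling.exists_slp`), which is written out by `RAM.emitAll`.
-/

namespace CircuitBalancing

universe u v w

/-! ### Reasoning about random access programs -/

namespace RAM

/-- The registers of the balancing program. -/
inductive Reg
  | len | idx | card | pend | cur | nxt | tk | deg | root | head | tail | val | pow | act | lim
  | thr | lev | beg | slot | ty | prv | out | tmp | ofs

/-- The number of a register. -/
def Reg.num : Reg → ℕ
  | len => 0 | idx => 1 | card => 2 | pend => 3 | cur => 4 | nxt => 5 | tk => 6 | deg => 7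
  | root => 8 | head => 9 | tail => 10 | val => 11 | pow => 12 | act => 13 | lim => 14
  | thr => 15 | lev => 16 | beg => 17 | slot => 18 | ty => 19 | prv => 20 | out => 21
  | tmp => 22 | ofs => 23

theorem Reg.num_injective : Function.Injective Reg.num := by
  intro a b h
  cases a <;> cases b <;> first | rfl | (exact absurd h (by decide))

/-- The arrays of the balancing program. There is one array per argument position for the children
of the nodes and for the arguments of the instructions. -/
inductive Arr
  | tok | out | rank | tyOf | fin | deg | root | ind | queue | rep | pi | pp | n | pn | ent | ext
  | nx | pv | bBeg | bLev | bSlot | bTy | tid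
  | ch (j : ℕ) | arg (j : ℕ)

/-- The number of an array. -/
def Arr.num : Arr → ℕ
  | tok => 0 | out => 1 | rank => 2 | tyOf => 3 | fin => 4 | deg => 5 | root => 6 | ind => 7
  | queue => 8 | rep => 9 | pi => 10 | pp => 11 | n => 12 | pn => 13 | ent => 14 | ext => 15
  | nx => 16 | pv => 17 | bBeg => 18 | bLev => 19 | bSlot => 20 | bTy => 21 | tid => 22
  | ch j => 30 + 2 * j | arg j => 31 + 2 * j

theorem Arr.num_injective : Function.Injective Arr.num := by
  intro a b h
  cases a <;> cases b <;> first
    | rfl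
    | (simp only [Arr.num] at h; exfalso; omega)
    | (simp only [Arr.num] at h; congr 1; omega)

namespace State

/-- The contents of a register. -/
def r (s : State) (x : Reg) : ℕ := s.reg x.num

/-- The contents of an array. -/
def m (s : State) (a : Arr) : ℕ → ℕ := s.mem a.num

/-- The state after an assignment to a register. -/
def setR (s : State) (x : Reg) (v : ℕ) : State := ⟨Function.update s.reg x.num v, s.mem⟩

/-- The state after an assignment to a cell of an array. -/
def setM (s : State) (a : Arr) (i v : ℕ) : State :=
  ⟨s.reg, Function.update s.mem a.num (Function.update (s.mem a.num) i v)⟩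

@[simp] theorem r_setR_same (s : State) (x : Reg) (v : ℕ) : (s.setR x v).r x = v := by
  simp [r, setR]

@[simp] theorem r_setR_ne (s : State) {x y : Reg} (v : ℕ) (h : y ≠ x) :
    (s.setR x v).r y = s.r y := by
  simp [r, setR, Function.update_of_ne (fun e => h (Reg.num_injective e))]

@[simp] theorem m_setR (s : State) (x : Reg) (v : ℕ) : (s.setR x v).m = s.m := rfl

@[simp] theorem r_setM (s : State) (a : Arr) (i v : ℕ) :
    (s.setM a i v).r = s.r := rfl

@[simp] theorem m_setM_same (s : State) (a : Arr) (i v : ℕ) :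
    (s.setM a i v).m a = Function.update (s.m a) i v := by
  simp [m, setM]

@[simp] theorem m_setM_ne (s : State) {a b : Arr} (i v : ℕ) (h : b ≠ a) :
    (s.setM a i v).m b = s.m b := by
  simp [m, setM, Function.update_of_ne (fun e => h (Arr.num_injective e))]

/-- All words in the state are at most `V`. -/
def Bd (V : ℕ) (s : State) : Prop := (∀ x, s.reg x ≤ V) ∧ ∀ a i, s.mem a i ≤ V

theorem Bd.r {V : ℕ} {s : State} (h : s.Bd V) (x : Reg) : s.r x ≤ V := h.1 _

theorem Bd.m {V : ℕ} {s : State} (h : s.Bd V) (a : Arr) (i : ℕ) : s.m a i ≤ V := h.2 _ _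

end State

namespace Expr

instance : Add Expr := ⟨arith .add⟩
instance : Sub Expr := ⟨arith .sub⟩
instance : Mul Expr := ⟨arith .mul⟩

/-- A register as an expression. -/
def rd (x : Reg) : Expr := reg x.num

/-- A cell of an array as an expression. -/
def ld (a : Arr) (e : Expr) : Expr := load a.num e

variable (s : State) (V : ℕ)

@[simp] theorem eval_const (c : ℕ) : (const c).eval s = c := rfl
@[simp] theorem eval_rd (x : Reg) : (rd x).eval s = s.r x := rfl
@[simp] theorem eval_ld (a : Arr) (e : Expr) : (ld a e).eval s = s.m a (e.eval s) := rfl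
@[simp] theorem eval_add (e f : Expr) : (e + f).eval s = e.eval s + f.eval s := rfl
@[simp] theorem eval_sub (e f : Expr) : (e - f).eval s = e.eval s - f.eval s := rfl
@[simp] theorem eval_mul (e f : Expr) : (e * f).eval s = e.eval s * f.eval s := rfl

/-- All products in the evaluation are at most `V`, and there are no divisions. -/
def Tame (V : ℕ) (s : State) : Expr → Prop
  | const _ => True
  | reg _ => True
  | load _ e => e.Tame V s
  | arith .add e f => e.Tame V s ∧ f.Tame V s
  | arith .sub e f => e.Tame V s ∧ f.Tame V s
  | arith .mul e f => e.Tame V s ∧ f.Tame V s ∧ e.eval s * f.eval s ≤ V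
  | arith .div _ _ => False

@[simp] theorem tame_const (c : ℕ) : (const c).Tame V s := trivial
@[simp] theorem tame_rd (x : Reg) : (rd x).Tame V s := trivial
@[simp] theorem tame_ld (a : Arr) (e : Expr) : (ld a e).Tame V s ↔ e.Tame V s := Iff.rfl
@[simp] theorem tame_add (e f : Expr) : (e + f).Tame V s ↔ e.Tame V s ∧ f.Tame V s := Iff.rfl
@[simp] theorem tame_sub (e f : Expr) : (e - f).Tame V s ↔ e.Tame V s ∧ f.Tame V s := Iff.rfl
@[simp] theorem tame_mul (e f : Expr) :
    (e * f).Tame V s ↔ e.Tame V s ∧ f.Tame V s ∧ e.eval s * f.eval s ≤ V := Iff.rfl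

/-- A bound for the values that arise in the evaluation of a tame expression, relative to a bound
for the words in the state. -/
def coef : Expr → ℕ
  | const c => c
  | reg _ => 1
  | load _ e => e.coef + 1
  | arith _ e f => e.coef + f.coef + 1

variable {s V}

theorem eval_le_coef (hs : s.Bd V) {e : Expr} (h : e.Tame V s) : e.eval s ≤ e.coef * (V + 1) := by
  induction e with
  | const c => simpa [eval, coef] using Nat.le_mul_of_pos_right c (Nat.succ_pos V)
  | reg x => simpa [eval, coef] using (hs.1 x).trans (Nat.le_succ V)
  | load a e ih => have := hs.2 a (e.eval s); simp only [eval, coef]; nlinarith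
  | arith o e f ihe ihf =>
    cases o <;> simp only [eval, coef, Tame, Arith.apply] at h ⊢
    · nlinarith [ihe h.1, ihf h.2]
    · have := ihe h.1
      exact (Nat.sub_le _ _).trans (this.trans (Nat.mul_le_mul_right _ (by omega)))
    · nlinarith [h.2.2]

theorem Tame.fits (hs : s.Bd V) {B : ℕ} {e : Expr} (h : e.Tame V s)
    (hB : e.coef * (V + 1) ≤ B) : e.Fits B s := by
  induction e with
  | const c => exact (eval_le_coef hs h).trans hB
  | reg x => exact (eval_le_coef (e := reg x) hs h).trans hB
  | load a e ih =>
    exact ⟨ih h ((Nat.mul_le_mul_right _ (by simp [coef])).trans hB),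
      (eval_le_coef (e := load a e) hs h).trans hB⟩
  | arith o e f ihe ihf =>
    have h1 : e.coef * (V + 1) ≤ B :=
      (Nat.mul_le_mul_right _ (by simp only [coef]; omega)).trans hB
    have h2 : f.coef * (V + 1) ≤ B :=
      (Nat.mul_le_mul_right _ (by simp only [coef]; omega)).trans hB
    have h3 := (eval_le_coef (e := arith o e f) hs h).trans hB
    cases o <;> simp only [Tame] at h
    · exact ⟨ihe h.1 h1, ihf h.2 h2, h3⟩
    · exact ⟨ihe h.1 h1, ihf h.2 h2, h3⟩
    · exact ⟨ihe h.1 h1, ihf h.2.1 h2, h3⟩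

end Expr

namespace Program

open CircuitBalancing.RAM.Expr

/-- The assignment of a value to a register. -/
def set (x : Reg) (e : Expr) : Program := assign x.num e

/-- The assignment of a value to a cell of an array. -/
def put (a : Arr) (i e : Expr) : Program := store a.num i e

/-- The effect of a program without loops. -/
def run : Program → State → State
  | skip, s => s
  | assign r e, s => ⟨Function.update s.reg r (e.eval s), s.mem⟩
  | store a i e, s =>
    ⟨s.reg, Function.update s.mem a (Function.update (s.mem a) (i.eval s) (e.eval s))⟩
  | seq P Q, s => Q.run (P.run s)
  | branch e f P Q, s => if e.eval s < f.eval s then P.run s else Q.run s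
  | loop _ _ _, s => s

/-- The program has no loops, all expressions that it evaluates are tame, and the words that it
writes are at most `V`. -/
def Safe (V : ℕ) : Program → State → Prop
  | skip, _ => True
  | assign _ e, s => e.Tame V s ∧ e.eval s ≤ V
  | store _ i e, s => i.Tame V s ∧ e.Tame V s ∧ e.eval s ≤ V
  | seq P Q, s => P.Safe V s ∧ Q.Safe V (P.run s)
  | branch e f P Q, s => e.Tame V s ∧ f.Tame V s ∧
      (e.eval s < f.eval s → P.Safe V s) ∧ (¬ e.eval s < f.eval s → Q.Safe V s)
  | loop _ _ _, _ => False

/-- A bound for the number of steps of a program without loops, and of one iteration of a loop. -/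
def wcost : Program → ℕ
  | skip => 1
  | assign _ e => e.cost + 1
  | store _ i e => i.cost + e.cost + 1
  | seq P Q => P.wcost + Q.wcost
  | branch e f P Q => e.cost + f.cost + 1 + (P.wcost + Q.wcost)
  | loop e f P => P.wcost + e.cost + f.cost + 1

/-- The sum of the coefficients of all expressions in the program. -/
def coef : Program → ℕ
  | skip => 0
  | assign _ e => e.coef
  | store _ i e => i.coef + e.coef
  | seq P Q => P.coef + Q.coef
  | branch e f P Q => e.coef + f.coef + P.coef + Q.coef
  | loop e f P => e.coef + f.coef + P.coef

variable {B V : ℕ}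

/-- A safe program runs as `run` says, within its cost, and keeps all words at most `V`. The factor
`coef` bounds the intermediate results in the evaluation of expressions. -/
theorem Safe.exec {P : Program} {s : State} (h : P.Safe V s) (hs : s.Bd V)
    (hB : P.coef * (V + 1) ≤ B) :
    ∃ T ≤ P.wcost, Exec B P s T (P.run s) ∧ (P.run s).Bd V := by
  induction P generalizing s with
  | skip => exact ⟨1, le_rfl, .skip s, hs⟩
  | assign r e =>
    refine ⟨_, le_rfl, .assign s r e (h.1.fits hs hB), fun x => ?_, hs.2⟩
    by_cases hx : x = r
    · subst hx; simpa [run] using h.2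
    · simpa [run, hx] using hs.1 x
  | store a i e =>
    refine ⟨_, le_rfl, .store s a i e
      (h.1.fits hs ((Nat.mul_le_mul_right _ (by simp only [coef]; omega)).trans hB))
      (h.2.1.fits hs ((Nat.mul_le_mul_right _ (by simp only [coef]; omega)).trans hB)),
      hs.1, fun b j => ?_⟩
    by_cases hb : b = a
    · subst hb
      by_cases hj : j = i.eval s
      · subst hj; simpa [run] using h.2.2
      · simpa [run, hj] using hs.2 b j
    · simpa [run, hb] using hs.2 b j
  | seq P Q ihP ihQ =>
    obtain ⟨T, hT, hP, hs'⟩ := ihP h.1 hs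
      ((Nat.mul_le_mul_right _ (by simp only [coef]; omega)).trans hB)
    obtain ⟨T', hT', hQ, hs''⟩ := ihQ h.2 hs'
      ((Nat.mul_le_mul_right _ (by simp only [coef]; omega)).trans hB)
    exact ⟨_, Nat.add_le_add hT hT', .seq hP hQ, hs''⟩
  | branch e f P Q ihP ihQ =>
    obtain ⟨he, hf, h1, h2⟩ := h
    have he := he.fits hs ((Nat.mul_le_mul_right _ (by simp only [coef]; omega)).trans hB)
    have hf := hf.fits hs ((Nat.mul_le_mul_right _ (by simp only [coef]; omega)).trans hB)
    by_cases hc : e.eval s < f.eval s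
    · obtain ⟨T, hT, hP, hs'⟩ := ihP (h1 hc) hs
        ((Nat.mul_le_mul_right _ (by simp only [coef]; omega)).trans hB)
      refine ⟨_, ?_, by simpa only [run, if_pos hc] using .branch_true he hf hc hP,
        by simpa only [run, if_pos hc] using hs'⟩
      simp only [wcost]; omega
    · obtain ⟨T, hT, hQ, hs'⟩ := ihQ (h2 hc) hs
        ((Nat.mul_le_mul_right _ (by simp only [coef]; omega)).trans hB)
      refine ⟨_, ?_, by simpa only [run, if_neg hc] using .branch_false he hf hc hQ,
        by simpa only [run, if_neg hc] using hs'⟩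
      simp only [wcost]; omega
  | loop e f P ih => exact h.elim

/-- The program writes to the array. -/
def Writes (a : ℕ) : Program → Prop
  | skip => False
  | assign _ _ => False
  | store b _ _ => a = b
  | seq P Q => P.Writes a ∨ Q.Writes a
  | branch _ _ P Q => P.Writes a ∨ Q.Writes a
  | loop _ _ P => P.Writes a

@[simp] theorem writes_skip (a : ℕ) : ¬ skip.Writes a := id
@[simp] theorem writes_set (a : ℕ) (x : Reg) (e : Expr) : ¬ (set x e).Writes a := id
@[simp] theorem writes_put (a b : Arr) (i e : Expr) : (put b i e).Writes a.num ↔ a = b :=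
  Arr.num_injective.eq_iff
@[simp] theorem writes_seq (a : ℕ) (P Q : Program) :
    (seq P Q).Writes a ↔ P.Writes a ∨ Q.Writes a := Iff.rfl
@[simp] theorem writes_branch (a : ℕ) (e f : Expr) (P Q : Program) :
    (branch e f P Q).Writes a ↔ P.Writes a ∨ Q.Writes a := Iff.rfl
@[simp] theorem writes_loop (a : ℕ) (e f : Expr) (P : Program) :
    (loop e f P).Writes a ↔ P.Writes a := Iff.rfl

/-- The program assigns to the register. -/
def Sets (x : ℕ) : Program → Prop
  | skip => False
  | assign y _ => x = y
  | store _ _ _ => False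
  | seq P Q => P.Sets x ∨ Q.Sets x
  | branch _ _ P Q => P.Sets x ∨ Q.Sets x
  | loop _ _ P => P.Sets x

@[simp] theorem sets_skip (x : ℕ) : ¬ skip.Sets x := id
@[simp] theorem sets_set (x y : Reg) (e : Expr) : (set y e).Sets x.num ↔ x = y :=
  Reg.num_injective.eq_iff
@[simp] theorem sets_put (x : ℕ) (b : Arr) (i e : Expr) : ¬ (put b i e).Sets x := id
@[simp] theorem sets_seq (x : ℕ) (P Q : Program) :
    (seq P Q).Sets x ↔ P.Sets x ∨ Q.Sets x := Iff.rfl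
@[simp] theorem sets_branch (x : ℕ) (e f : Expr) (P Q : Program) :
    (branch e f P Q).Sets x ↔ P.Sets x ∨ Q.Sets x := Iff.rfl
@[simp] theorem sets_loop (x : ℕ) (e f : Expr) (P : Program) :
    (loop e f P).Sets x ↔ P.Sets x := Iff.rfl

theorem run_mem {P : Program} {a : ℕ} (h : ¬ P.Writes a) (s : State) :
    (P.run s).mem a = s.mem a := by
  induction P generalizing s with
  | skip => rfl
  | assign => rfl
  | store b i e => simp only [Writes] at h; simp [run, h]
  | seq P Q ihP ihQ =>
    simp only [Writes, not_or] at h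
    rw [run, ihQ h.2, ihP h.1]
  | branch e f P Q ihP ihQ =>
    simp only [Writes, not_or] at h
    rw [run]; split
    · exact ihP h.1 s
    · exact ihQ h.2 s
  | loop => rfl

theorem run_reg {P : Program} {x : ℕ} (h : ¬ P.Sets x) (s : State) :
    (P.run s).reg x = s.reg x := by
  induction P generalizing s with
  | skip => rfl
  | assign y e => simp only [Sets] at h; simp [run, h]
  | store => rfl
  | seq P Q ihP ihQ =>
    simp only [Sets, not_or] at h
    rw [run, ihQ h.2, ihP h.1]
  | branch e f P Q ihP ihQ =>
    simp only [Sets, not_or] at h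
    rw [run]; split
    · exact ihP h.1 s
    · exact ihQ h.2 s
  | loop => rfl

/-- The states differ only in registers and arrays to which the program writes. -/
def Frame (P : Program) (s s' : State) : Prop :=
  (∀ a : Arr, ¬ P.Writes a.num → s'.m a = s.m a) ∧ ∀ x : Reg, ¬ P.Sets x.num → s'.r x = s.r x

theorem Frame.refl (P : Program) (s : State) : P.Frame s s := ⟨fun _ _ => rfl, fun _ _ => rfl⟩

theorem Frame.trans {P P' R : Program} {s s' s'' : State} (h : P.Frame s s')
    (h' : P'.Frame s' s'') (hw : ∀ a, P.Writes a ∨ P'.Writes a → R.Writes a)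
    (hr : ∀ x, P.Sets x ∨ P'.Sets x → R.Sets x) : R.Frame s s'' :=
  ⟨fun a ha => (h'.1 a fun h => ha (hw _ (.inr h))).trans (h.1 a fun h => ha (hw _ (.inl h))),
    fun x hx => (h'.2 x fun h => hx (hr _ (.inr h))).trans (h.2 x fun h => hx (hr _ (.inl h)))⟩

/-- The program preserves the bound for the words in the state, ends in a state that satisfies `Q`,
and takes at most `t` steps. -/
def Reaches (B V : ℕ) (P : Program) (s : State) (t : ℕ) (Q : State → Prop) : Prop :=
  ∃ T ≤ t, ∃ s', Exec B P s T s' ∧ s'.Bd V ∧ Q s'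

/-- The program is safe, and `Q` holds for the final state. -/
def Sat (V : ℕ) (P : Program) (s : State) (Q : State → Prop) : Prop := P.Safe V s ∧ Q (P.run s)

theorem Sat.reaches {P : Program} {s : State} {Q : State → Prop} (h : P.Sat V s Q) (hs : s.Bd V)
    (hB : P.coef * (V + 1) ≤ B) : P.Reaches B V s P.wcost Q :=
  let ⟨T, hT, hE, hb⟩ := h.1.exec hs hB
  ⟨T, hT, _, hE, hb, h.2⟩

theorem Sat.mono {P : Program} {s : State} {Q R : State → Prop} (h : P.Sat V s Q)
    (hQ : ∀ s', Q s' → R s') : P.Sat V s R := ⟨h.1, hQ _ h.2⟩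

theorem Sat.frame {P : Program} {s : State} {Q : State → Prop} (h : P.Sat V s Q) :
    P.Sat V s fun s' => Q s' ∧ P.Frame s s' :=
  ⟨h.1, h.2, fun _ ha => run_mem ha s, fun _ hx => run_reg hx s⟩

@[simp] theorem sat_skip (s : State) (Q : State → Prop) : skip.Sat V s Q ↔ Q s := by
  simp [Sat, Safe, run]

@[simp] theorem sat_set (x : Reg) (e : Expr) (s : State) (Q : State → Prop) :
    (set x e).Sat V s Q ↔ e.Tame V s ∧ e.eval s ≤ V ∧ Q (s.setR x (e.eval s)) := by
  simp [Sat, Safe, run, set, State.setR, and_assoc]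

@[simp] theorem sat_put (a : Arr) (i e : Expr) (s : State) (Q : State → Prop) :
    (put a i e).Sat V s Q ↔
      i.Tame V s ∧ e.Tame V s ∧ e.eval s ≤ V ∧ Q (s.setM a (i.eval s) (e.eval s)) := by
  simp [Sat, Safe, run, put, State.setM, and_assoc]

@[simp] theorem sat_seq (P P' : Program) (s : State) (Q : State → Prop) :
    (seq P P').Sat V s Q ↔ P.Sat V s fun s' => P'.Sat V s' Q := by
  simp [Sat, Safe, run, and_assoc]

@[simp] theorem sat_branch (e f : Expr) (P P' : Program) (s : State) (Q : State → Prop) :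
    (branch e f P P').Sat V s Q ↔ e.Tame V s ∧ f.Tame V s ∧
      (e.eval s < f.eval s → P.Sat V s Q) ∧ (f.eval s ≤ e.eval s → P'.Sat V s Q) := by
  simp only [Sat, Safe, run, ← not_lt]
  by_cases h : e.eval s < f.eval s <;> simp [h, and_assoc]

/-- The sequence of the programs `body 0, …, body (n - 1)`. -/
def unroll (body : ℕ → Program) : ℕ → Program
  | 0 => skip
  | n + 1 => seq (unroll body n) (body n)

/-- A loop over the numbers that are smaller than the contents of the register `x`, which must be
at most `n`; it is unrolled. -/
def upTo (n : ℕ) (x : Reg) (body : ℕ → Program) : Program :=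
  unroll (fun j => branch (const j) (rd x) (body j) skip) n

@[simp] theorem writes_unroll {a : ℕ} {body : ℕ → Program} {n : ℕ} :
    (unroll body n).Writes a ↔ ∃ j < n, (body j).Writes a := by
  induction n with
  | zero => simp [unroll]
  | succ n ih => simp [unroll, ih, le_iff_lt_or_eq, or_and_right, exists_or]

@[simp] theorem writes_upTo {a : ℕ} {body : ℕ → Program} {n : ℕ} {x : Reg} :
    (upTo n x body).Writes a ↔ ∃ j < n, (body j).Writes a := by
  simp [upTo, writes_unroll, Writes]

@[simp] theorem sets_unroll {x : ℕ} {body : ℕ → Program} {n : ℕ} :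
    (unroll body n).Sets x ↔ ∃ j < n, (body j).Sets x := by
  induction n with
  | zero => simp [unroll]
  | succ n ih => simp [unroll, ih, le_iff_lt_or_eq, or_and_right, exists_or]

@[simp] theorem sets_upTo {x : ℕ} {body : ℕ → Program} {n : ℕ} {y : Reg} :
    (upTo n y body).Sets x ↔ ∃ j < n, (body j).Sets x := by
  simp [upTo, sets_unroll, Sets]

theorem sat_unroll {body : ℕ → Program} {n : ℕ} (I : ℕ → State → Prop) {s : State} (h0 : I 0 s)
    (h : ∀ j < n, ∀ s', (unroll body n).Frame s s' → I j s' → (body j).Sat V s' (I (j + 1))) :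
    (unroll body n).Sat V s fun s' => I n s' ∧ (unroll body n).Frame s s' := by
  refine Sat.frame ?_
  induction n with
  | zero => simpa [unroll] using h0
  | succ n ih =>
    rw [unroll, sat_seq]
    refine (ih fun j hj s' hf hI => h j (by omega) s' ?_ hI).frame.mono fun s' hs' =>
      h n (by omega) s' ?_ hs'.1
    · exact hf.trans (Frame.refl (unroll body n) s') (by simp +contextual [unroll])
        (by simp +contextual [unroll])
    · exact hs'.2.trans (Frame.refl (unroll body n) s') (by simp +contextual [unroll])
        (by simp +contextual [unroll])

theorem sat_upTo {body : ℕ → Program} {n d : ℕ} {x : Reg} (hd : d ≤ n) (I : ℕ → State → Prop)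
    {s : State} (hx : s.r x = d) (hb : ∀ j, ¬ (body j).Sets x.num) (h0 : I 0 s)
    (h : ∀ j < d, ∀ s', (upTo n x body).Frame s s' → I j s' → (body j).Sat V s' (I (j + 1))) :
    (upTo n x body).Sat V s fun s' => I d s' ∧ (upTo n x body).Frame s s' := by
  have := sat_unroll (V := V) (body := fun j => branch (const j) (rd x) (body j) skip) (n := n)
    (fun j s => I (min j d) s) (s := s) (by simpa using h0) (fun j _ s' hf hs => by
      have hxs : s'.r x = d := (hf.2 x (by simp [hb])).trans hx
      simp only [sat_branch, tame_const, tame_rd, eval_const, eval_rd, hxs, sat_skip, true_and]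
      refine ⟨fun hlt => ?_, fun hge => ?_⟩
      · rw [min_eq_left hlt]
        rw [min_eq_left hlt.le] at hs
        exact h j hlt s' hf hs
      · rw [min_eq_right (by omega)]
        rwa [min_eq_right hge] at hs)
  rwa [min_eq_right hd] at this

/-! ### Rules for programs with loops -/

theorem Reaches.mono {P : Program} {s : State} {t t' : ℕ} {Q R : State → Prop}
    (h : P.Reaches B V s t Q) (ht : t ≤ t') (hQ : ∀ s', s'.Bd V → Q s' → R s') :
    P.Reaches B V s t' R :=
  let ⟨T, hT, s', hE, hb, hq⟩ := h
  ⟨T, hT.trans ht, s', hE, hb, hQ _ hb hq⟩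

/-- The costs of two programs add up if both are linear in the same number. -/
theorem Reaches.seq' {P P' : Program} {s : State} {n : ℕ} {Q R : State → Prop}
    (h : P.Reaches B V s (P.wcost * (n + 1)) Q)
    (h' : ∀ s', s'.Bd V → Q s' → P'.Reaches B V s' (P'.wcost * (n + 1)) R) :
    (Program.seq P P').Reaches B V s ((Program.seq P P').wcost * (n + 1)) R :=
  let ⟨_, hT, _, hE, hb, hq⟩ := h
  let ⟨_, hT', s', hE', hb', hq'⟩ := h' _ hb hq
  ⟨_, by rw [wcost, add_mul]; exact Nat.add_le_add hT hT', s', .seq hE hE', hb', hq'⟩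

theorem Sat.reaches' {P : Program} {s : State} {Q : State → Prop} (h : P.Sat V s Q)
    (hs : s.Bd V) (hB : P.coef * (V + 1) ≤ B) (n : ℕ) :
    P.Reaches B V s (P.wcost * (n + 1)) Q :=
  let ⟨T, hT, hE, hb⟩ := h.1.exec hs hB
  ⟨T, hT.trans (Nat.le_mul_of_pos_right _ (Nat.succ_pos n)), _, hE, hb, h.2⟩

theorem coef_seq_left {P Q : Program} (h : (Program.seq P Q).coef * (V + 1) ≤ B) :
    P.coef * (V + 1) ≤ B :=
  (Nat.mul_le_mul_right _ (by simp only [coef]; omega)).trans h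

theorem coef_seq_right {P Q : Program} (h : (Program.seq P Q).coef * (V + 1) ≤ B) :
    Q.coef * (V + 1) ≤ B :=
  (Nat.mul_le_mul_right _ (by simp only [coef]; omega)).trans h

theorem Reaches.seq {P P' : Program} {s : State} {t t' : ℕ} {Q R : State → Prop}
    (h : P.Reaches B V s t Q) (h' : ∀ s', s'.Bd V → Q s' → P'.Reaches B V s' t' R) :
    (Program.seq P P').Reaches B V s (t + t') R :=
  let ⟨_, hT, _, hE, hb, hq⟩ := h
  let ⟨_, hT', s', hE', hb', hq'⟩ := h' _ hb hq
  ⟨_, Nat.add_le_add hT hT', s', .seq hE hE', hb', hq'⟩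

theorem exec_mem {P : Program} {s s' : State} {T a : ℕ} (h : Exec B P s T s')
    (ha : ¬ P.Writes a) : s'.mem a = s.mem a := by
  induction h with
  | skip => rfl
  | assign => rfl
  | store s b i e => simp only [Writes] at ha; simp [ha]
  | seq _ _ ihP ihQ =>
    simp only [Writes, not_or] at ha
    rw [ihQ ha.2, ihP ha.1]
  | branch_true _ _ _ _ ih => simp only [Writes, not_or] at ha; exact ih ha.1
  | branch_false _ _ _ _ ih => simp only [Writes, not_or] at ha; exact ih ha.2
  | loop_true _ _ _ _ _ ihP ihL => rw [ihL ha, ihP ha]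
  | loop_false => rfl

theorem exec_reg {P : Program} {s s' : State} {T x : ℕ} (h : Exec B P s T s')
    (hx : ¬ P.Sets x) : s'.reg x = s.reg x := by
  induction h with
  | skip => rfl
  | assign s y e => simp only [Sets] at hx; simp [hx]
  | store => rfl
  | seq _ _ ihP ihQ =>
    simp only [Sets, not_or] at hx
    rw [ihQ hx.2, ihP hx.1]
  | branch_true _ _ _ _ ih => simp only [Sets, not_or] at hx; exact ih hx.1
  | branch_false _ _ _ _ ih => simp only [Sets, not_or] at hx; exact ih hx.2
  | loop_true _ _ _ _ _ ihP ihL => rw [ihL hx, ihP hx]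
  | loop_false => rfl

theorem Reaches.frame {P : Program} {s : State} {t : ℕ} {Q : State → Prop}
    (h : P.Reaches B V s t Q) :
    P.Reaches B V s t fun s' => Q s' ∧ P.Frame s s' :=
  let ⟨T, hT, s', hE, hb, hq⟩ := h
  ⟨T, hT, s', hE, hb, hq, fun _ ha => exec_mem hE ha, fun _ hx => exec_reg hE hx⟩

/-- The rule for loops with `n` iterations, of which the `i`-th one takes at most `t i` steps. -/
theorem reaches_loop_aux {e f : Expr} {P : Program} {n : ℕ} (I : ℕ → State → Prop) (t : ℕ → ℕ)
    (hB : (e.coef + f.coef) * (V + 1) ≤ B)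
    (hI : ∀ i ≤ n, ∀ s, s.Bd V → I i s → e.Tame V s ∧ f.Tame V s ∧
      (i < n ↔ e.eval s < f.eval s))
    (h : ∀ i < n, ∀ s, s.Bd V → I i s → P.Reaches B V s (t i) (I (i + 1))) {i : ℕ} (hi : i ≤ n)
    {s : State} (hs : s.Bd V) (h0 : I i s) :
    (loop e f P).Reaches B V s
      (∑ j ∈ Finset.Ico i n, (t j + (e.cost + f.cost + 1)) + (e.cost + f.cost + 1)) (I n) := by
  induction hk : n - i generalizing i s with
  | zero =>
    obtain rfl : i = n := by omega
    obtain ⟨he, hf, hc⟩ := hI i le_rfl s hs h0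
    refine ⟨_, ?_, s, .loop_false (he.fits hs ?_) (hf.fits hs ?_) (by simp [← hc]), hs, h0⟩
    · simp
    · exact (Nat.mul_le_mul_right _ (by omega)).trans hB
    · exact (Nat.mul_le_mul_right _ (by omega)).trans hB
  | succ k ih =>
    have hin : i < n := by omega
    obtain ⟨he, hf, hc⟩ := hI i hi s hs h0
    obtain ⟨T, hT, s', hE, hb, hq⟩ := h i hin s hs h0
    obtain ⟨T', hT', s'', hE', hb', hq'⟩ := ih (i := i + 1) (by omega) hb hq (by omega)
    refine ⟨_, ?_, s'', .loop_true (he.fits hs ?_) (hf.fits hs ?_) (hc.1 hin) hE hE', hb', hq'⟩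
    · rw [Finset.sum_eq_sum_Ico_succ_bot hin]; omega
    · exact (Nat.mul_le_mul_right _ (by omega)).trans hB
    · exact (Nat.mul_le_mul_right _ (by omega)).trans hB

/-- A loop with the invariant `I`, which runs exactly `n` times. -/
theorem reaches_loop {e f : Expr} {P : Program} {n : ℕ} (I : ℕ → State → Prop)
    {s : State} (hs : s.Bd V) (hB : (loop e f P).coef * (V + 1) ≤ B) (h0 : I 0 s)
    (hI : ∀ i ≤ n, ∀ s', (loop e f P).Frame s s' → I i s' →
      e.Tame V s' ∧ f.Tame V s' ∧ (i < n ↔ e.eval s' < f.eval s'))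
    (h : ∀ i < n, ∀ s', s'.Bd V → (loop e f P).Frame s s' → I i s' → P.Sat V s' (I (i + 1))) :
    (loop e f P).Reaches B V s ((loop e f P).wcost * (n + 1)) fun s' =>
      I n s' ∧ (loop e f P).Frame s s' := by
  refine (reaches_loop_aux (fun i s' => I i s' ∧ (loop e f P).Frame s s') (fun _ => P.wcost) ?_
    (fun i hi s' _ h1 => hI i hi s' h1.2 h1.1) (fun i hi s' hs' h1 =>
    ((h i hi s' hs' h1.2 h1.1).frame.reaches hs' ?_).mono le_rfl fun s'' _ h2 =>
      ⟨h2.1, h1.2.trans h2.2 (by simp) (by simp)⟩)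
    (Nat.zero_le n) hs ⟨h0, Frame.refl _ _⟩).mono ?_ fun _ _ h => h
  · exact (Nat.mul_le_mul_right _ (by simp only [coef]; omega)).trans hB
  · exact (Nat.mul_le_mul_right _ (by simp only [coef]; omega)).trans hB
  · simp only [Nat.Ico_zero_eq_range, Finset.sum_const, Finset.card_range, smul_eq_mul, wcost]
    nlinarith [Nat.zero_le P.wcost]

/-- A loop that runs the register `x` from `0` up to the contents of the register `y`. -/
def forTo (x y : Reg) (P : Program) : Program :=
  seq (set x (const 0)) (loop (rd x) (rd y) (seq P (set x (rd x + const 1))))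

@[simp] theorem writes_forTo {a : ℕ} {P : Program} {x y : Reg} :
    (forTo x y P).Writes a ↔ P.Writes a := by
  simp [forTo]

@[simp] theorem sets_forTo {z : Reg} {P : Program} {x y : Reg} :
    (forTo x y P).Sets z.num ↔ z = x ∨ P.Sets z.num := by
  simp [forTo]; tauto

theorem reaches_forTo {x y : Reg} {P : Program} {n : ℕ} (I : ℕ → State → Prop)
    {s : State} (hs : s.Bd V) (hB : (forTo x y P).coef * (V + 1) ≤ B) (hV : n ≤ V)
    (hy : s.r y = n) (hPx : ¬ P.Sets x.num) (hPy : ¬ P.Sets y.num) (hxy : y ≠ x)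
    (h0 : I 0 (s.setR x 0))
    (h : ∀ i < n, ∀ s', s'.Bd V → (forTo x y P).Frame s s' → s'.r x = i → s'.r y = n → I i s' →
      P.Sat V s' fun s'' => I (i + 1) (s''.setR x (i + 1))) :
    (forTo x y P).Reaches B V s ((forTo x y P).wcost * (n + 1)) fun s' =>
      I n s' ∧ (forTo x y P).Frame s s' := by
  refine Reaches.frame ?_
  have h1 : (set x (const 0)).Sat V s fun s' => s' = s.setR x 0 := by simp
  refine (h1.frame.reaches' hs (coef_seq_left hB) n).seq' ?_
  intro s1 hs1 hs1'
  refine (reaches_loop (fun i s' => s'.r x = i ∧ I i s') hs1 (coef_seq_right hB) ?_ ?_ ?_).mono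
    le_rfl fun s' _ h => h.1.2
  · rw [hs1'.1]; simpa using h0
  · intro i hi s' hf hI
    have : s'.r y = n := by
      rw [hf.2 y (by simp [hPy, hxy]), hs1'.2.2 y (by simpa using hxy), hy]
    simp [hI.1, this]
  · intro i hi s' hs' hf hI
    have hyn : s'.r y = n := by
      rw [hf.2 y (by simp [hPy, hxy]), hs1'.2.2 y (by simpa using hxy), hy]
    rw [sat_seq]
    refine (h i hi s' hs' ?_ hI.1 hyn hI.2).frame.mono fun s'' h2 => ?_
    · exact hs1'.2.trans hf (by simp [forTo]) (by simp [forTo])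
    · have : s''.r x = i := (h2.2.2 x hPx).trans hI.1
      simp only [sat_set, tame_add, tame_rd, tame_const, eval_add, eval_rd, eval_const, this]
      exact ⟨⟨trivial, trivial⟩, by omega, by simp, h2.1⟩

end Program

end RAM

/-! ### Programs as sequences of numbers -/

/-- A straight-line program, seen as a sequence of `N` tokens in prefix notation: `tok p` is the
token at position `p`, `rank (tok p)` the number of its arguments, `ch p j` the position of its
`j`-th argument, `fin p` the position behind the term that starts at `p`, and `root i` the position
of the right-hand side of the variable `i`, which is denoted by the token `k + i`; tokens below `k`
denote symbols. By `pend`, some terms are pending at every position before the end, so that the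
machine can find `N` by itself. The function `μ` witnesses acyclicity. -/
structure Source (k R : ℕ) (rank : ℕ → ℕ) where
  N : ℕ
  card : ℕ
  start : ℕ
  tok : ℕ → ℕ
  fin : ℕ → ℕ
  root : ℕ → ℕ
  μ : ℕ → ℕ
  ch : ℕ → ℕ → ℕ
  tok_lt : ∀ p < N, tok p < k + card
  pend : ∀ i < N, i < card + ∑ p ∈ Finset.range i, rank (tok p)
  pend_end : card + ∑ p ∈ Finset.range N, rank (tok p) = N
  ch_zero : ∀ p, ch p 0 = p + 1
  ch_succ : ∀ p < N, ∀ j < rank (tok p), ch p (j + 1) = fin (ch p j)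
  fin_eq : ∀ p < N, fin p = ch p (rank (tok p))
  fin_le : ∀ p < N, fin p ≤ N
  ch_lt : ∀ p < N, ∀ j < rank (tok p), p < ch p j ∧ ch p j < N
  root_zero : root 0 = 0
  root_succ : ∀ i, i + 1 < card → root (i + 1) = fin (root i)
  root_lt : ∀ i < card, root i < N
  μ_ch : ∀ p < N, ∀ j < rank (tok p), μ (ch p j) < μ p
  μ_root : ∀ p < N, k ≤ tok p → μ (root (tok p - k)) < μ p

namespace Source

variable {k R : ℕ} {rank : ℕ → ℕ} (G : Source k R rank)

/-- The number of children of a node; a variable has its right-hand side as its child. -/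
def deg (p : ℕ) : ℕ := if G.tok p < k then rank (G.tok p) else 1

/-- The children of a node. -/
def child (p j : ℕ) : ℕ := if G.tok p < k then G.ch p j else G.root (G.tok p - k)

/-- The input of the balancing program. -/
def IsInput (a : ℕ → ℕ) : Prop :=
  a 0 = G.card ∧ a 1 = G.start ∧ ∀ p < G.N, a (p + 2) = G.tok p

theorem card_le : G.card ≤ G.N := by have := G.pend_end; omega

end Source

namespace RAM

open Program CircuitBalancing.RAM.Expr State

variable {B V : ℕ}

/-- Fill the cells `0, …, n - 1` of an array with given constants. -/
def fillTable (a : Arr) (f : ℕ → ℕ) (n : ℕ) : Program :=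
  unroll (fun j => put a (const j) (const (f j))) n

theorem sat_fillTable (a : Arr) (f : ℕ → ℕ) (n : ℕ) {s : State} (hf : ∀ j < n, f j ≤ V)
    (hs : ∀ i, s.m a i = 0) :
    (fillTable a f n).Sat V s fun s' => (∀ i, s'.m a i = if i < n then f i else 0) ∧
      (fillTable a f n).Frame s s' := by
  refine sat_unroll (fun n s => ∀ i, s.m a i = if i < n then f i else 0) (by simpa using hs) ?_
  intro j hj s _ hs
  simp only [sat_put, tame_const, eval_const, m_setM_same, true_and, Function.update_apply, hs]
  refine ⟨hf j hj, fun i => ?_⟩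
  by_cases h : i = j
  · simp [h]
  · simp only [h, if_false]
    congr 1
    simp only [eq_iff_iff]; omega

/-- Determine the number of tokens. -/
def scan : Program :=
  seq (seq (set .pend (ld .tok (const 0))) <| seq (set .card (rd .pend)) (set .len (const 0))) <|
  loop (const 0) (rd .pend) <|
    seq (set .pend (rd .pend + ld .rank (ld .tok (rd .len + const 2)) - const 1))
      (set .len (rd .len + const 1))

variable {k R : ℕ} {rank : ℕ → ℕ} (G : Source k R rank)

theorem reaches_scan (hB : scan.coef * (V + 1) ≤ B) (hV : G.N ≤ V) {s : State} (hs : s.Bd V)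
    (hin : G.IsInput (s.m .tok)) (hr : ∀ t, s.m .rank t = rank t) :
    scan.Reaches B V s (scan.wcost * (G.N + 1)) fun s' =>
      s'.r .len = G.N ∧ s'.r .card = G.card := by
  have hc := G.card_le
  refine (Sat.reaches' (Q := fun s' => s'.m = s.m ∧ s'.r .pend = G.card ∧ s'.r .card = G.card ∧
    s'.r .len = 0) ?_ hs (coef_seq_left hB) _).seq' fun s1 hs1 h1 => ?_
  · simp [hin.1]; omega
  refine (reaches_loop (n := G.N) (fun i s' => s'.r .len = i ∧
    s'.r .pend + i = G.card + ∑ p ∈ Finset.range i, rank (G.tok p)) hs1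
    (coef_seq_right hB) ?_ ?_ ?_).mono le_rfl ?_
  · simp [h1]
  · intro i hi s' hf h
    simp only [tame_const, tame_rd, eval_const, eval_rd, true_and]
    rcases hi.lt_or_eq with hi | rfl
    · have := G.pend i hi; omega
    · have := G.pend_end; omega
  · intro i hi s' _ hf h
    have htok : s'.m .tok = s.m .tok := (hf.1 _ (by simp)).trans (by rw [h1.1])
    have hrank : s'.m .rank = s.m .rank := (hf.1 _ (by simp)).trans (by rw [h1.1])
    have e1 := G.pend i hi
    have e2 := G.pend_end
    have e3 : ∑ p ∈ Finset.range (i + 1), rank (G.tok p) ≤ ∑ p ∈ Finset.range G.N, rank (G.tok p) :=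
      Finset.sum_le_sum_of_subset (by simpa using hi)
    rw [Finset.sum_range_succ] at e3
    simp [h.1, htok, hrank, hr, hin.2.2 i hi, Finset.sum_range_succ]
    omega
  · intro s' _ h
    refine ⟨h.1.1, ?_⟩
    rw [h.2.2 _ (by simp)]; exact h1.2.2.1

/-- Determine the children of the symbols and the ends of the terms, from right to left. -/
def parse (R : ℕ) : Program :=
  forTo .idx .len <|
    seq (set .cur (rd .len - const 1 - rd .idx)) <|
    seq (set .deg (ld .rank (ld .tok (rd .cur + const 2)))) <|
    seq (put .deg (rd .cur) (rd .deg)) <|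
    seq (set .nxt (rd .cur + const 1)) <|
    seq (upTo R .deg fun j =>
      seq (put (.ch j) (rd .cur) (rd .nxt)) (set .nxt (ld .fin (rd .nxt)))) <|
    put .fin (rd .cur) (rd .nxt)

/-- The positions behind `p` have been treated before `p`, so the ends of the arguments of the token
at `p` are available, and each argument starts at the end of its predecessor. -/
theorem reaches_parse (hB : (parse R).coef * (V + 1) ≤ B) (hV : G.N + R ≤ V)
    (hR : ∀ t, rank t ≤ R) {s : State} (hs : s.Bd V)
    (hin : G.IsInput (s.m .tok)) (hr : ∀ t, s.m .rank t = rank t) (hl : s.r .len = G.N) :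
    (parse R).Reaches B V s ((parse R).wcost * (G.N + 1)) fun s' => (∀ p < G.N,
      s'.m .fin p = G.fin p ∧ s'.m .deg p = rank (G.tok p) ∧
      ∀ j < rank (G.tok p), s'.m (.ch j) p = G.ch p j) ∧ (parse R).Frame s s' := by
  refine (reaches_forTo (n := G.N) (fun i s => ∀ p < G.N, G.N ≤ p + i → s.m .fin p = G.fin p ∧
      s.m .deg p = rank (G.tok p) ∧ ∀ j < rank (G.tok p), s.m (.ch j) p = G.ch p j) hs hB (by omega)
      hl (by simp) (by simp) (by simp) ?_ ?_).mono le_rfl fun s' _ h => ⟨fun p hp => h.1 p hp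
        (by omega), h.2⟩
  · intros; omega
  · intro i hi s' _ hf hidx hlen h
    have htok : s'.m .tok = s.m .tok := hf.1 _ (by simp)
    have hrank : s'.m .rank = s.m .rank := hf.1 _ (by simp)
    obtain ⟨p, hp⟩ : ∃ p, p = G.N - 1 - i := ⟨_, rfl⟩
    have hpN : p < G.N := by omega
    simp only [hidx, hlen, ← hp, htok, hin.2.2 p hpN, hrank, hr, sat_seq, sat_set, sat_put,
      tame_sub, tame_rd, tame_const, eval_sub, eval_rd, eval_const, tame_ld, tame_add, eval_add,
      eval_ld, true_and, and_true, r_setR_same, m_setR, r_setM, ne_eq, reduceCtorEq,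
      not_false_eq_true, r_setR_ne]
    have := hR (G.tok p)
    refine ⟨by omega, by omega, by omega, by omega, ?_⟩
    refine (sat_upTo (hR (G.tok p)) (fun j s => s.r .nxt = G.ch p j ∧
      (∀ q < G.N, G.N ≤ q + i → s.m .fin q = G.fin q ∧
      s.m .deg q = rank (G.tok q) ∧ ∀ j < rank (G.tok q), s.m (.ch j) q = G.ch q j) ∧
      s.m .deg p = rank (G.tok p) ∧ ∀ j' < j, s.m (.ch j') p = G.ch p j') (by simp) (by simp)
        ?_ ?_).mono ?_
    · simp only [r_setR_same, m_setR, m_setM_same, ne_eq, reduceCtorEq,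
      not_false_eq_true, m_setM_ne, Function.update_self, Function.update_apply, G.ch_zero,
      true_and]
      refine ⟨fun q hq hqi => ?_, by simp⟩
      have := h q hq hqi
      simpa [show q ≠ p by omega] using this
    · intro j hj s1 hf1 h1
      have hcur : s1.r .cur = p := (hf1.2 _ (by simp)).trans (by simp)
      have hch := G.ch_lt p hpN j hj
      simp [h1.1, hcur]
      refine ⟨by omega, ?_, ?_, ?_, h1.2.2.1, ?_⟩
      · rw [(h1.2.1 _ hch.2 (by omega)).1]
        have := G.fin_le _ hch.2; omega
      · rw [(h1.2.1 _ hch.2 (by omega)).1, G.ch_succ p hpN j hj]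
      · intro q hq hqi
        refine ⟨(h1.2.1 q hq hqi).1, (h1.2.1 q hq hqi).2.1, fun j' hj' => ?_⟩
        have := (h1.2.1 q hq hqi).2.2 j' hj'
        by_cases e : j' = j
        · subst e; simp [Function.update_apply, this]; omega
        · simp [e, this]
      · intro j' hj'
        by_cases e : j' = j
        · subst e; simp
        · simp [e]; exact h1.2.2.2 j' (by omega)
    · rintro s1 ⟨h1, hf1⟩
      have hcur : s1.r .cur = p := (hf1.2 _ (by simp)).trans (by simp)
      have hfin := G.fin_eq p hpN
      have := G.fin_le p hpN
      simp [h1.1, hcur, ← hfin]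
      refine ⟨by omega, fun q hq hqi => ?_⟩
      by_cases e : q = p
      · subst e; simpa using ⟨h1.2.2.1, h1.2.2.2⟩
      · simpa [Function.update_apply, e] using h1.2.1 q hq (by omega)

end RAM

/-! ### Graphs and topological orders -/

/-- An acyclic graph with nodes `0, …, N - 1`, in which the node `u` has a list of `deg u` children;
`μ` witnesses acyclicity. -/
structure Graph where
  N : ℕ
  deg : ℕ → ℕ
  ch : ℕ → ℕ → ℕ
  μ : ℕ → ℕ
  ch_lt : ∀ u < N, ∀ j < deg u, ch u j < N
  μ_lt : ∀ u < N, ∀ j < deg u, μ (ch u j) < μ u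

namespace Graph

variable (D : Graph)

/-- The number of edges from `u` to `v` among the first `d` ones. -/
def edges (u d v : ℕ) : ℕ := ∑ j ∈ Finset.range d, if D.ch u j = v then 1 else 0

theorem edges_succ (u d v : ℕ) :
    D.edges u (d + 1) v = D.edges u d v + if D.ch u d = v then 1 else 0 :=
  Finset.sum_range_succ _ _

theorem edges_le (u d v : ℕ) : D.edges u d v ≤ d := by
  have := Finset.sum_le_card_nsmul (Finset.range d) (fun j => if D.ch u j = v then 1 else 0) 1
    (fun j _ => by split <;> simp)
  simpa [edges] using this

theorem edges_mono (u v : ℕ) {d d' : ℕ} (h : d ≤ d') : D.edges u d v ≤ D.edges u d' v :=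
  Finset.sum_le_sum_of_subset (by simpa using h)

theorem edges_ne_zero {u d v : ℕ} : D.edges u d v ≠ 0 ↔ ∃ j < d, D.ch u j = v := by
  simp [edges]

/-- The list `q 0, …, q (N - 1)` contains every node, and every node after its parents. -/
structure IsOrder (q : ℕ → ℕ) : Prop where
  lt : ∀ i < D.N, q i < D.N
  inj : ∀ i < D.N, ∀ i' < D.N, q i = q i' → i = i'
  topo : ∀ i < D.N, ∀ j < D.deg (q i), ∃ i', i < i' ∧ i' < D.N ∧ q i' = D.ch (q i) j

theorem surj_of_inj {N : ℕ} {q : ℕ → ℕ} (lt : ∀ i < N, q i < N)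
    (inj : ∀ i < N, ∀ i' < N, q i = q i' → i = i') {v : ℕ} (hv : v < N) : ∃ i < N, q i = v := by
  have h := Finset.surj_on_of_inj_on_of_card_le (s := Finset.range N) (t := Finset.range N)
    (fun i _ => q i) (by simpa using lt) (fun a b ha hb => inj a (by simpa using ha) b
      (by simpa using hb)) le_rfl v (by simpa using hv)
  obtain ⟨i, hi, e⟩ := h
  exact ⟨i, by simpa using hi, e.symm⟩

/-- The state of the topological sorting: the queue consists of `q 0, …, q (t - 1)`, its first `h`
nodes have been processed, and so have the first `d` edges of the node `q h`. Here `ind` counts the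
edges from nodes that have not been processed. -/
structure Kahn (q ind : ℕ → ℕ) (h d t : ℕ) : Prop where
  lt : ∀ i < t, q i < D.N
  inj : ∀ i < t, ∀ i' < t, q i = q i' → i = i'
  le : h ≤ t
  count : ∀ v < D.N, ind v + (∑ i ∈ Finset.range h, D.edges (q i) (D.deg (q i)) v +
    D.edges (q h) d v) = ∑ u ∈ Finset.range D.N, D.edges u (D.deg u) v
  zero : ∀ v < D.N, ind v = 0 ↔ ∃ i < t, q i = v
  parents : ∀ i < t, ∀ u < D.N, D.edges u (D.deg u) (q i) ≠ 0 → ∃ i' < i, q i' = u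

namespace Kahn

variable {D} {q ind : ℕ → ℕ} {h d t : ℕ}

theorem sum_add_le (K : D.Kahn q ind h d t) (hh : h < t) {u : ℕ} (hu : u < D.N)
    (hq : ∀ i ≤ h, q i ≠ u) (v : ℕ) :
    ∑ i ∈ Finset.range (h + 1), D.edges (q i) (D.deg (q i)) v + D.edges u (D.deg u) v ≤
      ∑ u ∈ Finset.range D.N, D.edges u (D.deg u) v := by
  classical
  rw [← Finset.sum_image (f := fun u => D.edges u (D.deg u) v) (g := q)
    (fun a ha b hb e => K.inj a (by simp at ha; omega) b (by simp at hb; omega) e),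
    add_comm, ← Finset.sum_insert (f := fun u => D.edges u (D.deg u) v)]
  · refine Finset.sum_le_sum_of_subset fun x hx => ?_
    simp only [Finset.mem_insert, Finset.mem_image, Finset.mem_range] at hx ⊢
    rcases hx with rfl | ⟨i, hi, rfl⟩
    · exact hu
    · exact K.lt i (by omega)
  · simp only [Finset.mem_image, Finset.mem_range, not_exists, not_and]
    exact fun i hi => hq i (by omega)

theorem t_le (K : D.Kahn q ind h d t) : t ≤ D.N := by
  have := Finset.card_le_card_of_injOn (s := Finset.range t) (t := Finset.range D.N) q
    (by simpa [Set.MapsTo] using K.lt) (fun a ha b hb => K.inj a (by simpa using ha) b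
      (by simpa using hb))
  simpa using this

/-- Before all nodes are processed, the queue is not empty. -/
theorem lt_tail (K : D.Kahn q ind h 0 t) (hN : h < D.N) : h < t := by
  classical
  refine lt_of_le_of_ne K.le fun e => ?_
  subst e
  let U := (Finset.range D.N) \ (Finset.range h).image q
  have hU : U.Nonempty := by
    rw [← Finset.card_pos]
    have h1 := Finset.le_card_sdiff ((Finset.range h).image q) (Finset.range D.N)
    have h2 := Finset.card_image_le (s := Finset.range h) (f := q)
    simp only [Finset.card_range] at h1 h2
    exact lt_of_lt_of_le (by omega) h1
  -- an unprocessed node `v` with maximal `μ` has no unprocessed parent, so it is in the queue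
  obtain ⟨v, hv, hmax⟩ := U.exists_max_image D.μ hU
  simp only [U, Finset.mem_sdiff, Finset.mem_range, Finset.mem_image, not_exists, not_and]
    at hv hmax
  have hind : ind v ≠ 0 := fun h0 => by
    obtain ⟨i, hi, e⟩ := (K.zero v hv.1).1 h0
    exact hv.2 i hi e
  have hc := K.count v hv.1
  have h0 : ∑ u ∈ U, D.edges u (D.deg u) v ≠ 0 := by
    intro h0
    have h1 := Finset.sum_sdiff (f := fun u => D.edges u (D.deg u) v)
      (s₁ := (Finset.range h).image q) (s₂ := Finset.range D.N) (by
        intro x hx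
        simp only [Finset.mem_image, Finset.mem_range] at hx ⊢
        obtain ⟨i, hi, rfl⟩ := hx
        exact K.lt i hi)
    rw [Finset.sum_image (fun a ha b hb e => K.inj a (by simpa using ha) b (by simpa using hb) e)]
      at h1
    simp only [edges, Finset.range_zero, Finset.sum_empty] at hc h0 h1
    simp only [U] at h0
    omega
  obtain ⟨u, hu, hne⟩ := Finset.exists_ne_zero_of_sum_ne_zero h0
  simp only [U, Finset.mem_sdiff, Finset.mem_range, Finset.mem_image, not_exists, not_and] at hu
  obtain ⟨j, hj, e⟩ := D.edges_ne_zero.1 hne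
  have := D.μ_lt u hu.1 j hj
  rw [e] at this
  exact absurd (hmax u hu) (by omega)

/-- The next edge of the head of the queue is processed; its end joins the queue if no other edge to
it is left. -/
theorem step (K : D.Kahn q ind h d t) (hh : h < t) (hd : d < D.deg (q h)) :
    0 < ind (D.ch (q h) d) ∧
    (ind (D.ch (q h) d) ≠ 1 →
      D.Kahn q (Function.update ind (D.ch (q h) d) (ind (D.ch (q h) d) - 1)) h (d + 1) t) ∧
    (ind (D.ch (q h) d) = 1 → t < D.N ∧
      D.Kahn (Function.update q t (D.ch (q h) d))
        (Function.update ind (D.ch (q h) d) (ind (D.ch (q h) d) - 1)) h (d + 1) (t + 1)) := by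
  obtain ⟨v, hv⟩ : ∃ v, v = D.ch (q h) d := ⟨_, rfl⟩
  have hvN : v < D.N := hv ▸ D.ch_lt _ (K.lt h hh) d hd
  have htot : ∀ v, ∑ i ∈ Finset.range h, D.edges (q i) (D.deg (q i)) v +
      D.edges (q h) (D.deg (q h)) v ≤ ∑ u ∈ Finset.range D.N, D.edges u (D.deg u) v := by
    intro v
    rw [← Finset.sum_range_succ (fun i => D.edges (q i) (D.deg (q i)) v),
      ← Finset.sum_image (f := fun u => D.edges u (D.deg u) v) (g := q)
      (fun a ha b hb e => K.inj a (by simp at ha; omega) b (by simp at hb; omega) e)]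
    refine Finset.sum_le_sum_of_subset fun x hx => ?_
    simp only [Finset.mem_image, Finset.mem_range] at hx ⊢
    obtain ⟨i, hi, rfl⟩ := hx
    exact K.lt i (by omega)
  have hpos : 0 < ind v := by
    have h1 := K.count v hvN
    have h2 := htot v
    have h3 := D.edges_mono (q h) v (d := d + 1) hd
    rw [edges_succ, if_pos hv.symm] at h3
    omega
  have hnot : ∀ i < t, q i ≠ v := fun i hi e => by
    have := (K.zero v hvN).2 ⟨i, hi, e⟩; omega
  have hcount : ∀ w < D.N, Function.update ind v (ind v - 1) w +
      (∑ i ∈ Finset.range h, D.edges (q i) (D.deg (q i)) w + D.edges (q h) (d + 1) w) =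
      ∑ u ∈ Finset.range D.N, D.edges u (D.deg u) w := by
    intro w hw
    have := K.count w hw
    rw [edges_succ, ← hv]
    by_cases e : w = v
    · subst e; simp; omega
    · rw [Function.update_of_ne e, if_neg (Ne.symm e)]; omega
  rw [← hv]
  refine ⟨hpos, fun h1 => ⟨K.lt, K.inj, K.le, hcount, fun w hw => ?_, K.parents⟩, fun h1 => ?_⟩
  · by_cases e : w = v
    · subst e
      rw [Function.update_self]
      exact ⟨fun h0 => by omega, fun ⟨i, hi, e⟩ => absurd e (hnot i hi)⟩
    · rw [Function.update_of_ne e]; exact K.zero w hw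
  · have hq : ∀ i < t, Function.update q t v i = q i := fun i hi =>
      Function.update_of_ne (by omega) _ _
    have K' : D.Kahn (Function.update q t v) (Function.update ind v (ind v - 1)) h (d + 1)
        (t + 1) := by
      refine ⟨fun i hi => ?_, fun i hi i' hi' => ?_, by have := K.le; omega, fun w hw => ?_,
        fun w hw => ?_, fun i hi u hu hne => ?_⟩
      · rcases Nat.lt_succ_iff_lt_or_eq.1 hi with hi | rfl
        · rw [hq i hi]; exact K.lt i hi
        · simpa using hvN
      · rcases Nat.lt_succ_iff_lt_or_eq.1 hi with hi | rfl <;>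
        rcases Nat.lt_succ_iff_lt_or_eq.1 hi' with hi' | rfl
        · rw [hq i hi, hq i' hi']; exact K.inj i hi i' hi'
        · rw [hq i hi, Function.update_self]; exact fun e => absurd e (hnot i hi)
        · rw [hq i' hi', Function.update_self]; exact fun e => absurd e.symm (hnot i' hi')
        · simp
      · rw [hq h hh, Finset.sum_congr rfl fun i hi => by
          rw [hq i (by simp at hi; omega)]]
        exact hcount w hw
      · by_cases e : w = v
        · subst e; simp [h1]; exact ⟨t, by simp⟩
        · rw [Function.update_of_ne e, K.zero w hw]
          constructor
          · rintro ⟨i, hi, rfl⟩; exact ⟨i, by omega, hq i hi⟩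
          · rintro ⟨i, hi, h2⟩
            rcases Nat.lt_succ_iff_lt_or_eq.1 hi with hi | rfl
            · exact ⟨i, hi, by rwa [hq i hi] at h2⟩
            · rw [Function.update_self] at h2; exact absurd h2.symm e
      · rcases Nat.lt_succ_iff_lt_or_eq.1 hi with hi | rfl
        · rw [hq i hi] at hne
          obtain ⟨i', hi', e⟩ := K.parents i hi u hu hne
          exact ⟨i', hi', by rw [hq i' (by omega), e]⟩
        · rw [Function.update_self] at hne
          by_contra hcon
          have h2 : ∀ i' ≤ h, q i' ≠ u := fun i' hi' e =>
            hcon ⟨i', by omega, by rw [hq i' (by omega), e]⟩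
          have h3 := K.sum_add_le hh hu h2 v
          have h4 := hcount v hvN
          have h5 := D.edges_mono (q h) v (d := d + 1) hd
          rw [Finset.sum_range_succ] at h3
          rw [Function.update_self, h1] at h4
          omega
    exact ⟨K'.t_le, K'⟩

theorem next (K : D.Kahn q ind h (D.deg (q h)) t) (hh : h < t) : D.Kahn q ind (h + 1) 0 t := by
  refine ⟨K.lt, K.inj, hh, fun v hv => ?_, K.zero, K.parents⟩
  rw [Finset.sum_range_succ, ← K.count v hv]
  simp [edges]

theorem isOrder (K : D.Kahn q ind D.N 0 t) : D.IsOrder q := by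
  obtain rfl : t = D.N := le_antisymm K.t_le K.le
  refine ⟨K.lt, K.inj, fun i hi j hj => ?_⟩
  obtain ⟨i', hi', e⟩ := surj_of_inj K.lt K.inj (D.ch_lt _ (K.lt i hi) j hj)
  obtain ⟨i'', h1, h2⟩ := K.parents i' hi' (q i) (K.lt i hi)
    (D.edges_ne_zero.2 ⟨j, hj, e.symm⟩)
  obtain rfl := K.inj _ (by omega) _ hi h2
  exact ⟨i', h1, hi', e⟩

end Kahn

end Graph

/-- The graph of the nodes of a program. -/
def Source.graph {k R : ℕ} {rank : ℕ → ℕ} (G : Source k R rank) : Graph where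
  N := G.N
  deg := G.deg
  ch := G.child
  μ := G.μ
  ch_lt u hu j hj := by
    unfold Source.child
    unfold Source.deg at hj
    split_ifs at hj ⊢ with h
    · exact (G.ch_lt u hu j hj).2
    · exact G.root_lt _ (by have := G.tok_lt u hu; omega)
  μ_lt u hu j hj := by
    unfold Source.child
    unfold Source.deg at hj
    split_ifs at hj ⊢ with h
    · exact G.μ_ch u hu j hj
    · exact G.μ_root u hu (by omega)

/-! ### Linking variables to their right-hand sides -/

namespace RAM

open Program CircuitBalancing.RAM.Expr State

variable {B V : ℕ} {k R : ℕ} {rank : ℕ → ℕ} (G : Source k R rank)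

/-- Determine the positions of the right-hand sides of the variables. -/
def findRoots : Program :=
  seq (set .cur (const 0)) <| forTo .idx .card <|
    seq (put .root (rd .idx) (rd .cur)) (set .cur (ld .fin (rd .cur)))

theorem reaches_findRoots (hB : findRoots.coef * (V + 1) ≤ B) (hV : G.N ≤ V)
    {s : State} (hs : s.Bd V) (hfin : ∀ p < G.N, s.m .fin p = G.fin p) (hc : s.r .card = G.card) :
    findRoots.Reaches B V s (findRoots.wcost * (G.N + 1)) fun s' =>
      ∀ i < G.card, s'.m .root i = G.root i := by
  have hcN := G.card_le
  refine (Sat.reaches' (Q := fun s' => s'.m = s.m ∧ s'.r .cur = 0 ∧ s'.r .card = G.card) ?_ hs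
    (coef_seq_left hB) _).seq' fun s1 hs1 h1 => ?_
  · simp [hc]
  refine (reaches_forTo (n := G.card) (fun i s => (i < G.card → s.r .cur = G.root i) ∧
    ∀ i' < i, s.m .root i' = G.root i') hs1 (coef_seq_right hB) (by omega) h1.2.2 (by simp)
    (by simp) (by simp) ?_ ?_).mono (Nat.mul_le_mul_left _ (by omega)) fun s' _ h => h.1.2
  · simp [h1, G.root_zero]
  · intro i hi s' hs' hf hidx _ h
    have hcur := h.1 hi
    have hlt := G.root_lt i hi
    have hfin' : s'.m .fin (G.root i) = G.fin (G.root i) := by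
      rw [hf.1 _ (by simp), h1.1, hfin _ hlt]
    have := G.fin_le _ hlt
    simp [hidx, hcur, hfin']
    refine ⟨by omega, by omega, fun h2 => (G.root_succ i h2).symm, fun i' hi' => ?_⟩
    rw [Function.update_apply]
    split_ifs with e
    · rw [e]
    · exact h.2 i' (by omega)

/-- Link the occurrences of variables to their right-hand sides, and count the incoming edges of the
nodes. -/
def link (k R : ℕ) : Program :=
  forTo .idx .len <|
    seq (set .tk (ld .tok (rd .idx + const 2))) <|
    seq (branch (rd .tk) (const k) skip
      (seq (put (.ch 0) (rd .idx) (ld .root (rd .tk - const k))) (put .deg (rd .idx) (const 1)))) <|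
    seq (set .deg (ld .deg (rd .idx))) <|
    upTo R .deg fun j =>
      seq (set .cur (ld (.ch j) (rd .idx))) (put .ind (rd .cur) (ld .ind (rd .cur) + const 1))

theorem reaches_link (hB : (link k R).coef * (V + 1) ≤ B) (hV : G.N * (R + 1) + R ≤ V)
    (hR : ∀ t, rank t ≤ R) (hR1 : 1 ≤ R) {s : State} (hs : s.Bd V) (hin : G.IsInput (s.m .tok))
    (hl : s.r .len = G.N)
    (hdeg : ∀ p < G.N, s.m .deg p = rank (G.tok p))
    (hch : ∀ p < G.N, ∀ j < rank (G.tok p), s.m (.ch j) p = G.ch p j)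
    (hroot : ∀ i < G.card, s.m .root i = G.root i) (hind : ∀ i, s.m .ind i = 0) :
    (link k R).Reaches B V s ((link k R).wcost * (G.N + 1)) fun s' => (∀ p < G.N,
      s'.m .deg p = G.deg p ∧ ∀ j < G.deg p, s'.m (.ch j) p = G.child p j) ∧
      ∀ v, s'.m .ind v = ∑ u ∈ Finset.range G.N, G.graph.edges u (G.deg u) v := by
  have hdegle : ∀ p, G.deg p ≤ R := fun p => by
    unfold Source.deg; split_ifs
    · exact hR _
    · exact hR1
  refine (reaches_forTo (n := G.N) (fun i s => (∀ p < G.N,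
      (p < i → s.m .deg p = G.deg p ∧ ∀ j < G.deg p, s.m (.ch j) p = G.child p j) ∧
      (i ≤ p → s.m .deg p = rank (G.tok p) ∧ ∀ j < rank (G.tok p), s.m (.ch j) p = G.ch p j)) ∧
      ∀ v, s.m .ind v = ∑ u ∈ Finset.range i, G.graph.edges u (G.deg u) v) hs hB (by nlinarith)
      hl (by simp) (by simp) (by simp) ?_ ?_).mono le_rfl fun s' _ h => ⟨fun p hp => (h.1.1 p hp).1
        hp, h.1.2⟩
  · simpa [hind] using fun p hp => ⟨hdeg p hp, hch p hp⟩
  · intro i hi s' _ hf hidx _ h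
    have htok : s'.m .tok = s.m .tok := hf.1 _ (by simp)
    have hroot' : s'.m .root = s.m .root := hf.1 _ (by simp)
    have htl := G.tok_lt i hi
    have := G.card_le
    -- after the first three steps the node itself is linked
    refine (sat_seq _ _ _ _).2 ((sat_set _ _ _ _).2 ⟨by simp, ?_, ?_⟩)
    · simp [hidx, htok, hin.2.2 i hi]
      rw [← hin.2.2 i hi]; exact hs.m _ _
    refine (sat_seq _ _ _ _).2 (Sat.mono (Q := fun s1 => s1.r .idx = i ∧ s1.m .ind = s'.m .ind ∧
      ∀ p < G.N, (p < i + 1 → s1.m .deg p = G.deg p ∧ ∀ j < G.deg p, s1.m (.ch j) p = G.child p j) ∧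
      (i + 1 ≤ p → s1.m .deg p = rank (G.tok p) ∧ ∀ j < rank (G.tok p), s1.m (.ch j) p = G.ch p j))
      ?_ fun s1 h1 => ?_)
    · simp [hidx, htok, hin.2.2 i hi, hroot']
      constructor
      · intro hlt p hp
        constructor
        · intro hpi
          rcases hpi.lt_or_eq with hpi | rfl
          · exact (h.1 p hp).1 hpi
          · have := (h.1 p hp).2 le_rfl
            simpa [Source.deg, Source.child, hlt] using this
        · exact fun hpi => (h.1 p hp).2 (by omega)
      · intro hge
        have hlt := G.root_lt (G.tok i - k) (by omega)
        rw [hroot _ (by omega)]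
        refine ⟨by nlinarith, by nlinarith, fun p hp => ⟨fun hpi => ?_, fun hpi => ?_⟩⟩
        · rcases hpi.lt_or_eq with hpi | rfl
          · have := (h.1 p hp).1 hpi
            rw [Function.update_of_ne (by omega)]
            refine ⟨this.1, fun j hj => ?_⟩
            by_cases e : j = 0
            · subst e; simp [show p ≠ i by omega, this.2 0 hj]
            · simp [e, this.2 j hj]
          · simp [Source.deg, Source.child, hge.not_gt]
        · have := (h.1 p hp).2 (by omega)
          rw [Function.update_of_ne (by omega)]
          refine ⟨this.1, fun j hj => ?_⟩
          by_cases e : j = 0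
          · subst e; simp [show p ≠ i by omega, this.2 0 hj]
          · simp [e, this.2 j hj]
    obtain ⟨hidx1, hind1, h1⟩ := h1
    have hd1 := (h1 i hi).1 (by omega)
    have hdl := hdegle i
    refine (sat_seq _ _ _ _).2 ((sat_set _ _ _ _).2 ⟨by simp, ?_, ?_⟩)
    · simp [hidx1, hd1]; omega
    refine (sat_upTo hdl (fun j s2 => ∀ v, s2.m .ind v =
      ∑ u ∈ Finset.range i, G.graph.edges u (G.deg u) v + G.graph.edges i j v)
      (by simp [hidx1, hd1]) (by simp) ?_ ?_).mono ?_
    · simp [hind1, h.2, Graph.edges]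
    · intro j hj s2 hf2 h2
      have hi2 : s2.r .idx = i := by rw [hf2.2 _ (by simp)]; simp [hidx1]
      have hch2 : ∀ j', s2.m (.ch j') = s1.m (.ch j') := fun j' => by
        rw [hf2.1 _ (by simp)]; simp
      have hcl := G.graph.ch_lt i hi j hj
      have hb : ∑ u ∈ Finset.range i, G.graph.edges u (G.deg u) (G.child i j) ≤ i * R := by
        have := Finset.sum_le_card_nsmul (Finset.range i)
          (fun u => G.graph.edges u (G.deg u) (G.child i j)) R
          (fun u _ => (G.graph.edges_le _ _ _).trans (hdegle u))
        simpa using this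
      have hb2 := G.graph.edges_le i j (G.child i j)
      simp [hi2, hch2, hd1.2 j hj, h2]
      refine ⟨?_, ?_, fun v => ?_⟩
      · have : G.child i j < G.N := hcl
        nlinarith
      · have : i * R + R ≤ G.N * R := by nlinarith
        nlinarith
      · rw [Graph.edges_succ]
        by_cases e : v = G.child i j
        · subst e; simp [Source.graph]; ring
        · have : G.graph.ch i j ≠ v := fun e' => e e'.symm
          simp [e, this, h2]
    · rintro s2 ⟨h2, hf2⟩
      refine ⟨fun p hp => ?_, fun v => ?_⟩
      · have e1 : s2.m .deg = s1.m .deg := by rw [hf2.1 _ (by simp)]; simp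
        have e2 : ∀ j', s2.m (.ch j') = s1.m (.ch j') := fun j' => by
          rw [hf2.1 _ (by simp)]; simp
        simp only [m_setR, e1, e2]
        exact h1 p hp
      · rw [m_setR, h2, Finset.sum_range_succ]

end RAM

/-! ### Topological sorting, and replacing variables -/

namespace RAM

open Program CircuitBalancing.RAM.Expr State

variable {B V : ℕ}

/-- Put the nodes without parents into the queue. -/
def initQueue : Program :=
  seq (set .tail (const 0)) <| forTo .idx .len <|
    branch (const 0) (ld .ind (rd .idx)) skip <|
      seq (put .queue (rd .tail) (rd .idx)) (set .tail (rd .tail + const 1))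

theorem reaches_initQueue (D : Graph) (hB : initQueue.coef * (V + 1) ≤ B) (hV : D.N ≤ V)
    {s : State} (hs : s.Bd V) (hl : s.r .len = D.N)
    (hind : ∀ v, s.m .ind v = ∑ u ∈ Finset.range D.N, D.edges u (D.deg u) v) :
    initQueue.Reaches B V s (initQueue.wcost * (D.N + 1)) fun s' =>
      D.Kahn (s'.m .queue) (s'.m .ind) 0 0 (s'.r .tail) := by
  refine (Sat.reaches' (Q := fun s' => s'.m = s.m ∧ s'.r .tail = 0 ∧ s'.r .len = D.N) ?_ hs
    (coef_seq_left hB) _).seq' fun s1 hs1 h1 => ?_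
  · simp [hl]
  refine (reaches_forTo (n := D.N) (fun i s => s.r .tail ≤ i ∧
    (∀ i' < s.r .tail, s.m .queue i' < i) ∧
    (∀ a < s.r .tail, ∀ b < s.r .tail, s.m .queue a = s.m .queue b → a = b) ∧
    ∀ v < i, s1.m .ind v = 0 ↔ ∃ i' < s.r .tail, s.m .queue i' = v) hs1 (coef_seq_right hB) hV
    h1.2.2 (by simp) (by simp) (by simp) ?_ ?_).mono le_rfl ?_
  · simp [h1]
  · intro i hi s' _ hf hidx _ ⟨ht, hlt, hinj, hz⟩
    have hind' : s'.m .ind = s1.m .ind := hf.1 _ (by simp)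
    obtain ⟨t, htt⟩ : ∃ t, t = s'.r .tail := ⟨_, rfl⟩
    simp only [← htt] at ht hlt hinj hz
    simp only [sat_branch, tame_const, tame_ld, tame_rd, eval_const, eval_ld, eval_rd, hidx, hind',
      true_and, sat_skip, sat_seq, sat_put, sat_set, r_setR_ne, ne_eq, reduceCtorEq, m_setM_same,
      not_false_eq_true, m_setR, ← htt, tame_add, eval_add, r_setM, r_setR_same]
    refine ⟨fun hpos => ⟨by omega, fun i' hi' => (hlt i' hi').trans (by omega), hinj,
      fun v hv => ?_⟩,
      fun hzero => ⟨by omega, by omega, by omega, fun i' hi' => ?_, fun a ha b hb => ?_,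
        fun v hv => ?_⟩⟩
    · rcases Nat.lt_succ_iff_lt_or_eq.1 hv with hv | rfl
      · exact hz v hv
      · exact ⟨fun e => by omega, fun ⟨i', hi', e⟩ => by have := hlt i' hi'; omega⟩
    · rcases Nat.lt_succ_iff_lt_or_eq.1 hi' with hi' | rfl
      · rw [Function.update_of_ne (by omega)]
        exact (hlt i' hi').trans (by omega)
      · simp
    · rcases Nat.lt_succ_iff_lt_or_eq.1 ha with ha | rfl <;>
      rcases Nat.lt_succ_iff_lt_or_eq.1 hb with hb | rfl
      · rw [Function.update_of_ne (by omega), Function.update_of_ne (by omega)]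
        exact hinj a ha b hb
      · rw [Function.update_of_ne (by omega), Function.update_self]
        have := hlt a ha
        exact fun e => by omega
      · rw [Function.update_of_ne (a := b) (by omega), Function.update_self]
        have := hlt b hb
        exact fun e => by omega
      · simp
    · rcases Nat.lt_succ_iff_lt_or_eq.1 hv with hv | rfl
      · rw [hz v hv]
        constructor
        · rintro ⟨a, ha, e⟩
          exact ⟨a, by omega, by rw [Function.update_of_ne (by omega), e]⟩
        · rintro ⟨a, ha, e⟩
          rcases Nat.lt_succ_iff_lt_or_eq.1 ha with ha | rfl
          · exact ⟨a, ha, by rwa [Function.update_of_ne (by omega)] at e⟩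
          · rw [Function.update_self] at e; omega
      · exact ⟨fun _ => ⟨t, by omega, by simp⟩, fun _ => by omega⟩
  · rintro s' - ⟨⟨_, hlt, hinj, hz⟩, hf⟩
    have hind' : s'.m .ind = s1.m .ind := hf.1 _ (by simp)
    refine ⟨hlt, hinj, Nat.zero_le _, fun v _ => ?_, fun v hv => by rw [hind']; exact hz v hv,
      fun i hi u hu hne => ?_⟩
    · simp [Graph.edges, hind', h1.1, hind]
    · have h0 := (hz _ (hlt i hi)).2 ⟨i, hi, rfl⟩
      rw [h1.1, hind, Finset.sum_eq_zero_iff] at h0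
      exact absurd (h0 u (by simpa using hu)) hne

/-- Topological sorting. -/
def topSort (R : ℕ) : Program :=
  forTo .head .len <|
    seq (set .cur (ld .queue (rd .head))) <|
    seq (set .deg (ld .deg (rd .cur))) <|
    upTo R .deg fun j =>
      seq (set .nxt (ld (.ch j) (rd .cur))) <|
      seq (put .ind (rd .nxt) (ld .ind (rd .nxt) - const 1)) <|
      branch (const 0) (ld .ind (rd .nxt)) skip <|
      seq (put .queue (rd .tail) (rd .nxt)) (set .tail (rd .tail + const 1))

theorem reaches_topSort {R : ℕ} (D : Graph) (hB : (topSort R).coef * (V + 1) ≤ B)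
    (hV : D.N * (R + 1) + R ≤ V) (hR : ∀ u < D.N, D.deg u ≤ R)
    {s : State} (hs : s.Bd V) (hl : s.r .len = D.N)
    (hdeg : ∀ u < D.N, s.m .deg u = D.deg u)
    (hch : ∀ u < D.N, ∀ j < D.deg u, s.m (.ch j) u = D.ch u j)
    (hK : D.Kahn (s.m .queue) (s.m .ind) 0 0 (s.r .tail)) :
    (topSort R).Reaches B V s ((topSort R).wcost * (D.N + 1)) fun s' =>
      D.IsOrder (s'.m .queue) := by
  refine (reaches_forTo (n := D.N) (fun h s => D.Kahn (s.m .queue) (s.m .ind) h 0 (s.r .tail))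
    hs hB (by nlinarith) hl (by simp) (by simp) (by simp) (by simpa using hK) ?_).mono le_rfl
    fun s' _ h => h.1.isOrder
  intro h hh s' hs' hf hidx _ K
  have hdeg' : s'.m .deg = s.m .deg := hf.1 _ (by simp)
  have hch' : ∀ j, s'.m (.ch j) = s.m (.ch j) := fun j => hf.1 _ (by simp)
  have ht := K.lt_tail hh
  obtain ⟨u, hu⟩ : ∃ u, u = s'.m .queue h := ⟨_, rfl⟩
  have huN : u < D.N := hu ▸ K.lt h ht
  have hdR := hR u huN
  have hNV : D.N + R ≤ V := by nlinarith
  simp only [sat_seq, sat_set, tame_ld, tame_rd, eval_ld, eval_rd, hidx, ← hu, m_setR, r_setR_same,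
    hdeg', hdeg u huN, true_and]
  refine ⟨by omega, by omega, ?_⟩
  refine (sat_upTo hdR (fun j s2 => D.Kahn (s2.m .queue) (s2.m .ind) h j (s2.r .tail) ∧
    s2.m .queue h = u ∧ h < s2.r .tail ∧ ∀ v < D.N, s2.m .ind v ≤ V)
    (by simp) (by simp) ?_ ?_).mono ?_
  · simp only [m_setR, ne_eq, reduceCtorEq, not_false_eq_true, r_setR_ne]
    exact ⟨K, hu.symm, ht, fun v hv => hs'.m _ _⟩
  · rintro j hj s2 hf2 ⟨K2, hq2, ht2, hb2⟩
    have hcur : s2.r .cur = u := by rw [hf2.2 _ (by simp)]; simp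
    have hch2 : s2.m (.ch j) u = D.ch u j := by
      rw [hf2.1 _ (by simp), m_setR, m_setR, hch', hch u huN j hj]
    have hcN := D.ch_lt u huN j hj
    have hstep := K2.step ht2 (by rwa [hq2])
    rw [hq2] at hstep
    obtain ⟨hpos, hs1, hs2⟩ := hstep
    obtain ⟨t, htt⟩ : ∃ t, t = s2.r .tail := ⟨_, rfl⟩
    have hbc := hb2 _ hcN
    simp only [sat_seq, sat_set, tame_ld, tame_rd, eval_ld, eval_rd, hcur, hch2, true_and, sat_put,
      tame_sub, tame_const, eval_sub, eval_const, m_setR, r_setR_same, sat_branch, r_setM,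
      m_setM_same, Function.update_self, sat_skip, ne_eq, reduceCtorEq, not_false_eq_true,
      r_setR_ne, m_setM_ne, tame_add, eval_add, ← htt] at *
    have hupd : ∀ v < D.N,
        Function.update (s2.m .ind) (D.ch u j) (s2.m .ind (D.ch u j) - 1) v ≤ V := by
      intro v hv
      rw [Function.update_apply]; split_ifs
      · omega
      · exact hb2 v hv
    refine ⟨by omega, by omega, fun hlt => ⟨hs1 (by omega), hq2, ht2, hupd⟩, fun hle => ?_⟩
    obtain ⟨htN, K3⟩ := hs2 (by omega)
    exact ⟨by omega, by omega, K3, by rw [Function.update_of_ne (by omega), hq2], by omega, hupd⟩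
  · rintro s2 ⟨⟨K2, hq2, ht2, -⟩, -⟩
    simp only [ne_eq, reduceCtorEq, not_false_eq_true, r_setR_ne]
    exact (show D.Kahn _ _ h (D.deg (s2.m .queue h)) _ by rwa [hq2]).next ht2

/-- Replace the children of the symbols that are variables by the symbols that these variables stand
for, from the leaves to the root. Afterwards variables have no children. -/
def resolve (k R : ℕ) : Program :=
  forTo .idx .len <|
    seq (set .cur (ld .queue (rd .len - const 1 - rd .idx))) <|
    branch (ld .tok (rd .cur + const 2)) (const k)
      (seq (set .deg (ld .deg (rd .cur))) <|
        seq (upTo R .deg fun j => put (.ch j) (rd .cur) (ld .rep (ld (.ch j) (rd .cur)))) <|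
        put .rep (rd .cur) (rd .cur))
      (seq (put .rep (rd .cur) (ld .rep (ld (.ch 0) (rd .cur)))) (put .deg (rd .cur) (const 0)))

variable {k R : ℕ} {rank : ℕ → ℕ} (G : Source k R rank)

/-- The symbol at position `c` is a replacement for the node `c'` in a position behind `a`. -/
def _root_.CircuitBalancing.Source.Replaces {α : Type*} (val : ℕ → α) (q : ℕ → ℕ)
    (a c c' : ℕ) : Prop :=
  G.tok c < k ∧ val c = val c' ∧ ∃ b, a < b ∧ b < G.N ∧ q b = c

/-- The nodes are treated in reverse topological order. The value `val` is preserved, and the new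
children come behind their parents in the same order. -/
theorem reaches_resolve {α : Type*} (val : ℕ → α)
    (hval : ∀ p < G.N, k ≤ G.tok p → val (G.child p 0) = val p)
    (hB : (resolve k R).coef * (V + 1) ≤ B) (hV : G.N + R ≤ V)
    (hR : ∀ p < G.N, G.deg p ≤ R)
    {s : State} (hs : s.Bd V) (hin : G.IsInput (s.m .tok)) (hl : s.r .len = G.N)
    (hdeg : ∀ u < G.N, s.m .deg u = G.deg u)
    (hch : ∀ u < G.N, ∀ j < G.deg u, s.m (.ch j) u = G.child u j)
    (hq : G.graph.IsOrder (s.m .queue)) :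
    (resolve k R).Reaches B V s ((resolve k R).wcost * (G.N + 1)) fun s' => ∀ a < G.N,
      s'.m .deg (s.m .queue a) =
        (if G.tok (s.m .queue a) < k then rank (G.tok (s.m .queue a)) else 0) ∧
      (∃ b, a ≤ b ∧ b < G.N ∧ s.m .queue b = s'.m .rep (s.m .queue a)) ∧
      G.tok (s'.m .rep (s.m .queue a)) < k ∧
      val (s'.m .rep (s.m .queue a)) = val (s.m .queue a) ∧
      ∀ j < s'.m .deg (s.m .queue a), G.Replaces val (s.m .queue) a
        (s'.m (.ch j) (s.m .queue a)) (G.child (s.m .queue a) j) := by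
  obtain ⟨q, hqq⟩ : ∃ q, q = s.m .queue := ⟨_, rfl⟩
  rw [← hqq] at hq ⊢
  refine (reaches_forTo (n := G.N) (fun i s' => (∀ a < G.N, G.N ≤ a + i →
      s'.m .deg (q a) = (if G.tok (q a) < k then rank (G.tok (q a)) else 0) ∧
      (∃ b, a ≤ b ∧ b < G.N ∧ q b = s'.m .rep (q a)) ∧ G.tok (s'.m .rep (q a)) < k ∧
      val (s'.m .rep (q a)) = val (q a) ∧
      ∀ j < s'.m .deg (q a), G.Replaces val q a (s'.m (.ch j) (q a)) (G.child (q a) j)) ∧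
    (∀ a < G.N, a + i < G.N → s'.m .deg (q a) = G.deg (q a) ∧
      ∀ j < G.deg (q a), s'.m (.ch j) (q a) = G.child (q a) j)) hs hB (by omega)
      hl (by simp) (by simp) (by simp) ?_ ?_).mono le_rfl
      fun s' _ h a ha => h.1.1 a ha (by omega)
  · simp only [m_setR]
    exact ⟨fun a ha h => by omega, fun a ha _ => ⟨hdeg _ (hq.lt a ha), hch _ (hq.lt a ha)⟩⟩
  · intro i hi s' _ hf hidx hlen ⟨h1, h2⟩
    have htok : s'.m .tok = s.m .tok := hf.1 _ (by simp)
    have hque : s'.m .queue = q := (hf.1 _ (by simp)).trans hqq.symm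
    obtain ⟨a, ha⟩ : ∃ a, a = G.N - 1 - i := ⟨_, rfl⟩
    have haN : a < G.N := by omega
    have huN := hq.lt a haN
    change q a < G.N at huN
    obtain ⟨hdu, hcu⟩ := h2 a haN (by omega)
    have hRu := hR _ huN
    -- the replacement of a child has been determined before
    have hrep : ∀ j < G.deg (q a), G.Replaces val q a (s'.m .rep (G.child (q a) j))
        (G.child (q a) j) := by
      intro j hj
      obtain ⟨b, hab, hbN, hb⟩ := hq.topo a haN j hj
      change q b = G.child (q a) j at hb
      obtain ⟨-, ⟨b', hb', hbN', e⟩, h4, h5, -⟩ := h1 b hbN (by change b < G.N at hbN; omega)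
      rw [← hb]
      exact ⟨h4, h5, b', by omega, hbN', e⟩
    have hrep_le : ∀ j < G.deg (q a), s'.m .rep (G.child (q a) j) ≤ V := by
      intro j hj
      obtain ⟨-, -, b, -, hb, e⟩ := hrep j hj
      have := hq.lt b hb
      change q b < G.N at this
      omega
    -- other nodes are not affected
    have hne : ∀ b < G.N, b ≠ a → q b ≠ q a := fun b hb hba e => hba (hq.inj b hb a haN e)
    simp only [sat_seq (Program.set _ _), sat_set, tame_sub, tame_rd, tame_const, eval_sub, eval_rd,
      eval_const, tame_ld, eval_ld, hidx, hlen, ← ha, hque, true_and, and_true, sat_branch,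
      tame_add, eval_add, r_setR_same, m_setR, htok, hin.2.2 _ huN]
    refine ⟨by omega, fun hlt => ?_, fun hge => ?_⟩
    · have hd : G.deg (q a) = rank (G.tok (q a)) := if_pos hlt
      refine ⟨by omega, ?_⟩
      rw [sat_seq]
      refine (sat_upTo hRu (fun j s2 => (∀ b < G.N, b ≠ a → ∀ j', s2.m (.ch j') (q b) =
        s'.m (.ch j') (q b)) ∧ (∀ j' < j, s2.m (.ch j') (q a) = s'.m .rep (G.child (q a) j')) ∧
        ∀ j', j ≤ j' → s2.m (.ch j') = s'.m (.ch j'))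
        (by simp [hdu]) (by simp) (by simp) ?_).mono ?_
      · rintro j hj s2 hf2 ⟨h3, h4, h5⟩
        have hcur : s2.r .cur = q a := by rw [hf2.2 _ (by simp)]; simp
        have hr2 : s2.m .rep = s'.m .rep := by rw [hf2.1 _ (by simp)]; simp
        simp only [sat_put, tame_rd, tame_ld, eval_ld, eval_rd, hcur, hr2, h5 j le_rfl, hcu j hj,
          true_and]
        refine ⟨hrep_le j hj, fun b hb hba j' => ?_, fun j' hj' => ?_, fun j' hj' => ?_⟩
        · by_cases e : j' = j
          · subst e; simp [Function.update_of_ne (hne b hb hba), h5]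
          · simp [e, h3 b hb hba]
        · by_cases e : j' = j
          · subst e; simp
          · simp [e, h4 j' (by omega)]
        · simp [show j' ≠ j by omega, h5 j' (by omega)]
      · rintro s2 ⟨⟨h3, h4, h5⟩, hf2⟩
        have hcur : s2.r .cur = q a := by rw [hf2.2 _ (by simp)]; simp
        have hr2 : s2.m .rep = s'.m .rep := by rw [hf2.1 _ (by simp)]; simp
        have hd2 : s2.m .deg = s'.m .deg := by rw [hf2.1 _ (by simp)]; simp
        simp only [sat_put, tame_rd, eval_rd, hcur, hr2, hd2, true_and, m_setM_same, ne_eq,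
          reduceCtorEq, not_false_eq_true, m_setM_ne]
        refine ⟨by omega, fun b hb hbi => ?_, fun b hb hbi => ?_⟩
        · by_cases e : b = a
          · subst e
            simp only [Function.update_self, hdu, hd, if_pos hlt, true_and]
            refine ⟨⟨b, le_rfl, hb, rfl⟩, hlt, fun j hj => ?_⟩
            rw [h4 j (by omega)]
            exact hrep j (by omega)
          · rw [Function.update_of_ne (hne b hb e)]
            simp only [h3 b hb e]
            exact h1 b hb (by omega)
        · simp only [h3 b hb (by omega)]
          exact h2 b hb (by omega)
    · have hd : G.deg (q a) = 1 := if_neg (by omega)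
      have hr0 := hrep 0 (by omega)
      simp only [sat_seq, sat_put, tame_rd, tame_ld, tame_const, eval_ld, eval_rd, eval_const,
        r_setR_same, m_setR, true_and, r_setM, m_setM_same, ne_eq, reduceCtorEq,
        not_false_eq_true, m_setM_ne, hcu 0 (by omega)]
      refine ⟨hrep_le 0 (by omega), by omega, fun b hb hbi => ?_, fun b hb hbi => ?_⟩
      · by_cases e : b = a
        · subst e
          obtain ⟨h3, h4, b', h5, h6, h7⟩ := hr0
          simp only [Function.update_self, if_neg hge.not_gt, true_and]
          exact ⟨⟨b', h5.le, h6, h7⟩, h3, h4.trans (hval _ huN hge), by omega⟩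
        · rw [Function.update_of_ne (hne b hb e), Function.update_of_ne (hne b hb e)]
          exact h1 b hb (by omega)
      · rw [Function.update_of_ne (hne b hb (by omega))]
        exact h2 b hb (by omega)

end RAM

/-! ### Unfoldings of acyclic graphs -/

/-- The unfolding of an acyclic graph from its node `root`: the number `μ u` of nodes of the tree
into which the graph unfolds from `u` satisfies the obvious recursion. -/
structure Dag extends Graph where
  root : ℕ
  root_lt : root < N
  μ_eq : ∀ u < N, μ u = 1 + ∑ j ∈ Finset.range (deg u), μ (ch u j)

namespace Dag

variable (D : Dag)

theorem μ_pos {u : ℕ} (hu : u < D.N) : 0 < D.μ u := by rw [D.μ_eq u hu]; omega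

/-- The number of occurrences of `v` in the tree into which the graph unfolds from `u`. -/
def occ (v u : ℕ) : ℕ :=
  if _h : u < D.N then
    if u = v then 1 else ∑ j : Fin (D.deg u), occ v (D.ch u j)
  else 0
termination_by D.μ u
decreasing_by exact D.μ_lt u _h j j.2

theorem occ_self {u : ℕ} (hu : u < D.N) : D.occ u u = 1 := by
  rw [occ]; simp [hu]

theorem occ_of_ne {u v : ℕ} (hu : u < D.N) (h : u ≠ v) :
    D.occ v u = ∑ j ∈ Finset.range (D.deg u), D.occ v (D.ch u j) := by
  rw [occ]; simp [hu, h, Finset.sum_range]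

/-- Induction along the edges. -/
theorem induction {p : ℕ → Prop}
    (h : ∀ u < D.N, (∀ j < D.deg u, p (D.ch u j)) → p u) {u : ℕ} (hu : u < D.N) : p u := by
  induction hn : D.μ u using Nat.strong_induction_on generalizing u with
  | _ n ih =>
    exact h u hu fun j hj => ih _ (hn ▸ D.μ_lt u hu j hj) (D.ch_lt u hu j hj) rfl

theorem occ_mul_le {u : ℕ} (v : ℕ) (hu : u < D.N) : D.occ v u * D.μ v ≤ D.μ u := by
  refine D.induction (p := fun u => D.occ v u * D.μ v ≤ D.μ u) (fun u hu ih => ?_) hu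
  by_cases h : u = v
  · subst h; simp [D.occ_self hu]
  · rw [D.occ_of_ne hu h, D.μ_eq u hu, Finset.sum_mul]
    exact (Finset.sum_le_sum fun j hj => ih j (by simpa using hj)).trans (by omega)

theorem occ_eq_zero {u v : ℕ} (hu : u < D.N) (h : D.μ u < D.μ v) : D.occ v u = 0 := by
  have := D.occ_mul_le v hu
  by_contra h0
  have : 1 * D.μ v ≤ D.occ v u * D.μ v := Nat.mul_le_mul_right _ (by omega)
  omega

/-- Every occurrence of `v`, apart from the root, has a unique parent. -/
theorem occ_eq_parents {u v : ℕ} (hu : u < D.N) :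
    D.occ v u = (if u = v then 1 else 0) +
      ∑ w ∈ Finset.range D.N, D.occ w u * D.edges w (D.deg w) v := by
  refine D.induction (p := fun u => D.occ v u = (if u = v then 1 else 0) +
      ∑ w ∈ Finset.range D.N, D.occ w u * D.edges w (D.deg w) v) (fun u hu ih => ?_) hu
  -- the sum without the term for `u` itself counts in the subtrees of the children
  have h1 : ∑ w ∈ Finset.range D.N, D.occ w u * D.edges w (D.deg w) v =
      D.edges u (D.deg u) v + ∑ w ∈ Finset.range D.N,
        (∑ j ∈ Finset.range (D.deg u), D.occ w (D.ch u j)) * D.edges w (D.deg w) v := by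
    rw [← Finset.add_sum_erase _ _ (Finset.mem_range.2 hu),
      ← Finset.add_sum_erase (Finset.range D.N) (fun w => (∑ j ∈ Finset.range (D.deg u),
        D.occ w (D.ch u j)) * D.edges w (D.deg w) v) (Finset.mem_range.2 hu), D.occ_self hu,
      Finset.sum_eq_zero (s := Finset.range (D.deg u)) fun j hj =>
        D.occ_eq_zero (D.ch_lt u hu j (by simpa using hj)) (D.μ_lt u hu j (by simpa using hj))]
    rw [one_mul, zero_mul, zero_add]
    congr 1
    refine Finset.sum_congr rfl fun w hw => ?_
    rw [D.occ_of_ne hu (Finset.ne_of_mem_erase hw).symm]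
  have h2 : ∑ j ∈ Finset.range (D.deg u), D.occ v (D.ch u j) = D.edges u (D.deg u) v +
      ∑ w ∈ Finset.range D.N,
        (∑ j ∈ Finset.range (D.deg u), D.occ w (D.ch u j)) * D.edges w (D.deg w) v := by
    rw [Finset.sum_congr rfl fun j hj => ih j (by simpa using hj), Finset.sum_add_distrib,
      Graph.edges, Finset.sum_comm]
    simp_rw [Finset.sum_mul]
  rw [h1, ← h2]
  by_cases h : u = v
  · subst h
    rw [D.occ_self hu, Finset.sum_eq_zero (s := Finset.range (D.deg u)) fun j hj =>
        D.occ_eq_zero (D.ch_lt u hu j (by simpa using hj)) (D.μ_lt u hu j (by simpa using hj))]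
    simp
  · rw [D.occ_of_ne hu h, if_neg h, zero_add]

/-- The number of occurrences of a node in the unfolding. -/
def paths (v : ℕ) : ℕ := D.occ v D.root

theorem paths_mul_le (v : ℕ) : D.paths v * D.μ v ≤ D.μ D.root := D.occ_mul_le v D.root_lt

theorem paths_root : D.paths D.root = 1 := D.occ_self D.root_lt

theorem paths_eq (v : ℕ) : D.paths v = (if D.root = v then 1 else 0) +
    ∑ u ∈ Finset.range D.N, D.paths u * D.edges u (D.deg u) v := D.occ_eq_parents D.root_lt

theorem paths_le {v : ℕ} (hv : v < D.N) : D.paths v ≤ D.μ D.root :=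
  (Nat.le_mul_of_pos_right _ (D.μ_pos hv)).trans (D.paths_mul_le v)

theorem μ_le_root {v : ℕ} (hp : 0 < D.paths v) : D.μ v ≤ D.μ D.root :=
  (Nat.le_mul_of_pos_left _ hp).trans (D.paths_mul_le v)

theorem paths_edge_le {u : ℕ} (hu : u < D.N) {j : ℕ} (hj : j < D.deg u) :
    D.paths u ≤ D.paths (D.ch u j) := by
  have h1 : 1 ≤ D.edges u (D.deg u) (D.ch u j) :=
    Nat.one_le_iff_ne_zero.2 (D.edges_ne_zero.2 ⟨j, hj, rfl⟩)
  have h2 := Finset.single_le_sum (f := fun w => D.paths w * D.edges w (D.deg w) (D.ch u j))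
    (fun _ _ => Nat.zero_le _) (Finset.mem_range.2 hu)
  have h3 := D.paths_eq (D.ch u j)
  have h4 := Nat.mul_le_mul_left (D.paths u) h1
  omega

/-- Two different edges to `v` contribute different occurrences. -/
theorem paths_add_le {u u' j j' : ℕ} (hu : u < D.N) (hu' : u' < D.N) (hj : j < D.deg u)
    (hj' : j' < D.deg u') (e : D.ch u j = D.ch u' j') (hne : u = u' → j ≠ j') :
    D.paths u + D.paths u' ≤ D.paths (D.ch u j) := by
  rw [D.paths_eq (D.ch u j)]
  by_cases h : u = u'
  · subst h
    have h1 : 2 ≤ D.edges u (D.deg u) (D.ch u j) := by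
      have := Finset.sum_le_sum_of_subset (f := fun i => if D.ch u i = D.ch u j then 1 else 0)
        (s := {j, j'}) (t := Finset.range (D.deg u)) (by
          intro x; simp only [Finset.mem_insert, Finset.mem_singleton, Finset.mem_range]
          rintro (rfl | rfl) <;> assumption)
      rw [Finset.sum_pair (hne rfl)] at this
      simpa [e.symm, Graph.edges] using this
    have h2 := Finset.single_le_sum (f := fun w => D.paths w * D.edges w (D.deg w) (D.ch u j))
      (fun _ _ => Nat.zero_le _) (Finset.mem_range.2 hu)
    have h3 := Nat.mul_le_mul_left (D.paths u) h1
    omega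
  · have h1 : 1 ≤ D.edges u (D.deg u) (D.ch u j) :=
      Nat.one_le_iff_ne_zero.2 (D.edges_ne_zero.2 ⟨j, hj, rfl⟩)
    have h1' : 1 ≤ D.edges u' (D.deg u') (D.ch u j) :=
      Nat.one_le_iff_ne_zero.2 (D.edges_ne_zero.2 ⟨j', hj', e.symm⟩)
    have h2 := Finset.sum_le_sum_of_subset
      (f := fun w => D.paths w * D.edges w (D.deg w) (D.ch u j))
      (s := {u, u'}) (t := Finset.range D.N) (by
        intro x; simp only [Finset.mem_insert, Finset.mem_singleton, Finset.mem_range]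
        rintro (rfl | rfl) <;> assumption)
    rw [Finset.sum_pair h] at h2
    have h3 := Nat.mul_le_mul_left (D.paths u) h1
    have h4 := Nat.mul_le_mul_left (D.paths u') h1'
    omega

theorem μ_add_le {u j j' : ℕ} (hu : u < D.N) (hj : j < D.deg u) (hj' : j' < D.deg u)
    (hne : j ≠ j') : 1 + D.μ (D.ch u j) + D.μ (D.ch u j') ≤ D.μ u := by
  rw [D.μ_eq u hu]
  have h2 := Finset.sum_le_sum_of_subset (f := fun i => D.μ (D.ch u i))
      (s := {j, j'}) (t := Finset.range (D.deg u)) (by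
        intro x; simp only [Finset.mem_insert, Finset.mem_singleton, Finset.mem_range]
        rintro (rfl | rfl) <;> assumption)
  rw [Finset.sum_pair hne] at h2
  omega

/-! ### Symmetric centroid decomposition -/

/-- The logarithm of the size of the unfolding from a node. -/
def nl (u : ℕ) : ℕ := Nat.log 2 (D.μ u)

/-- The logarithm of the number of occurrences of a node. -/
def pl (u : ℕ) : ℕ := Nat.log 2 (D.paths u)

/-- The edge from `u` to its `j`-th child is central: the logarithms of the number of occurrences
and of the size do not change. -/
def SC (u j : ℕ) : Prop :=
  u < D.N ∧ 0 < D.paths u ∧ j < D.deg u ∧ D.nl (D.ch u j) = D.nl u ∧ D.pl (D.ch u j) = D.pl u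

variable {D}

theorem two_pow_nl_le {u : ℕ} (hu : u < D.N) : 2 ^ D.nl u ≤ D.μ u :=
  Nat.pow_log_le_self 2 (D.μ_pos hu).ne'

theorem lt_two_pow_nl (u : ℕ) : D.μ u < 2 * 2 ^ D.nl u := by
  rw [mul_comm, ← pow_succ]; exact Nat.lt_pow_succ_log_self one_lt_two _

theorem two_pow_pl_le {u : ℕ} (hu : 0 < D.paths u) : 2 ^ D.pl u ≤ D.paths u :=
  Nat.pow_log_le_self 2 hu.ne'

theorem lt_two_pow_pl (u : ℕ) : D.paths u < 2 * 2 ^ D.pl u := by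
  rw [mul_comm, ← pow_succ]; exact Nat.lt_pow_succ_log_self one_lt_two _

theorem nl_ch_le {u j : ℕ} (hu : u < D.N) (hj : j < D.deg u) : D.nl (D.ch u j) ≤ D.nl u :=
  Nat.log_mono_right (D.μ_lt u hu j hj).le

theorem pl_le_ch {u j : ℕ} (hu : u < D.N) (hj : j < D.deg u) : D.pl u ≤ D.pl (D.ch u j) :=
  Nat.log_mono_right (D.paths_edge_le hu hj)

theorem paths_ch_pos {u j : ℕ} (hu : u < D.N) (hp : 0 < D.paths u) (hj : j < D.deg u) :
    0 < D.paths (D.ch u j) := hp.trans_le (D.paths_edge_le hu hj)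

namespace SC

variable {u u' j j' : ℕ}

theorem ch_lt (h : D.SC u j) : D.ch u j < D.N := D.ch_lt u h.1 j h.2.2.1

theorem paths_pos (h : D.SC u j) : 0 < D.paths (D.ch u j) := paths_ch_pos h.1 h.2.1 h.2.2.1

theorem μ_lt (h : D.SC u j) : D.μ (D.ch u j) < D.μ u := D.μ_lt u h.1 j h.2.2.1

/-- Two central children would together be larger than the unfolding from `u`. -/
theorem unique_child (h : D.SC u j) (h' : D.SC u j') : j = j' := by
  by_contra hne
  have h1 := D.μ_add_le h.1 h.2.2.1 h'.2.2.1 hne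
  have h2 := two_pow_nl_le h.ch_lt
  have h3 := two_pow_nl_le h'.ch_lt
  have h4 := lt_two_pow_nl (D := D) u
  rw [h.2.2.2.1] at h2
  rw [h'.2.2.2.1] at h3
  omega

/-- The occurrences of two central parents would add up to more than those of the child. -/
theorem unique_parent (h : D.SC u j) (h' : D.SC u' j') (e : D.ch u j = D.ch u' j') : u = u' := by
  by_contra hne
  have h1 := D.paths_add_le h.1 h'.1 h.2.2.1 h'.2.2.1 e fun h => absurd h hne
  have h2 := two_pow_pl_le h.2.1
  have h3 := two_pow_pl_le h'.2.1
  have h4 := lt_two_pow_pl (D := D) (D.ch u j)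
  rw [← h.2.2.2.2] at h2
  rw [← h'.2.2.2.2, ← e] at h3
  omega

end SC

/-- The array `E` contains, for every node `v`, the maximum of `2 ^ pl u` over all edges to `v` that
are not central and start at a node `u` with at least one occurrence; it is `0` if there are none.
The root counts as the end of an edge from a node with one occurrence. -/
structure IsEntry (D : Dag) (E : ℕ → ℕ) : Prop where
  le : ∀ u < D.N, 0 < D.paths u → ∀ j < D.deg u, ¬ D.SC u j → 2 ^ D.pl u ≤ E (D.ch u j)
  root : 1 ≤ E D.root
  cases : ∀ v < D.N, E v = 0 ∨ (v = D.root ∧ E v = 1) ∨ ∃ u < D.N, 0 < D.paths u ∧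
    ∃ j < D.deg u, ¬ D.SC u j ∧ D.ch u j = v ∧ E v = 2 ^ D.pl u

/-- The number `x` is the maximum of `1` and of `2 ^ nl v` over all edges from `u` to nodes `v` that
are not central. -/
structure IsExit (D : Dag) (u : ℕ) (x : ℕ) : Prop where
  le : ∀ j < D.deg u, ¬ D.SC u j → 2 ^ D.nl (D.ch u j) ≤ x
  cases : x = 1 ∨ ∃ j < D.deg u, ¬ D.SC u j ∧ x = 2 ^ D.nl (D.ch u j)

theorem not_ch_root {u j : ℕ} (hu : u < D.N) (hp : 0 < D.paths u) (hj : j < D.deg u) :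
    D.ch u j ≠ D.root := fun e => by
  have := D.μ_lt u hu j hj
  have := D.μ_le_root hp
  rw [e] at *
  omega

theorem IsEntry.le_paths {E : ℕ → ℕ} (h : D.IsEntry E) {v : ℕ} (hv : v < D.N) :
    E v ≤ D.paths v := by
  rcases h.cases v hv with h0 | ⟨rfl, h1⟩ | ⟨u, hu, hp, j, hj, -, rfl, e⟩
  · omega
  · rw [h1, D.paths_root]
  · rw [e]; exact (two_pow_pl_le hp).trans (D.paths_edge_le hu hj)

/-- Along a central edge, the occurrences of `u` and those that are counted by `E` are different
occurrences of the child. -/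
theorem IsEntry.add_le {E : ℕ → ℕ} (h : D.IsEntry E) {u j : ℕ} (hs : D.SC u j) :
    D.paths u + E (D.ch u j) ≤ D.paths (D.ch u j) := by
  rcases h.cases _ hs.ch_lt with h0 | ⟨h1, -⟩ | ⟨u', hu', hp', j', hj', hn, he, e⟩
  · rw [h0]; exact D.paths_edge_le hs.1 hs.2.2.1
  · exact absurd h1 (not_ch_root hs.1 hs.2.1 hs.2.2.1)
  · rw [e]
    exact (Nat.add_le_add_left (two_pow_pl_le hp') _).trans
      (D.paths_add_le hs.1 hu' hs.2.2.1 hj' he.symm fun h1 h2 => hn (by subst h1 h2; exact hs))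

theorem IsExit.pos {u x : ℕ} (h : D.IsExit u x) : 0 < x := by
  rcases h.cases with rfl | ⟨j, -, -, rfl⟩ <;> positivity

/-- Along a central edge, the unfoldings from the central child and from another child are disjoint
parts of the unfolding from `u`. -/
theorem IsExit.add_le {u x j : ℕ} (h : D.IsExit u x) (hs : D.SC u j) :
    x + D.μ (D.ch u j) ≤ D.μ u := by
  rcases h.cases with rfl | ⟨j', hj', hn, rfl⟩
  · have := hs.μ_lt; omega
  · have h1 := D.μ_add_le hs.1 hs.2.2.1 hj' fun e => hn (e ▸ hs)
    have h2 := two_pow_nl_le (D.ch_lt u hs.1 j' hj')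
    omega

/-- The largest power of two that is at most `x`, and `0` for `x = 0`. -/
def fl (x : ℕ) : ℕ := if x = 0 then 0 else 2 ^ Nat.log 2 x

theorem fl_of_pos {x : ℕ} (h : 0 < x) : fl x = 2 ^ Nat.log 2 x := if_neg h.ne'

theorem fl_le (x : ℕ) : fl x ≤ x := by
  unfold fl; split_ifs with h
  · omega
  · exact Nat.pow_log_le_self 2 h

theorem fl_eq {x l : ℕ} (h1 : 2 ^ l ≤ x) (h2 : x < 2 * 2 ^ l) : fl x = 2 ^ l := by
  have : 0 < 2 ^ l := by positivity
  rw [fl_of_pos (by omega), Nat.log_eq_of_pow_le_of_lt_pow h1 (by rw [pow_succ]; omega)]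

/-- The power of two of a sum is the maximum of those of the summands, or twice this maximum. So it
can be updated by one comparison. -/
theorem fl_add (x : ℕ) {y : ℕ} (hy : 0 < y) : fl (x + y) =
    if x + y < max (fl x) (fl y) + max (fl x) (fl y) then max (fl x) (fl y)
      else max (fl x) (fl y) + max (fl x) (fl y) := by
  obtain ⟨b, hb1, hb2, hb⟩ : ∃ b, 2 ^ b ≤ y ∧ y < 2 * 2 ^ b ∧ fl y = 2 ^ b :=
    ⟨Nat.log 2 y, Nat.pow_log_le_self 2 hy.ne', by
      rw [mul_comm, ← pow_succ]; exact Nat.lt_pow_succ_log_self one_lt_two _, fl_of_pos hy⟩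
  rcases Nat.eq_zero_or_pos x with rfl | hx
  · rw [hb, show fl 0 = 0 from rfl, Nat.zero_max, zero_add, hb, if_pos (by omega)]
  obtain ⟨a, ha1, ha2, ha⟩ : ∃ a, 2 ^ a ≤ x ∧ x < 2 * 2 ^ a ∧ fl x = 2 ^ a :=
    ⟨Nat.log 2 x, Nat.pow_log_le_self 2 hx.ne', by
      rw [mul_comm, ← pow_succ]; exact Nat.lt_pow_succ_log_self one_lt_two _, fl_of_pos hx⟩
  obtain ⟨m, hm, h1, h2⟩ : ∃ m, max (fl x) (fl y) = 2 ^ m ∧ 2 ^ m ≤ x + y ∧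
      x + y < 2 * (2 * 2 ^ m) := by
    rw [ha, hb]
    rcases le_total a b with h | h
    · have := Nat.pow_le_pow_right two_pos h
      exact ⟨b, max_eq_right this, by omega, by omega⟩
    · have := Nat.pow_le_pow_right two_pos h
      exact ⟨a, max_eq_left this, by omega, by omega⟩
  rw [hm]
  split_ifs with h
  · exact fl_eq h1 (by omega)
  · rw [← two_mul, mul_comm, ← pow_succ]
    exact fl_eq (by rw [pow_succ]; omega) (by rw [pow_succ]; omega)

end Dag

theorem Graph.IsOrder.sum_eq {D : Graph} {q : ℕ → ℕ} (hq : D.IsOrder q) (f : ℕ → ℕ) :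
    ∑ u ∈ Finset.range D.N, f u = ∑ a ∈ Finset.range D.N, f (q a) := by
  symm
  refine Finset.sum_nbij q (fun a ha => ?_) (fun a ha b hb => ?_) (fun v hv => ?_) fun _ _ => rfl
  · simpa using hq.lt a (by simpa using ha)
  · exact hq.inj a (by simpa using ha) b (by simpa using hb)
  · obtain ⟨a, ha, e⟩ := Graph.surj_of_inj hq.lt hq.inj (v := v) (by simpa using hv)
    exact ⟨a, by simpa using ha, e⟩

namespace Dag

variable {D : Dag} {q : ℕ → ℕ}

/-- Before the node at position `i` of a topological order, all its parents occur. -/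
theorem paths_prefix (hq : D.IsOrder q) {i : ℕ} (hi : i < D.N) :
    (if D.root = q i then 1 else 0) + ∑ a ∈ Finset.range i,
      D.paths (q a) * D.edges (q a) (D.deg (q a)) (q i) = D.paths (q i) := by
  rw [D.paths_eq (q i), hq.sum_eq (fun u => D.paths u * D.edges u (D.deg u) (q i))]
  congr 1
  refine Finset.sum_subset (by simpa using hi.le) fun a ha hai => ?_
  simp only [Finset.mem_range, not_lt] at ha hai
  by_contra h
  obtain ⟨j, hj, e⟩ := D.edges_ne_zero.1 (right_ne_zero_of_mul h)
  obtain ⟨b, hb, hbN, e'⟩ := hq.topo a ha j hj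
  have := hq.inj b hbN i hi (e'.trans e)
  omega

theorem paths_prefix_le (hq : D.IsOrder q) {i : ℕ} (hi : i < D.N) (v : ℕ) :
    (if D.root = v then 1 else 0) + (∑ a ∈ Finset.range i,
      D.paths (q a) * D.edges (q a) (D.deg (q a)) v +
      D.paths (q i) * D.edges (q i) (D.deg (q i)) v) ≤ D.paths v := by
  rw [D.paths_eq v, hq.sum_eq (fun u => D.paths u * D.edges u (D.deg u) v),
    ← Finset.sum_range_succ (fun a => D.paths (q a) * D.edges (q a) (D.deg (q a)) v)]
  exact Nat.add_le_add_left (Finset.sum_le_sum_of_subset (by simpa using hi)) _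

/-- The central parents and the weights of the entries, as far as they are determined by a set of
edges. -/
structure Entries (D : Dag) (Done : ℕ → ℕ → Prop) (pv E : ℕ → ℕ) : Prop where
  pv_cases : ∀ v < D.N, (pv v = 0 ∧ ∀ u j, D.SC u j → Done u j → D.ch u j ≠ v) ∨
    ∃ u j, D.SC u j ∧ D.ch u j = v ∧ pv v = u + 1
  le : ∀ u < D.N, 0 < D.paths u → ∀ j < D.deg u, ¬ D.SC u j → Done u j →
    2 ^ D.pl u ≤ E (D.ch u j)
  root : 1 ≤ E D.root
  cases : ∀ v < D.N, E v = 0 ∨ (v = D.root ∧ E v = 1) ∨ ∃ u < D.N, 0 < D.paths u ∧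
    ∃ j < D.deg u, ¬ D.SC u j ∧ D.ch u j = v ∧ E v = 2 ^ D.pl u

namespace Entries

variable {Done Done' : ℕ → ℕ → Prop} {pv E : ℕ → ℕ} {u j : ℕ}

theorem mono (h : D.Entries Done pv E)
    (hd : ∀ u j, u < D.N → 0 < D.paths u → j < D.deg u → Done' u j → Done u j) :
    D.Entries Done' pv E where
  pv_cases v hv := (h.pv_cases v hv).imp (fun h1 => ⟨h1.1, fun u j hs hdd =>
    h1.2 u j hs (hd u j hs.1 hs.2.1 hs.2.2.1 hdd)⟩) id
  le u hu hp j hj hn hdd := h.le u hu hp j hj hn (hd u j hu hp hj hdd)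
  root := h.root
  cases := h.cases

theorem central (h : D.Entries Done pv E) (hs : D.SC u j) :
    D.Entries (fun w l => Done w l ∨ (w = u ∧ l = j))
      (Function.update pv (D.ch u j) (u + 1)) E where
  pv_cases v hv := by
    by_cases e : v = D.ch u j
    · subst e; exact .inr ⟨u, j, hs, rfl, by simp⟩
    · rw [Function.update_of_ne e]
      refine (h.pv_cases v hv).imp (fun h1 => ⟨h1.1, fun w l hw hd => ?_⟩) id
      rcases hd with hd | ⟨rfl, rfl⟩
      · exact h1.2 w l hw hd
      · exact Ne.symm e
  le w hw hp l hl hn hd := by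
    rcases hd with hd | ⟨rfl, rfl⟩
    · exact h.le w hw hp l hl hn hd
    · exact absurd hs hn
  root := h.root
  cases := h.cases

theorem other (h : D.Entries Done pv E) (hu : u < D.N) (hp : 0 < D.paths u) (hj : j < D.deg u)
    (hs : ¬ D.SC u j) :
    D.Entries (fun w l => Done w l ∨ (w = u ∧ l = j)) pv
      (Function.update E (D.ch u j) (max (E (D.ch u j)) (2 ^ D.pl u))) where
  pv_cases v hv := by
    refine (h.pv_cases v hv).imp (fun h1 => ⟨h1.1, fun w l hw hd => ?_⟩) id
    rcases hd with hd | ⟨rfl, rfl⟩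
    · exact h1.2 w l hw hd
    · exact absurd hw hs
  le w hw hpw l hl hn hd := by
    rw [Function.update_apply]
    rcases hd with hd | ⟨rfl, rfl⟩
    · have := h.le w hw hpw l hl hn hd
      split_ifs with e
      · rw [e] at this; exact this.trans (le_max_left _ _)
      · exact this
    · simp
  root := by
    rw [Function.update_apply]; split_ifs with e
    · have := h.root; rw [e] at this; exact this.trans (le_max_left _ _)
    · exact h.root
  cases v hv := by
    rw [Function.update_apply]; split_ifs with e
    · subst e
      rcases max_cases (E (D.ch u j)) (2 ^ D.pl u) with ⟨e, _⟩ | ⟨e, _⟩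
      · rw [e]; exact h.cases _ hv
      · rw [e]; exact .inr (.inr ⟨u, hu, hp, j, hj, hs, rfl, rfl⟩)
    · exact h.cases v hv

end Entries

/-- The data of the symmetric centroid decomposition, for the nodes that occur in the unfolding:
`nx u` is one more than the index of the central child of `u`, `pv v` is one more than the central
parent of `v` (or `0`, if there is none), and `E` and `X` are the weights of entries and exits. -/
structure Decomp (D : Dag) (nx pv E X : ℕ → ℕ) : Prop where
  nx_cases : ∀ u < D.N, 0 < D.paths u → (nx u = 0 ∧ ∀ j, ¬ D.SC u j) ∨ ∃ j, nx u = j + 1 ∧ D.SC u j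
  pv_cases : ∀ v < D.N, (pv v = 0 ∧ ∀ u j, D.SC u j → D.ch u j ≠ v) ∨
    ∃ u j, D.SC u j ∧ D.ch u j = v ∧ pv v = u + 1
  entry : D.IsEntry E
  exit : ∀ u < D.N, 0 < D.paths u → D.IsExit u (X u)

end Dag

/-! ### Counting the occurrences of the nodes -/

namespace RAM

open Program CircuitBalancing.RAM.Expr State Dag

variable {B V : ℕ}

/-- Add the register `val` to a cell of the array `a`; the array `p` holds the powers of two of the
same magnitude. -/
def accum (a p : Arr) (x : Reg) : Program :=
  seq (put a (rd x) (ld a (rd x) + rd .val)) <|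
  seq (branch (ld p (rd x)) (rd .pow) (put p (rd x) (rd .pow)) skip) <|
  branch (ld a (rd x)) (ld p (rd x) + ld p (rd x)) skip
    (put p (rd x) (ld p (rd x) + ld p (rd x)))

theorem sat_accum {a p : Arr} (hap : a ≠ p) {x : Reg} {s : State} {i y : ℕ} (hx : s.r x = i)
    (hv : s.r .val = y) (hy : 0 < y) (hw : s.r .pow = fl y) (hp : s.m p i = fl (s.m a i))
    (hV : s.m a i + y ≤ V) :
    (accum a p x).Sat V s fun s' => (s'.m a = Function.update (s.m a) i (s.m a i + y) ∧
      s'.m p = Function.update (s.m p) i (fl (s.m a i + y))) ∧ (accum a p x).Frame s s' := by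
  refine Sat.frame ?_
  have h1 := fl_le (s.m a i)
  have h2 := fl_le y
  have h3 := fl_le (s.m a i + y)
  simp only [accum, sat_seq, sat_put, tame_rd, tame_ld, tame_add, eval_add, eval_ld, eval_rd,
    hx, hv,
    true_and, sat_branch, m_setM_ne _ _ _ hap.symm, hp, r_setM, hw, m_setM_same, sat_skip,
    Function.update_self, Function.update_idem, m_setM_ne _ _ _ hap]
  refine ⟨hV, fun hlt => ⟨by omega, fun h4 => ?_, fun h4 => ⟨?_, ?_⟩⟩,
    fun hge => ⟨fun h4 => ?_, fun h4 => ⟨?_, ?_⟩⟩⟩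
  · rw [fl_add _ hy, max_eq_right hlt.le, if_pos h4]
  · omega
  · rw [fl_add _ hy, max_eq_right hlt.le, if_neg (by omega)]
  · rw [fl_add _ hy, max_eq_left hge, if_pos h4, ← hp, Function.update_eq_self]
  · omega
  · rw [fl_add _ hy, max_eq_left hge, if_neg (by omega)]

/-- Count the occurrences of the nodes in the unfolding, in topological order. -/
def countPaths (R : ℕ) : Program :=
  seq (seq (set .root (ld .rep (ld .root (ld .tok (const 1))))) <|
    seq (put .pi (rd .root) (const 1)) <| seq (put .pp (rd .root) (const 1)) <|
    put .ent (rd .root) (const 1)) <|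
  forTo .idx .len <|
    seq (set .cur (ld .queue (rd .idx))) <|
    seq (set .val (ld .pi (rd .cur))) <|
    seq (set .pow (ld .pp (rd .cur))) <|
    branch (const 0) (rd .val)
      (seq (set .deg (ld .deg (rd .cur))) <|
        upTo R .deg fun j => seq (set .nxt (ld (.ch j) (rd .cur))) (accum .pi .pp .nxt))
      skip

theorem reaches_countPaths {R : ℕ} (D : Dag) (hB : (countPaths R).coef * (V + 1) ≤ B)
    (hV : D.N + R + D.μ D.root ≤ V) (hR : ∀ u < D.N, D.deg u ≤ R)
    {s : State} (hs : s.Bd V) (hl : s.r .len = D.N)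
    (hroot : s.m .rep (s.m .root (s.m .tok 1)) = D.root)
    (hdeg : ∀ u < D.N, s.m .deg u = D.deg u)
    (hch : ∀ u < D.N, ∀ j < D.deg u, s.m (.ch j) u = D.ch u j)
    (hq : D.IsOrder (s.m .queue))
    (hpi : ∀ i, s.m .pi i = 0) (hpp : ∀ i, s.m .pp i = 0) (hent : ∀ i, s.m .ent i = 0) :
    (countPaths R).Reaches B V s ((countPaths R).wcost * (D.N + 1)) fun s' =>
      s'.r .root = D.root ∧ (∀ v < D.N, s'.m .pi v = D.paths v ∧ s'.m .pp v = fl (D.paths v)) ∧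
      ∀ v, s'.m .ent v = if v = D.root then 1 else 0 := by
  have hrl := D.root_lt
  have hrp := D.μ_pos hrl
  refine (Sat.reaches' (Q := fun s' => (s'.r .root = D.root ∧ s'.r .len = D.N ∧
    (∀ v, s'.m .pi v = if D.root = v then 1 else 0) ∧
    (∀ v, s'.m .pp v = fl (s'.m .pi v)) ∧ ∀ v, s'.m .ent v = if v = D.root then 1 else 0) ∧
    Frame _ s s') (Sat.frame ?_) hs
    (coef_seq_left hB) _).seq' fun s1 hs1 h1 => ?_
  · simp [hroot, hl]
    refine ⟨by omega, by omega, fun v => ?_, fun v => ?_, fun v => ?_⟩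
    · simp [Function.update_apply, hpi, eq_comm]
    · by_cases e : v = D.root <;> simp [e, hpi, hpp, fl]
    · simp [Function.update_apply, hent]
  obtain ⟨⟨hr1, hl1, hpi1, hpp1, hent1⟩, hf1⟩ := h1
  have hdeg1 : s1.m .deg = s.m .deg := hf1.1 _ (by simp)
  have hque1 : s1.m .queue = s.m .queue := hf1.1 _ (by simp)
  have hch1 : ∀ j, s1.m (.ch j) = s.m (.ch j) := fun j => hf1.1 _ (by simp)
  obtain ⟨q, hqq⟩ : ∃ q, q = s.m .queue := ⟨_, rfl⟩
  rw [← hqq] at hq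
  refine (reaches_forTo (n := D.N)
    (fun i s => (∀ v < D.N, s.m .pi v = (if D.root = v then 1 else 0) +
      ∑ a ∈ Finset.range i, D.paths (q a) * D.edges (q a) (D.deg (q a)) v) ∧
      ∀ v < D.N, s.m .pp v = fl (s.m .pi v))
    hs1 (coef_seq_right hB) (by omega) hl1 (by simp [accum]) (by simp [accum]) (by simp) ?_
    ?_).mono le_rfl ?_
  · simp [hpi1, hpp1]
  · intro i hi s' _ hf hidx _ ⟨h1, h2⟩
    have hdeg' : s'.m .deg = s.m .deg := (hf.1 _ (by simp [accum])).trans hdeg1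
    have hque' : s'.m .queue = q := ((hf.1 _ (by simp [accum])).trans hque1).trans hqq.symm
    have hch' : ∀ j, s'.m (.ch j) = s.m (.ch j) := fun j =>
      (hf.1 _ (by simp [accum])).trans (hch1 j)
    have huN : q i < D.N := hq.lt i hi
    obtain ⟨u, hu⟩ : ∃ u, u = q i := ⟨_, rfl⟩
    have hpu : s'.m .pi u = D.paths u := by rw [hu, h1 _ huN, paths_prefix hq hi]
    rw [← hu] at huN
    have hple := D.paths_le huN
    have hfle := fl_le (D.paths u)
    simp only [sat_seq, sat_set, tame_ld, tame_rd, eval_ld, eval_rd, hidx, hque', ← hu, m_setR,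
      r_setR_same, hpu, h2 u huN, true_and, sat_branch, tame_const, eval_const, ne_eq, reduceCtorEq,
      not_false_eq_true, r_setR_ne, hdeg', hdeg u huN, sat_skip, Finset.sum_range_succ]
    refine ⟨by omega, by omega, by omega, fun hpos => ⟨by have := hR u huN; omega, ?_⟩,
      fun h0 => ⟨fun v hv => ?_, fun v hv => h2 v hv⟩⟩
    · refine (sat_upTo (hR u huN) (fun j s2 => ∀ v < D.N, s2.m .pi v = (if D.root = v then 1 else 0)
          + (∑ a ∈ Finset.range i, D.paths (q a) * D.edges (q a) (D.deg (q a)) v +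
            D.paths u * D.edges u j v) ∧ s2.m .pp v = fl (s2.m .pi v))
        (by simp) (by simp [accum]) ?_ ?_).mono ?_
      · simp only [m_setR]
        exact fun v hv => ⟨by simpa [Graph.edges] using h1 v hv, h2 v hv⟩
      · intro j hj s2 hf2 h3
        have hcur : s2.r .cur = u := by rw [hf2.2 _ (by simp [accum])]; simp
        have hval : s2.r .val = D.paths u := by rw [hf2.2 _ (by simp [accum])]; simp
        have hpow : s2.r .pow = fl (D.paths u) := by rw [hf2.2 _ (by simp [accum])]; simp
        have hch2 : s2.m (.ch j) u = D.ch u j := by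
          rw [hf2.1 _ (by simp [accum]), m_setR, m_setR, m_setR, m_setR, hch', hch u huN j hj]
        have hcN := D.ch_lt u huN j hj
        simp only [sat_seq, sat_set, tame_ld, tame_rd, eval_ld, eval_rd, hcur, hch2, true_and]
        refine ⟨by omega, (sat_accum (V := V) (by simp) (i := D.ch u j) (y := D.paths u) (by simp)
          (by simpa using hval) hpos (by simpa using hpow) ?_ ?_).mono ?_⟩
        · simpa using (h3 _ hcN).2
        · have h4 := paths_prefix_le hq hi (D.ch u j)
          rw [← hu] at h4
          have h5 := Nat.mul_le_mul_left (D.paths u) (D.edges_mono u (D.ch u j) (d := j + 1) hj)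
          rw [Graph.edges_succ, if_pos rfl, mul_add, mul_one] at h5
          have h6 := D.paths_le hcN
          rw [m_setR, (h3 _ hcN).1]
          omega
        · rintro s3 ⟨⟨e1, e2⟩, -⟩ v hv
          rw [e1, e2, m_setR, Graph.edges_succ]
          by_cases e : v = D.ch u j
          · subst e
            simp [(h3 _ hcN).1, mul_add]
            omega
          · have := h3 v hv
            simpa [e, Ne.symm e] using this
      · rintro s2 ⟨h3, -⟩
        exact ⟨fun v hv => (h3 v hv).1, fun v hv => (h3 v hv).2⟩
    · rw [h1 v hv, Nat.le_zero.1 h0]; simp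
  · rintro s' - ⟨⟨h1, h2⟩, hf⟩
    have hent' : s'.m .ent = s1.m .ent := hf.1 _ (by simp [accum])
    refine ⟨by rw [hf.2 _ (by simp [accum]), hr1], fun v hv => ?_, by rw [hent']; exact hent1⟩
    have : s'.m .pi v = D.paths v := by
      rw [h1 v hv, D.paths_eq v, hq.sum_eq (fun u => D.paths u * D.edges u (D.deg u) v)]
    exact ⟨this, by rw [h2 v hv, this]⟩

end RAM

/-! ### Computation of the decomposition -/

/-- Since `nl` cannot increase and `pl` cannot decrease, a single comparison of powers of two
decides whether an edge is central. -/
theorem Dag.sc_iff {D : Dag} {u j : ℕ} (hu : u < D.N) (hp : 0 < D.paths u) (hj : j < D.deg u) :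
    D.SC u j ↔ 2 ^ D.nl u + 2 ^ D.pl (D.ch u j) ≤ 2 ^ D.nl (D.ch u j) + 2 ^ D.pl u := by
  have h1 := Nat.pow_le_pow_right two_pos (D.nl_ch_le hu hj)
  have h2 := Nat.pow_le_pow_right two_pos (D.pl_le_ch hu hj)
  constructor
  · rintro ⟨-, -, -, e1, e2⟩; rw [e1, e2]
  · intro h
    exact ⟨hu, hp, hj, Nat.pow_right_injective le_rfl (by simp only; omega),
      Nat.pow_right_injective le_rfl (by simp only; omega)⟩

namespace RAM

open Program CircuitBalancing.RAM.Expr State Dag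

variable {B V : ℕ}

/-- Replace the contents of a cell by the maximum of it and the value of an expression. -/
def raise (a : Arr) (i e : Expr) : Program := branch (ld a i) e (put a i e) skip

theorem State.setM_self (s : State) (a : Arr) (i : ℕ) : s.setM a i (s.m a i) = s := by
  simp [setM, State.m]

@[simp] theorem sat_raise (a : Arr) (i e : Expr) (s : State) (Q : State → Prop) :
    (raise a i e).Sat V s Q ↔ i.Tame V s ∧ e.Tame V s ∧
      (s.m a (i.eval s) < e.eval s → e.eval s ≤ V) ∧
      Q (s.setM a (i.eval s) (max (s.m a (i.eval s)) (e.eval s))) := by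
  simp only [raise, sat_branch, tame_ld, eval_ld, sat_put, sat_skip]
  rcases lt_or_ge (s.m a (i.eval s)) (e.eval s) with h | h
  · simp only [max_eq_right h.le, h, h.not_ge, true_imp_iff, false_imp_iff, and_true]
    tauto
  · simp only [max_eq_left h, h, h.not_gt, true_imp_iff, false_imp_iff, true_and, State.setM_self]

@[simp] theorem writes_raise (a b : Arr) (i e : Expr) :
    (raise b i e).Writes a.num ↔ a = b := by simp [raise]

@[simp] theorem sets_raise (x : ℕ) (b : Arr) (i e : Expr) : ¬ (raise b i e).Sets x := by
  simp [raise]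

@[simp] theorem writes_accum (a b p : Arr) (x : Reg) :
    (accum b p x).Writes a.num ↔ a = b ∨ a = p := by simp [accum]

@[simp] theorem sets_accum (x : ℕ) (b p : Arr) (y : Reg) : ¬ (accum b p y).Sets x := by
  simp [accum]

/-- The size of the unfolding from the node in the register `cur`. -/
def addSizes (R : ℕ) : Program :=
  upTo R .deg fun j => seq (set .nxt (ld (.ch j) (rd .cur))) <|
    seq (set .val (ld .n (rd .nxt))) <| seq (set .pow (ld .pn (rd .nxt))) (accum .n .pn .cur)

/-- Classify the edges from the node in the register `cur`. -/
def classify (R : ℕ) : Program :=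
  upTo R .deg fun j => seq (set .nxt (ld (.ch j) (rd .cur))) <|
    branch (ld .pn (rd .nxt) + ld .pp (rd .cur)) (ld .pn (rd .cur) + ld .pp (rd .nxt))
      (seq (raise .ext (rd .cur) (ld .pn (rd .nxt))) (raise .ent (rd .nxt) (ld .pp (rd .cur))))
      (seq (put .nx (rd .cur) (const (j + 1))) (put .pv (rd .nxt) (rd .cur + const 1)))

/-- Compute the sizes of the unfoldings and the symmetric centroid decomposition, in reverse
topological order. -/
def decompose (R : ℕ) : Program :=
  forTo .idx .len <| seq (set .cur (ld .queue (rd .len - const 1 - rd .idx))) <|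
    branch (const 0) (ld .pi (rd .cur))
      (seq (put .n (rd .cur) (const 1)) <| seq (put .pn (rd .cur) (const 1)) <|
        seq (put .ext (rd .cur) (const 1)) <| seq (put .nx (rd .cur) (const 0)) <|
        seq (set .deg (ld .deg (rd .cur))) <| seq (addSizes R) (classify R)) skip

@[simp] theorem writes_addSizes {a : Arr} {R : ℕ} :
    (addSizes R).Writes a.num → a = .n ∨ a = .pn := by simp [addSizes]

@[simp] theorem writes_classify {a : Arr} {R : ℕ} :
    (classify R).Writes a.num → a = .ext ∨ a = .ent ∨ a = .nx ∨ a = .pv := by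
  simp [classify]; tauto

theorem sets_addSizes {x : Reg} {R : ℕ} :
    (addSizes R).Sets x.num → x = .nxt ∨ x = .val ∨ x = .pow := by simp [addSizes]

theorem writes_decompose {a : Arr} {R : ℕ} : (decompose R).Writes a.num →
    a = .n ∨ a = .pn ∨ a = .ext ∨ a = .ent ∨ a = .nx ∨ a = .pv := by
  simp [decompose, addSizes, classify]; tauto

theorem sets_decompose {x : Reg} {R : ℕ} : (decompose R).Sets x.num →
    x = .nxt ∨ x = .val ∨ x = .pow ∨ x = .cur ∨ x = .deg ∨ x = .idx := by
  simp [decompose, addSizes, classify]; tauto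

theorem sat_addSizes {R u : ℕ} (D : Dag) {s : State} (hu : u < D.N) (hp : 0 < D.paths u)
    (hV : D.μ D.root ≤ V)
    (hR : D.deg u ≤ R) (hcN : D.N ≤ V) (hcur : s.r .cur = u) (hdeg : s.r .deg = D.deg u)
    (hch : ∀ j < D.deg u, s.m (.ch j) u = D.ch u j) (hn : s.m .n u = 1) (hpn : s.m .pn u = 1)
    (hs : ∀ j < D.deg u, s.m .n (D.ch u j) = D.μ (D.ch u j) ∧
      s.m .pn (D.ch u j) = 2 ^ D.nl (D.ch u j)) :
    (addSizes R).Sat V s fun s' => (s'.m .n = Function.update (s.m .n) u (D.μ u) ∧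
      s'.m .pn = Function.update (s.m .pn) u (2 ^ D.nl u)) ∧ (addSizes R).Frame s s' := by
  have key : ∀ j, (j ≤ D.deg u) → 1 + ∑ l ∈ Finset.range j, D.μ (D.ch u l) ≤ D.μ u := fun j hj => by
    rw [D.μ_eq u hu]
    exact Nat.add_le_add_left (Finset.sum_le_sum_of_subset (by simpa using hj)) _
  have hroot := D.μ_le_root hp
  refine (sat_upTo hR (fun j s' =>
    s'.m .n = Function.update (s.m .n) u (1 + ∑ l ∈ Finset.range j, D.μ (D.ch u l)) ∧
    s'.m .pn = Function.update (s.m .pn) u (fl (1 + ∑ l ∈ Finset.range j, D.μ (D.ch u l))))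
    hdeg (by simp) ⟨?_, ?_⟩ ?_).mono ?_
  · rw [Finset.sum_range_zero, add_zero, ← hn, Function.update_eq_self]
  · rw [Finset.sum_range_zero, add_zero, show fl 1 = 1 by simp [fl], ← hpn, Function.update_eq_self]
  · rintro j hj s2 hf ⟨h1, h2⟩
    have hcur : s2.r .cur = u := by rw [hf.2 _ (by simp)]; exact hcur
    have hch2 : s2.m (.ch j) u = D.ch u j := by rw [hf.1 _ (by simp), hch j hj]
    have hc := D.ch_lt u hu j hj
    have hne : D.ch u j ≠ u := fun e => by have := D.μ_lt u hu j hj; rw [e] at this; omega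
    have hle := D.μ_lt u hu j hj
    have hk := key (j + 1) hj
    rw [Finset.sum_range_succ, ← add_assoc] at hk
    have h3 := Nat.pow_log_le_self 2 (D.μ_pos hc).ne'
    simp only [sat_seq, sat_set, tame_ld, tame_rd, eval_ld, eval_rd, hcur, hch2, true_and, m_setR,
      r_setR_same, h1, h2, Function.update_of_ne hne, hs j hj, ne_eq, reduceCtorEq,
      not_false_eq_true, r_setR_ne]
    refine ⟨by omega, by omega, h3.trans (by omega), (sat_accum (V := V) (by simp) (i := u)
      (y := D.μ (D.ch u j)) (by simp [hcur]) (by simp) (D.μ_pos hc)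
      (by simp [fl_of_pos (D.μ_pos hc), nl]) (by simp [h1, h2]) (by simp [h1]; omega)).mono ?_⟩
    rintro s3 ⟨⟨e1, e2⟩, -⟩
    rw [e1, e2]
    simp only [m_setR, h1, h2, Function.update_self, Function.update_idem, Finset.sum_range_succ,
      ← add_assoc, and_self]
  · rintro s' ⟨⟨h1, h2⟩, hf⟩
    rw [← D.μ_eq u hu] at h1 h2
    exact ⟨⟨h1, by rw [h2, fl_of_pos (D.μ_pos hu)]; rfl⟩, hf⟩

theorem sat_classify {R u : ℕ} (D : Dag) {s : State} (hu : u < D.N) (hp : 0 < D.paths u)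
    (hV : D.N + R + D.μ D.root ≤ V) (hR : D.deg u ≤ R)
    (hcur : s.r .cur = u) (hdeg : s.r .deg = D.deg u)
    (hch : ∀ j < D.deg u, s.m (.ch j) u = D.ch u j)
    (hext : s.m .ext u = 1) (hnx : s.m .nx u = 0)
    (hpn : s.m .pn u = 2 ^ D.nl u) (hpp : s.m .pp u = 2 ^ D.pl u)
    (hs : ∀ j < D.deg u, s.m .pn (D.ch u j) = 2 ^ D.nl (D.ch u j) ∧
      s.m .pp (D.ch u j) = 2 ^ D.pl (D.ch u j)) {Done : ℕ → ℕ → Prop}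
    (he : D.Entries Done (s.m .pv) (s.m .ent)) :
    (classify R).Sat V s fun s' =>
      ((s'.m .nx u = 0 ∧ ∀ j, ¬ D.SC u j) ∨ ∃ j, s'.m .nx u = j + 1 ∧ D.SC u j) ∧
      D.IsExit u (s'.m .ext u) ∧
      D.Entries (fun w l => Done w l ∨ w = u) (s'.m .pv) (s'.m .ent) ∧
      ∀ v ≠ u, s'.m .nx v = s.m .nx v ∧ s'.m .ext v = s.m .ext v := by
  refine (sat_upTo hR (fun j s' =>
      ((s'.m .nx u = 0 ∧ ∀ l < j, ¬ D.SC u l) ∨ ∃ l, s'.m .nx u = l + 1 ∧ D.SC u l) ∧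
      ((∀ l < j, ¬ D.SC u l → 2 ^ D.nl (D.ch u l) ≤ s'.m .ext u) ∧
        (s'.m .ext u = 1 ∨ ∃ l < D.deg u, ¬ D.SC u l ∧ s'.m .ext u = 2 ^ D.nl (D.ch u l))) ∧
      D.Entries (fun w l => Done w l ∨ (w = u ∧ l < j)) (s'.m .pv) (s'.m .ent) ∧
      ∀ v ≠ u, s'.m .nx v = s.m .nx v ∧ s'.m .ext v = s.m .ext v)
    hdeg (by simp) ⟨.inl ⟨hnx, by simp⟩, ⟨by simp, .inl hext⟩, ?_, by simp⟩ ?_).mono ?_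
  · exact he.mono (by simp)
  · rintro j hj s2 hf ⟨h1, ⟨h2, h2'⟩, h3, h4⟩
    have hcur : s2.r .cur = u := by rw [hf.2 _ (by simp)]; exact hcur
    have hch2 : s2.m (.ch j) u = D.ch u j := by rw [hf.1 _ (by simp), hch j hj]
    have hpn2 : s2.m .pn = s.m .pn := hf.1 _ (by simp)
    have hpp2 : s2.m .pp = s.m .pp := hf.1 _ (by simp)
    have hc := D.ch_lt u hu j hj
    have hcp := paths_ch_pos hu hp hj
    have hle := D.μ_lt u hu j hj
    have hroot := D.μ_le_root hp
    have hv1 : 2 ^ D.nl (D.ch u j) ≤ D.μ (D.ch u j) := Nat.pow_log_le_self 2 (D.μ_pos hc).ne'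
    have hv2 : 2 ^ D.pl u ≤ D.paths u := Nat.pow_log_le_self 2 hp.ne'
    have hv3 := D.paths_le hu
    simp only [sat_seq, sat_set, tame_ld, tame_rd, eval_ld, eval_rd, hcur, hch2, true_and, m_setR,
      r_setR_same, sat_branch, tame_add, eval_add, hpn2, hpp2, hpn, hpp, (hs j hj).1,
      (hs j hj).2, sat_raise, sat_put, tame_const, eval_const, ne_eq, reduceCtorEq,
      not_false_eq_true, r_setR_ne, m_setM_same, m_setM_ne, r_setM, and_true]
    refine ⟨by omega, fun hlt => ?_, fun hge => ?_⟩
    · have hsc : ¬ D.SC u j := fun h => by rw [D.sc_iff hu hp hj] at h; omega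
      refine ⟨fun _ => by omega, fun _ => by omega, ?_, ⟨fun l hl hn => ?_, ?_⟩, ?_, fun v hv => ?_⟩
      · refine h1.imp (fun h => ⟨h.1, fun l hl => ?_⟩) id
        rcases Nat.lt_succ_iff_lt_or_eq.1 hl with hl | rfl
        exacts [h.2 l hl, hsc]
      · rw [Function.update_self]
        rcases Nat.lt_succ_iff_lt_or_eq.1 hl with hl | rfl
        exacts [(h2 l hl hn).trans (le_max_left _ _), le_max_right _ _]
      · rw [Function.update_self]
        rcases max_choice (s2.m .ext u) (2 ^ D.nl (D.ch u j)) with e | e <;> rw [e]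
        exacts [h2', .inr ⟨j, hj, hsc, rfl⟩]
      · refine (h3.other hu hp hj hsc).mono fun w l _ _ _ hd => ?_
        rcases hd with hd | ⟨rfl, hd⟩
        · exact .inl (.inl hd)
        · rcases Nat.lt_succ_iff_lt_or_eq.1 hd with hl | rfl
          exacts [.inl (.inr ⟨rfl, hl⟩), .inr ⟨rfl, rfl⟩]
      · rw [Function.update_of_ne hv]; exact h4 v hv
    · have hsc : D.SC u j := by rw [D.sc_iff hu hp hj]; omega
      refine ⟨by omega, by omega, .inr ⟨j, by simp, hsc⟩, ⟨fun l hl hn => ?_, h2'⟩, ?_,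
        fun v hv => ?_⟩
      · rcases Nat.lt_succ_iff_lt_or_eq.1 hl with hl | rfl
        exacts [h2 l hl hn, absurd hsc hn]
      · refine (h3.central hsc).mono fun w l _ _ _ hd => ?_
        rcases hd with hd | ⟨rfl, hd⟩
        · exact .inl (.inl hd)
        · rcases Nat.lt_succ_iff_lt_or_eq.1 hd with hl | rfl
          exacts [.inl (.inr ⟨rfl, hl⟩), .inr ⟨rfl, rfl⟩]
      · rw [Function.update_of_ne hv]; exact h4 v hv
  · rintro s' ⟨⟨h1, h2, h3, h4⟩, -⟩
    refine ⟨h1.imp (fun h => ⟨h.1, fun j hj => h.2 j hj.2.2.1 hj⟩) id, ⟨h2.1, h2.2⟩,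
      h3.mono fun w l hw hpw hl hd => hd.imp id ?_, h4⟩
    rintro rfl; exact ⟨rfl, hl⟩

theorem reaches_decompose {R : ℕ} (D : Dag) (hB : (decompose R).coef * (V + 1) ≤ B)
    (hV : D.N + R + D.μ D.root ≤ V) (hR : ∀ u < D.N, D.deg u ≤ R)
    {s : State} (hs : s.Bd V) (hl : s.r .len = D.N)
    (hdeg : ∀ u < D.N, s.m .deg u = D.deg u)
    (hch : ∀ u < D.N, ∀ j < D.deg u, s.m (.ch j) u = D.ch u j)
    (hq : D.IsOrder (s.m .queue))
    (hpi : ∀ v < D.N, s.m .pi v = D.paths v ∧ s.m .pp v = fl (D.paths v))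
    (hent : ∀ v, s.m .ent v = if v = D.root then 1 else 0) (hpv : ∀ v, s.m .pv v = 0) :
    (decompose R).Reaches B V s ((decompose R).wcost * (D.N + 1)) fun s' =>
      ((∀ u < D.N, 0 < D.paths u → s'.m .pn u = 2 ^ D.nl u) ∧
      D.Decomp (s'.m .nx) (s'.m .pv) (s'.m .ent) (s'.m .ext)) ∧ (decompose R).Frame s s' := by
  obtain ⟨q, hqq⟩ : ∃ q, q = s.m .queue := ⟨_, rfl⟩
  rw [← hqq] at hq
  have hμ0 := D.μ_pos D.root_lt
  refine Reaches.frame ((reaches_forTo (n := D.N) (fun i s =>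
      (∀ a < D.N, D.N ≤ a + i → 0 < D.paths (q a) → s.m .n (q a) = D.μ (q a) ∧
        s.m .pn (q a) = 2 ^ D.nl (q a) ∧
        ((s.m .nx (q a) = 0 ∧ ∀ j, ¬ D.SC (q a) j) ∨
          ∃ j, s.m .nx (q a) = j + 1 ∧ D.SC (q a) j) ∧ D.IsExit (q a) (s.m .ext (q a))) ∧
      D.Entries (fun w _ => ∃ a < D.N, D.N ≤ a + i ∧ q a = w) (s.m .pv) (s.m .ent))
    hs hB (by omega) hl (by simp [addSizes, classify]) (by simp [addSizes, classify])
    (by simp) ?_ ?_).mono le_rfl ?_)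
  · refine ⟨fun a ha h => by omega, ⟨fun v hv => .inl ⟨hpv v, ?_⟩, ?_, ?_, fun v hv => ?_⟩⟩
    · rintro u j _ ⟨a, ha, h, -⟩; omega
    · rintro u _ _ j _ _ ⟨a, ha, h, -⟩; omega
    · simp [hent]
    · simp only [m_setR, hent]; split_ifs with e
      exacts [.inr (.inl ⟨e, rfl⟩), .inl rfl]
  · intro i hi s' _ hf hidx hlen ⟨h1, h2⟩
    have hfm : ∀ a : Arr, ¬ (a = .n ∨ a = .pn ∨ a = .ext ∨ a = .ent ∨ a = .nx ∨ a = .pv) →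
        s'.m a = s.m a := fun a ha => hf.1 a (mt writes_decompose ha)
    have hdeg' : s'.m .deg = s.m .deg := hfm _ (by simp)
    have hque' : s'.m .queue = q := (hfm _ (by simp)).trans hqq.symm
    have hch' : ∀ j, s'.m (.ch j) = s.m (.ch j) := fun j => hfm _ (by simp)
    have hpi' : s'.m .pi = s.m .pi := hfm _ (by simp)
    have hpp' : s'.m .pp = s.m .pp := hfm _ (by simp)
    obtain ⟨b, hb, hbN⟩ : ∃ b, b = D.N - 1 - i ∧ b < D.N := ⟨_, rfl, by omega⟩
    have huN : q b < D.N := hq.lt b hbN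
    obtain ⟨u, hu⟩ : ∃ u, u = q b := ⟨_, rfl⟩
    rw [← hu] at huN
    have hnew : ∀ a < D.N, D.N ≤ a + (i + 1) → a = b ∨ (D.N ≤ a + i ∧ q a ≠ u) := by
      intro a ha h
      by_cases e : a = b
      · exact .inl e
      · exact .inr ⟨by omega, fun e' => e (hq.inj a ha b hbN (e'.trans hu))⟩
    have hRu := hR u huN
    simp only [sat_seq, sat_set, tame_ld, tame_rd, eval_ld, eval_rd, hidx, hlen, hque', ← hb, ← hu,
      m_setR, tame_sub, eval_sub, tame_const, eval_const, sat_branch,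
      r_setR_same, hpi', (hpi u huN).1, true_and, sat_put, m_setM_ne, r_setM, ne_eq,
      reduceCtorEq, not_false_eq_true, hdeg', hdeg u huN, sat_skip, and_true, zero_le]
    refine ⟨by omega, fun hpos => ⟨by omega, by omega, by omega, by omega, ?_⟩, fun h0 => ⟨?_, ?_⟩⟩
    · have hchild : ∀ j < D.deg u, D.ch u j ≠ u ∧ s'.m .n (D.ch u j) = D.μ (D.ch u j) ∧
          s'.m .pn (D.ch u j) = 2 ^ D.nl (D.ch u j) := by
        intro j hj
        obtain ⟨a, hab, haN, e⟩ := hq.topo b hbN j (hu ▸ hj)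
        have hpc := paths_ch_pos huN hpos hj
        rw [← hu] at e
        have h3 := h1 a haN (by omega) (by rw [e]; exact hpc)
        rw [e] at h3
        have hne : D.ch u j ≠ u := fun e' => by
          have := D.μ_lt u huN j hj; rw [e'] at this; omega
        exact ⟨hne, h3.1, h3.2.1⟩
      refine (sat_addSizes (V := V) D huN hpos (by omega) hRu (by omega) ?_ ?_ ?_ ?_ ?_ ?_).mono ?_
      · simp
      · simp
      · exact fun j hj => by simp [hch', hch u huN j hj]
      · simp
      · simp
      · exact fun j hj => by simp [hchild j hj]
      · rintro s2 ⟨⟨hn2, hpn2⟩, hf2⟩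
        have hfm2 : ∀ a : Arr, ¬ (a = .n ∨ a = .pn) → _ :=
          fun a ha => hf2.1 a (mt writes_addSizes ha)
        have hpv2 := hfm2 .pv (by simp)
        have hent2 := hfm2 .ent (by simp)
        have hnx2 := hfm2 .nx (by simp)
        have hext2 := hfm2 .ext (by simp)
        have hpp2 := hfm2 .pp (by simp)
        have hcur2 := hf2.2 .cur (mt sets_addSizes (by simp))
        have hdeg2 := hf2.2 .deg (mt sets_addSizes (by simp))
        have hch2 := fun j => hfm2 (.ch j) (by simp)
        simp only [m_setR, m_setM_ne, m_setM_same, r_setM, ne_eq, reduceCtorEq, not_false_eq_true,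
          r_setR_same, r_setR_ne] at hpv2 hent2 hnx2 hext2 hpp2 hcur2 hdeg2 hch2 hn2 hpn2
        refine (sat_classify D huN hpos hV hRu hcur2 hdeg2
          (fun j hj => by rw [hch2, hch', hch u huN j hj]) (by simp [hext2]) (by simp [hnx2])
          (by simp [hpn2]) (by rw [hpp2, hpp', (hpi u huN).2, fl_of_pos hpos]; rfl)
          (fun j hj => ⟨?_, ?_⟩)
          (Done := fun w _ => ∃ a < D.N, D.N ≤ a + i ∧ q a = w) ?_).frame.mono ?_
        · simp [hpn2, hchild j hj]
        · rw [hpp2, hpp', (hpi _ (D.ch_lt u huN j hj)).2, fl_of_pos (paths_ch_pos huN hpos hj)]; rfl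
        · rw [hpv2, hent2]; exact h2
        · rintro s3 ⟨⟨h3, h4, h5, h6⟩, hf3⟩
          have hn3 := hf3.1 .n (mt writes_classify (by simp))
          have hpn3 := hf3.1 .pn (mt writes_classify (by simp))
          refine ⟨fun a ha hle hpa => ?_, h5.mono ?_⟩
          · simp only [hn3, hpn3, hn2, hpn2]
            rcases hnew a ha hle with rfl | ⟨hle', hne⟩
            · rw [← hu]
              exact ⟨by simp, by simp, h3, h4⟩
            · rw [(h6 _ hne).1, (h6 _ hne).2, hnx2, hext2]
              simpa [hne] using h1 a ha hle' hpa
          · rintro w l - - - ⟨a, ha, hle, e⟩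
            rcases hnew a ha hle with rfl | ⟨hle', hne⟩
            · exact .inr (e.symm.trans hu.symm)
            · exact .inl ⟨a, ha, hle', e⟩
    · intro a ha hle hpa
      rcases hnew a ha hle with rfl | ⟨hle', hne⟩
      · rw [← hu] at hpa; omega
      · exact h1 a ha hle' hpa
    · refine h2.mono ?_
      rintro w l - hpw - ⟨a, ha, hle, e⟩
      rcases hnew a ha hle with rfl | ⟨hle', hne⟩
      · rw [← e, ← hu] at hpw; omega
      · exact ⟨a, ha, hle', e⟩
  · rintro s' - ⟨⟨h1, h2⟩, hf⟩
    have hsurj : ∀ u < D.N, ∃ a < D.N, q a = u := fun u hu => Graph.surj_of_inj hq.lt hq.inj hu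
    refine ⟨fun u hu hp => ?_, ⟨fun u hu hp => ?_, fun v hv => ?_, ⟨?_, h2.root, h2.cases⟩,
      fun u hu hp => ?_⟩⟩
    · obtain ⟨a, ha, rfl⟩ := hsurj u hu
      exact (h1 a ha (by omega) hp).2.1
    · obtain ⟨a, ha, rfl⟩ := hsurj u hu
      exact (h1 a ha (by omega) hp).2.2.1
    · refine (h2.pv_cases v hv).imp (fun h => ⟨h.1, fun u j hs => h.2 u j hs ?_⟩) id
      obtain ⟨a, ha, e⟩ := hsurj u hs.1
      exact ⟨a, ha, by omega, e⟩
    · intro u hu hp j hj hn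
      obtain ⟨a, ha, e⟩ := hsurj u hu
      exact h2.le u hu hp j hj hn ⟨a, ha, by omega, e⟩
    · obtain ⟨a, ha, rfl⟩ := hsurj u hu
      exact (h1 a ha (by omega) hp).2.2.2

end RAM

/-! ### Paths of central edges -/

namespace Dag

/-- `v` is the central child of `u`. -/
def Nxt (D : Dag) (u v : ℕ) : Prop := ∃ j, D.SC u j ∧ D.ch u j = v

namespace Nxt

variable {D : Dag} {u u' v v' : ℕ}

theorem lt (h : D.Nxt u v) : u < D.N := let ⟨_, h, _⟩ := h; h.1
theorem paths_pos (h : D.Nxt u v) : 0 < D.paths u := let ⟨_, h, _⟩ := h; h.2.1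
theorem lt' (h : D.Nxt u v) : v < D.N := by obtain ⟨j, h, rfl⟩ := h; exact h.ch_lt
theorem paths_pos' (h : D.Nxt u v) : 0 < D.paths v := by obtain ⟨j, h, rfl⟩ := h; exact h.paths_pos
theorem μ_lt (h : D.Nxt u v) : D.μ v < D.μ u := by obtain ⟨j, h, rfl⟩ := h; exact h.μ_lt
theorem nl_eq (h : D.Nxt u v) : D.nl v = D.nl u := by obtain ⟨j, h, rfl⟩ := h; exact h.2.2.2.1
theorem pl_eq (h : D.Nxt u v) : D.pl v = D.pl u := by obtain ⟨j, h, rfl⟩ := h; exact h.2.2.2.2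

theorem right_unique (h : D.Nxt u v) (h' : D.Nxt u v') : v = v' := by
  obtain ⟨j, h, rfl⟩ := h
  obtain ⟨j', h', rfl⟩ := h'
  rw [h.unique_child h']

theorem left_unique (h : D.Nxt u v) (h' : D.Nxt u' v) : u = u' := by
  obtain ⟨j, h, rfl⟩ := h
  obtain ⟨j', h', e⟩ := h'
  exact h.unique_parent h' e.symm

end Nxt

/-- `u` comes before `v`, or is equal to `v`, on a path of central edges. -/
def Above (D : Dag) (u v : ℕ) : Prop := Relation.ReflTransGen D.Nxt u v

theorem Above.total {D : Dag} {w u v : ℕ} (h : D.Above w u) (h' : D.Above w v) :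
    D.Above u v ∨ D.Above v u :=
  Relation.ReflTransGen.total_of_right_unique (fun _ _ _ h h' => h.right_unique h') h h'

theorem Above.μ_le {D : Dag} {u v : ℕ} (h : D.Above u v) : D.μ v ≤ D.μ u := by
  induction h with
  | refl => exact le_rfl
  | tail _ h ih => exact h.μ_lt.le.trans ih

namespace Decomp

variable {D : Dag} {nx pv E X : ℕ → ℕ} (h : D.Decomp nx pv E X) {u v : ℕ}

include h

theorem pv_eq_iff (hv : v < D.N) : pv v = u + 1 ↔ D.Nxt u v := by
  constructor
  · intro e
    rcases h.pv_cases v hv with ⟨h0, -⟩ | ⟨u', j, hs, e', h1⟩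
    · omega
    · obtain rfl : u' = u := by omega
      exact ⟨j, hs, e'⟩
  · intro hn
    rcases h.pv_cases v hv with ⟨h0, h1⟩ | ⟨u', j, hs, e', h1⟩
    · obtain ⟨j, hs, e⟩ := hn
      exact absurd e (h1 u j hs)
    · rw [h1, hn.left_unique ⟨j, hs, e'⟩]

theorem nx_pos_iff (hu : u < D.N) (hp : 0 < D.paths u) : 0 < nx u ↔ ∃ v, D.Nxt u v := by
  rcases h.nx_cases u hu hp with ⟨h0, h1⟩ | ⟨j, e, hs⟩
  · simp only [h0, lt_irrefl, false_iff]
    rintro ⟨v, j, hs, -⟩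
    exact h1 j hs
  · rw [e]; exact ⟨fun _ => ⟨_, j, hs, rfl⟩, fun _ => by omega⟩

theorem ch_nx (hn : D.Nxt u v) : 0 < nx u ∧ nx u - 1 < D.deg u ∧ D.ch u (nx u - 1) = v := by
  obtain ⟨j, hs, e⟩ := hn
  rcases h.nx_cases u hs.1 hs.2.1 with ⟨-, h1⟩ | ⟨j', e', hs'⟩
  · exact absurd hs (h1 j)
  · obtain rfl := hs.unique_child hs'
    rw [e']; exact ⟨by omega, hs.2.2.1, e⟩

theorem add_le_paths (hn : D.Nxt u v) : D.paths u + E v ≤ D.paths v := by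
  obtain ⟨j, hs, rfl⟩ := hn; exact h.entry.add_le hs

theorem add_le_μ (hn : D.Nxt u v) : X u + D.μ v ≤ D.μ u := by
  obtain ⟨j, hs, rfl⟩ := hn; exact (h.exit u hs.1 hs.2.1).add_le hs

end Decomp

/-- The weight of a node on a path of central edges. The values of `nl` and `pl` do not change along
the path, so both terms are comparable with `2 ^ (nl + pl)`. -/
def weight (D : Dag) (E X : ℕ → ℕ) (u : ℕ) : ℕ := max (E u * 2 ^ D.nl u) (X u * 2 ^ D.pl u)

/-- The logarithm of the weight. -/
def wl (D : Dag) (E X : ℕ → ℕ) (u : ℕ) : ℕ := Nat.log 2 (D.weight E X u)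

theorem two_pow_wl {D : Dag} {nx pv E X : ℕ → ℕ} (h : D.Decomp nx pv E X) {u : ℕ} (hu : u < D.N)
    (hp : 0 < D.paths u) : 2 ^ D.wl E X u = D.weight E X u := by
  have hX : ∃ l, X u = 2 ^ l := by
    rcases (h.exit u hu hp).cases with e | ⟨j, -, -, e⟩
    exacts [⟨0, e⟩, ⟨_, e⟩]
  have hE : E u = 0 ∨ ∃ l, E u = 2 ^ l := by
    rcases h.entry.cases u hu with e | ⟨-, e⟩ | ⟨_, _, _, _, _, _, _, e⟩
    exacts [.inl e, .inr ⟨0, e⟩, .inr ⟨_, e⟩]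
  have : ∃ l, D.weight E X u = 2 ^ l := by
    obtain ⟨l, hl⟩ := hX
    unfold weight
    rcases max_choice (E u * 2 ^ D.nl u) (X u * 2 ^ D.pl u) with e | e
    · rcases hE with e0 | ⟨l', hl'⟩
      · rw [e0, zero_mul, Nat.zero_max, hl, ← pow_add]; exact ⟨_, rfl⟩
      · rw [e, hl', ← pow_add]; exact ⟨_, rfl⟩
    · rw [e, hl, ← pow_add]; exact ⟨_, rfl⟩
  obtain ⟨l, hl⟩ := this
  rw [wl, hl, Nat.log_pow one_lt_two]

end Dag

/-! ### Merge trees -/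

/-- Binary trees whose leaves are the nodes of a path. The leaf `v` stands for the context from `v`
to its central child, and an inner node for the composition of the contexts of its subtrees. -/
inductive MTree
  | leaf (v : ℕ)
  | node (l r : MTree)

namespace MTree

/-- The first leaf. -/
def first : MTree → ℕ
  | leaf v => v
  | node l _ => l.first

/-- The leaves. -/
def Mem (v : ℕ) : MTree → Prop
  | leaf u => u = v
  | node l r => l.Mem v ∨ r.Mem v

/-- The slot for the context that belongs to a tree: a node of the path has slots for its value,
for the context of a leaf, and for the context of the inner node whose right subtree starts
there. -/
def slot : MTree → ℕ
  | leaf v => 3 * v + 1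
  | node _ r => 3 * r.first + 2

variable (lv : ℕ → ℕ)

/-- The level of a tree with given levels of the leaves. -/
def lev : MTree → ℕ
  | leaf v => lv v
  | node l r => if l.lev = r.lev then l.lev + 1 else max l.lev r.lev

/-- A bound for the height of a tree, in which leaves of level `i` have height `3 * i`. -/
def height : MTree → ℕ
  | leaf v => 3 * lv v
  | node l r => max l.height r.height + 1

/-- The total weight of the leaves. -/
def sum (f : ℕ → ℕ) : MTree → ℕ
  | leaf v => f v
  | node l r => l.sum f + r.sum f

variable {lv} in
theorem lev_node_of_lt {l r : MTree} (h : l.lev lv < r.lev lv) :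
    (node l r).lev lv = r.lev lv := by
  rw [lev, if_neg h.ne, max_eq_right h.le]

variable {lv} in
theorem lev_node_of_eq {l r : MTree} (h : l.lev lv = r.lev lv) :
    (node l r).lev lv = r.lev lv + 1 := by
  rw [lev, if_pos h, h]

variable {lv} in
theorem lev_node_of_gt {l r : MTree} (h : r.lev lv < l.lev lv) :
    (node l r).lev lv = l.lev lv := by
  rw [lev, if_neg h.ne', max_eq_left h.le]

/-- Only the merging of trees of equal level increases the level, and then the weights add up. -/
theorem two_pow_lev_le (T : MTree) : 2 ^ T.lev lv ≤ T.sum fun v => 2 ^ lv v := by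
  induction T with
  | leaf v => exact le_rfl
  | node l r hl hr =>
    simp only [lev, sum]
    split_ifs with h
    · rw [pow_succ, mul_two]; nth_rw 2 [h]; exact Nat.add_le_add hl hr
    · rcases max_choice (l.lev lv) (r.lev lv) with e | e <;> rw [e] <;> omega

/-- The leaves are the nodes of a path of central edges that ends before `m`. -/
def Path (D : Dag) : MTree → ℕ → Prop
  | leaf v, m => D.Nxt v m
  | node l r, m => l.Path D r.first ∧ r.Path D m

theorem mem_first (T : MTree) : T.Mem T.first := by
  induction T with
  | leaf v => rfl
  | node l r hl hr => exact .inl hl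

namespace Path

variable {D : Dag} {T : MTree} {m : ℕ}

theorem mem (h : T.Path D m) : ∀ {v : ℕ}, T.Mem v → D.Above v m ∧ D.Above T.first v ∧
    D.μ m < D.μ v := by
  induction T generalizing m with
  | leaf u => rintro v rfl; exact ⟨.single h, .refl, h.μ_lt⟩
  | node l r hl hr =>
    intro v hv
    have h2 := hr h.2 r.mem_first
    have h1 := hl h.1 l.mem_first
    rcases hv with hv | hv
    · have h3 := hl h.1 hv
      exact ⟨h3.1.trans h2.1, h3.2.1, h2.2.2.trans h3.2.2⟩
    · have h3 := hr h.2 hv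
      exact ⟨h3.1, h1.1.trans h3.2.1, h3.2.2⟩

theorem above (h : T.Path D m) : D.Above T.first m := (h.mem T.mem_first).1

theorem μ_lt (h : T.Path D m) : D.μ m < D.μ T.first := (h.mem T.mem_first).2.2

theorem exists_last (h : T.Path D m) : ∃ u, T.Mem u ∧ D.Nxt u m := by
  induction T generalizing m with
  | leaf u => exact ⟨u, rfl, h⟩
  | node l r hl hr => obtain ⟨u, h1, h2⟩ := hr h.2; exact ⟨u, .inr h1, h2⟩

theorem mem_lt (h : T.Path D m) {v : ℕ} (hv : T.Mem v) : v < D.N ∧ 0 < D.paths v := by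
  induction T generalizing m with
  | leaf u => obtain rfl : u = v := hv; exact ⟨Dag.Nxt.lt h, Dag.Nxt.paths_pos h⟩
  | node l r hl hr => exact hv.elim (hl h.1) (hr h.2)

theorem lt (h : T.Path D m) : m < D.N ∧ 0 < D.paths m := by
  obtain ⟨u, -, h⟩ := h.exists_last; exact ⟨h.lt', h.paths_pos'⟩

theorem mem_or_above (h : T.Path D m) {w : ℕ} (hw : D.Above w m) (hne : w ≠ m) :
    T.Mem w ∨ (D.Above w T.first ∧ w ≠ T.first) := by
  induction T generalizing m with
  | leaf u =>
    rcases Relation.ReflTransGen.cases_tail hw with e | ⟨u', h1, h2⟩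
    · exact absurd e.symm hne
    · obtain rfl := h2.left_unique h
      by_cases e : w = u'
      exacts [.inl e.symm, .inr ⟨h1, e⟩]
  | node l r hl hr =>
    rcases hr h.2 hw hne with h1 | ⟨h1, h2⟩
    · exact .inl (.inr h1)
    · exact (hl h.1 h1 h2).imp .inl id

end Path

theorem nl_eq_of_above {D : Dag} {u v : ℕ} (h : D.Above u v) :
    D.nl v = D.nl u ∧ D.pl v = D.pl u := by
  induction h with
  | refl => exact ⟨rfl, rfl⟩
  | tail _ h ih => exact ⟨h.nl_eq.trans ih.1, h.pl_eq.trans ih.2⟩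

section

variable {D : Dag} {nx pv E X : ℕ → ℕ} (h : D.Decomp nx pv E X) {T : MTree} {m : ℕ}

include h

/-- The weights of the entries telescope: each of them is paid for by the increase of the number of
occurrences from the preceding node. -/
theorem sum_entry_le (hT : T.Path D m) :
    ∃ u, D.Nxt u m ∧ T.sum E + D.paths T.first ≤ D.paths u + E T.first := by
  induction T generalizing m with
  | leaf v => exact ⟨v, hT, by simp only [sum, first]; omega⟩
  | node l r hl hr =>
    obtain ⟨u, h1, h2⟩ := hl hT.1
    obtain ⟨u', h1', h2'⟩ := hr hT.2
    have := h.add_le_paths h1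
    exact ⟨u', h1', by simp only [sum, first]; omega⟩

/-- The weights of the exits telescope: each of them is paid for by the decrease of the size. -/
theorem sum_exit_le (hT : T.Path D m) : T.sum X + D.μ m ≤ D.μ T.first := by
  induction T generalizing m with
  | leaf v => exact h.add_le_μ hT
  | node l r hl hr =>
    have := hl hT.1
    have := hr hT.2
    simp only [sum, first]; omega

theorem sum_weight_le (hT : T.Path D m) :
    (T.sum fun v => 2 ^ D.wl E X v) ≤ T.sum E * 2 ^ D.nl m + T.sum X * 2 ^ D.pl m := by
  induction T generalizing m with
  | leaf v =>
    simp only [sum]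
    rw [Dag.two_pow_wl h (Dag.Nxt.lt hT) (Dag.Nxt.paths_pos hT), Dag.weight, Dag.Nxt.nl_eq hT,
      Dag.Nxt.pl_eq hT]
    omega
  | node l r hl hr =>
    have h1 := hl hT.1
    have h2 := hr hT.2
    have h3 := nl_eq_of_above hT.2.above
    rw [← h3.1, ← h3.2] at h1
    simp only [sum, add_mul]; omega

/-- The weights along a path of central edges telescope, so that the levels are bounded in terms of
the data that the nodes of the path have in common. -/
theorem lev_lt (hT : T.Path D m) : T.lev (D.wl E X) < D.nl m + D.pl m + 2 := by
  have h1 := (two_pow_lev_le (D.wl E X) T).trans (sum_weight_le h hT)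
  obtain ⟨u, hu, h2⟩ := sum_entry_le h hT
  have h3 := sum_exit_le h hT
  have h4 := h.entry.le_paths (hT.mem_lt T.mem_first).1
  have h5 := Dag.lt_two_pow_pl (D := D) u
  have h6 := Dag.lt_two_pow_nl (D := D) T.first
  have h7 := nl_eq_of_above hT.above
  rw [← hu.pl_eq] at h5
  rw [← h7.1] at h6
  have h8 : T.sum E * 2 ^ D.nl m < 2 * 2 ^ D.pl m * 2 ^ D.nl m :=
    Nat.mul_lt_mul_of_pos_right (by omega) (by positivity)
  have h9 : T.sum X * 2 ^ D.pl m ≤ 2 * 2 ^ D.nl m * 2 ^ D.pl m :=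
    Nat.mul_le_mul_right _ (by omega)
  refine (Nat.pow_lt_pow_iff_right one_lt_two).1 (h1.trans_lt ?_)
  rw [pow_add, pow_add]
  nlinarith

end

/-- A stack, from the top, in which the levels increase. The bound for the heights leaves room for
one merge with a tree of smaller level. -/
def Sound (R : List MTree) : Prop :=
  R.Pairwise (fun T T' => T.lev lv < T'.lev lv) ∧ ∀ T ∈ R, T.height lv ≤ 3 * T.lev lv + 2

/-- The possible forms of a stack on top of which a leaf of level `y` is put. -/
def AtRest (y : ℕ) : List MTree → Prop
  | [] => True
  | Z :: R => Sound lv R ∧ (∀ T ∈ R, Z.lev lv < T.lev lv ∧ y ≤ T.lev lv) ∧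
      (Z.height lv ≤ 3 * Z.lev lv + 2 ∨ (Z.height lv ≤ 3 * Z.lev lv + 3 ∧ Z.lev lv < y))

/-- The possible forms of a tree `Y` into which the trees of the stack `R` are merged, as long as
their level is at most the level of `Y`, or smaller than the threshold `θ`. -/
def Merging (θ : ℕ) (Y : MTree) (R : List MTree) : Prop :=
  (∃ v, Y = leaf v ∧ AtRest lv (lv v) R) ∨ (Sound lv R ∧
    ((Y.height lv ≤ 3 * Y.lev lv + 2 ∧ ∀ T ∈ R, Y.lev lv ≤ T.lev lv) ∨
      (Y.height lv ≤ 3 * Y.lev lv + 3 ∧ Y.lev lv < θ ∧ ∀ T ∈ R, Y.lev lv < T.lev lv)))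

variable {lv} {θ : ℕ} {Y T : MTree} {R : List MTree}

theorem Sound.tail (h : Sound lv (T :: R)) : Sound lv R ∧ ∀ T' ∈ R, T.lev lv < T'.lev lv := by
  have := List.pairwise_cons.1 h.1
  exact ⟨⟨this.2, fun T' hT' => h.2 T' (List.mem_cons_of_mem _ hT')⟩, this.1⟩

/-- The topmost tree of the stack is merged. -/
theorem Merging.step (h : Merging lv θ Y (T :: R)) (hT : T.lev lv ≤ Y.lev lv ∨ T.lev lv < θ) :
    Merging lv θ (node T Y) R := by
  right
  rcases h with ⟨v, rfl, h1, h2, h3⟩ | ⟨h1, h2⟩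
  · refine ⟨h1, ?_⟩
    have hl : (leaf v).lev lv = lv v := rfl
    simp only [height]
    rcases lt_trichotomy (T.lev lv) (lv v) with h | h | h
    · left
      rw [lev_node_of_lt h, hl]
      exact ⟨by omega, fun T' hT' => (h2 T' hT').2⟩
    · left
      rw [lev_node_of_eq h, hl]
      exact ⟨by omega, fun T' hT' => by have := (h2 T' hT').1; omega⟩
    · right
      rw [lev_node_of_gt (r := leaf v) h]
      exact ⟨by omega, by omega, fun T' hT' => (h2 T' hT').1⟩
  · have h3 := h1.tail
    have h4 := h1.2 T List.mem_cons_self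
    refine ⟨h3.1, ?_⟩
    simp only [height]
    rcases h2 with ⟨h5, h6⟩ | ⟨h5, h6, h7⟩
    · have h7 := h6 T List.mem_cons_self
      rcases h7.lt_or_eq with h | h
      · right
        rw [lev_node_of_gt h]
        exact ⟨by omega, by omega, h3.2⟩
      · left
        rw [lev_node_of_eq h.symm]
        exact ⟨by omega, fun T' hT' => by have := h3.2 T' hT'; omega⟩
    · have h := h7 T List.mem_cons_self
      right
      rw [lev_node_of_gt h]
      exact ⟨by omega, by omega, h3.2⟩

/-- When the loop ends, a leaf of level `θ` can be pushed. -/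
theorem Merging.atRest (h : Merging lv θ Y R)
    (hR : ∀ T ∈ R.head?, Y.lev lv < T.lev lv ∧ θ ≤ T.lev lv) : AtRest lv θ (Y :: R) := by
  have key : Sound lv R → ∀ T ∈ R, Y.lev lv < T.lev lv ∧ θ ≤ T.lev lv := by
    intro hs T hT
    cases R with
    | nil => simp at hT
    | cons Z R =>
      have h1 := hR Z rfl
      rcases List.mem_cons.1 hT with rfl | hT
      · exact h1
      · have := hs.tail.2 T hT; omega
  rcases h with ⟨v, rfl, h1⟩ | ⟨h1, h2⟩
  · cases R with
    | nil => exact ⟨⟨by simp, by simp⟩, by simp, .inl (by simp [height, lev])⟩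
    | cons Z R =>
      have h2 := hR Z rfl
      simp only [lev] at h2
      have hs : Sound lv (Z :: R) := by
        refine ⟨List.pairwise_cons.2 ⟨fun T hT => (h1.2.1 T hT).1, h1.1.1⟩, fun T hT => ?_⟩
        rcases List.mem_cons.1 hT with rfl | hT
        · rcases h1.2.2 with h3 | h3
          exacts [h3, by omega]
        · exact h1.1.2 T hT
      exact ⟨hs, key hs, .inl (by simp [height, lev])⟩
  · refine ⟨h1, key h1, ?_⟩
    rcases h2 with h2 | h2
    exacts [.inl h2.1, .inr ⟨h2.1, h2.2.1⟩]

theorem Merging.height_le (h : Merging lv θ Y R) : Y.height lv ≤ 3 * Y.lev lv + 3 := by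
  rcases h with ⟨v, rfl, -⟩ | ⟨-, h | h⟩
  · simp [height, lev]
  · omega
  · exact h.1

end MTree

/-! ### Instructions for the merge trees -/

/-- The numbering of the templates of instructions: for `k` symbols, at most `R` arguments, and `K`
types of slots. -/
structure Numbering where
  k : ℕ
  R : ℕ
  K : ℕ
  tyOf : ℕ → ℕ
  tyOf_lt : ∀ t, tyOf t < K

namespace Numbering

variable (c : Numbering)

/-- The template for the application of a symbol to values. -/
def opT (f : ℕ) : ℕ := 1 + f

/-- The template for the context that consists of a symbol with a hole at argument `j`. -/
def leafT (f j : ℕ) : ℕ := 1 + c.k + (f * c.R + j)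

/-- The template for the composition of contexts of given types. -/
def mergeT (y z : ℕ) : ℕ := 1 + c.k + c.k * c.R + (y * c.K + z)

/-- The template for the application of a context of a given type to a value. -/
def appT (y : ℕ) : ℕ := 1 + c.k + c.k * c.R + c.K * c.K + y

/-- The number of templates. -/
def size : ℕ := 1 + c.k + c.k * c.R + c.K * c.K + c.K

theorem opT_lt {f : ℕ} (hf : f < c.k) : opT f < c.size := by
  simp only [opT, size]; nlinarith [Nat.zero_le (c.k * c.R), Nat.zero_le (c.K * c.K)]

theorem leafT_lt {f j : ℕ} (hf : f < c.k) (hj : j < c.R) : c.leafT f j < c.size := by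
  simp only [leafT, size]; nlinarith [Nat.zero_le (c.K * c.K)]

theorem mergeT_lt {y z : ℕ} (hy : y < c.K) (hz : z < c.K) : c.mergeT y z < c.size := by
  simp only [mergeT, size]; nlinarith

theorem appT_lt {y : ℕ} (hy : y < c.K) : c.appT y < c.size := by
  simp only [appT, size]; omega

end Numbering

/-- The symmetric centroid decomposition of a graph, whose nodes are labelled by symbols. -/
structure Plan extends Numbering where
  D : Dag
  tok : ℕ → ℕ
  nx : ℕ → ℕ
  pv : ℕ → ℕ
  E : ℕ → ℕ
  X : ℕ → ℕ
  dec : D.Decomp nx pv E X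
  tok_lt : ∀ u < D.N, 0 < D.paths u → tok u < k
  deg_le : ∀ u < D.N, D.deg u ≤ R

/-- An instruction for every slot: the number of its template, and the slots of its arguments. -/
structure Instrs where
  tid : ℕ → ℕ
  arg : ℕ → ℕ → ℕ

/-- The instructions of a slot coincide. -/
def Instrs.Agree (I I' : Instrs) (q : ℕ) : Prop := I'.tid q = I.tid q ∧ ∀ j, I'.arg j q = I.arg j q

namespace Plan

variable (P : Plan)

/-- The level of a node on a path of central edges. -/
abbrev lv (u : ℕ) : ℕ := P.D.wl P.E P.X u

/-- The threshold for merging when a node is reached. At the end of a path everything is merged: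
there the threshold is larger than all levels, see `Plan.lev_lt`. -/
def thr (v : ℕ) : ℕ := if P.nx v = 0 then P.D.nl v + P.D.pl v + 3 else P.lv v

/-- The instruction for the value of a node applies its symbol to the values of the children. -/
def IsOp (I : Instrs) (v : ℕ) : Prop :=
  I.tid (3 * v) = Numbering.opT (P.tok v) ∧ ∀ j < P.D.deg v, I.arg j (3 * v) = 3 * P.D.ch v j

/-- The instruction for the context from a node to its central child. -/
def IsLeaf (I : Instrs) (v : ℕ) : Prop :=
  I.tid (3 * v + 1) = P.leafT (P.tok v) (P.nx v - 1) ∧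
    ∀ j < P.D.deg v, I.arg j (3 * v + 1) = 3 * P.D.ch v j

/-- The type of a slot. -/
def ty (I : Instrs) (q : ℕ) : ℕ := P.tyOf (I.tid q)

/-- The value of `v` is obtained by applying the context of a tree to the value of `m`. -/
def IsApp (I : Instrs) (v : ℕ) (T : MTree) (m : ℕ) : Prop :=
  I.tid (3 * v) = P.appT (P.ty I T.slot) ∧ I.arg 0 (3 * v) = T.slot ∧ I.arg 1 (3 * v) = 3 * m

/-- The context of a tree is composed of those of the subtrees. -/
def IsMerge (I : Instrs) (l r : MTree) : Prop :=
  I.tid (3 * r.first + 2) = P.mergeT (P.ty I l.slot) (P.ty I r.slot) ∧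
    I.arg 0 (3 * r.first + 2) = l.slot ∧ I.arg 1 (3 * r.first + 2) = r.slot

/-- The instructions for a tree, whose leaves form a path that ends before `m`: those for the
contexts of all subtrees, and those for the values of all leaves but the first. -/
def Built (I : Instrs) : MTree → ℕ → Prop
  | .leaf v, m => P.D.Nxt v m ∧ P.IsLeaf I v
  | .node l r, m => Built I l r.first ∧ Built I r m ∧ P.IsApp I r.first r m ∧ P.IsMerge I l r

variable {P} {I I' : Instrs} {T : MTree} {m : ℕ}

theorem Built.path (h : P.Built I T m) : T.Path P.D m := by
  induction T generalizing m with
  | leaf v => exact h.1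
  | node l r hl hr => exact ⟨hl h.1, hr h.2.1⟩

theorem ty_eq {q : ℕ} (h : I.Agree I' q) : P.ty I' q = P.ty I q := by rw [ty, ty, h.1]

theorem first_ne_of_mem {l r : MTree} (hl : l.Path P.D r.first) (hr : r.Path P.D m) {u : ℕ}
    (hu : r.Mem u) : u ≠ l.first := fun e => by
  have h1 := hl.μ_lt
  have h2 := (hr.mem hu).2.1.μ_le
  rw [e] at h2; omega

theorem slot_agree (hT : T.Path P.D m) (h : ∀ u, T.Mem u → I.Agree I' (3 * u + 1) ∧
    (u ≠ T.first → I.Agree I' (3 * u) ∧ I.Agree I' (3 * u + 2))) : I.Agree I' T.slot := by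
  cases T with
  | leaf v => exact (h v rfl).1
  | node l r =>
    exact ((h r.first (.inr r.mem_first)).2 (first_ne_of_mem hT.1 hT.2 r.mem_first)).2

theorem Built.congr (hb : P.Built I T m) (h : ∀ u, T.Mem u → I.Agree I' (3 * u + 1) ∧
    (u ≠ T.first → I.Agree I' (3 * u) ∧ I.Agree I' (3 * u + 2))) : P.Built I' T m := by
  induction T generalizing m with
  | leaf v =>
    obtain ⟨h1, h2, h3⟩ := hb
    have h4 := (h v rfl).1
    exact ⟨h1, by rw [h4.1, h2], fun j hj => by rw [h4.2, h3 j hj]⟩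
  | node l r ihl ihr =>
    obtain ⟨hl, hr, ⟨ha1, ha2, ha3⟩, hm1, hm2, hm3⟩ := hb
    have hne := fun u => first_ne_of_mem hl.path hr.path (u := u)
    have h1 : ∀ u, l.Mem u → I.Agree I' (3 * u + 1) ∧
        (u ≠ l.first → I.Agree I' (3 * u) ∧ I.Agree I' (3 * u + 2)) := fun u hu => h u (.inl hu)
    have h2 : ∀ u, r.Mem u → I.Agree I' (3 * u + 1) ∧
        (u ≠ r.first → I.Agree I' (3 * u) ∧ I.Agree I' (3 * u + 2)) :=
      fun u hu => ⟨(h u (.inr hu)).1, fun _ => (h u (.inr hu)).2 (hne u hu)⟩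
    have h3 := (h r.first (.inr r.mem_first)).2 (hne _ r.mem_first)
    have h4 := slot_agree hl.path h1
    have h5 := slot_agree hr.path h2
    refine ⟨ihl hl h1, ihr hr h2, ⟨?_, ?_, ?_⟩, ?_, ?_, ?_⟩
    · rw [h3.1.1, ty_eq h5, ha1]
    · rw [h3.1.2, ha2]
    · rw [h3.1.2, ha3]
    · rw [h3.2.1, ty_eq h4, ty_eq h5, hm1]
    · rw [h3.2.2, hm2]
    · rw [h3.2.2, hm3]

theorem IsOp.congr {v : ℕ} (h : P.IsOp I v) (ha : I.Agree I' (3 * v)) : P.IsOp I' v :=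
  ⟨by rw [ha.1, h.1], fun j hj => by rw [ha.2, h.2 j hj]⟩

/-- All instructions for a path of central edges that ends in `e` have been determined. -/
structure Final (P : Plan) (I : Instrs) (e : ℕ) : Prop where
  op : P.IsOp I e
  unused : I.tid (3 * e + 1) = 0 ∧ I.tid (3 * e + 2) = 0
  tree : P.pv e = 0 ∨ ∃ T, P.Built I T e ∧ P.IsApp I T.first T e ∧ P.pv T.first = 0 ∧
    I.tid (3 * T.first + 2) = 0 ∧ T.height P.lv ≤ 3 * T.lev P.lv + 3

theorem Final.congr {e : ℕ} (hf : P.Final I e)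
    (h : ∀ u, P.D.Above u e → I.Agree I' (3 * u) ∧ I.Agree I' (3 * u + 1) ∧
      I.Agree I' (3 * u + 2)) :
    P.Final I' e where
  op := hf.op.congr (h e .refl).1
  unused := by rw [(h e .refl).2.1.1, (h e .refl).2.2.1]; exact hf.unused
  tree := by
    refine hf.tree.imp id ?_
    rintro ⟨T, h1, h2, h3, h4, h5⟩
    have hT : ∀ u, T.Mem u → I.Agree I' (3 * u + 1) ∧
        (u ≠ T.first → I.Agree I' (3 * u) ∧ I.Agree I' (3 * u + 2)) := fun u hu =>
      have := h u (h1.path.mem hu).1; ⟨this.2.1, fun _ => ⟨this.1, this.2.2⟩⟩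
    have h6 := h T.first h1.path.above
    refine ⟨T, h1.congr hT, ⟨?_, ?_, ?_⟩, h3, by rw [h6.2.2.1, h4], h5⟩
    · rw [h6.1.1, h2.1, ty_eq (slot_agree h1.path hT)]
    · rw [h6.1.2, h2.2.1]
    · rw [h6.1.2, h2.2.2]

end Plan

namespace RAM

open Program CircuitBalancing.RAM.Expr State

/-- The instructions in the arrays of a state. -/
def State.instrs (s : State) : Instrs := ⟨s.m .tid, fun j => s.m (.arg j)⟩

variable (P : Plan)

/-- The record of a tree, in cell `b` of the arrays for trees. Instead of the level, its power of
two is stored. -/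
def IsRecord (s : State) (T : MTree) (b : ℕ) : Prop :=
  s.m .bBeg b = T.first ∧ s.m .bLev b = 2 ^ T.lev P.lv ∧ s.m .bSlot b = T.slot ∧
    s.m .bTy b = P.ty s.instrs T.slot

/-- The trees of a stack, from the top, cover a path that ends before `m`. The record of a tree is
indexed by the predecessor of the node behind the tree. -/
def IsStack (s : State) : List MTree → ℕ → Prop
  | [], m => P.pv m = 0
  | T :: R, m => P.Built s.instrs T m ∧ s.m .tid (3 * T.first + 2) = 0 ∧
      IsRecord P s T (P.pv m) ∧ IsStack s R T.first

variable {P}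

/-- Neither the instructions of a node nor the record that is indexed by it change. -/
def AgreeAt (s s' : State) (u : ℕ) : Prop :=
  (∀ i < 3, s.instrs.Agree s'.instrs (3 * u + i)) ∧ s'.m .bBeg (u + 1) = s.m .bBeg (u + 1) ∧
    s'.m .bLev (u + 1) = s.m .bLev (u + 1) ∧ s'.m .bSlot (u + 1) = s.m .bSlot (u + 1) ∧
    s'.m .bTy (u + 1) = s.m .bTy (u + 1)

theorem AgreeAt.refl (s : State) (u : ℕ) : AgreeAt s s u :=
  ⟨fun _ _ => ⟨rfl, fun _ => rfl⟩, rfl, rfl, rfl, rfl⟩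

theorem AgreeAt.trans {s s' s'' : State} {u : ℕ} (h : AgreeAt s s' u) (h' : AgreeAt s' s'' u) :
    AgreeAt s s'' u :=
  ⟨fun i hi => ⟨(h'.1 i hi).1.trans (h.1 i hi).1,
    fun j => ((h'.1 i hi).2 j).trans ((h.1 i hi).2 j)⟩,
    h'.2.1.trans h.2.1, h'.2.2.1.trans h.2.2.1, h'.2.2.2.1.trans h.2.2.2.1,
    h'.2.2.2.2.trans h.2.2.2.2⟩

theorem built_congr {s s' : State} {T : MTree} {m : ℕ} (hb : P.Built s.instrs T m)
    (h : ∀ u, T.Mem u → ∀ i < 3, (u = T.first → i = 1) →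
      s.instrs.Agree s'.instrs (3 * u + i)) : P.Built s'.instrs T m :=
  hb.congr fun u hu => ⟨h u hu 1 (by omega) fun _ => rfl, fun hne =>
    ⟨h u hu 0 (by omega) fun e => absurd e hne, h u hu 2 (by omega) fun e => absurd e hne⟩⟩

theorem slot_congr {s s' : State} {T : MTree} {m : ℕ} (hT : T.Path P.D m)
    (h : ∀ u, T.Mem u → ∀ i < 3, (u = T.first → i = 1) →
      s.instrs.Agree s'.instrs (3 * u + i)) : s.instrs.Agree s'.instrs T.slot :=
  Plan.slot_agree hT fun u hu => ⟨h u hu 1 (by omega) fun _ => rfl, fun hne =>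
    ⟨h u hu 0 (by omega) fun e => absurd e hne, h u hu 2 (by omega) fun e => absurd e hne⟩⟩

theorem IsStack.congr {s s' : State} {R : List MTree} {m : ℕ} (hs : IsStack P s R m)
    (h : ∀ u, P.D.Above u m → u ≠ m → AgreeAt s s' u) : IsStack P s' R m := by
  induction R generalizing m with
  | nil => exact hs
  | cons T R ih =>
    obtain ⟨h1, h2, ⟨r1, r2, r3, r4⟩, h4⟩ := hs
    have hT : ∀ u, T.Mem u → AgreeAt s s' u := fun u hu => by
      have := h1.path.mem hu
      exact h u this.1 fun e => by rw [e] at this; omega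
    obtain ⟨u, hu, hum⟩ := h1.path.exists_last
    have hpv := (P.dec.pv_eq_iff hum.lt').2 hum
    have hag := hT u hu
    refine ⟨built_congr h1 fun u hu i hi _ => (hT u hu).1 i hi, ?_, ⟨?_, ?_, ?_, ?_⟩,
      ih h4 fun u hu hne => h u (hu.trans h1.path.above) fun e => ?_⟩
    · rw [← h2]; exact ((hT _ T.mem_first).1 2 (by omega)).1
    · rw [← r1, hpv, hag.2.1]
    · rw [← r2, hpv, hag.2.2.1]
    · rw [← r3, hpv, hag.2.2.2.1]
    · rw [Plan.ty_eq (slot_congr h1.path fun u hu i hi _ => (hT u hu).1 i hi), ← r4, hpv,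
        hag.2.2.2.2]
    · have := hu.μ_le; have := h1.path.μ_lt; rw [e] at *; omega

end RAM

namespace RAM

open Program CircuitBalancing.RAM.Expr State

variable {B V : ℕ}

/-! ### Amortized running times -/

namespace Program

/-- The program takes at most `c` steps, apart from the increase of a potential. -/
def Amort (B V : ℕ) (φ : State → ℕ) (P : Program) (s : State) (c : ℕ) (Q : State → Prop) : Prop :=
  ∃ T s', Exec B P s T s' ∧ s'.Bd V ∧ Q s' ∧ T + φ s ≤ c + φ s'

variable {φ : State → ℕ}

theorem Sat.amort {P : Program} {s : State} {Q : State → Prop} (h : P.Sat V s Q) (hs : s.Bd V)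
    (hB : P.coef * (V + 1) ≤ B) (hφ : ∀ s', Q s' → φ s ≤ φ s') : P.Amort B V φ s P.wcost Q :=
  let ⟨T, hT, s', hE, hb, hQ⟩ := h.reaches hs hB
  ⟨T, s', hE, hb, hQ, Nat.add_le_add hT (hφ s' hQ)⟩

theorem Amort.seq {P P' : Program} {s : State} {c c' : ℕ} {Q R : State → Prop}
    (h : P.Amort B V φ s c Q) (h' : ∀ s', s'.Bd V → Q s' → P'.Amort B V φ s' c' R) :
    (Program.seq P P').Amort B V φ s (c + c') R :=
  let ⟨T, _, hE, hb, hQ, hT⟩ := h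
  let ⟨T', s'', hE', hb', hQ', hT'⟩ := h' _ hb hQ
  ⟨T + T', s'', .seq hE hE', hb', hQ', by omega⟩

theorem Amort.mono {P : Program} {s : State} {c c' : ℕ} {Q R : State → Prop}
    (h : P.Amort B V φ s c Q) (hc : c ≤ c') (hQ : ∀ s', Q s' → R s') : P.Amort B V φ s c' R :=
  let ⟨T, s', hE, hb, hq, hT⟩ := h
  ⟨T, s', hE, hb, hQ _ hq, by omega⟩

theorem Amort.frame {P : Program} {s : State} {c : ℕ} {Q : State → Prop}
    (h : P.Amort B V φ s c Q) : P.Amort B V φ s c fun s' => Q s' ∧ P.Frame s s' :=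
  let ⟨T, s', hE, hb, hq, hT⟩ := h
  ⟨T, s', hE, hb, ⟨hq, fun _ ha => exec_mem hE ha, fun _ hx => exec_reg hE hx⟩, hT⟩

/-- A loop whose iterations are paid for by the potential. -/
theorem amort_while {e f : Expr} {P : Program} (J : ℕ → State → Prop)
    (hB : (loop e f P).coef * (V + 1) ≤ B)
    (ht : ∀ n s, J n s → e.Tame V s ∧ f.Tame V s ∧ (e.eval s < f.eval s → 0 < n))
    (h : ∀ n s, s.Bd V → J (n + 1) s → e.eval s < f.eval s →
      P.Sat V s fun s' => J n s' ∧ φ s + (loop e f P).wcost ≤ φ s') {n : ℕ} {s : State}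
    (hs : s.Bd V) (h0 : J n s) :
    (loop e f P).Amort B V φ s (e.cost + f.cost + 1)
      fun s' => ∃ n, J n s' ∧ f.eval s' ≤ e.eval s' := by
  have hBe : e.coef * (V + 1) ≤ B :=
    (Nat.mul_le_mul_right _ (by simp only [coef]; omega)).trans hB
  have hBf : f.coef * (V + 1) ≤ B :=
    (Nat.mul_le_mul_right _ (by simp only [coef]; omega)).trans hB
  have hBP : P.coef * (V + 1) ≤ B :=
    (Nat.mul_le_mul_right _ (by simp only [coef]; omega)).trans hB
  induction n generalizing s with
  | zero =>
    obtain ⟨he, hf, hc⟩ := ht 0 s h0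
    have hc : ¬ e.eval s < f.eval s := fun h => (hc h).false
    exact ⟨_, s, .loop_false (he.fits hs hBe) (hf.fits hs hBf) hc, hs, ⟨0, h0, by omega⟩, le_rfl⟩
  | succ n ih =>
    obtain ⟨he, hf, -⟩ := ht (n + 1) s h0
    by_cases hc : e.eval s < f.eval s
    · obtain ⟨T, hT, s', hE, hb, hJ, hφ⟩ := (h n s hs h0 hc).reaches hs hBP
      obtain ⟨T', s'', hE', hb', hJ', hT'⟩ := ih hb hJ
      refine ⟨_, s'', .loop_true (he.fits hs hBe) (hf.fits hs hBf) hc hE hE', hb', hJ', ?_⟩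
      simp only [wcost] at hφ; omega
    · exact ⟨_, s, .loop_false (he.fits hs hBe) (hf.fits hs hBf) hc, hs, ⟨_, h0, by omega⟩, le_rfl⟩

/-- A counting loop whose iterations have amortized cost `c`. -/
theorem amort_forTo {x y : Reg} {P : Program} {n c : ℕ} (I : ℕ → State → Prop)
    {s : State} (hs : s.Bd V) (hB : (forTo x y P).coef * (V + 1) ≤ B) (hV : n ≤ V)
    (hy : s.r y = n) (hPx : ¬ P.Sets x.num) (hPy : ¬ P.Sets y.num) (hxy : y ≠ x)
    (hφ : ∀ s v, φ (s.setR x v) = φ s)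
    (h0 : I 0 (s.setR x 0))
    (h : ∀ i < n, ∀ s', s'.Bd V → (forTo x y P).Frame s s' → s'.r x = i → I i s' →
      P.Amort B V φ s' c fun s'' => I (i + 1) (s''.setR x (i + 1))) :
    (forTo x y P).Amort B V φ s ((c + 10) * (n + 1)) fun s' =>
      I n s' ∧ (forTo x y P).Frame s s' := by
  refine Amort.frame ?_
  have hBs : (set x (const 0)).coef * (V + 1) ≤ B := coef_seq_left hB
  have hBl : ((rd x).coef + (rd y).coef) * (V + 1) ≤ B :=
    (Nat.mul_le_mul_right _ (by simp only [forTo, coef]; omega)).trans hB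
  have hBi : (set x (rd x + const 1)).coef * (V + 1) ≤ B :=
    (Nat.mul_le_mul_right _ (by simp only [forTo, coef]; omega)).trans hB
  have h1 : (set x (const 0)).Sat V s fun s' => s' = s.setR x 0 := by simp
  obtain ⟨T1, hT1, s1, hE1, hb1, e1, hf1⟩ := h1.frame.reaches hs hBs
  obtain ⟨T2, s2, hE2, hb2, ⟨e2, hI2, hf2⟩, hφ2⟩ : ∃ T2 s2, Exec B _ s1 T2 s2 ∧ s2.Bd V ∧
      (s2.r x = n ∧ I n s2 ∧ (forTo x y P).Frame s s2) ∧
      T2 + φ s ≤ (n * (c + 7) + 3) + φ s2 := by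
    have key : ∀ k i s', n = i + k → s'.Bd V → s'.r x = i → I i s' → (forTo x y P).Frame s s' →
        ∃ T s'', Exec B (loop (rd x) (rd y) (seq P (set x (rd x + const 1)))) s' T s'' ∧
        s''.Bd V ∧ (s''.r x = n ∧ I n s'' ∧ (forTo x y P).Frame s s'') ∧
        T + φ s' ≤ (k * (c + 7) + 3) + φ s'' := by
      intro k
      induction k with
      | zero =>
        intro i s' hn hs' hx hI hf
        have hyn : s'.r y = n := by rw [hf.2 y (by simp [hPy, hxy]), hy]
        obtain rfl : n = i := hn
        refine ⟨_, s', .loop_false (Tame.fits hs' (tame_rd s' V x) ?_)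
          (Tame.fits hs' (tame_rd s' V y) ?_) ?_, hs', ⟨hx, hI, hf⟩, ?_⟩
        · exact (Nat.mul_le_mul_right _ (by omega)).trans hBl
        · exact (Nat.mul_le_mul_right _ (by omega)).trans hBl
        · simp [hx, hyn]
        · simp [rd, cost]
      | succ k ih =>
        intro i s' hn hs' hx hI hf
        have hyn : s'.r y = n := by rw [hf.2 y (by simp [hPy, hxy]), hy]
        obtain ⟨T, s2, hE, hb, ⟨hI2, hf2⟩, hT⟩ := (h i (by omega) s' hs' hf hx hI).frame
        have hx2 : s2.r x = i := (hf2.2 x hPx).trans hx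
        have h3 : (set x (rd x + const 1)).Sat V s2 fun s' => s' = s2.setR x (i + 1) := by
          simp [hx2]; omega
        obtain ⟨T3, hT3, s3, hE3, hb3, e3⟩ := h3.reaches hb hBi
        subst e3
        have hf3 : (forTo x y P).Frame s (s2.setR x (i + 1)) := by
          refine (hf.trans hf2 (R := forTo x y P) (by simp) ?_).trans
            (P' := set x (rd x + const 1)) (R := forTo x y P) ⟨fun _ _ => rfl, fun z hz => ?_⟩ ?_ ?_
          · simp only [forTo, sets_seq, sets_loop]; tauto
          · exact r_setR_ne _ _ fun e => hz (by simp [e])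
          · simp
          · simp only [forTo, sets_seq, sets_loop]; tauto
        obtain ⟨T4, s4, hE4, hb4, h4, hT4⟩ := ih (i + 1) _ (by omega) hb3 (by simp) hI2 hf3
        refine ⟨_, s4, .loop_true (Tame.fits hs' (tame_rd s' V x) ?_)
          (Tame.fits hs' (tame_rd s' V y) ?_) ?_ (.seq hE hE3) hE4, hb4, h4, ?_⟩
        · exact (Nat.mul_le_mul_right _ (by omega)).trans hBl
        · exact (Nat.mul_le_mul_right _ (by omega)).trans hBl
        · simp [hx, hyn]; omega
        · rw [hφ] at hT4
          have hc1 : (rd x).cost = 1 := rfl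
          have hc2 : (rd y).cost = 1 := rfl
          have hc3 : (set x (rd x + const 1)).wcost = 4 := rfl
          rw [hc1, hc2]; rw [hc3] at hT3
          have : (k + 1) * (c + 7) = k * (c + 7) + (c + 7) := by ring
          omega
    obtain ⟨T, s'', hE, hb, h2, hT⟩ := key n 0 s1 (by omega) hb1 (by simp [e1])
      (by simpa [e1] using h0)
      (hf1.trans (Frame.refl (set x (const 0)) s1) (by simp) (by simp [forTo]; tauto))
    refine ⟨T, s'', hE, hb, h2, ?_⟩
    rwa [e1, hφ] at hT
  refine ⟨_, s2, .seq hE1 hE2, hb2, hI2, ?_⟩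
  have hc3 : (set x (const 0)).wcost = 2 := rfl
  rw [hc3] at hT1
  have : (c + 10) * (n + 1) = n * (c + 7) + 3 * n + (c + 10) := by ring
  omega

end Program

/-! ### Merging -/

/-- Copy the slots of the values of the children of `cur` to the arguments of the instruction for
the slot in `ofs`. -/
def copyArgs (R : ℕ) : Program :=
  upTo R .deg fun j => put (.arg j) (rd .ofs) (const 3 * ld (.ch j) (rd .cur))

/-- The value of `beg` is obtained by applying the current context to the value of `cur`. -/
def putApp (c : Numbering) : Program :=
  seq (put .tid (const 3 * rd .beg) (const (c.appT 0) + rd .ty)) <|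
  seq (put (.arg 0) (const 3 * rd .beg) (rd .slot)) <|
  put (.arg 1) (const 3 * rd .beg) (const 3 * rd .cur)

/-- The context of the tree with record `prv` is composed with the current context. -/
def putMerge (c : Numbering) : Program :=
  seq (set .tmp (const (c.mergeT 0 0) + (ld .bTy (rd .prv) * const c.K + rd .ty))) <|
  seq (put .tid (const 3 * rd .beg + const 2) (rd .tmp)) <|
  seq (put (.arg 0) (const 3 * rd .beg + const 2) (ld .bSlot (rd .prv))) <|
  put (.arg 1) (const 3 * rd .beg + const 2) (rd .slot)

/-- The composed context becomes the current one. -/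
def takeMerged : Program :=
  seq (branch (ld .bLev (rd .prv)) (rd .lev) skip <|
    branch (rd .lev) (ld .bLev (rd .prv)) (set .lev (ld .bLev (rd .prv)))
      (set .lev (rd .lev + rd .lev))) <|
  seq (set .slot (const 3 * rd .beg + const 2)) <|
  seq (set .beg (ld .bBeg (rd .prv))) (set .ty (ld .tyOf (rd .tmp)))

/-- Trees for which the power of two of the level is below the limit are to be merged with the
current one, i.e. those whose level is at most that of the current tree, or below the threshold.
Since `pv` is `0` at the beginning of a path, cell `0` serves as a sentinel below the bottom of the
stack. -/
def setLim : Program :=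
  seq (branch (rd .lev) (rd .thr) (set .lim (rd .thr)) (set .lim (rd .lev + const 1))) <|
  put .bLev (const 0) (rd .lim)

/-- Merge the topmost tree of the stack with the current tree. -/
def mergeStep (c : Numbering) : Program :=
  seq (set .prv (ld .pv (rd .beg))) <| seq (putApp c) <| seq (putMerge c) <| seq takeMerged setLim

/-- Merge all trees below the limit. -/
def mergeLoop (c : Numbering) : Program :=
  loop (ld .bLev (ld .pv (rd .beg))) (rd .lim) (mergeStep c)

/-- The power of two of the threshold for the node `cur`. At the end of a path, the factor `8` gives
`nl + pl + 3`; otherwise the threshold is the level of the node. -/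
def setThr : Program :=
  branch (const 0) (ld .nx (rd .cur))
    (branch (ld .ent (rd .cur) * ld .pn (rd .cur)) (ld .ext (rd .cur) * ld .pp (rd .cur))
      (set .thr (ld .ext (rd .cur) * ld .pp (rd .cur)))
      (set .thr (ld .ent (rd .cur) * ld .pn (rd .cur))))
    (set .thr (const 8 * (ld .pp (rd .cur) * ld .pn (rd .cur))))

/-- The topmost tree on the stack becomes the current one. -/
def loadTop : Program :=
  branch (const 0) (ld .pv (rd .cur))
    (seq (set .prv (ld .pv (rd .cur))) <| seq (set .beg (ld .bBeg (rd .prv))) <|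
      seq (set .lev (ld .bLev (rd .prv))) <| seq (set .slot (ld .bSlot (rd .prv))) <|
      seq (set .ty (ld .bTy (rd .prv))) setLim) skip

/-- Start with the node at position `idx` of the queue. -/
def openNode (R : ℕ) : Program :=
  seq (set .cur (ld .queue (rd .idx))) <| seq (set .act (ld .pi (rd .cur))) <|
  seq (set .lim (const 0)) <| branch (const 0) (rd .act)
    (seq (set .deg (ld .deg (rd .cur))) <| seq (set .ofs (const 3 * rd .cur)) <|
      seq (put .tid (rd .ofs) (const 1 + ld .tok (rd .cur + const 2))) <|
      seq (copyArgs R) <| seq setThr loadTop) skip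

/-- Put the current tree back onto the stack, or finish the path. -/
def storeTop (c : Numbering) : Program :=
  branch (const 0) (ld .pv (rd .cur))
    (seq (put .bBeg (ld .pv (rd .cur)) (rd .beg)) <| seq (put .bLev (ld .pv (rd .cur)) (rd .lev)) <|
      seq (put .bSlot (ld .pv (rd .cur)) (rd .slot)) <|
      seq (put .bTy (ld .pv (rd .cur)) (rd .ty)) <|
      branch (const 0) (ld .nx (rd .cur)) skip (putApp c)) skip

/-- Push the leaf for the node `cur`. -/
def pushLeaf (c : Numbering) : Program :=
  branch (const 0) (ld .nx (rd .cur))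
    (seq (set .tmp (const (c.leafT 0 0) + (ld .tok (rd .cur + const 2) * const c.R +
        (ld .nx (rd .cur) - const 1)))) <|
      seq (set .ofs (const 3 * rd .cur + const 1)) <| seq (put .tid (rd .ofs) (rd .tmp)) <|
      seq (copyArgs c.R) <| seq (put .bBeg (rd .cur + const 1) (rd .cur)) <|
      seq (put .bLev (rd .cur + const 1) (rd .thr)) <|
      seq (put .bSlot (rd .cur + const 1) (rd .ofs)) <|
      put .bTy (rd .cur + const 1) (ld .tyOf (rd .tmp))) skip

/-- Finish with the node `cur`. -/
def closeNode (c : Numbering) : Program :=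
  branch (const 0) (rd .act) (seq (storeTop c) (pushLeaf c)) skip

end RAM

namespace RAM

open Program CircuitBalancing.RAM.Expr State

variable {B V : ℕ}

instance : DecidableEq Arr := Arr.num_injective.decidableEq

theorem State.m_setM (s : State) (a b : Arr) (i v q : ℕ) :
    (s.setM a i v).m b q = if b = a ∧ q = i then v else s.m b q := by
  by_cases h : b = a
  · subst h; simp [Function.update_apply]
  · simp [h]

theorem agree_setM {s₀ s : State} {a : Arr} {i v q : ℕ} (h : q ≠ i) :
    s₀.instrs.Agree (s.setM a i v).instrs q ↔ s₀.instrs.Agree s.instrs q := by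
  simp [Instrs.Agree, State.instrs, m_setM, h]

theorem agree_refl (I : Instrs) (q : ℕ) : I.Agree I q := ⟨rfl, fun _ => rfl⟩

theorem _root_.CircuitBalancing.Instrs.Agree.trans {I I' I'' : Instrs} {q : ℕ}
    (h : I.Agree I' q) (h' : I'.Agree I'' q) :
    I.Agree I'' q := ⟨h'.1.trans h.1, fun j => (h'.2 j).trans (h.2 j)⟩

theorem agree_of_frame {P : Program} {s s' : State} (h : P.Frame s s')
    (h1 : ¬ P.Writes Arr.tid.num) (h2 : ∀ j, ¬ P.Writes (Arr.arg j).num) (q : ℕ) :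
    s.instrs.Agree s'.instrs q := by
  refine ⟨?_, fun j => ?_⟩
  · simp only [State.instrs]; rw [h.1 _ h1]
  · simp only [State.instrs]; rw [h.1 _ (h2 j)]

section frames

variable {R : ℕ} {c : Numbering}

@[simp] theorem writes_copyArgs {a : Arr} :
    (copyArgs R).Writes a.num ↔ ∃ j < R, a = .arg j := by simp [copyArgs]
@[simp] theorem sets_copyArgs {x : ℕ} : ¬ (copyArgs R).Sets x := by simp [copyArgs]
@[simp] theorem writes_putApp {a : Arr} :
    (putApp c).Writes a.num ↔ a = .tid ∨ a = .arg 0 ∨ a = .arg 1 := by simp [putApp]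
@[simp] theorem sets_putApp {x : ℕ} : ¬ (putApp c).Sets x := by simp [putApp]
@[simp] theorem writes_putMerge {a : Arr} :
    (putMerge c).Writes a.num ↔ a = .tid ∨ a = .arg 0 ∨ a = .arg 1 := by simp [putMerge]
@[simp] theorem sets_putMerge {x : Reg} : (putMerge c).Sets x.num ↔ x = .tmp := by simp [putMerge]
@[simp] theorem writes_takeMerged {a : ℕ} : ¬ takeMerged.Writes a := by simp [takeMerged]
@[simp] theorem sets_takeMerged {x : Reg} :
    takeMerged.Sets x.num ↔ x = .lev ∨ x = .slot ∨ x = .beg ∨ x = .ty := by simp [takeMerged]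
@[simp] theorem writes_setLim {a : Arr} : setLim.Writes a.num ↔ a = .bLev := by simp [setLim]
@[simp] theorem sets_setLim {x : Reg} : setLim.Sets x.num ↔ x = .lim := by simp [setLim]
@[simp] theorem writes_setThr {a : ℕ} : ¬ setThr.Writes a := by simp [setThr]
@[simp] theorem sets_setThr {x : Reg} : setThr.Sets x.num ↔ x = .thr := by simp [setThr]
@[simp] theorem writes_loadTop {a : Arr} : loadTop.Writes a.num ↔ a = .bLev := by simp [loadTop]
@[simp] theorem sets_loadTop {x : Reg} : loadTop.Sets x.num ↔
    x = .prv ∨ x = .beg ∨ x = .lev ∨ x = .slot ∨ x = .ty ∨ x = .lim := by simp [loadTop]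
@[simp] theorem writes_mergeStep {a : Arr} :
    (mergeStep c).Writes a.num ↔ a = .tid ∨ a = .arg 0 ∨ a = .arg 1 ∨ a = .bLev := by
  simp [mergeStep]; tauto
@[simp] theorem sets_mergeStep {x : Reg} : (mergeStep c).Sets x.num ↔ x = .prv ∨ x = .tmp ∨
    x = .lev ∨ x = .slot ∨ x = .beg ∨ x = .ty ∨ x = .lim := by
  simp [mergeStep]; tauto
@[simp] theorem writes_mergeLoop {a : Arr} :
    (mergeLoop c).Writes a.num ↔ a = .tid ∨ a = .arg 0 ∨ a = .arg 1 ∨ a = .bLev := by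
  simp [mergeLoop]
@[simp] theorem sets_mergeLoop {x : Reg} : (mergeLoop c).Sets x.num ↔ x = .prv ∨ x = .tmp ∨
    x = .lev ∨ x = .slot ∨ x = .beg ∨ x = .ty ∨ x = .lim := by
  simp [mergeLoop]
@[simp] theorem writes_openNode {a : Arr} :
    (openNode R).Writes a.num ↔ a = .tid ∨ (∃ j < R, a = .arg j) ∨ a = .bLev := by
  simp [openNode]
@[simp] theorem sets_openNode {x : Reg} : (openNode R).Sets x.num ↔ x = .cur ∨ x = .act ∨
    x = .lim ∨ x = .deg ∨ x = .ofs ∨ x = .thr ∨ x = .prv ∨ x = .beg ∨ x = .lev ∨ x = .slot ∨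
    x = .ty := by
  simp [openNode]; tauto
@[simp] theorem writes_storeTop {a : Arr} : (storeTop c).Writes a.num ↔ a = .tid ∨ a = .arg 0 ∨
    a = .arg 1 ∨ a = .bBeg ∨ a = .bLev ∨ a = .bSlot ∨ a = .bTy := by
  simp [storeTop]; tauto
@[simp] theorem sets_storeTop {x : ℕ} : ¬ (storeTop c).Sets x := by simp [storeTop]
@[simp] theorem writes_pushLeaf {a : Arr} : (pushLeaf c).Writes a.num ↔ a = .tid ∨
    (∃ j < c.R, a = .arg j) ∨ a = .bBeg ∨ a = .bLev ∨ a = .bSlot ∨ a = .bTy := by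
  simp [pushLeaf]
@[simp] theorem sets_pushLeaf {x : Reg} : (pushLeaf c).Sets x.num ↔ x = .tmp ∨ x = .ofs := by
  simp [pushLeaf]

end frames

theorem sat_copyArgs (D : Dag) {R u q : ℕ} {s : State} (hu : u < D.N) (hR : D.deg u ≤ R)
    (hV : 3 * D.N ≤ V) (hcur : s.r .cur = u) (hdeg : s.r .deg = D.deg u) (hofs : s.r .ofs = q)
    (hch : ∀ j < D.deg u, s.m (.ch j) u = D.ch u j) :
    (copyArgs R).Sat V s fun s' => ((∀ j < D.deg u, s'.m (.arg j) q = 3 * D.ch u j) ∧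
      ∀ q' ≠ q, s.instrs.Agree s'.instrs q') ∧ (copyArgs R).Frame s s' := by
  refine Sat.frame ((sat_upTo hR (fun d s' => (∀ j < d, s'.m (.arg j) q = 3 * D.ch u j) ∧
      ∀ q' ≠ q, s.instrs.Agree s'.instrs q') hdeg (by simp) ⟨by simp, fun q' _ => agree_refl _ _⟩
    ?_).mono fun s' h => ⟨h.1.1, h.1.2⟩)
  rintro j hj s2 hf ⟨h1, h2⟩
  have hcur2 : s2.r .cur = u := by rw [hf.2 _ (by simp)]; exact hcur
  have hofs2 : s2.r .ofs = q := by rw [hf.2 _ (by simp)]; exact hofs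
  have hch2 : s2.m (.ch j) u = D.ch u j := by rw [hf.1 _ (by simp), hch j hj]
  have := D.ch_lt u hu j hj
  simp only [sat_put, tame_rd, tame_mul, tame_const, tame_ld, eval_const, eval_ld, eval_rd, hcur2,
    hch2, eval_mul, hofs2, true_and, m_setM]
  refine ⟨by omega, by omega, fun l hl => ?_, fun q' hq' => (agree_setM hq').2 (h2 q' hq')⟩
  rcases Nat.lt_succ_iff_lt_or_eq.1 hl with hl | rfl
  · rw [if_neg (by simp; omega), h1 l hl]
  · simp

theorem sat_putApp {c : Numbering} {s : State} {b v : ℕ} (hb : s.r .beg = b) (hv : s.r .cur = v)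
    (hbV : 3 * b ≤ V) (hvV : 3 * v ≤ V) (hs : s.r .slot ≤ V) (hc : c.appT (s.r .ty) ≤ V) :
    (putApp c).Sat V s fun s' => (s'.m .tid (3 * b) = c.appT (s.r .ty) ∧
      s'.m (.arg 0) (3 * b) = s.r .slot ∧ s'.m (.arg 1) (3 * b) = 3 * v ∧
      ∀ q ≠ 3 * b, s.instrs.Agree s'.instrs q) ∧ (putApp c).Frame s s' := by
  refine Sat.frame ?_
  have he : c.appT 0 + s.r .ty = c.appT (s.r .ty) := by simp [Numbering.appT]
  simp [putApp, hb, hv, m_setM, he]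
  refine ⟨hbV, hc, hbV, hs, hbV, hvV, fun q hq => ?_⟩
  rw [agree_setM hq, agree_setM hq, agree_setM hq]
  exact agree_refl _ _

theorem sat_putMerge {c : Numbering} {s : State} {b p : ℕ} (hb : s.r .beg = b) (hp : s.r .prv = p)
    (hbV : 3 * b ≤ V) (hs : s.r .slot ≤ V) (hs' : s.m .bSlot p ≤ V)
    (hc : c.mergeT (s.m .bTy p) (s.r .ty) ≤ V) :
    (putMerge c).Sat V s fun s' => (s'.r .tmp = c.mergeT (s.m .bTy p) (s.r .ty) ∧
      s'.m .tid (3 * b + 2) = c.mergeT (s.m .bTy p) (s.r .ty) ∧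
      s'.m (.arg 0) (3 * b + 2) = s.m .bSlot p ∧ s'.m (.arg 1) (3 * b + 2) = s.r .slot ∧
      ∀ q ≠ 3 * b + 2, s.instrs.Agree s'.instrs q) ∧ (putMerge c).Frame s s' := by
  refine Sat.frame ?_
  have he : c.mergeT 0 0 + (s.m .bTy p * c.K + s.r .ty) = c.mergeT (s.m .bTy p) (s.r .ty) := by
    simp [Numbering.mergeT]
  have h1 : s.m .bTy p * c.K ≤ V := by simp only [Numbering.mergeT] at hc; omega
  simp [putMerge, hb, hp, m_setM, he]
  refine ⟨h1, hc, hbV, hc, hbV, hs', hbV, hs, fun q hq => ?_⟩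
  rw [agree_setM hq, agree_setM hq, agree_setM hq]
  exact agree_refl _ _

theorem sat_takeMerged {s : State} {b p : ℕ} (hb : s.r .beg = b) (hp : s.r .prv = p)
    (hbV : 3 * b + 2 ≤ V) (h1 : s.m .bLev p ≤ V) (h2 : s.m .bBeg p ≤ V)
    (h3 : s.m .tyOf (s.r .tmp) ≤ V) (hl : s.r .lev + s.r .lev ≤ V) :
    takeMerged.Sat V s fun s' => (s'.r .lev = (if s.m .bLev p = s.r .lev then s.r .lev + s.r .lev
        else max (s.m .bLev p) (s.r .lev)) ∧
      s'.r .slot = 3 * b + 2 ∧ s'.r .beg = s.m .bBeg p ∧ s'.r .ty = s.m .tyOf (s.r .tmp)) ∧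
      takeMerged.Frame s s' := by
  refine Sat.frame ?_
  simp only [takeMerged, sat_seq, sat_branch, tame_ld, tame_rd, eval_ld, eval_rd, hp, true_and,
    sat_skip, sat_set, tame_add, tame_mul, tame_const, eval_add, eval_mul, eval_const, hb,
    r_setR_same, ne_eq, reduceCtorEq, not_false_eq_true, r_setR_ne, m_setR, and_true]
  refine ⟨fun h => ?_, fun h => ⟨fun h' => ?_, fun h' => ?_⟩⟩
  · rw [if_neg h.ne, max_eq_right h.le]; omega
  · rw [if_neg h'.ne', max_eq_left h]; omega
  · rw [if_pos (le_antisymm h' h)]; omega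

theorem sat_setLim {s : State} (hl : s.r .lev < V) (ht : s.r .thr ≤ V) :
    setLim.Sat V s fun s' => (s'.r .lim = max (s.r .lev + 1) (s.r .thr) ∧ s'.m .bLev 0 = s'.r .lim ∧
      ∀ b, 0 < b → s'.m .bLev b = s.m .bLev b) ∧ setLim.Frame s s' := by
  refine Sat.frame ?_
  simp only [setLim, sat_seq, sat_branch, tame_rd, eval_rd, true_and, sat_set, tame_add,
    tame_const, eval_add, eval_const, sat_put, r_setR_same, m_setM, r_setM, m_setR]
  refine ⟨fun h => ?_, fun h => ?_⟩
  · rw [max_eq_right h]; exact ⟨ht, ht, rfl, by simp, fun b hb => by simp [hb.ne']⟩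
  · rw [max_eq_left (by omega)]; exact ⟨hl, hl, rfl, by simp, fun b hb => by simp [hb.ne']⟩

end RAM

/-! ### Words and invariants of the merging -/

namespace MTree

theorem two_pow_lev_node (lv : ℕ → ℕ) (l r : MTree) : 2 ^ (node l r).lev lv =
    if 2 ^ l.lev lv = 2 ^ r.lev lv then 2 ^ r.lev lv + 2 ^ r.lev lv
      else max (2 ^ l.lev lv) (2 ^ r.lev lv) := by
  rcases lt_trichotomy (l.lev lv) (r.lev lv) with h | h | h
  · have := (Nat.pow_lt_pow_iff_right one_lt_two).2 h
    rw [lev_node_of_lt h, if_neg this.ne, max_eq_right this.le]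
  · rw [lev_node_of_eq h, if_pos (by rw [h]), pow_succ, mul_two]
  · have := (Nat.pow_lt_pow_iff_right one_lt_two).2 h
    rw [lev_node_of_gt h, if_neg this.ne', max_eq_left this.le]

end MTree

namespace Plan

variable {P : Plan}

theorem two_pow_le {v l : ℕ} (hv : v < P.D.N) (hp : 0 < P.D.paths v)
    (hl : l ≤ P.D.nl v + P.D.pl v + 3) : 2 ^ l ≤ 8 * P.D.μ P.D.root := by
  refine (Nat.pow_le_pow_right two_pos hl).trans ?_
  have := Nat.mul_le_mul (Dag.two_pow_pl_le hp) (Dag.two_pow_nl_le hv)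
  have := P.D.paths_mul_le v
  rw [pow_add, pow_add]; linarith

theorem lev_lt {T : MTree} {m : ℕ} (hT : T.Path P.D m) :
    T.lev P.lv < P.D.nl m + P.D.pl m + 2 := MTree.lev_lt P.dec hT

theorem thr_le {v : ℕ} (hv : v < P.D.N) (hp : 0 < P.D.paths v) :
    P.thr v ≤ P.D.nl v + P.D.pl v + 3 := by
  unfold thr
  split_ifs with h
  · exact le_rfl
  · obtain ⟨w, hw⟩ := (P.dec.nx_pos_iff hv hp).1 (Nat.pos_of_ne_zero h)
    have := lev_lt (P := P) (T := .leaf v) hw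
    rw [hw.nl_eq, hw.pl_eq] at this
    simp only [MTree.lev] at this; omega

/-- A bound for the words that occur in the construction of the instructions. -/
def bound (P : Plan) : ℕ := 3 * P.D.N + P.R + P.size + 8 * P.D.μ P.D.root + 8

theorem mergeT_le_bound (P : Plan) (y z : ℕ) (hy : y < P.K) (hz : z < P.K) :
    P.mergeT y z ≤ P.bound := by
  have := P.mergeT_lt hy hz; unfold bound; omega

theorem appT_le_bound (P : Plan) (y : ℕ) (hy : y < P.K) : P.appT y ≤ P.bound := by
  have := P.appT_lt hy; unfold bound; omega

end Plan

namespace RAM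

open Program CircuitBalancing.RAM.Expr State

variable {B V : ℕ}

/-- The arrays that are modified by the construction of the instructions. -/
def Arr.Own (a : Arr) : Prop :=
  a = tid ∨ (∃ j, a = arg j) ∨ a = bBeg ∨ a = bLev ∨ a = bSlot ∨ a = bTy

/-- The arrays of the state contain the given decomposition of a graph. -/
structure Loaded (P : Plan) (s : State) : Prop where
  tyOf : ∀ t < P.size, s.m .tyOf t = P.tyOf t
  tok : ∀ u < P.D.N, 0 < P.D.paths u → s.m .tok (u + 2) = P.tok u
  deg : ∀ u < P.D.N, s.m .deg u = P.D.deg u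
  ch : ∀ u < P.D.N, ∀ j < P.D.deg u, s.m (.ch j) u = P.D.ch u j
  pi : ∀ u < P.D.N, s.m .pi u = P.D.paths u
  pp : ∀ u < P.D.N, 0 < P.D.paths u → s.m .pp u = 2 ^ P.D.pl u
  pn : ∀ u < P.D.N, 0 < P.D.paths u → s.m .pn u = 2 ^ P.D.nl u
  nx : s.m .nx = P.nx
  pv : s.m .pv = P.pv
  ent : s.m .ent = P.E
  ext : s.m .ext = P.X

variable {P : Plan}

theorem Loaded.congr {s s' : State} (h : Loaded P s) (hs : ∀ a : Arr, ¬ a.Own → s'.m a = s.m a) :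
    Loaded P s' := by
  constructor
  · rw [hs _ (by simp [Arr.Own])]; exact h.tyOf
  · rw [hs _ (by simp [Arr.Own])]; exact h.tok
  · rw [hs _ (by simp [Arr.Own])]; exact h.deg
  · intro u hu j; rw [hs _ (by simp [Arr.Own])]; exact h.ch u hu j
  · rw [hs _ (by simp [Arr.Own])]; exact h.pi
  · rw [hs _ (by simp [Arr.Own])]; exact h.pp
  · rw [hs _ (by simp [Arr.Own])]; exact h.pn
  · rw [hs _ (by simp [Arr.Own])]; exact h.nx
  · rw [hs _ (by simp [Arr.Own])]; exact h.pv
  · rw [hs _ (by simp [Arr.Own])]; exact h.ent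
  · rw [hs _ (by simp [Arr.Own])]; exact h.ext

theorem Loaded.frame {s s' : State} {Q : Program} (h : Loaded P s) (hf : Q.Frame s s')
    (hQ : ∀ a : Arr, Q.Writes a.num → a.Own) : Loaded P s' :=
  h.congr fun a ha => hf.1 a (mt (hQ a) ha)

/-- The number of slots of merged contexts that have an instruction. -/
def merged (N : ℕ) (t : ℕ → ℕ) : ℕ := ((Finset.range N).filter fun v => t (3 * v + 2) ≠ 0).card

theorem merged_le (N : ℕ) (t : ℕ → ℕ) : merged N t ≤ N :=
  (Finset.card_filter_le _ _).trans (by simp)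

theorem merged_mono {N : ℕ} {t t' : ℕ → ℕ}
    (h : ∀ v < N, t (3 * v + 2) ≠ 0 → t' (3 * v + 2) ≠ 0) : merged N t ≤ merged N t' :=
  Finset.card_le_card fun v hv => by
    simp only [Finset.mem_filter, Finset.mem_range] at hv ⊢
    exact ⟨hv.1, h v hv.1 hv.2⟩

theorem merged_lt {N : ℕ} {t t' : ℕ → ℕ} {b : ℕ} (hb : b < N) (h0 : t (3 * b + 2) = 0)
    (h1 : t' (3 * b + 2) ≠ 0) (h : ∀ v < N, t (3 * v + 2) ≠ 0 → t' (3 * v + 2) ≠ 0) :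
    merged N t + 1 ≤ merged N t' :=
  Finset.card_lt_card ⟨fun v hv => by
    simp only [Finset.mem_filter, Finset.mem_range] at hv ⊢
    exact ⟨hv.1, h v hv.1 hv.2⟩, fun hs => by
      have := hs (Finset.mem_filter.2 ⟨Finset.mem_range.2 hb, h1⟩)
      exact (Finset.mem_filter.1 this).2 h0⟩

/-- The trees of the stack `R` are being merged with the tree `Y`, which is in the registers; the
node `v` follows. The sentinel `guard` stops the loop when the stack is empty. Only nodes before `v`
on its path have changed since state `s₀`. -/
structure InLoop (P : Plan) (s₀ : State) (v : ℕ) (Y : MTree) (R : List MTree) (s : State) :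
    Prop where
  loaded : Loaded P s
  cur : s.r .cur = v
  beg : s.r .beg = Y.first
  slot : s.r .slot = Y.slot
  lev : s.r .lev = 2 ^ Y.lev P.lv
  ty : s.r .ty = P.ty s.instrs Y.slot
  thr : s.r .thr = 2 ^ P.thr v
  lim : s.r .lim = max (2 ^ Y.lev P.lv + 1) (2 ^ P.thr v)
  guard : s.m .bLev 0 = s.r .lim
  built : P.Built s.instrs Y v
  fresh : s.m .tid (3 * Y.first + 2) = 0
  stack : IsStack P s R Y.first
  merging : MTree.Merging P.lv (P.thr v) Y R
  op : P.IsOp s.instrs v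
  off : ∀ u, ¬ (P.D.Above u v ∧ u ≠ v) → AgreeAt s₀ s u

theorem agreeAt_of {s s' : State} {u : ℕ} {a : Set ℕ} (ha : ∀ i < 3, 3 * u + i ∉ a)
    (h : ∀ q ∉ a, s.instrs.Agree s'.instrs q) (h1 : s'.m .bBeg = s.m .bBeg)
    (h2 : ∀ b, 0 < b → s'.m .bLev b = s.m .bLev b) (h3 : s'.m .bSlot = s.m .bSlot)
    (h4 : s'.m .bTy = s.m .bTy) : AgreeAt s s' u :=
  ⟨fun i hi => h _ (ha i hi), by rw [h1], h2 _ (by omega), by rw [h3], by rw [h4]⟩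

/-- Every merge creates the instruction of a slot that had none. -/
theorem sat_mergeStep (hV : P.bound ≤ V) {s₀ s : State} {v : ℕ} {Y T : MTree} {R : List MTree}
    (hs : s.Bd V) (h : InLoop P s₀ v Y (T :: R) s) (hg : 2 ^ T.lev P.lv < s.r .lim) :
    (mergeStep P.toNumbering).Sat V s fun s' => InLoop P s₀ v (.node T Y) R s' ∧
      merged P.D.N (s.m .tid) + 1 ≤ merged P.D.N (s'.m .tid) := by
  obtain ⟨hT, hfT, ⟨r1, r2, r3, r4⟩, hR⟩ := h.stack
  have hpath : (MTree.node T Y).Path P.D v := ⟨hT.path, h.built.path⟩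
  have hv := h.built.path.lt
  have hmb := (h.built.path.mem_lt Y.mem_first).1
  have hbv := h.built.path.μ_lt
  have hTb := hT.path.μ_lt
  have hpv := P.dec
  have hlev := P.two_pow_le hv.1 hv.2 (l := Y.lev P.lv + 1) (by
    have := P.lev_lt h.built.path; omega)
  have hlev' := P.two_pow_le hv.1 hv.2 (l := (MTree.node T Y).lev P.lv + 1) (by
    have := P.lev_lt hpath; omega)
  have hthr := P.two_pow_le hv.1 hv.2 (P.thr_le hv.1 hv.2)
  have hV' := hV
  rw [Plan.bound] at hV'
  rw [pow_succ] at hlev hlev'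
  have hty : P.ty s.instrs Y.slot < P.K := P.tyOf_lt _
  have hty' : P.ty s.instrs T.slot < P.K := P.tyOf_lt _
  obtain ⟨b, hb⟩ : ∃ b, b = Y.first := ⟨_, rfl⟩
  obtain ⟨p, hp⟩ : ∃ p, p = P.pv b := ⟨_, rfl⟩
  rw [← hb] at hmb hbv hTb r1 r2 r3 r4 hT
  rw [← hp] at r1 r2 r3 r4
  have h0 : (set .prv (ld .pv (rd .beg))).Sat V s fun s' => s' = s.setR .prv p := by
    simp only [sat_set, tame_ld, tame_rd, eval_ld, eval_rd, h.beg, h.loaded.pv, ← hb, ← hp,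
      and_true,
      true_and]
    rw [hp, ← h.loaded.pv]; exact hs.m _ _
  rw [mergeStep, sat_seq]
  refine h0.mono ?_
  rintro s1 rfl
  rw [sat_seq]
  refine (sat_putApp (V := V) (b := b) (v := v) (by simp [h.beg, hb]) (by simp [h.cur]) (by omega)
    (by omega) (by simpa using hs.r .slot) ?_).mono ?_
  · simp only [ne_eq, reduceCtorEq, not_false_eq_true, r_setR_ne, h.ty]
    exact (P.appT_le_bound _ hty).trans hV
  rintro s2 ⟨⟨a1, a2, a3, a4⟩, f2⟩
  simp only [ne_eq, reduceCtorEq, not_false_eq_true, r_setR_ne, h.ty] at a1 a2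
  have hr2 : ∀ x, s2.r x = (s.setR .prv p).r x := fun x => f2.2 x (by simp)
  rw [sat_seq]
  refine (sat_putMerge (V := V) (b := b) (p := p) (by simp [hr2, h.beg, hb]) (by simp [hr2])
    (by omega) (by simpa [hr2] using hs.r .slot) ?_ ?_).mono ?_
  · rw [f2.1 _ (by simp)]; exact hs.m _ _
  · rw [f2.1 .bTy (by simp), hr2]
    simp only [ne_eq, reduceCtorEq, not_false_eq_true, r_setR_ne, m_setR, r4, h.ty]
    exact (P.mergeT_le_bound _ _ hty' hty).trans hV
  rintro s3 ⟨⟨c1, c2, c3, c4, c5⟩, f3⟩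
  rw [f2.1 .bTy (by simp), hr2] at c1 c2
  rw [f2.1 .bSlot (by simp)] at c3
  rw [hr2] at c4
  simp only [ne_eq, reduceCtorEq, not_false_eq_true, r_setR_ne, m_setR, r4, h.ty] at c1 c2 c3 c4
  have hr3 : ∀ x, x ≠ .tmp → s3.r x = (s.setR .prv p).r x := fun x hx =>
    (f3.2 x (by simpa using hx)).trans (hr2 x)
  have hm3 : ∀ a : Arr, a ≠ .tid → a ≠ .arg 0 → a ≠ .arg 1 → s3.m a = s.m a := fun a h1 h2 h3 =>
    (f3.1 a (by simp [h1, h2, h3])).trans (f2.1 a (by simp [h1, h2, h3]))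
  have ag3 : ∀ q ∉ ({3 * b, 3 * b + 2} : Set ℕ), s.instrs.Agree s3.instrs q := fun q hq => by
    simp only [Set.mem_insert_iff, Set.mem_singleton_iff, not_or] at hq
    exact Instrs.Agree.trans (a4 q hq.1) (c5 q hq.2)
  have hbd : s3.m .bLev p ≤ V ∧ s3.m .bBeg p ≤ V ∧ s3.m .tyOf (s3.r .tmp) ≤ V := by
    rw [hm3 _ (by simp) (by simp) (by simp), hm3 _ (by simp) (by simp) (by simp),
      hm3 _ (by simp) (by simp) (by simp)]
    exact ⟨hs.m _ _, hs.m _ _, hs.m _ _⟩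
  rw [sat_seq]
  refine (sat_takeMerged (V := V) (b := b) (p := p) (by simp [hr3, h.beg, hb]) (by simp [hr3])
    (by omega) hbd.1 hbd.2.1 hbd.2.2 ?_).mono ?_
  · simp [hr3, h.lev]; omega
  rintro s4 ⟨⟨d1, d2, d3, d4⟩, f4⟩
  rw [hm3 _ (by simp) (by simp) (by simp), r2, hr3 _ (by simp), r_setR_ne _ _ (by simp), h.lev,
    ← MTree.two_pow_lev_node] at d1
  rw [hm3 _ (by simp) (by simp) (by simp), r1] at d3
  rw [hm3 _ (by simp) (by simp) (by simp), c1, h.loaded.tyOf _ (P.mergeT_lt hty' hty)] at d4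
  have hm4 : s4.m = s3.m := funext fun a => f4.1 a (by simp)
  have hthr4 : s4.r .thr = 2 ^ P.thr v := by
    rw [f4.2 _ (by simp), hr3 _ (by simp), r_setR_ne _ _ (by simp), h.thr]
  refine (sat_setLim (V := V) (by omega) (by omega)).mono ?_
  rintro s5 ⟨⟨e1, e2, e3⟩, f5⟩
  have ag : ∀ q ∉ ({3 * b, 3 * b + 2} : Set ℕ), s.instrs.Agree s5.instrs q := fun q hq =>
    (ag3 q hq).trans ((agree_of_frame f4 (by simp) (by simp) q).trans
      (agree_of_frame f5 (by simp) (by simp) q))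
  have ag35 : ∀ q, s3.instrs.Agree s5.instrs q := fun q =>
    (agree_of_frame f4 (by simp) (by simp) q).trans (agree_of_frame f5 (by simp) (by simp) q)
  have ag25 : s2.instrs.Agree s5.instrs (3 * b) := (c5 (3 * b) (by omega)).trans (ag35 _)
  have hm5 : ∀ a : Arr, a ≠ .tid → a ≠ .arg 0 → a ≠ .arg 1 → a ≠ .bLev → s5.m a = s.m a :=
    fun a h1 h2 h3 h4 => (f5.1 a (by simpa using h4)).trans (by rw [hm4, hm3 a h1 h2 h3])
  have hne : ∀ u i, u ≠ b → i < 3 → 3 * u + i ∉ ({3 * b, 3 * b + 2} : Set ℕ) := fun u i hu hi => by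
    simp only [Set.mem_insert_iff, Set.mem_singleton_iff, not_or]; omega
  have hat : ∀ u, u ≠ b → AgreeAt s s5 u := fun u hu =>
    agreeAt_of (fun i hi => hne u i hu hi) ag (hm5 _ (by simp) (by simp) (by simp) (by simp))
      (fun c hc => by rw [e3 c hc, hm4, hm3 _ (by simp) (by simp) (by simp)])
      (hm5 _ (by simp) (by simp) (by simp) (by simp))
      (hm5 _ (by simp) (by simp) (by simp) (by simp))
  have hTm : ∀ u, T.Mem u → u ≠ b := fun u hu e => by
    have := (hT.path.mem hu).2.2; rw [e] at this; omega
  have agT : ∀ u, T.Mem u → ∀ i < 3, (u = T.first → i = 1) →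
      s.instrs.Agree s5.instrs (3 * u + i) := fun u hu i hi _ => ag _ (hne u i (hTm u hu) hi)
  have agY : ∀ u, Y.Mem u → ∀ i < 3, (u = Y.first → i = 1) →
      s.instrs.Agree s5.instrs (3 * u + i) := fun u hu i hi h1 => by
    by_cases e : u = b
    · rw [← hb] at h1
      refine ag _ ?_
      simp only [Set.mem_insert_iff, Set.mem_singleton_iff, not_or]
      have := h1 e; omega
    · exact ag _ (hne u i e hi)
  have tyT := Plan.ty_eq (P := P) (slot_congr hT.path agT)
  have tyY := Plan.ty_eq (P := P) (slot_congr h.built.path agY)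
  have e5 : s5.instrs.tid (3 * b + 2) = P.mergeT (P.ty s.instrs T.slot) (P.ty s.instrs Y.slot) :=
    (ag35 _).1.trans c2
  have hr5 : ∀ x, x ≠ .tmp → x ≠ .lev → x ≠ .slot → x ≠ .beg → x ≠ .ty → x ≠ .lim → x ≠ .prv →
      s5.r x = s.r x := fun x h1 h2 h3 h4 h5 h6 h7 => by
    rw [f5.2 x (by simpa using h6), f4.2 x (by simp [h2, h3, h4, h5]), hr3 x h1, r_setR_ne _ _ h7]
  refine ⟨⟨?_, ?_, ?_, ?_, ?_, ?_, ?_, ?_, e2, ?_, ?_, ?_, ?_, ?_, ?_⟩, ?_⟩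
  · refine h.loaded.congr fun a ha => hm5 a ?_ ?_ ?_ ?_ <;>
      rintro rfl <;> exact ha (by simp [Arr.Own])
  · rw [hr5 _ (by simp) (by simp) (by simp) (by simp) (by simp) (by simp) (by simp), h.cur]
  · rw [f5.2 _ (by simp), d3]; rfl
  · rw [f5.2 _ (by simp), d2, hb]; rfl
  · rw [f5.2 _ (by simp), d1]
  · rw [f5.2 _ (by simp), d4]
    change _ = P.tyOf (s5.instrs.tid (3 * Y.first + 2))
    rw [← hb, e5]
  · rw [f5.2 _ (by simp), hthr4]
  · rw [e1, d1, hthr4]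
  · refine ⟨hb ▸ built_congr hT agT, built_congr h.built agY, ⟨?_, ?_, ?_⟩, ?_, ?_, ?_⟩
    · rw [← hb, tyY]; exact ag25.1.trans a1
    · rw [← hb]; exact (ag25.2 0).trans (a2.trans h.slot)
    · rw [← hb]; exact (ag25.2 1).trans a3
    · rw [← hb, tyT, tyY, e5]
    · rw [← hb]; exact ((ag35 _).2 0).trans (c3.trans r3)
    · rw [← hb]; exact ((ag35 _).2 1).trans (c4.trans h.slot)
  · have := (ag _ (hne T.first 2 (hTm _ T.mem_first) (by omega))).1
    simp only [State.instrs] at this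
    rw [MTree.first, this, hfT]
  · refine hR.congr fun u hu _ => hat u fun e => ?_
    have := hu.μ_le; rw [e] at this; omega
  · refine h.merging.step ?_
    rw [h.lim, lt_max_iff, Nat.lt_succ_iff, Nat.pow_le_pow_iff_right one_lt_two,
      Nat.pow_lt_pow_iff_right one_lt_two] at hg
    exact hg
  · exact h.op.congr (ag _ (hne v 0 (fun e => by rw [e] at hbv; omega) (by omega)))
  · intro u hu
    refine (h.off u hu).trans (hat u fun e => hu ?_)
    have := (h.built.path.mem Y.mem_first)
    rw [← hb] at this
    rw [e]
    exact ⟨this.1, fun e => by rw [e] at hbv; omega⟩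
  · refine merged_lt hmb (by rw [hb, h.fresh]) ?_ fun w _ hw => ?_
    · change s5.instrs.tid _ ≠ 0
      rw [e5]; simp only [Numbering.mergeT]; omega
    · by_cases e : w = b
      · subst e; rw [hb, h.fresh] at hw; exact absurd rfl hw
      · have := (ag _ (hne w 2 e (by omega))).1
        simp only [State.instrs] at this
        rwa [this]

end RAM

namespace RAM

open Program CircuitBalancing.RAM.Expr State

variable {B V : ℕ} {P : Plan}

/-- The loop is paid for by the merged contexts that it creates, apart from a constant. -/
theorem amort_mergeLoop (hV : P.bound ≤ V) (hB : (mergeLoop P.toNumbering).coef * (V + 1) ≤ B)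
    {s₀ s : State} {v : ℕ} {Y : MTree} {R : List MTree} (hs : s.Bd V)
    (h : InLoop P s₀ v Y R s) :
    (mergeLoop P.toNumbering).Amort B V
      (fun s => (mergeLoop P.toNumbering).wcost * merged P.D.N (s.m .tid)) s
      (mergeLoop P.toNumbering).wcost fun s' => ∃ Y R, InLoop P s₀ v Y R s' ∧
        ∀ T ∈ R.head?, Y.lev P.lv < T.lev P.lv ∧ P.thr v ≤ T.lev P.lv := by
  have hg : ∀ {Y T R s}, InLoop P s₀ v Y (T :: R) s →
      (ld .bLev (ld .pv (rd .beg))).eval s = 2 ^ T.lev P.lv := fun h => by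
    simp only [eval_ld, eval_rd, h.beg, h.loaded.pv]
    exact h.stack.2.2.1.2.1
  refine (amort_while (fun n s => ∃ Y R, R.length = n ∧ InLoop P s₀ v Y R s) hB ?_ ?_ hs
    ⟨Y, R, rfl, h⟩).mono (by simp only [mergeLoop, wcost]; omega) ?_
  · rintro n s ⟨Y, R, hn, h⟩
    refine ⟨by simp, by simp, fun hlt => ?_⟩
    cases R with
    | nil =>
      have : P.pv Y.first = 0 := h.stack
      simp [h.beg, h.loaded.pv, this, h.guard] at hlt
    | cons T R => rw [← hn]; simp
  · rintro n s hs ⟨Y, R, hn, h⟩ hlt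
    cases R with
    | nil => simp at hn
    | cons T R =>
      rw [hg h] at hlt
      refine (sat_mergeStep hV hs h hlt).mono fun s' h' => ⟨⟨_, R, by simpa using hn, h'.1⟩, ?_⟩
      have := Nat.mul_le_mul_left (mergeLoop P.toNumbering).wcost h'.2
      rw [mul_add, mul_one] at this
      exact this
  · rintro s' ⟨n, ⟨Y, R, -, h⟩, hge⟩
    refine ⟨Y, R, h, fun T hT => ?_⟩
    cases R with
    | nil => simp at hT
    | cons T' R =>
      obtain rfl : T' = T := by simpa using hT
      rw [hg h, eval_rd, h.lim, max_le_iff, Nat.succ_le_iff, Nat.pow_lt_pow_iff_right one_lt_two,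
        Nat.pow_le_pow_iff_right one_lt_two] at hge
      exact hge

theorem amort_mergeLoop_of_lim (hB : (mergeLoop P.toNumbering).coef * (V + 1) ≤ B)
    {s : State} (hs : s.Bd V) (h : s.r .lim = 0) {φ : State → ℕ} :
    (mergeLoop P.toNumbering).Amort B V φ s (mergeLoop P.toNumbering).wcost fun s' => s' = s := by
  refine (amort_while (fun n s' => n = 0 ∧ s' = s) hB ?_ ?_ hs ⟨rfl, rfl⟩).mono
    (by simp only [mergeLoop, wcost]; omega) fun s' ⟨n, h, _⟩ => h.2
  · rintro n s' ⟨rfl, rfl⟩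
    exact ⟨by simp, by simp, fun hlt => by simp [h] at hlt⟩
  · rintro n s' _ ⟨h, -⟩; omega

theorem sat_setThr (hV : P.bound ≤ V) {s : State} (hL : Loaded P s) {v : ℕ} (hv : v < P.D.N)
    (hp : 0 < P.D.paths v) (hc : s.r .cur = v) :
    setThr.Sat V s fun s' => s'.r .thr = 2 ^ P.thr v ∧ setThr.Frame s s' := by
  refine Sat.frame ?_
  have h1 := P.two_pow_le hv hp (P.thr_le hv hp)
  rw [Plan.bound] at hV
  simp only [setThr, sat_branch, tame_const, tame_ld, tame_rd, eval_const, eval_ld, eval_rd, hc,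
    hL.nx, hL.ent, hL.ext, hL.pn v hv hp, hL.pp v hv hp, tame_mul, eval_mul, true_and, sat_set,
    r_setR_same]
  refine ⟨fun h => ?_, fun h => ?_⟩
  · have hw : 2 ^ P.thr v = max (P.E v * 2 ^ P.D.nl v) (P.X v * 2 ^ P.D.pl v) := by
      rw [Plan.thr, if_neg h.ne', Plan.lv, Dag.two_pow_wl P.dec hv hp, Dag.weight]
    have h2 : P.E v * 2 ^ P.D.nl v ≤ 2 ^ P.thr v := hw ▸ le_max_left _ _
    have h3 : P.X v * 2 ^ P.D.pl v ≤ 2 ^ P.thr v := hw ▸ le_max_right _ _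
    refine ⟨by omega, by omega, fun h4 => ?_, fun h4 => ?_⟩
    · rw [hw, max_eq_right h4.le]; omega
    · rw [hw, max_eq_left h4]; omega
  · have hw : 2 ^ P.thr v = 8 * (2 ^ P.D.pl v * 2 ^ P.D.nl v) := by
      rw [Plan.thr, if_pos (by omega), pow_add, pow_add]; ring
    rw [hw]; omega

theorem sat_loadTop {s : State} (hL : Loaded P s) {v : ℕ} (hc : s.r .cur = v)
    (hlev : 0 < P.pv v → s.m .bLev (P.pv v) < V) (hpv : P.pv v ≤ V) (h1 : s.m .bBeg (P.pv v) ≤ V)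
    (h2 : s.m .bSlot (P.pv v) ≤ V) (h3 : s.m .bTy (P.pv v) ≤ V) (h4 : s.r .thr ≤ V) :
    loadTop.Sat V s fun s' => ((P.pv v = 0 → s' = s) ∧
      (∀ b, 0 < b → s'.m .bLev b = s.m .bLev b) ∧
      (0 < P.pv v → s'.r .beg = s.m .bBeg (P.pv v) ∧ s'.r .lev = s.m .bLev (P.pv v) ∧
        s'.r .slot = s.m .bSlot (P.pv v) ∧ s'.r .ty = s.m .bTy (P.pv v) ∧
        s'.r .lim = max (s.m .bLev (P.pv v) + 1) (s.r .thr) ∧ s'.m .bLev 0 = s'.r .lim)) ∧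
      loadTop.Frame s s' := by
  refine Sat.frame ?_
  simp only [loadTop, sat_branch, tame_const, tame_ld, tame_rd, eval_const, eval_ld, eval_rd, hc,
    hL.pv, true_and, sat_seq, sat_set, sat_skip, r_setR_same, m_setR, ne_eq, reduceCtorEq,
    not_false_eq_true, r_setR_ne]
  refine ⟨fun h => ⟨hpv, h1, (hlev h).le, h2, h3, ?_⟩, fun h =>
    ⟨fun _ => trivial, fun _ _ => trivial, fun h' => by omega⟩⟩
  refine (sat_setLim (by simpa using hlev h) (by simpa using h4)).mono ?_
  rintro s' ⟨⟨e1, e2, e3⟩, f⟩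
  refine ⟨fun h' => by omega, fun b hb => by simpa using e3 b hb, fun _ => ?_⟩
  rw [e1, f.2 _ (by simp), f.2 _ (by simp), f.2 _ (by simp), f.2 _ (by simp), e2, e1]
  simp

theorem sat_openNode (hV : P.bound ≤ V) {s : State} (hs : s.Bd V) (hL : Loaded P s) {v : ℕ}
    (hv : v < P.D.N) (hq : s.m .queue (s.r .idx) = v) (hlev : 0 < P.pv v → s.m .bLev (P.pv v) < V) :
    (openNode P.R).Sat V s fun s' => ((P.D.paths v = 0 → s'.m = s.m ∧ s'.r .lim = 0) ∧
      (0 < P.D.paths v → P.IsOp s'.instrs v ∧ (∀ q ≠ 3 * v, s.instrs.Agree s'.instrs q) ∧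
        s'.r .deg = P.D.deg v ∧ s'.r .thr = 2 ^ P.thr v ∧ (P.pv v = 0 → s'.r .lim = 0) ∧
        (∀ b, 0 < b → s'.m .bLev b = s.m .bLev b) ∧
        (0 < P.pv v → s'.r .beg = s.m .bBeg (P.pv v) ∧ s'.r .lev = s.m .bLev (P.pv v) ∧
          s'.r .slot = s.m .bSlot (P.pv v) ∧ s'.r .ty = s.m .bTy (P.pv v) ∧
          s'.r .lim = max (s.m .bLev (P.pv v) + 1) (2 ^ P.thr v) ∧ s'.m .bLev 0 = s'.r .lim)) ∧
      s'.r .cur = v ∧ s'.r .act = P.D.paths v) ∧ (openNode P.R).Frame s s' := by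
  refine Sat.frame ?_
  have h0 := P.D.paths_le hv
  have hV' := hV
  rw [Plan.bound] at hV'
  have hR := P.deg_le v hv
  simp only [openNode, sat_branch, tame_const, tame_ld, tame_rd, eval_const, eval_ld, eval_rd, hq,
    true_and, sat_seq (set _ _), sat_set, sat_skip, r_setR_same, m_setR, ne_eq, reduceCtorEq,
    not_false_eq_true, r_setR_ne, hL.pi v hv, hL.deg v hv, and_true, tame_mul, eval_mul]
  refine ⟨by omega, by omega, by omega, fun hp => ⟨by omega, by omega, by omega, ?_⟩,
    fun hp => ⟨fun _ => trivial, fun hp' => by omega⟩⟩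
  have htok := P.opT_lt (P.tok_lt v hv hp)
  rw [sat_seq]
  have h1 : (put .tid (rd .ofs) (const 1 + ld .tok (rd .cur + const 2))).Sat V
      (((((s.setR .cur v).setR .act (P.D.paths v)).setR .lim 0).setR .deg (P.D.deg v)).setR
        .ofs (3 * v)) fun s' => s' = (((((s.setR .cur v).setR .act (P.D.paths v)).setR .lim 0).setR
        .deg (P.D.deg v)).setR .ofs (3 * v)).setM .tid (3 * v) (Numbering.opT (P.tok v)) := by
    simp only [sat_put, tame_rd, tame_add, tame_const, tame_ld, eval_add, eval_const, eval_ld,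
      eval_rd, r_setR_same, ne_eq, reduceCtorEq, not_false_eq_true, r_setR_ne, m_setR,
      hL.tok v hv hp, true_and, Numbering.opT, and_true]
    simp only [Numbering.opT] at htok; omega
  refine h1.mono ?_
  rintro s1 rfl
  set s1 : State := (((((s.setR .cur v).setR .act (P.D.paths v)).setR .lim 0).setR .deg
    (P.D.deg v)).setR .ofs (3 * v)).setM .tid (3 * v) (Numbering.opT (P.tok v)) with hs1
  have hm1 : ∀ a : Arr, a ≠ .tid → s1.m a = s.m a := fun a ha => by simp [hs1, ha]
  have ag1 : ∀ q ≠ 3 * v, s.instrs.Agree s1.instrs q := fun q hq => by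
    rw [hs1, agree_setM hq]; exact agree_refl _ _
  have t1 : s1.m .tid (3 * v) = Numbering.opT (P.tok v) := by simp [hs1]
  have c1 : s1.r .cur = v := by simp [hs1]
  have a1 : s1.r .act = P.D.paths v := by simp [hs1]
  have l1 : s1.r .lim = 0 := by simp [hs1]
  have d1 : s1.r .deg = P.D.deg v := by simp [hs1]
  have o1 : s1.r .ofs = 3 * v := by simp [hs1]
  rw [sat_seq]
  refine (sat_copyArgs P.D hv hR (by omega) c1 d1 o1 fun j hj => by
    rw [hm1 _ (by simp), hL.ch v hv j hj]).mono ?_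
  rintro s2 ⟨⟨g1, g2⟩, f2⟩
  have hr2 : ∀ x, s2.r x = s1.r x := fun x => f2.2 x (by simp)
  have hm2 : ∀ a : Arr, (∀ j, a ≠ .arg j) → a ≠ .tid → s2.m a = s.m a := fun a h1 h2 => by
    rw [f2.1 a (by simp [h1]), hm1 a h2]
  have hL2 : Loaded P s2 := hL.congr fun a ha => hm2 a (fun j e => ha (by simp [e, Arr.Own]))
    fun e => ha (by simp [e, Arr.Own])
  rw [sat_seq]
  refine (sat_setThr hV hL2 hv hp (by rw [hr2, c1])).mono ?_
  rintro s3 ⟨ht3, f3⟩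
  have hm3 : s3.m = s2.m := funext fun a => f3.1 a (by simp)
  have hr3 : ∀ x, x ≠ .thr → s3.r x = s1.r x := fun x hx => by rw [f3.2 x (by simpa using hx), hr2]
  have hL3 : Loaded P s3 := hL2.congr fun a _ => by rw [hm3]
  have hm3' : ∀ a : Arr, (∀ j, a ≠ .arg j) → a ≠ .tid → s3.m a = s.m a := fun a h1 h2 => by
    rw [hm3, hm2 a h1 h2]
  have hthr := P.two_pow_le hv hp (P.thr_le hv hp)
  have hpv : P.pv v ≤ V := by rw [← hL.pv]; exact hs.m _ _
  refine (sat_loadTop hL3 (by rw [hr3 _ (by simp), c1]) (by rwa [hm3' _ (by simp) (by simp)]) hpv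
    (by rw [hm3' _ (by simp) (by simp)]; exact hs.m _ _)
    (by rw [hm3' _ (by simp) (by simp)]; exact hs.m _ _)
    (by rw [hm3' _ (by simp) (by simp)]; exact hs.m _ _) (by omega)).mono ?_
  rintro s4 ⟨⟨h4, h5, h6⟩, f4⟩
  have ag24 : ∀ q, s2.instrs.Agree s4.instrs q := fun q =>
    (agree_of_frame f3 (by simp) (by simp) q).trans (agree_of_frame f4 (by simp) (by simp) q)
  have hr4 : ∀ x, x ≠ .thr → x ≠ .prv → x ≠ .beg → x ≠ .lev → x ≠ .slot → x ≠ .ty → x ≠ .lim →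
      s4.r x = s1.r x := fun x e1 e2 e3 e4 e5 e6 e7 => by
    rw [f4.2 x (by simp [e2, e3, e4, e5, e6, e7]), hr3 x e1]
  rw [hm3' .bBeg (by simp) (by simp), hm3' .bLev (by simp) (by simp),
    hm3' .bSlot (by simp) (by simp), hm3' .bTy (by simp) (by simp), ht3] at h6
  refine ⟨fun h => by omega, fun _ => ⟨⟨?_, fun j hj => ?_⟩, fun q hq => ?_, ?_, ?_, fun h => ?_,
    fun b hb => ?_, h6⟩, ?_, ?_⟩
  · exact (ag24 _).1.trans ((congrFun (f2.1 .tid (by simp)) _).trans t1)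
  · exact ((ag24 _).2 j).trans (g1 j hj)
  · exact (ag1 q hq).trans ((g2 q hq).trans (ag24 q))
  · rw [hr4 _ (by simp) (by simp) (by simp) (by simp) (by simp) (by simp) (by simp), d1]
  · rw [f4.2 _ (by simp), ht3]
  · rw [h4 h, hr3 _ (by simp), l1]
  · rw [h5 b hb, hm3' .bLev (by simp) (by simp)]
  · rw [hr4 _ (by simp) (by simp) (by simp) (by simp) (by simp) (by simp) (by simp), c1]
  · rw [hr4 _ (by simp) (by simp) (by simp) (by simp) (by simp) (by simp) (by simp), a1]

theorem sat_storeTop (hV : P.bound ≤ V) {s : State} (hL : Loaded P s) {v b y : ℕ}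
    (hc : s.r .cur = v) (hv : v < P.D.N) (hb : s.r .beg = b) (hbN : b < P.D.N)
    (hlev : s.r .lev ≤ V) (hslot : s.r .slot ≤ V) (hy : s.r .ty = y) (hyK : y < P.K)
    (hpv : 0 < P.pv v) :
    (storeTop P.toNumbering).Sat V s fun s' => ((∀ q ≠ 3 * b, s.instrs.Agree s'.instrs q) ∧
      (P.nx v = 0 → s'.m .tid (3 * b) = P.appT y ∧ s'.m (.arg 0) (3 * b) = s.r .slot ∧
        s'.m (.arg 1) (3 * b) = 3 * v) ∧ (0 < P.nx v → s'.m .tid = s.m .tid) ∧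
      s'.m .bBeg = Function.update (s.m .bBeg) (P.pv v) b ∧
      s'.m .bLev = Function.update (s.m .bLev) (P.pv v) (s.r .lev) ∧
      s'.m .bSlot = Function.update (s.m .bSlot) (P.pv v) (s.r .slot) ∧
      s'.m .bTy = Function.update (s.m .bTy) (P.pv v) y) ∧ (storeTop P.toNumbering).Frame s s' := by
  refine Sat.frame ?_
  have h1 := (P.appT_le_bound _ hyK).trans hV
  have hV' := hV
  have hy' : y ≤ V := by simp only [Numbering.appT] at h1; omega
  rw [Plan.bound] at hV'
  simp only [storeTop, sat_branch, tame_const, tame_ld, tame_rd, eval_const, eval_ld, eval_rd, hc,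
    hL.pv, true_and, sat_seq (put _ _ _), sat_put, sat_skip, m_setM_ne, r_setM, ne_eq,
    reduceCtorEq, not_false_eq_true, hb, hy, hL.nx, hpv, true_imp_iff, hpv.not_ge, false_imp_iff,
    and_true]
  refine ⟨by omega, hlev, hslot, hy', fun h => ?_, fun h => ?_⟩
  · refine ⟨fun q _ => ?_, fun h' => by omega, by simp, by simp, by simp, by simp⟩
    simp [Instrs.Agree, State.instrs]
  · refine (sat_putApp (V := V) (b := b) (v := v) (by simp [hb]) (by simp [hc]) (by omega)
      (by omega) (by simpa using hslot) (by simpa [hy] using h1)).mono ?_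
    rintro s' ⟨⟨e1, e2, e3, e4⟩, f⟩
    refine ⟨fun q hq => ?_, fun _ => ?_, fun h' => by omega, ?_, ?_, ?_, ?_⟩
    · have := e4 q hq
      simpa [Instrs.Agree, State.instrs] using this
    · exact ⟨by simpa [hy] using e1, by simpa using e2, e3⟩
    · rw [f.1 _ (by simp)]; simp
    · rw [f.1 _ (by simp)]; simp
    · rw [f.1 _ (by simp)]; simp
    · rw [f.1 _ (by simp)]; simp

theorem sat_pushLeaf (hV : P.bound ≤ V) {s : State} (hL : Loaded P s) {v : ℕ}
    (hc : s.r .cur = v) (hv : v < P.D.N) (hp : 0 < P.D.paths v) (hd : s.r .deg = P.D.deg v)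
    (ht : s.r .thr = 2 ^ P.thr v) :
    (pushLeaf P.toNumbering).Sat V s fun s' => ((∀ q ≠ 3 * v + 1, s.instrs.Agree s'.instrs q) ∧
      (∀ b ≠ v + 1, s'.m .bBeg b = s.m .bBeg b ∧ s'.m .bLev b = s.m .bLev b ∧
        s'.m .bSlot b = s.m .bSlot b ∧ s'.m .bTy b = s.m .bTy b) ∧
      (P.nx v = 0 → s' = s) ∧ (0 < P.nx v → P.IsLeaf s'.instrs v ∧
        IsRecord P s' (.leaf v) (v + 1))) ∧ (pushLeaf P.toNumbering).Frame s s' := by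
  refine Sat.frame ?_
  have hthr := P.two_pow_le hv hp (P.thr_le hv hp)
  have hV' := hV
  rw [Plan.bound] at hV'
  simp only [pushLeaf, sat_branch, tame_const, tame_ld, tame_rd, eval_const, eval_ld, eval_rd, hc,
    hL.nx, true_and, sat_seq (set _ _), sat_set, sat_skip, ne_eq, reduceCtorEq,
    not_false_eq_true, r_setR_ne, hL.tok v hv hp, and_true, tame_mul, eval_mul, tame_add, tame_sub,
    eval_add, eval_sub]
  refine ⟨fun h => ?_, fun h => ⟨fun q _ => agree_refl _ _, by simp, fun _ => trivial,
    fun h' => by omega⟩⟩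
  obtain ⟨w, hw⟩ := (P.dec.nx_pos_iff hv hp).1 h
  have hj := P.dec.ch_nx hw
  have hR := P.deg_le v hv
  have hlt := P.leafT_lt (P.tok_lt v hv hp) (hj.2.1.trans_le hR)
  have he : P.leafT 0 0 + (P.tok v * P.R + (P.nx v - 1)) = P.leafT (P.tok v) (P.nx v - 1) := by
    simp [Numbering.leafT]
  rw [he]
  have h1 : P.tok v * P.R ≤ V := by
    have := hlt; simp only [Numbering.leafT] at this; omega
  refine ⟨h1, by omega, by omega, by omega, ?_⟩
  have h0 : (put .tid (rd .ofs) (rd .tmp)).Sat V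
      ((s.setR .tmp (P.leafT (P.tok v) (P.nx v - 1))).setR .ofs (3 * v + 1)) fun s' => s' =
      ((s.setR .tmp (P.leafT (P.tok v) (P.nx v - 1))).setR .ofs (3 * v + 1)).setM .tid (3 * v + 1)
        (P.leafT (P.tok v) (P.nx v - 1)) := by
    simp; omega
  rw [sat_seq]
  refine h0.mono ?_
  rintro s1 hs1
  have hm1 : ∀ a : Arr, a ≠ .tid → s1.m a = s.m a := fun a ha => by simp [hs1, ha]
  have ag1 : ∀ q ≠ 3 * v + 1, s.instrs.Agree s1.instrs q := fun q hq => by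
    rw [hs1, agree_setM hq]; exact agree_refl _ _
  rw [sat_seq]
  refine (sat_copyArgs P.D (q := 3 * v + 1) hv hR (by omega) (by simp [hs1, hc]) (by simp [hs1, hd])
    (by simp [hs1]) fun j hj => by rw [hm1 _ (by simp), hL.ch v hv j hj]).mono ?_
  rintro s2 ⟨⟨g1, g2⟩, f2⟩
  have hr2 : ∀ x, s2.r x = s1.r x := fun x => f2.2 x (by simp)
  have hm2 : ∀ a : Arr, (∀ j, a ≠ .arg j) → a ≠ .tid → s2.m a = s.m a := fun a h1 h2 => by
    rw [f2.1 a (by simp [h1]), hm1 a h2]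
  have hc2 : s2.r .cur = v := by simp [hr2, hs1, hc]
  have ho2 : s2.r .ofs = 3 * v + 1 := by simp [hr2, hs1]
  have ht2 : s2.r .thr = 2 ^ P.thr v := by simp [hr2, hs1, ht]
  have htm2 : s2.r .tmp = P.leafT (P.tok v) (P.nx v - 1) := by simp [hr2, hs1]
  have htid2 : s2.m .tid (3 * v + 1) = P.leafT (P.tok v) (P.nx v - 1) := by
    rw [f2.1 _ (by simp), hs1]; simp
  have hty2 : s2.m .tyOf (P.leafT (P.tok v) (P.nx v - 1)) =
      P.tyOf (P.leafT (P.tok v) (P.nx v - 1)) := by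
    rw [hm2 _ (by simp) (by simp), hL.tyOf _ hlt]
  have hyV : P.tyOf (P.leafT (P.tok v) (P.nx v - 1)) ≤ V := by
    have h1 := P.tyOf_lt (P.leafT (P.tok v) (P.nx v - 1))
    have h2 : P.K ≤ P.size := by simp only [Numbering.size]; omega
    omega
  simp only [sat_seq, sat_put, tame_rd, tame_add, tame_const, tame_ld, eval_add, eval_const,
    eval_ld,
    eval_rd, hc2, ho2, ht2, htm2, r_setM, m_setM_ne, ne_eq, reduceCtorEq, not_false_eq_true,
    true_and, and_true, hty2]
  refine ⟨by omega, by omega, by omega, hyV, fun q hq => ?_, fun b hb => ?_, fun h' => by omega,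
    fun _ => ⟨⟨?_, fun j hj => ?_⟩, ?_⟩⟩
  · have := (ag1 q hq).trans (g2 q hq)
    simpa [Instrs.Agree, State.instrs] using this
  · simp [hb, hm2]
  · simpa [State.instrs] using htid2
  · simpa [State.instrs] using g1 j hj
  · have hw : P.thr v = P.lv v := by rw [Plan.thr, if_neg h.ne']
    simp [IsRecord, MTree.first, MTree.lev, MTree.slot, Plan.ty, State.instrs, htid2, hw]

end RAM

/-! ### Processing a node -/

theorem Dag.Above.μ_lt {D : Dag} {u v : ℕ} (h : D.Above u v) (hne : u ≠ v) : D.μ v < D.μ u := by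
  rcases Relation.ReflTransGen.cases_head h with e | ⟨w, h1, h2⟩
  · exact absurd e hne
  · have h3 : D.Above w v := h2
    exact h3.μ_le.trans_lt h1.μ_lt

namespace RAM

open Program CircuitBalancing.RAM.Expr State

variable {B V : ℕ} {P : Plan}

/-- The predecessors of `v` on its path of central edges have been processed: their trees are on the
stack, with the leaf of the central parent `p` on top. -/
def Live (P : Plan) (s : State) (v : ℕ) : Prop :=
  ∃ p R, IsStack P s (.leaf p :: R) v ∧ MTree.AtRest P.lv (P.lv p) R

theorem Live.congr {s s' : State} {v : ℕ} (h : Live P s v)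
    (ha : ∀ u, P.D.Above u v → u ≠ v → AgreeAt s s' u) : Live P s' v :=
  let ⟨p, R, h1, h2⟩ := h
  ⟨p, R, h1.congr ha, h2⟩

/-- The node `v` has been processed, except that its leaf is not on the stack. If `v` ends its path,
then all trees have been merged. -/
structure Mid (P : Plan) (s₀ : State) (v : ℕ) (s : State) : Prop where
  loaded : Loaded P s
  cur : s.r .cur = v
  deg : s.r .deg = P.D.deg v
  thr : s.r .thr = 2 ^ P.thr v
  op : P.IsOp s.instrs v
  unused : s.m .tid (3 * v + 1) = 0 ∧ s.m .tid (3 * v + 2) = 0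
  off : ∀ u, ¬ P.D.Above u v → AgreeAt s₀ s u
  stack : ∃ R, IsStack P s R v ∧ MTree.AtRest P.lv (P.thr v) R
  tree : P.nx v = 0 → P.pv v = 0 ∨ ∃ T, P.Built s.instrs T v ∧ P.IsApp s.instrs T.first T v ∧
    P.pv T.first = 0 ∧ s.m .tid (3 * T.first + 2) = 0 ∧ T.height P.lv ≤ 3 * T.lev P.lv + 3

theorem sat_pushLeaf' (hV : P.bound ≤ V) {s₀ s : State} {v : ℕ} (hv : v < P.D.N)
    (hp : 0 < P.D.paths v) (h : Mid P s₀ v s) :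
    (pushLeaf P.toNumbering).Sat V s fun s' => Loaded P s' ∧
      (∀ u, ¬ P.D.Above u v → AgreeAt s₀ s' u) ∧ (P.nx v = 0 → P.Final s'.instrs v) ∧
      (∀ w, P.D.Nxt v w → Live P s' w) ∧ ∀ w, s'.m .tid (3 * w + 2) = s.m .tid (3 * w + 2) := by
  refine (sat_pushLeaf hV h.loaded h.cur hv hp h.deg h.thr).mono ?_
  rintro s' ⟨⟨h1, h2, h3, h4⟩, f⟩
  have hag : ∀ u ≠ v, AgreeAt s s' u := fun u hu =>
    ⟨fun i hi => h1 _ (by omega), (h2 _ (by omega)).1, (h2 _ (by omega)).2.1,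
      (h2 _ (by omega)).2.2.1, (h2 _ (by omega)).2.2.2⟩
  refine ⟨h.loaded.frame f fun a ha => ?_, fun u hu => ?_, fun h0 => ?_, fun w hw => ?_,
    fun w => ?_⟩
  · rw [writes_pushLeaf] at ha
    rcases ha with rfl | ⟨j, -, rfl⟩ | rfl | rfl | rfl | rfl <;> simp [Arr.Own]
  · exact (h.off u hu).trans (hag u fun e => hu (e ▸ .refl))
  · rw [h3 h0]; exact ⟨h.op, h.unused, h.tree h0⟩
  · obtain ⟨R, hR, hr⟩ := h.stack
    have hn := (P.dec.nx_pos_iff hv hp).2 ⟨w, hw⟩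
    have ht : P.thr v = P.lv v := by rw [Plan.thr, if_neg hn.ne']
    rw [ht] at hr
    refine ⟨v, R, ⟨⟨hw, (h4 hn).1⟩, ?_, ?_, hR.congr fun u _ hne => hag u hne⟩, hr⟩
    · have := (h1 (3 * v + 2) (by omega)).1
      exact this.trans h.unused.2
    · rw [(P.dec.pv_eq_iff hw.lt').2 hw]; exact (h4 hn).2
  · exact (h1 _ (by omega)).1

theorem sat_storeTop_of_root {s₀ s s₁ : State} {v : ℕ} (hp : P.pv v = 0)
    (h1 : Loaded P s₁) (h2 : s₁.r .cur = v) (h3 : s₁.r .deg = P.D.deg v)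
    (h4 : s₁.r .thr = 2 ^ P.thr v) (h5 : P.IsOp s₁.instrs v)
    (h6 : s₁.m .tid (3 * v + 1) = 0 ∧ s₁.m .tid (3 * v + 2) = 0)
    (h7 : ∀ u, ¬ P.D.Above u v → AgreeAt s₀ s₁ u) (h8 : s = s₁) :
    (storeTop P.toNumbering).Sat V s fun s' => Mid P s₀ v s' ∧
      ∀ w, s'.m .tid (3 * w + 2) = s.m .tid (3 * w + 2) := by
  subst h8
  simp only [storeTop, sat_branch, tame_const, tame_ld, tame_rd, eval_const, eval_ld, eval_rd, h2,
    h1.pv, hp, lt_irrefl, false_imp_iff, true_and, le_refl, true_imp_iff, sat_skip, implies_true,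
    and_true]
  exact ⟨h1, h2, h3, h4, h5, h6, h7, ⟨[], hp, trivial⟩, fun _ => .inl hp⟩

theorem sat_storeTop_of_inLoop (hV : P.bound ≤ V) {s₀ s₁ s : State} (hs : s.Bd V) {v : ℕ}
    (hpv : 0 < P.pv v) {Y : MTree} {R : List MTree} (h : InLoop P s₁ v Y R s)
    (hR : ∀ T ∈ R.head?, Y.lev P.lv < T.lev P.lv ∧ P.thr v ≤ T.lev P.lv)
    (h3 : s.r .deg = P.D.deg v)
    (h6 : s₁.m .tid (3 * v + 1) = 0 ∧ s₁.m .tid (3 * v + 2) = 0)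
    (h7 : ∀ u, ¬ P.D.Above u v → AgreeAt s₀ s₁ u) :
    (storeTop P.toNumbering).Sat V s fun s' => Mid P s₀ v s' ∧
      ∀ w, s'.m .tid (3 * w + 2) = s.m .tid (3 * w + 2) := by
  have hYf := h.built.path.mem Y.mem_first
  have hb := (h.built.path.mem_lt Y.mem_first).1
  have hv := h.built.path.lt
  obtain ⟨l, hl, hlv⟩ := h.built.path.exists_last
  have hpl := (P.dec.pv_eq_iff hlv.lt').2 hlv
  have hlm := h.built.path.mem hl
  refine (sat_storeTop hV h.loaded h.cur hv.1 h.beg hb (hs.r _) (hs.r _) h.ty (P.tyOf_lt _)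
    hpv).mono ?_
  rintro s' ⟨⟨a1, a2, a3, a4, a5, a6, a7⟩, f⟩
  have hag : ∀ u, u ≠ Y.first → u ≠ l → AgreeAt s s' u := fun u hu hul =>
    ⟨fun i hi => a1 _ (by omega), by rw [a4, Function.update_of_ne (by omega)],
      by rw [a5, Function.update_of_ne (by omega)], by rw [a6, Function.update_of_ne (by omega)],
      by rw [a7, Function.update_of_ne (by omega)]⟩
  have hvb : v ≠ Y.first := fun e => by rw [← e] at hYf; exact hYf.2.2.false
  have hvl : v ≠ l := fun e => by rw [e] at hlm; exact hlm.2.2.false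
  have agY : ∀ u, Y.Mem u → ∀ i < 3, (u = Y.first → i = 1) →
      s.instrs.Agree s'.instrs (3 * u + i) := fun u hu i hi h1 => a1 _ (by omega)
  have tyY := Plan.ty_eq (P := P) (slot_congr h.built.path agY)
  have hbuilt := built_congr h.built agY
  have hfresh : s'.m .tid (3 * Y.first + 2) = 0 := ((a1 _ (by omega)).1).trans h.fresh
  have hoff := h.off v fun e => e.2 rfl
  refine ⟨⟨h.loaded.frame f fun a ha => ?_, ?_, ?_, ?_, ?_, ⟨?_, ?_⟩, fun u hu => ?_, ⟨Y :: R,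
    ⟨hbuilt, hfresh, ?_, h.stack.congr fun u hu hne => ?_⟩, ?_⟩, fun h0 => .inr ⟨Y, hbuilt, ?_, ?_,
    hfresh, h.merging.height_le⟩⟩, fun w => (a1 _ (by omega)).1⟩
  · rw [writes_storeTop] at ha
    rcases ha with rfl | rfl | rfl | rfl | rfl | rfl | rfl <;> simp [Arr.Own]
  · rw [f.2 _ (by simp), h.cur]
  · rw [f.2 _ (by simp), h3]
  · rw [f.2 _ (by simp), h.thr]
  · exact h.op.congr ((hag v hvb hvl).1 0 (by omega))
  · exact ((hag v hvb hvl).1 1 (by omega)).1.trans ((hoff.1 1 (by omega)).1.trans h6.1)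
  · exact ((hag v hvb hvl).1 2 (by omega)).1.trans ((hoff.1 2 (by omega)).1.trans h6.2)
  · exact ((h7 u hu).trans (h.off u fun e => hu e.1)).trans
      (hag u (fun e => hu (e ▸ hYf.1)) fun e => hu (e ▸ hlm.1))
  · refine ⟨by rw [a4]; simp, by rw [a5, h.lev]; simp, by rw [a6, h.slot]; simp, ?_⟩
    rw [a7, tyY]; simp
  · have h1 := hu.μ_lt hne
    have h2 := hlm.2.1.μ_le
    exact hag u hne fun e => by rw [e] at h1; omega
  · exact h.merging.atRest hR
  · obtain ⟨b1, b2, b3⟩ := a2 h0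
    exact ⟨by rw [tyY]; exact b1, b2.trans h.slot, b3⟩
  · cases R with
    | nil => exact h.stack
    | cons T R =>
      exfalso
      have h1 := (hR T rfl).2
      have h2 := P.lev_lt h.stack.1.path
      have h4 := MTree.nl_eq_of_above hYf.1
      rw [Plan.thr, if_pos h0] at h1
      omega

/-- Process a node. -/
def processNode (c : Numbering) : Program := seq (openNode c.R) (seq (mergeLoop c) (closeNode c))

/-- The potential: every merged context pays for the iteration of the loop that composes it. -/
def potential (P : Plan) (s : State) : ℕ :=
  (mergeLoop P.toNumbering).wcost * merged P.D.N (s.m .tid)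

/-- A bound for the amortized running time for a node. -/
def nodeCost (c : Numbering) : ℕ :=
  (openNode c.R).wcost + ((mergeLoop c).wcost + (closeNode c).wcost)

theorem potential_mono {s s' : State} (h : ∀ w, s'.m .tid (3 * w + 2) = s.m .tid (3 * w + 2)) :
    potential P s ≤ potential P s' :=
  Nat.mul_le_mul_left _ (merged_mono fun v _ hv => by rwa [h])

theorem amort_processNode_of_inactive (hV : P.bound ≤ V)
    (hB : (processNode P.toNumbering).coef * (V + 1) ≤ B) {s : State} (hs : s.Bd V)
    (hL : Loaded P s) {v : ℕ} (hv : v < P.D.N) (hq : s.m .queue (s.r .idx) = v)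
    (hp : P.D.paths v = 0) :
    (processNode P.toNumbering).Amort B V (potential P) s (nodeCost P.toNumbering)
      fun s' => s'.m = s.m := by
  have hpv : P.pv v = 0 := by
    by_contra h
    have := (P.dec.pv_eq_iff (u := P.pv v - 1) hv).1 (by omega)
    exact absurd hp this.paths_pos'.ne'
  refine Amort.seq (((sat_openNode hV hs hL hv hq (by omega)).amort hs (coef_seq_left hB)
    fun s' h => potential_mono fun w => ?_)) fun s1 hs1 h1 => ?_
  · rw [(h.1.1 hp).1]
  · obtain ⟨h2, h3⟩ := h1.1.1 hp
    refine (amort_mergeLoop_of_lim (coef_seq_left (coef_seq_right hB)) hs1 h3).seq ?_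
    rintro s2 hs2 rfl
    refine Sat.amort (Sat.mono (Q := fun s' => s' = s2) ?_ (by rintro s' rfl; exact h2)) hs2
      (coef_seq_right (coef_seq_right hB)) (fun s' h => ?_)
    · simp [closeNode, h1.1.2.2.2, hp]
    · exact potential_mono fun w => by rw [h, h2]

/-- The node `v` gets its instructions, and only nodes on its path of central edges are touched. At
the end of a path the instructions for the whole path are complete; otherwise the stack is ready for
the central child. -/
theorem amort_processNode (hV : P.bound ≤ V)
    (hB : (processNode P.toNumbering).coef * (V + 1) ≤ B) {s : State} (hs : s.Bd V)
    (hL : Loaded P s) {v : ℕ} (hv : v < P.D.N) (hq : s.m .queue (s.r .idx) = v)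
    (hp : 0 < P.D.paths v)
    (h6 : s.m .tid (3 * v + 1) = 0 ∧ s.m .tid (3 * v + 2) = 0)
    (hlive : P.pv v = 0 ∨ Live P s v) :
    (processNode P.toNumbering).Amort B V (potential P) s (nodeCost P.toNumbering) fun s' =>
      Loaded P s' ∧ (∀ u, ¬ P.D.Above u v → AgreeAt s s' u) ∧ (P.nx v = 0 → P.Final s'.instrs v) ∧
      ∀ w, P.D.Nxt v w → Live P s' w := by
  have hlev : 0 < P.pv v → s.m .bLev (P.pv v) < V := by
    intro h
    rcases hlive with h | ⟨p, R, hR, -⟩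
    · omega
    · rw [hR.2.2.1.2.1]
      have h1 := P.lev_lt hR.1.path
      have h2 := P.two_pow_le hv hp (l := (MTree.leaf p).lev P.lv) (by omega)
      rw [Plan.bound] at hV; omega
  refine Amort.seq (((sat_openNode hV hs hL hv hq hlev).amort hs (coef_seq_left hB)
    fun s' h => potential_mono fun w => ((h.1.2.1 hp).2.1 _ (by omega)).1)) fun s1 hs1 h1 => ?_
  obtain ⟨⟨-, h1, hc1, ha1⟩, f1⟩ := h1
  obtain ⟨hop, hag, hdeg, hthr, hlim, hbl, htop⟩ := h1 hp
  have hL1 : Loaded P s1 := hL.frame f1 fun a ha => by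
    rw [writes_openNode] at ha
    rcases ha with rfl | ⟨j, -, rfl⟩ | rfl <;> simp [Arr.Own]
  have hat : ∀ u ≠ v, AgreeAt s s1 u := fun u hu =>
    ⟨fun i hi => hag _ (by omega), by rw [f1.1 _ (by simp)], hbl _ (by omega),
      by rw [f1.1 _ (by simp)], by rw [f1.1 _ (by simp)]⟩
  have hat' : ∀ u, ¬ P.D.Above u v → AgreeAt s s1 u := fun u hu => hat u fun e => hu (e ▸ .refl)
  have h61 : s1.m .tid (3 * v + 1) = 0 ∧ s1.m .tid (3 * v + 2) = 0 :=
    ⟨(hag _ (by omega)).1.trans h6.1, (hag _ (by omega)).1.trans h6.2⟩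
  have close : ∀ s2, s2.Bd V → s2.r .act = P.D.paths v →
      ((storeTop P.toNumbering).Sat V s2 fun s' => Mid P s v s' ∧
        ∀ w, s'.m .tid (3 * w + 2) = s2.m .tid (3 * w + 2)) →
      (closeNode P.toNumbering).Amort B V (potential P) s2 (closeNode P.toNumbering).wcost fun s' =>
        Loaded P s' ∧ (∀ u, ¬ P.D.Above u v → AgreeAt s s' u) ∧
        (P.nx v = 0 → P.Final s'.instrs v) ∧ ∀ w, P.D.Nxt v w → Live P s' w := by
    intro s2 hs2 ha2 hst
    have hsat : (closeNode P.toNumbering).Sat V s2 fun s' => (Loaded P s' ∧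
        (∀ u, ¬ P.D.Above u v → AgreeAt s s' u) ∧ (P.nx v = 0 → P.Final s'.instrs v) ∧
        ∀ w, P.D.Nxt v w → Live P s' w) ∧ ∀ w, s'.m .tid (3 * w + 2) = s2.m .tid (3 * w + 2) := by
      simp only [closeNode, sat_branch, tame_const, tame_rd, eval_const, eval_rd, ha2, hp,
        true_imp_iff, hp.not_ge, false_imp_iff, true_and, and_true, sat_seq]
      refine hst.mono fun s3 h3 => (sat_pushLeaf' hV hv hp h3.1).mono fun s4 h4 =>
        ⟨⟨h4.1, h4.2.1, h4.2.2.1, h4.2.2.2.1⟩, fun w => (h4.2.2.2.2 w).trans (h3.2 w)⟩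
    exact (hsat.amort hs2 (coef_seq_right (coef_seq_right hB)) fun s' h =>
      potential_mono h.2).mono le_rfl fun s' h => h.1
  rcases Nat.eq_zero_or_pos (P.pv v) with hpv | hpv
  · refine (amort_mergeLoop_of_lim (coef_seq_left (coef_seq_right hB)) hs1 (hlim hpv)).seq ?_
    rintro s2 hs2 rfl
    exact close _ hs2 ha1 (sat_storeTop_of_root hpv hL1 hc1 hdeg hthr hop h61 hat' rfl)
  · obtain ⟨p, R, ⟨hb, hfr, ⟨r1, r2, r3, r4⟩, hR⟩, hrest⟩ := hlive.resolve_left hpv.ne'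
    have hpp : p ≠ v := fun e => by have := Dag.Nxt.μ_lt hb.1; rw [e] at this; omega
    obtain ⟨t1, t2, t3, t4, t5, t6⟩ := htop hpv
    have agp : ∀ u, (MTree.leaf p).Mem u → ∀ i < 3, (u = (MTree.leaf p).first → i = 1) →
        s.instrs.Agree s1.instrs (3 * u + i) := by
      rintro u rfl i hi -; exact (hat p hpp).1 i hi
    have hin : InLoop P s1 v (.leaf p) R s1 :=
      { loaded := hL1, cur := hc1, beg := t1.trans r1, slot := t3.trans r3, lev := t2.trans r2
        ty := by rw [t4, r4, Plan.ty_eq (slot_congr hb.path agp)]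
        thr := hthr, lim := by rw [t5, r2], guard := t6, built := built_congr hb agp
        fresh := ((hat p hpp).1 2 (by omega)).1.trans hfr
        stack := hR.congr fun u hu hne => hat u fun e => by
          have h1 := hu.μ_le
          have h2 := Dag.Nxt.μ_lt hb.1
          simp only [MTree.first] at h1
          rw [e] at h1; omega
        merging := .inl ⟨p, rfl, hrest⟩, op := hop, off := fun u _ => AgreeAt.refl _ _ }
    refine (amort_mergeLoop hV (coef_seq_left (coef_seq_right hB)) hs1 hin).frame.seq ?_
    rintro s2 hs2 ⟨⟨Y, R', h2, h3⟩, f2⟩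
    exact close _ hs2 (by rw [f2.2 _ (by simp), ha1]) (sat_storeTop_of_inLoop hV hs2 hpv h2 h3
      (by rw [f2.2 _ (by simp), hdeg]) h61 hat')

end RAM

/-! ### Balancing all paths -/

namespace RAM

open Program CircuitBalancing.RAM.Expr State

variable {B V : ℕ} {P : Plan}

/-- Balance the paths of central edges, in topological order. -/
def mergePaths (c : Numbering) : Program := forTo .idx .len (processNode c)

/-- The running time of `mergePaths`, per node; the last summand pays for the final potential. -/
def mergeCost (c : Numbering) : ℕ := nodeCost c + 10 + (mergeLoop c).wcost

theorem writes_processNode {c : Numbering} {a : Arr} (h : (processNode c).Writes a.num) :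
    a.Own := by
  simp only [processNode, writes_seq, writes_openNode, writes_mergeLoop, closeNode, writes_branch,
    writes_storeTop, writes_pushLeaf, writes_skip, or_false] at h
  unfold Arr.Own
  aesop

theorem sets_processNode {c : Numbering} {x : Reg} (h : (processNode c).Sets x.num) :
    x ≠ .idx ∧ x ≠ .len ∧ x ≠ .root := by
  simp only [processNode, sets_seq, sets_openNode, sets_mergeLoop, closeNode, sets_branch,
    sets_storeTop, sets_pushLeaf, sets_skip, or_false, false_or] at h
  constructor
  · rintro rfl; simp at h
  · constructor <;> rintro rfl <;> simp at h

/-- The first `i` nodes of a topological order have been processed. -/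
structure Processed (P : Plan) (q : ℕ → ℕ) (i : ℕ) (s : State) : Prop where
  loaded : Loaded P s
  unused : ∀ a, i ≤ a → a < P.D.N → ∀ x < 3, s.m .tid (3 * q a + x) = 0
  final : ∀ a < i, 0 < P.D.paths (q a) → P.nx (q a) = 0 → P.Final s.instrs (q a)
  inactive : ∀ a < i, P.D.paths (q a) = 0 → ∀ x < 3, s.m .tid (3 * q a + x) = 0
  live : ∀ a < i, ∀ w, P.D.Nxt (q a) w → (∀ b < i, q b ≠ w) → Live P s w

theorem processed_of_nxt {D : Dag} {q : ℕ → ℕ} (hq : D.IsOrder q) {a : ℕ} (ha : a < D.N) {w : ℕ}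
    (h : D.Nxt w (q a)) : ∃ b < a, q b = w := by
  obtain ⟨b, hb, rfl⟩ := Graph.surj_of_inj hq.lt hq.inj h.lt
  obtain ⟨j, hs, e⟩ := h
  obtain ⟨c, hbc, hc, e'⟩ := hq.topo b hb j hs.2.2.1
  have := hq.inj c hc a ha (e'.trans e)
  exact ⟨b, by omega, rfl⟩

theorem processed_of_above {D : Dag} {q : ℕ → ℕ} (hq : D.IsOrder q) {a : ℕ} (ha : a < D.N) {w : ℕ}
    (h : D.Above w (q a)) : ∃ b ≤ a, q b = w := by
  obtain ⟨v, hv⟩ : ∃ v, v = q a := ⟨_, rfl⟩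
  rw [← hv] at h
  induction h generalizing a with
  | refl => exact ⟨a, le_rfl, hv.symm⟩
  | tail _ h ih =>
    rw [hv] at h
    obtain ⟨b, hb, e⟩ := processed_of_nxt hq ha h
    obtain ⟨c, hc, e'⟩ := ih (by omega) e.symm
    exact ⟨c, by omega, e'⟩

theorem Processed.succ {q : ℕ → ℕ} (hq : P.D.IsOrder q) {i : ℕ} (hi : i < P.D.N) {s s' : State}
    (h : Processed P q i s) (hp : 0 < P.D.paths (q i)) (h1 : Loaded P s')
    (h2 : ∀ u, ¬ P.D.Above u (q i) → AgreeAt s s' u)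
    (h3 : P.nx (q i) = 0 → P.Final s'.instrs (q i))
    (h4 : ∀ w, P.D.Nxt (q i) w → Live P s' w) : Processed P q (i + 1) s' := by
  have hne : ∀ a < P.D.N, a ≠ i → q a ≠ q i := fun a ha hai e => hai (hq.inj a ha i hi e)
  refine ⟨h1, fun a ha haN x hx => ?_, fun a ha hpa hn => ?_, fun a ha hpa x hx => ?_,
    fun a ha w hw hb => ?_⟩
  · have hnab : ¬ P.D.Above (q a) (q i) := fun hab => by
      obtain ⟨b, hb, e⟩ := processed_of_above hq hi hab
      have := hq.inj b (by omega) a haN e; omega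
    exact (((h2 _ hnab).1 x hx).1).trans (h.unused a (by omega) haN x hx)
  · rcases Nat.lt_succ_iff_lt_or_eq.1 ha with ha | rfl
    · refine (h.final a ha hpa hn).congr fun u hu => ?_
      have hnab : ¬ P.D.Above u (q i) := fun hab => by
        rcases hab.total hu with h5 | h5
        · obtain ⟨b, hb, e⟩ := processed_of_above hq (by omega) h5
          exact hne b (by omega) (by omega) e
        · rcases Relation.ReflTransGen.cases_head h5 with e | ⟨w, hw, -⟩
          · exact hne a (by omega) ha.ne e
          · have := (P.dec.nx_pos_iff hw.lt hpa).2 ⟨w, hw⟩; omega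
      have h6 := h2 u hnab
      exact ⟨h6.1 0 (by omega), h6.1 1 (by omega), h6.1 2 (by omega)⟩
    · exact h3 hn
  · rcases Nat.lt_succ_iff_lt_or_eq.1 ha with ha | rfl
    · have hnab : ¬ P.D.Above (q a) (q i) := fun hab => by
        rcases Relation.ReflTransGen.cases_head hab with e | ⟨w, hw, -⟩
        · exact hne a (by omega) ha.ne e
        · exact absurd hpa hw.paths_pos.ne'
      exact (((h2 _ hnab).1 x hx).1).trans (h.inactive a ha hpa x hx)
    · omega
  · rcases Nat.lt_succ_iff_lt_or_eq.1 ha with ha | rfl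
    · refine (h.live a ha w hw fun b hbi => hb b (by omega)).congr fun u hu huw =>
        h2 u fun hab => ?_
      obtain ⟨c, hcN, rfl⟩ := Graph.surj_of_inj hq.lt hq.inj hw.lt'
      rcases hab.total hu with h5 | h5
      · rcases Relation.ReflTransGen.cases_tail h5 with e | ⟨p, h6, h7⟩
        · exact hb i (by omega) e.symm
        · obtain rfl := h7.left_unique hw
          obtain ⟨b, hba, e⟩ := processed_of_above hq (by omega) h6
          exact hne b (by omega) (by omega) e
      · obtain ⟨b, hba, e⟩ := processed_of_above hq hi h5
        exact hb b (by omega) e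
    · exact h4 w hw

/-- There are at most `N` merged contexts, so the running time is linear. -/
theorem amort_mergePaths (hV : P.bound ≤ V) (hB : (mergePaths P.toNumbering).coef * (V + 1) ≤ B)
    {s : State} (hs : s.Bd V) (hL : Loaded P s) (hl : s.r .len = P.D.N)
    (hq : P.D.IsOrder (s.m .queue)) (h0 : ∀ q, s.m .tid q = 0) :
    (mergePaths P.toNumbering).Reaches B V s (mergeCost P.toNumbering * (P.D.N + 1)) fun s' =>
      ((∀ e < P.D.N, 0 < P.D.paths e → P.nx e = 0 → P.Final s'.instrs e) ∧
      ∀ u < P.D.N, P.D.paths u = 0 → ∀ x < 3, s'.m .tid (3 * u + x) = 0) ∧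
      (mergePaths P.toNumbering).Frame s s' := by
  obtain ⟨q, hqq⟩ : ∃ q, q = s.m .queue := ⟨_, rfl⟩
  rw [← hqq] at hq
  have hBp : (processNode P.toNumbering).coef * (V + 1) ≤ B :=
    (Nat.mul_le_mul_right _ (by simp only [mergePaths, forTo, Program.coef]; omega)).trans hB
  -- the bound for the potential at the end is added only after the loop
  have key : (mergePaths P.toNumbering).Amort B V (potential P) s
      ((nodeCost P.toNumbering + 10) * (P.D.N + 1)) fun s' =>
      Processed P q P.D.N s' ∧ (mergePaths P.toNumbering).Frame s s' := by
    refine amort_forTo (n := P.D.N) (fun i s => Processed P q i s) hs hB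
      (by rw [Plan.bound] at hV; omega) hl (fun h => (sets_processNode h).1 rfl)
      (fun h => (sets_processNode h).2.1 rfl) (by simp) (fun _ _ => rfl) ?_ ?_
    · exact ⟨hL.congr fun _ _ => rfl, fun a _ _ x _ => h0 _, by simp, by simp, by simp⟩
    · intro i hi s' hs' hf hidx h
      have hque : s'.m .queue (s'.r .idx) = q i := by
        rw [hidx, hqq, hf.1 .queue fun hw => ?_]
        have := writes_processNode (writes_forTo.1 hw)
        simp [Arr.Own] at this
      have hv := hq.lt i hi
      rcases Nat.eq_zero_or_pos (P.D.paths (q i)) with hp | hp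
      · refine (amort_processNode_of_inactive hV hBp hs' h.loaded hv hque hp).mono le_rfl ?_
        intro s2 h2
        have hag : ∀ u, AgreeAt s' (s2.setR .idx (i + 1)) u := fun u => by
          simp [AgreeAt, Instrs.Agree, State.instrs, h2]
        have hin : ∀ q, (s2.setR .idx (i + 1)).m .tid q = s'.m .tid q := fun q => by simp [h2]
        have hI : (s2.setR .idx (i + 1)).instrs = s'.instrs := by simp [State.instrs, h2]
        refine ⟨h.loaded.congr fun a _ => by simp [h2], fun a ha haN x hx => ?_,
          fun a ha hpa hn => ?_, fun a ha hpa x hx => ?_, fun a ha w hw hb => ?_⟩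
        · rw [hin]; exact h.unused a (by omega) haN x hx
        · rcases Nat.lt_succ_iff_lt_or_eq.1 ha with ha | rfl
          · rw [hI]; exact h.final a ha hpa hn
          · omega
        · rw [hin]
          rcases Nat.lt_succ_iff_lt_or_eq.1 ha with ha | rfl
          exacts [h.inactive a ha hpa x hx, h.unused a le_rfl hi x hx]
        · rcases Nat.lt_succ_iff_lt_or_eq.1 ha with ha | rfl
          · exact (h.live a ha w hw fun b hbi => hb b (by omega)).congr fun u _ _ => hag u
          · exact absurd hp hw.paths_pos.ne'
      · refine (amort_processNode hV hBp hs' h.loaded hv hque hp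
          ⟨h.unused i le_rfl hi 1 (by omega), h.unused i le_rfl hi 2 (by omega)⟩ ?_).mono le_rfl ?_
        · refine (P.dec.pv_cases _ hv).imp (fun h => h.1) ?_
          rintro ⟨u, j, hs, e, -⟩
          obtain ⟨b, hb, e'⟩ := processed_of_nxt hq hi ⟨j, hs, e⟩
          refine h.live b hb _ (e' ▸ ⟨j, hs, e⟩) fun b hb e => ?_
          have := hq.inj b (by omega) i hi e; omega
        · rintro s2 ⟨h1, h2, h3, h4⟩
          exact h.succ hq hi hp (h1.congr fun _ _ => rfl) h2 h3 fun w hw =>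
            (h4 w hw).congr fun u _ _ => ⟨fun _ _ => ⟨rfl, fun _ => rfl⟩, rfl, rfl, rfl, rfl⟩
  obtain ⟨T, s', hE, hb, ⟨hP, hf⟩, hT⟩ := key
  refine ⟨T, ?_, s', hE, hb, ⟨fun e he hp hn => ?_, fun u hu hp => ?_⟩, hf⟩
  · have := Nat.mul_le_mul_left (mergeLoop P.toNumbering).wcost (merged_le P.D.N (s'.m .tid))
    rw [mergeCost, add_mul, mul_add (mergeLoop P.toNumbering).wcost]
    simp only [potential] at hT
    omega
  · obtain ⟨a, ha, rfl⟩ := Graph.surj_of_inj hq.lt hq.inj he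
    exact hP.final a ha hp hn
  · obtain ⟨a, ha, rfl⟩ := Graph.surj_of_inj hq.lt hq.inj hu
    exact hP.inactive a ha hp

end RAM

/-! ### Substitution in terms and contexts -/

section

namespace Term

variable {S : Type u} {Γ : Signature.{u, v} S} {ι κ : Type} {σ : ι → S} {τ : κ → S}

theorem eval_subst (A : SortedAlgebra.{u, v, w} Γ) (a : (i : κ) → A.carrier (τ i))
    (η : (i : ι) → Term Γ τ (σ i)) {p : S} (t : Term Γ σ p) :
    (t.subst η).eval A a = t.eval A fun i => (η i).eval A a := by
  induction t with
  | var i => rfl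
  | op f args ih => simp only [subst, eval, ih]

theorem subst_subst {ξ : Type} {υ : ξ → S} (η : (i : ι) → Term Γ τ (σ i))
    (θ : (i : κ) → Term Γ υ (τ i)) {p : S} (t : Term Γ σ p) :
    (t.subst η).subst θ = t.subst fun i => (η i).subst θ := by
  induction t with
  | var i => rfl
  | op f args ih => simp only [subst, ih]

theorem occurs_of_subst {η : (i : ι) → Term Γ τ (σ i)} {j : κ} {p : S} {t : Term Γ σ p}
    (h : (t.subst η).Occurs j) : ∃ i, t.Occurs i ∧ (η i).Occurs j := by
  induction t with
  | var i => exact ⟨i, rfl, h⟩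
  | op f args ih =>
    obtain ⟨l, hl⟩ := h
    obtain ⟨i, hi, hj⟩ := ih l hl
    exact ⟨i, ⟨l, hi⟩, hj⟩

theorem depth_subst_le {η : (i : ι) → Term Γ τ (σ i)} {D : ℕ} (h : ∀ i, (η i).depth ≤ D) {p : S}
    (t : Term Γ σ p) : (t.subst η).depth ≤ t.depth + D := by
  induction t with
  | var i => simpa [subst, depth] using h i
  | op f args ih =>
    refine Finset.sup_le fun j _ => ?_
    have h1 := Finset.le_sup (f := fun j => 1 + (args j).depth) (Finset.mem_univ j)
    have h2 := ih j
    simp only [depth] at h1 ⊢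
    omega

theorem count_subst [DecidableEq ι] [DecidableEq κ] {η : (i : ι) → Term Γ τ (σ i)} {i₀ : ι} {j : κ}
    {n : ℕ} (h : ∀ i, (η i).count j = if i₀ = i then n else 0) {p : S} (t : Term Γ σ p) :
    (t.subst η).count j = t.count i₀ * n := by
  induction t with
  | var i => simp [subst, count, h]
  | op f args ih => simp only [subst, count, ih, Finset.sum_mul]

/-- Substitution of variables for variables preserves the size. -/
theorem size_subst {η : (i : ι) → Term Γ τ (σ i)} (h : ∀ i, (η i).size = 0) {p : S}
    (t : Term Γ σ p) : (t.subst η).size = t.size := by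
  induction t with
  | var i => simp [subst, size, h]
  | op f args ih => simp only [subst, size, ih]

theorem isVar_of_subst {η : (i : ι) → Term Γ τ (σ i)} {p : S} {t : Term Γ σ p}
    (h : (t.subst η).IsVar) : t.IsVar := by
  cases t with
  | var i => trivial
  | op f args => exact h.elim

theorem count_of_forall_ne [DecidableEq ι] {i₀ : ι} {p : S} {t : Term Γ σ p}
    (h : ∀ i, t.Occurs i → i ≠ i₀) : t.count i₀ = 0 := by
  induction t with
  | var i => simp [count, (h i rfl).symm]
  | op f args ih => exact Finset.sum_eq_zero fun j _ => ih j fun i hi => h i ⟨j, hi⟩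

end Term

variable {S : Type u} {Γ : Signature.{u, v} S}

/-- An assignment for the variables of a context. -/
def assign {A : SortedAlgebra.{u, v, w} Γ} {ι : Type} {σ : ι → S} {p : S} (a : A.carrier p)
    (x : (i : ι) → A.carrier (σ i)) : (o : Option ι) → A.carrier (extend σ p o)
  | none => a
  | some i => x i

theorem termFun_subst_liftSubst (A : SortedAlgebra.{u, v, w} Γ) {ι : Type} {σ : ι → S} {p q : S}
    (t : Term Γ (extend σ p) q) (η : (i : ι) → GroundTerm Γ (σ i)) (a : A.carrier p) :
    termFun A (t.subst (liftSubst p η)) a =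
      t.eval A (assign a fun i => (η i).groundEval A) := by
  rw [termFun, Term.eval_subst]
  congr 1
  funext o
  cases o with
  | none => rfl
  | some i =>
    simp only [liftSubst, Term.eval_subst, assign, Term.groundEval]
    congr 1

theorem eval_subst_liftSubst (A : SortedAlgebra.{u, v, w} Γ) {ι κ : Type} {σ : ι → S} {τ : κ → S}
    {p q : S} (t : Term Γ (extend τ p) q) (ζ : (k : κ) → Term Γ σ (τ k)) (a : A.carrier p)
    (x : (i : ι) → A.carrier (σ i)) :
    (t.subst (liftSubst p ζ)).eval A (assign a x) =
      t.eval A (assign a fun k => (ζ k).eval A x) := by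
  rw [Term.eval_subst]
  congr 1
  funext o
  cases o with
  | none => rfl
  | some k => simp only [liftSubst, Term.eval_subst, assign]; rfl

section Rename

variable {n : ℕ} {ι : Type} (σ : ι → S) (e : Fin n ≃ ι)

/-- The variable with the number of a given variable, in an enumeration of the variables. -/
def numVar (i : ι) : Term Γ (fun j => σ (e j)) (σ i) :=
  (e.apply_symm_apply i) ▸ Term.var (σ := fun j => σ (e j)) (e.symm i)

theorem numVar_subst {κ : Type} {τ : κ → S} (η : (i : ι) → Term Γ τ (σ i)) (i : ι) :
    (numVar σ e i).subst (fun j => η (e j)) = η i := by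
  have : ∀ (j : Fin n) (h : e j = i),
      (h ▸ Term.var (Γ := Γ) (σ := fun j => σ (e j)) j : Term Γ _ (σ i)).subst
        (fun j => η (e j)) = η i := by
    rintro j rfl; rfl
  exact this _ _

end Rename

/-- Every context over finitely many auxiliary variables is subsumed by a member of the base. -/
theorem IsSubsumptionBase.exists_subst {A : SortedAlgebra.{u, v, w} Γ}
    {C : (p q : S) → Set (AnyContext Γ p q)} (hC : IsSubsumptionBase A C) {ι : Type}
    [DecidableEq ι] [Finite ι] {σ : ι → S} {p q : S} (s : Context Γ σ p q) :
    ∃ t ∈ C p q, ∃ ζ : (k : Fin t.numVars) → Term Γ σ (t.sort k),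
      ∀ (η : (i : ι) → GroundTerm Γ (σ i)) (a : A.carrier p),
        s.term.eval A (assign a fun i => (η i).groundEval A) =
          t.context.term.eval A (assign a fun k => ((ζ k).subst η).groundEval A) := by
  obtain ⟨n, ⟨e⟩⟩ := Finite.exists_equiv_fin ι
  let e := e.symm
  have hl : ∀ o, (liftSubst p (numVar (Γ := Γ) σ e) o).count none =
      if none = o then 1 else 0 := by
    rintro (_ | i)
    · simp [liftSubst, Term.count]
    · simp only [liftSubst, reduceCtorEq, if_false]
      refine Term.count_of_forall_ne fun o ho => ?_
      obtain ⟨j, -, h⟩ := Term.occurs_of_subst ho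
      cases h
      simp
  obtain ⟨t, ht, ζ, h⟩ := hC p q ⟨n, fun j => σ (e j), s.term.subst (liftSubst p (numVar σ e)),
    fun h => s.not_var (Term.isVar_of_subst h), by rw [Term.count_subst hl, s.linear]⟩
  refine ⟨t, ht, fun k => (ζ k).subst fun j => Term.var (e j), fun η a => ?_⟩
  have := congrFun (h fun j => η (e j)) a
  simp only [termFun_subst_liftSubst, eval_subst_liftSubst] at this
  rw [show (fun i => (η i).groundEval A) = fun i => (numVar σ e i).eval A
    (fun j => (η (e j)).groundEval A) from funext fun i => ?_, this]
  · simp only [Term.groundEval, Term.eval_subst, Term.eval]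
  · rw [Term.groundEval, ← numVar_subst σ e η i, Term.eval_subst]
    rfl

end

section

variable {S : Type u} {Γ : Signature.{u, v} S} {A : SortedAlgebra.{u, v, w} Γ}

/-! ### Contexts with a uniform number of parameters -/

/-- The context `t` takes the values of `s` everywhere, if its auxiliary variables are suitably
replaced by terms in the auxiliary variables of `s`. -/
def Covers (A : SortedAlgebra.{u, v, w} Γ) {n : ℕ} {τ : Fin n → S} {p q : S} (t : Context Γ τ p q)
    {ι : Type} [DecidableEq ι] {σ : ι → S} (s : Context Γ σ p q) : Prop :=
  ∃ ζ : (k : Fin n) → Term Γ σ (τ k), ∀ (η : (i : ι) → GroundTerm Γ (σ i)) (a : A.carrier p),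
    s.term.eval A (assign a fun i => (η i).groundEval A) =
      t.term.eval A (assign a fun k => ((ζ k).subst η).groundEval A)

/-- A term that consists of a symbol without arguments. -/
def Term.const {ι : Type} {σ : ι → S} (c : Γ.Symb) (hc : Γ.rank c = 0) : Term Γ σ (Γ.cod c) :=
  .op c fun j => (Fin.cast hc j).elim0

/-- A further auxiliary variable, which does not occur in the context, is substituted by a constant.
-/
theorem exists_covers_succ (c : Γ.Symb) (hc : Γ.rank c = 0) {n : ℕ} {τ : Fin n → S} {p q : S}
    (t : Context Γ τ p q) : ∃ (τ' : Fin (n + 1) → S) (t' : Context Γ τ' p q),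
      ∀ {ι : Type} [DecidableEq ι] {σ : ι → S} (s : Context Γ σ p q),
        Covers A t s → Covers A t' s := by
  let θ : (o : Option (Fin n)) → Term Γ (extend (Fin.cons (Γ.cod c) τ : Fin (n + 1) → S) p)
      (extend τ p o) := fun
    | none => .var (σ := extend (Fin.cons (Γ.cod c) τ : Fin (n + 1) → S) p) none
    | some k => .var (σ := extend (Fin.cons (Γ.cod c) τ : Fin (n + 1) → S) p) (some k.succ)
  have hθ : ∀ o, (θ o).count none = if none = o then 1 else 0 := by
    rintro (_ | k) <;> rfl
  refine ⟨_, ⟨t.term.subst θ, fun h => t.not_var (Term.isVar_of_subst h),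
    by rw [Term.count_subst hθ, t.linear]⟩, ?_⟩
  rintro ι _ σ s ⟨ζ, h⟩
  refine ⟨Fin.cons (.const c hc) ζ, fun η a => ?_⟩
  rw [h, Term.eval_subst]
  congr 1
  funext o
  cases o <;> rfl

theorem exists_covers_of_le (c : Γ.Symb) (hc : Γ.rank c = 0) {n N : ℕ} (h : n ≤ N) {τ : Fin n → S}
    {p q : S} (t : Context Γ τ p q) : ∃ (τ' : Fin N → S) (t' : Context Γ τ' p q),
      ∀ {ι : Type} [DecidableEq ι] {σ : ι → S} (s : Context Γ σ p q),
        Covers A t s → Covers A t' s := by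
  induction N, h using Nat.le_induction with
  | base => exact ⟨τ, t, fun _ h => h⟩
  | succ N _ ih =>
    obtain ⟨τ', t', h⟩ := ih
    obtain ⟨τ'', t'', h'⟩ := exists_covers_succ (A := A) c hc t'
    exact ⟨τ'', t'', fun s hs => h' s (h s hs)⟩

variable (A) in
/-- A finite subsumption base, all of whose contexts have the same number `m + 1` of auxiliary
variables, and a symbol without arguments. -/
structure Base where
  m : ℕ
  count : S → S → ℕ
  sort : {p q : S} → Fin (count p q) → Fin (m + 1) → S
  ctx : {p q : S} → (c : Fin (count p q)) → Context Γ (sort c) p q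
  covers : ∀ {ι : Type} [DecidableEq ι] [Finite ι] {σ : ι → S} {p q : S} (s : Context Γ σ p q),
    ∃ c : Fin (count p q), Covers A (ctx c) s
  c₀ : Γ.Symb
  rank_c₀ : Γ.rank c₀ = 0

/-- A finite base contains only finitely many numbers of auxiliary variables, so that all its
members can be brought to the same number. -/
theorem HasFiniteSubsumptionBase.nonempty_base [Finite S] (hA : HasFiniteSubsumptionBase A)
    (c : Γ.Symb) (hc : Γ.rank c = 0) : Nonempty (Base A) := by
  obtain ⟨C, hf, hC⟩ := hA
  obtain ⟨N, hN⟩ : ∃ N, ∀ p q, ∀ t ∈ C p q, t.numVars ≤ N + 1 := by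
    cases nonempty_fintype S
    choose N hN using fun p q => ((hf p q).image AnyContext.numVars).bddAbove
    refine ⟨∑ p, ∑ q, N p q, fun p q t ht => ?_⟩
    have h1 := hN p q ⟨t, ht, rfl⟩
    have h2 : N p q ≤ ∑ q, N p q := Finset.single_le_sum (f := N p) (by simp) (Finset.mem_univ q)
    have h3 : ∑ q, N p q ≤ ∑ p, ∑ q, N p q :=
      Finset.single_le_sum (f := fun p => ∑ q, N p q) (by simp) (Finset.mem_univ p)
    omega
  have := fun p q => (hf p q).to_subtype
  choose n e using fun p q => Finite.exists_equiv_fin (C p q)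
  let e := fun p q => (e p q).some.symm
  choose τ t h using fun (p q : S) (c' : Fin (n p q)) =>
    exists_covers_of_le (A := A) c hc (hN p q _ (e p q c').2) (e p q c').1.context
  refine ⟨⟨N, n, fun {p q} c => τ p q c, fun {p q} c => t p q c, ?_, c, hc⟩⟩
  intro ι _ _ σ p q s
  obtain ⟨b, hb, hs⟩ := hC.exists_subst s
  refine ⟨(e p q).symm ⟨b, hb⟩, h p q _ s ?_⟩
  rw [Equiv.apply_symm_apply]
  exact hs

/-! ### Bundles of terms, and templates -/

/-- The kinds of bundles of terms: no meaning, the value of a term, or the parameters of a context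
from the base. -/
inductive Kind (L : Base A)
  | dflt
  | val (p : S)
  | blk {p q : S} (c : Fin (L.count p q))

namespace Kind

variable {L : Base A}

/-- The sorts of the terms of a bundle. A bundle for a value has it in component `0`. -/
def sort : Kind L → Fin (L.m + 1) → S
  | dflt, _ => Γ.cod L.c₀
  | val p, i => Fin.cases p (fun _ => Γ.cod L.c₀) i
  | blk c, i => L.sort c i

end Kind

/-- A family of ground terms of the sorts that a kind requires. -/
abbrev Bundle (L : Base A) := Σ κ : Kind L, (i : Fin (L.m + 1)) → GroundTerm Γ (κ.sort i)

namespace Bundle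

variable {L : Base A}

/-- The value of component `0`. -/
def value (b : Bundle L) : Σ p, A.carrier p := ⟨b.1.sort 0, (b.2 0).groundEval A⟩

/-- The function that is defined by a bundle of parameters of a context from the base. -/
noncomputable def fn : Bundle L → (Σ p, A.carrier p) → Σ p, A.carrier p
  | ⟨.blk (p := p) (q := q) c, x⟩, a =>
    open Classical in
    if h : a.1 = p then
      ⟨q, (L.ctx c).term.eval A (assign (h ▸ a.2) fun k => (x k).groundEval A)⟩
    else a
  | _, a => a

theorem fn_blk {p q : S} (c : Fin (L.count p q)) (x : (i : Fin (L.m + 1)) →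
    GroundTerm Γ (L.sort c i)) (a : A.carrier p) :
    fn (⟨.blk c, x⟩ : Bundle L) ⟨p, a⟩ =
      ⟨q, (L.ctx c).term.eval A (assign a fun k => (x k).groundEval A)⟩ := by
  simp only [fn, dite_true]
  rfl

end Bundle

/-- A template: terms that define a bundle in terms of bundles of given kinds. The argument `x` is
the one with number `idx x` of an instruction. -/
structure Template (L : Base A) where
  Arg : Type
  idx : Arg → ℕ
  kind : Arg → Kind L
  out : Kind L
  tm : (i : Fin (L.m + 1)) →
    Term Γ (fun x : Arg × Fin (L.m + 1) => (kind x.1).sort x.2) (out.sort i)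

namespace Template

variable {L : Base A}

/-- The variable for a component of an argument of a template. -/
def arg {X : Type} (κ : X → Kind L) (x : X) (i : Fin (L.m + 1)) :
    Term Γ (fun x : X × Fin (L.m + 1) => (κ x.1).sort x.2) ((κ x).sort i) :=
  .var (σ := fun x : X × Fin (L.m + 1) => (κ x.1).sort x.2) (x, i)

/-- A family of terms for a bundle of kind `val p`. -/
def single {ι : Type} {σ : ι → S} {p : S} (t : Term Γ σ p) (i : Fin (L.m + 1)) :
    Term Γ σ ((Kind.val p : Kind L).sort i) :=
  Fin.cases (motive := fun i => Term Γ σ ((Kind.val p : Kind L).sort i)) t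
    (fun _ => .const L.c₀ L.rank_c₀) i

/-- The bundle that a template defines. -/
def apply (T : Template L) (y : (x : T.Arg) → (i : Fin (L.m + 1)) →
    GroundTerm Γ ((T.kind x).sort i)) : Bundle L :=
  ⟨T.out, fun i => (T.tm i).subst fun x : T.Arg × Fin (L.m + 1) => y x.1 x.2⟩

/-- The template for a bundle without meaning. -/
def dflt (L : Base A) : Template L where
  Arg := Empty
  idx _ := 0
  kind _ := .dflt
  out := .dflt
  tm _ := .const L.c₀ L.rank_c₀

/-- The template for the application of a symbol. -/
def opn (L : Base A) (f : Γ.Symb) : Template L where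
  Arg := Fin (Γ.rank f)
  idx j := j
  kind j := .val (Γ.dom f j)
  out := .val (Γ.cod f)
  tm := single (.op f fun j => arg (fun j => .val (Γ.dom f j)) j 0)

theorem value_opn (f : Γ.Symb) (y : (x : (opn L f).Arg) → (i : Fin (L.m + 1)) →
    GroundTerm Γ (((opn L f).kind x).sort i)) :
    ((opn L f).apply y).value = ⟨Γ.cod f, A.op f fun j => (y j 0).groundEval A⟩ := rfl

/-- A term of sort `p` is a term of sort `q = p`. -/
def _root_.CircuitBalancing.Term.castSort {ι : Type} {σ : ι → S} {p q : S} (h : p = q)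
    (t : Term Γ σ p) : Term Γ σ q := h ▸ t

/-- The term of a symbol applied to variables, one of which is the main one. -/
def holeTerm (f : Γ.Symb) (j : Fin (Γ.rank f)) :
    Term Γ (extend (fun a : {a // a ≠ j} => Γ.dom f a) (Γ.dom f j)) (Γ.cod f) :=
  .op f fun a => if h : a = j then Term.castSort (congrArg (Γ.dom f) h.symm) (.var (σ := extend
    (fun a : {a // a ≠ j} => Γ.dom f a) (Γ.dom f j)) none) else .var (σ := extend (fun a :
      {a // a ≠ j} => Γ.dom f a) (Γ.dom f j)) (some ⟨a, h⟩)

/-- The context that consists of a symbol, with a hole at argument `j`. -/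
def hole (f : Γ.Symb) (j : Fin (Γ.rank f)) :
    Context Γ (fun a : {a // a ≠ j} => Γ.dom f a) (Γ.dom f j) (Γ.cod f) where
  term := holeTerm f j
  not_var := id
  linear := by
    rw [holeTerm, Term.count, Finset.sum_eq_single j]
    · rw [dif_pos rfl]; rfl
    · intro a _ h
      rw [dif_neg h]; rfl
    · simp

theorem eval_hole (f : Γ.Symb) (j : Fin (Γ.rank f)) (x : (a : Fin (Γ.rank f)) →
    A.carrier (Γ.dom f a)) : (hole f j).term.eval A (assign (x j) fun a : {a // a ≠ j} => x a) =
      A.op f x := by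
  simp only [hole, holeTerm, Term.eval]
  congr 1
  funext a
  by_cases h : a = j
  · subst h; rw [dif_pos rfl]; rfl
  · rw [dif_neg h]; rfl

/-- The template for the context that consists of a symbol, with a hole at argument `j`. -/
noncomputable def leaf (L : Base A) (f : Γ.Symb) (j : Fin (Γ.rank f)) : Template L where
  Arg := {a // a ≠ j}
  idx a := a.1
  kind a := .val (Γ.dom f a)
  out := .blk (L.covers (hole f j)).choose
  tm i := ((L.covers (hole f j)).choose_spec.choose i).subst fun a =>
    arg (fun a : {a // a ≠ j} => .val (Γ.dom f a)) a 0

/-- The context of a node maps the value of the child at the hole to the value of the node, if the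
other children have the values of the given bundles. -/
theorem fn_leaf (f : Γ.Symb) (j : Fin (Γ.rank f)) (y : (x : (leaf L f j).Arg) →
    (i : Fin (L.m + 1)) → GroundTerm Γ (((leaf L f j).kind x).sort i))
    (x : (a : Fin (Γ.rank f)) → A.carrier (Γ.dom f a))
    (h : ∀ a : {a // a ≠ j}, (y a 0).groundEval A = x a) :
    ((leaf L f j).apply y).fn ⟨Γ.dom f j, x j⟩ = ⟨Γ.cod f, A.op f x⟩ := by
  have h1 := (L.covers (hole f j)).choose_spec.choose_spec (fun a => y a 0) (x j)
  have h2 : (fun a : {a // a ≠ j} => x a) = fun a => (y a 0).groundEval A :=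
    funext fun a => (h a).symm
  rw [← eval_hole f j x, h2]
  refine (Bundle.fn_blk _ _ _).trans (congrArg (Sigma.mk _) (Eq.trans ?_ h1.symm))
  exact congrArg (fun x => (L.ctx _).term.eval A (assign _ x))
    (funext fun k => congrArg (Term.groundEval A) (Term.subst_subst _ _ _))

/-- The composition of contexts. -/
def comp {p q r n n' : _} {τ : Fin n → S} {τ' : Fin n' → S} (s : Context Γ τ p q)
    (t : Context Γ τ' r p) : Context Γ (Sum.elim τ τ') r q where
  term := s.term.subst fun
    | none => t.term.subst fun
      | none => .var (σ := extend (Sum.elim τ τ') r) none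
      | some k => .var (σ := extend (Sum.elim τ τ') r) (some (.inr k))
    | some k => .var (σ := extend (Sum.elim τ τ') r) (some (.inl k))
  not_var h := s.not_var (Term.isVar_of_subst h)
  linear := by
    rw [Term.count_subst (i₀ := none) (n := 1), s.linear]
    rintro (_ | k)
    · rw [Term.count_subst (i₀ := none) (n := 1), t.linear]
      · rfl
      · rintro (_ | k) <;> rfl
    · rfl

theorem eval_comp {p q r : S} {n n' : ℕ} {τ : Fin n → S} {τ' : Fin n' → S} (s : Context Γ τ p q)
    (t : Context Γ τ' r p) (a : A.carrier r) (x : (i : Fin n ⊕ Fin n') →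
      A.carrier (Sum.elim τ τ' i)) : (comp s t).term.eval A (assign a x) =
    s.term.eval A (assign (t.term.eval A (assign a fun k => x (.inr k))) fun k => x (.inl k)) := by
  rw [comp, Term.eval_subst]
  congr 1
  funext o
  rcases o with _ | k
  · simp only [assign]
    rw [Term.eval_subst]
    congr 1
    funext o
    cases o <;> rfl
  · rfl

/-- The template for the composition of contexts from the base. -/
noncomputable def merge (L : Base A) {p q r : S} (c : Fin (L.count p q)) (d : Fin (L.count r p)) :
    Template L where
  Arg := Bool
  idx b := b.toNat
  kind b := b.rec (.blk c) (.blk d)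
  out := .blk (L.covers (comp (L.ctx c) (L.ctx d))).choose
  tm i := ((L.covers (comp (L.ctx c) (L.ctx d))).choose_spec.choose i).subst fun
    | .inl k => arg (fun b => b.rec (.blk c) (.blk d)) false k
    | .inr k => arg (fun b => b.rec (.blk c) (.blk d)) true k

theorem fn_merge {p q r : S} (c : Fin (L.count p q)) (d : Fin (L.count r p))
    (y : (x : (merge L c d).Arg) → (i : Fin (L.m + 1)) →
      GroundTerm Γ (((merge L c d).kind x).sort i)) (a : A.carrier r) :
    ((merge L c d).apply y).fn ⟨r, a⟩ =
      Bundle.fn ⟨.blk c, y false⟩ (Bundle.fn ⟨.blk d, y true⟩ ⟨r, a⟩) := by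
  have h1 := (L.covers (comp (L.ctx c) (L.ctx d))).choose_spec.choose_spec
    (fun i => Sum.rec (motive := fun i => GroundTerm Γ (Sum.elim (L.sort c) (L.sort d) i))
      (fun k => y false k) (fun k => y true k) i) a
  rw [eval_comp] at h1
  refine ((Bundle.fn_blk _ _ _).trans (congrArg (Sigma.mk q) (Eq.trans ?_ h1.symm))).trans
    ((Bundle.fn_blk c _ _).symm.trans (congrArg _ (Bundle.fn_blk d _ _).symm))
  congr 1
  funext o
  rcases o with _ | k
  · rfl
  · refine congrArg (Term.groundEval A) ((Term.subst_subst _ _ _).trans ?_)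
    exact congrArg (Term.subst · _) (funext fun i => by cases i <;> rfl)

/-- The template for the application of a context from the base to a value. -/
def app (L : Base A) {p q : S} (c : Fin (L.count p q)) : Template L where
  Arg := Bool
  idx b := b.toNat
  kind b := b.rec (.blk c) (.val p)
  out := .val q
  tm := single ((L.ctx c).term.subst fun
    | none => arg (fun b => b.rec (.blk c) (.val p)) true 0
    | some k => arg (fun b => b.rec (.blk c) (.val p)) false k)

theorem value_app {p q : S} (c : Fin (L.count p q)) (y : (x : (app L c).Arg) →
    (i : Fin (L.m + 1)) → GroundTerm Γ (((app L c).kind x).sort i)) :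
    ((app L c).apply y).value =
      Bundle.fn ⟨.blk c, y false⟩ (Bundle.value ⟨.val p, y true⟩) := by
  refine Eq.trans ?_ (Bundle.fn_blk _ _ _).symm
  refine congrArg (Sigma.mk q) ((Term.eval_subst A _ _ _).trans <|
    (Term.eval_subst A _ _ _).trans ?_)
  exact congrArg (fun x => (L.ctx c).term.eval A x) (funext fun o => by cases o <;> rfl)

end Template

end

section

variable {S : Type u} {Γ : Signature.{u, v} S} {A : SortedAlgebra.{u, v, w} Γ} {k : ℕ}

/-! ### Straight-line programs from instructions for bundles -/

/-- An item of the output: a number, or a reference to a component of an argument. -/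
inductive Item
  | lit (n : ℕ)
  | ref (a i : ℕ)

/-- The number that an item denotes, given the slots of the arguments. Component `i` of slot `q` is
the variable `q * M + i`. -/
def Item.eval (k M : ℕ) (arg : ℕ → ℕ) : Item → ℕ
  | lit n => n
  | ref a i => k + (arg a * M + i)

namespace Term

variable {ι κ : Type} {σ : ι → S} {τ : κ → S}

/-- The tokens of a term, whose variables are references. -/
def items (code : Γ.Symb ≃ Fin k) (idx : ι → ℕ × ℕ) : {p : S} → Term Γ σ p → List Item
  | _, var i => [.ref (idx i).1 (idx i).2]
  | _, op f args => .lit (code f) :: (List.ofFn fun j => (args j).items code idx).flatten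

theorem tokens_subst {n : ℕ} {ρ : Fin n → S} (code : Γ.Symb ≃ Fin k) (idx : ι → ℕ × ℕ) (M : ℕ)
    (arg : ℕ → ℕ) {η : (i : ι) → Term Γ ρ (σ i)}
    (h : ∀ i, (η i).tokens code = [(Item.ref (idx i).1 (idx i).2).eval k M arg]) {p : S}
    (t : Term Γ σ p) :
    (t.subst η).tokens code = (t.items code idx).map (Item.eval k M arg) := by
  induction t with
  | var i => exact h i
  | op f args ih =>
    simp only [subst, tokens, items, List.map_cons, List.map_flatten, List.map_ofFn, ih]
    rfl

theorem castSort_subst {p q : S} (h : p = q) (t : Term Γ σ p) (η : (i : ι) → Term Γ τ (σ i)) :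
    (t.castSort h).subst η = (t.subst η).castSort h := by subst h; rfl

theorem castSort_castSort {p q r : S} (h : p = q) (h' : q = r) (t : Term Γ σ p) :
    (t.castSort h).castSort h' = t.castSort (h.trans h') := by subst h; rfl

theorem occurs_castSort {p q : S} (h : p = q) (t : Term Γ σ p) (i : ι) :
    (t.castSort h).Occurs i ↔ t.Occurs i := by subst h; rfl

theorem tokens_castSort {n : ℕ} {ρ : Fin n → S} (code : Γ.Symb ≃ Fin k) {p q : S} (h : p = q)
    (t : Term Γ ρ p) : (t.castSort h).tokens code = t.tokens code := by subst h; rfl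

theorem size_castSort {p q : S} (h : p = q) (t : Term Γ σ p) :
    (t.castSort h).size = t.size := by subst h; rfl

theorem depth_castSort {p q : S} (h : p = q) (t : Term Γ σ p) :
    (t.castSort h).depth = t.depth := by subst h; rfl

theorem sigma_castSort {p q : S} (h : p = q) (t : GroundTerm Γ p) :
    (⟨q, (t.castSort h).groundEval A⟩ : Σ p, A.carrier p) = ⟨p, t.groundEval A⟩ := by
  subst h; rfl

end Term

/-- The depth of a bundle of terms. -/
def Bundle.depth {L : Base A} (b : Bundle L) : ℕ := Finset.univ.sup fun i => (b.2 i).depth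

namespace Template

variable {L : Base A}

/-- The tokens of a template. -/
def items (T : Template L) (code : Γ.Symb ≃ Fin k) : List Item :=
  (List.ofFn fun i => (T.tm i).items code fun x => (T.idx x.1, x.2)).flatten

/-- The size of a template. -/
def size (T : Template L) : ℕ := ∑ i, (T.tm i).size

/-- The depth of a template. -/
def depth (T : Template L) : ℕ := Finset.univ.sup fun i => (T.tm i).depth

theorem depth_apply_le (T : Template L) {y : (x : T.Arg) → (i : Fin (L.m + 1)) →
    GroundTerm Γ ((T.kind x).sort i)} {D : ℕ}
    (h : ∀ x, Bundle.depth (⟨T.kind x, y x⟩ : Bundle L) ≤ D) : (T.apply y).depth ≤ T.depth + D := by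
  refine Finset.sup_le fun i _ => (Term.depth_subst_le (D := D) (fun x => ?_) _).trans ?_
  · exact (Finset.le_sup (f := fun i => (y x.1 i).depth) (Finset.mem_univ x.2)).trans (h x.1)
  · exact Nat.add_le_add_right
      (Finset.le_sup (f := fun i => (T.tm i).depth) (Finset.mem_univ i)) _

end Template

variable (A) in
/-- An acyclic system of equations for bundles of terms, one for each of finitely many slots. -/
structure System (L : Base A) where
  Q : ℕ
  T : Fin Q → Template L
  arg : (q : Fin Q) → (T q).Arg → Fin Q
  kind_arg : ∀ q x, (T (arg q x)).out = (T q).kind x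
  wf : WellFounded fun q' q => ∃ x, arg q x = q'
  start : Fin Q

namespace System

variable {L : Base A} (E : System A L)

/-- The variable for a component of a slot. -/
def num {Q M : ℕ} (q : Fin Q) (i : Fin M) : Fin (Q * M) := ⟨q * M + i, by
  calc (q : ℕ) * M + i < q * M + M := by omega
    _ = (q + 1) * M := by ring
    _ ≤ Q * M := Nat.mul_le_mul_right _ q.2⟩

theorem divNat_num {Q M : ℕ} (q : Fin Q) (i : Fin M) : (num q i).divNat = q := by
  have : 0 < M := i.pos
  ext
  simp [num, Fin.divNat, mul_comm, Nat.mul_add_div this, Nat.div_eq_of_lt i.2]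

theorem modNat_num {Q M : ℕ} (q : Fin Q) (i : Fin M) : (num q i).modNat = i := by
  ext
  simp [num, Fin.modNat, mul_comm, Nat.mod_eq_of_lt i.2]

theorem num_divNat_modNat {Q M : ℕ} (X : Fin (Q * M)) : num X.divNat X.modNat = X := by
  ext
  simp [num, Fin.divNat, Fin.modNat, Nat.div_add_mod']

/-- The sorts of the variables. -/
def sort (X : Fin (E.Q * (L.m + 1))) : S := (E.T X.divNat).out.sort X.modNat

theorem sort_num (q : Fin E.Q) (i : Fin (L.m + 1)) :
    E.sort (num q i) = (E.T q).out.sort i := by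
  rw [sort, divNat_num, modNat_num]

theorem sort_arg (q : Fin E.Q) (x : (E.T q).Arg) (i : Fin (L.m + 1)) :
    E.sort (num (E.arg q x) i) = ((E.T q).kind x).sort i := by
  rw [sort_num, kind_arg]

/-- The right-hand side for a component of a slot. -/
def rhs (q : Fin E.Q) (i : Fin (L.m + 1)) : Term Γ E.sort ((E.T q).out.sort i) :=
  ((E.T q).tm i).subst fun x : (E.T q).Arg × Fin (L.m + 1) =>
    (Term.var (num (E.arg q x.1) x.2)).castSort (E.sort_arg q x.1 x.2)

/-- The straight-line program for a system of equations. -/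
def slp : SLP Γ where
  card := E.Q * (L.m + 1)
  sort := E.sort
  rhs X := E.rhs X.divNat X.modNat
  start := num E.start 0
  acyclic X h := by
    have key : ∀ X Y, Relation.TransGen (fun Y Z => (E.rhs Y.divNat Y.modNat).Occurs Z) X Y →
        Relation.TransGen (fun q q' => ∃ x, E.arg q x = q') X.divNat Y.divNat := by
      intro X Y h
      refine h.lift Fin.divNat fun X Y h => ?_
      obtain ⟨x, -, hx⟩ := Term.occurs_of_subst h
      rw [Term.occurs_castSort] at hx
      obtain rfl := hx
      exact ⟨x.1, (divNat_num _ _).symm⟩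
    have h1 := Relation.transGen_swap.2 (key X X h)
    exact (E.wf.transGen.irrefl).irrefl _ h1

/-- The bundle of a slot. -/
def bundle (q : Fin E.Q) : Bundle L :=
  ⟨(E.T q).out, fun i => (E.slp.val (num q i)).castSort (E.sort_num q i)⟩

theorem bundle_eq_cast {κ κ' : Kind L} (h : κ = κ')
    (v : (i : Fin (L.m + 1)) → GroundTerm Γ (κ.sort i)) :
    (⟨κ, v⟩ : Bundle L) = ⟨κ', fun i => (v i).castSort (by rw [h])⟩ := by subst h; rfl

/-- The bundles of the slots satisfy the equations of the system. -/
theorem exists_bundle (q : Fin E.Q) : ∃ y : (x : (E.T q).Arg) → (i : Fin (L.m + 1)) →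
    GroundTerm Γ (((E.T q).kind x).sort i),
    (∀ x, E.bundle (E.arg q x) = ⟨(E.T q).kind x, y x⟩) ∧ E.bundle q = (E.T q).apply y := by
  refine ⟨fun x i => (E.slp.val (num (E.arg q x) i)).castSort (E.sort_arg q x i), fun x => ?_, ?_⟩
  · rw [bundle, bundle_eq_cast (E.kind_arg q x)]
    exact congrArg (Sigma.mk _) (funext fun i => Term.castSort_castSort _ _ _)
  · refine congrArg (Sigma.mk _) (funext fun i => ?_)
    have h1 : ∀ (q' : Fin E.Q) (i' : Fin (L.m + 1)) (hq : q' = q) (hi : i' = i),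
        ((E.rhs q' i').subst E.slp.val).castSort (by rw [hq, hi]) =
          (E.rhs q i).subst E.slp.val := by
      rintro _ _ rfl rfl; rfl
    refine ((congrArg (Term.castSort _) (E.slp.val_eq (num q i))).trans
      (h1 _ _ (divNat_num q i) (modNat_num q i))).trans ?_
    rw [rhs]
    refine (Term.subst_subst _ _ _).trans ?_
    refine congrArg (fun η => Term.subst η _) (funext fun x => ?_)
    exact Term.castSort_subst _ _ _

theorem value_slp : E.slp.value A = (E.bundle E.start).value :=
  (Term.sigma_castSort (E.sort_num E.start 0) _).symm

theorem depth_slp_le : E.slp.depth ≤ (E.bundle E.start).depth := by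
  have := Finset.le_sup (f := fun i => ((E.bundle E.start).2 i).depth)
    (Finset.mem_univ (0 : Fin (L.m + 1)))
  exact (Term.depth_castSort (E.sort_num E.start 0) _).symm.le.trans this

theorem size_slp : E.slp.size = ∑ q, (E.T q).size := by
  have h : ∀ q i, (E.rhs q i).size = ((E.T q).tm i).size := fun q i =>
    Term.size_subst (fun x => by rw [Term.size_castSort]; rfl) _
  have h1 : E.slp.size = ∑ X : Fin (E.Q * (L.m + 1)), (E.rhs X.divNat X.modNat).size := rfl
  rw [h1]
  simp only [Template.size, ← h]
  rw [← Fintype.sum_prod_type' (f := fun q i => (E.rhs q i).size)]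
  refine Fintype.sum_bijective (fun X => (X.divNat, X.modNat)) ⟨fun X Y h => ?_, fun x => ?_⟩ _ _
    fun _ => rfl
  · simp only [Prod.mk.injEq] at h
    rw [← num_divNat_modNat X, ← num_divNat_modNat Y, h.1, h.2]
  · exact ⟨num x.1 x.2, Prod.ext (divNat_num _ _) (modNat_num _ _)⟩

theorem encode_slp (code : Γ.Symb ≃ Fin k) {narg : ℕ → ℕ → ℕ}
    (h : ∀ q x, (E.arg q x : ℕ) = narg ((E.T q).idx x) q) :
    E.slp.encode code = E.Q * (L.m + 1) :: E.start * (L.m + 1) :: (List.ofFn fun q : Fin E.Q =>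
      ((E.T q).items code).map (Item.eval k (L.m + 1) fun a => narg a q)).flatten := by
  have h1 : ∀ q i, (E.rhs q i).tokens code = (((E.T q).tm i).items code
      fun x => ((E.T q).idx x.1, x.2)).map (Item.eval k (L.m + 1) fun a => narg a q) := fun q i =>
    Term.tokens_subst code _ _ _ (fun x => by
      rw [Term.tokens_castSort]
      simp only [Term.tokens, num, Item.eval, ← h]) _
  refine congrArg (List.cons _) (congrArg₂ List.cons rfl ?_)
  change (List.ofFn fun X : Fin (E.Q * (L.m + 1)) =>
    (E.rhs X.divNat X.modNat).tokens code).flatten = _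
  rw [List.ofFn_mul]
  simp only [List.flatten_flatten, Template.items, List.map_flatten, List.map_ofFn]
  congr 2
  funext q
  simp only [Function.comp_apply]
  congr 2
  funext i
  refine Eq.trans ?_ (h1 q i)
  exact congrArg₂ (fun q i => (E.rhs q i).tokens code) (divNat_num q i) (modNat_num q i)

end System

end

section

variable {S : Type u} {Γ : Signature.{u, v} S} {A : SortedAlgebra.{u, v, w} Γ} {k : ℕ}

/-! ### The table of templates -/

/-- Numberings of the symbols and of the contexts in a base, and a bound for the ranks of the
symbols. -/
structure Coding (L : Base A) (k : ℕ) where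
  code : Γ.Symb ≃ Fin k
  R : ℕ
  rank_le : ∀ f, Γ.rank f ≤ R
  nC : ℕ
  e : (Σ p q, Fin (L.count p q)) ≃ Fin nC

theorem nonempty_coding [Finite S] (L : Base A) (code : Γ.Symb ≃ Fin k) :
    ∃ c : Coding L k, 1 ≤ c.R ∧ c.code = code := by
  obtain ⟨n, ⟨e⟩⟩ := Finite.exists_equiv_fin (Σ p q, Fin (L.count p q))
  refine ⟨⟨code, ∑ i, Γ.rank (code.symm i) + 1, fun f => ?_, n, e⟩, Nat.succ_pos _, rfl⟩
  have := Finset.single_le_sum (f := fun i => Γ.rank (code.symm i)) (by simp)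
    (Finset.mem_univ (code f))
  simp only [Equiv.symm_apply_apply] at this
  omega

namespace Coding

variable {L : Base A} (c : Coding L k)

/-- The context with a given positive number. -/
def ctx (y : ℕ) : Option (Σ p q, Fin (L.count p q)) :=
  if h : 0 < y ∧ y - 1 < c.nC then some (c.e.symm ⟨y - 1, h.2⟩) else none

/-- The template for the composition of two contexts, if this makes sense. -/
noncomputable def mergeOf : Option (Σ p q, Fin (L.count p q)) →
    Option (Σ p q, Fin (L.count p q)) → Template L
  | some ⟨p, _, c⟩, some ⟨_, p', d⟩ =>
    open Classical in if h : p' = p then .merge L c (h ▸ d) else .dflt L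
  | _, _ => .dflt L

/-- The template for the application of a context. -/
def appOf : Option (Σ p q, Fin (L.count p q)) → Template L
  | some ⟨_, _, c⟩ => .app L c
  | none => .dflt L

/-- The table of all templates. -/
noncomputable def template (t : ℕ) : Template L :=
  if t = 0 then .dflt L
  else if h : t - 1 < k then .opn L (c.code.symm ⟨t - 1, h⟩)
  else if h : t - 1 - k < k * c.R then
    if hj : (t - 1 - k) % c.R < Γ.rank (c.code.symm ⟨(t - 1 - k) / c.R,
      Nat.div_lt_of_lt_mul (by rwa [mul_comm])⟩) then .leaf L _ ⟨_, hj⟩ else .dflt L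
  else if t - 1 - k - k * c.R < (c.nC + 1) * (c.nC + 1) then
    mergeOf (c.ctx ((t - 1 - k - k * c.R) / (c.nC + 1)))
      (c.ctx ((t - 1 - k - k * c.R) % (c.nC + 1)))
  else appOf (c.ctx (t - 1 - k - k * c.R - (c.nC + 1) * (c.nC + 1)))

/-- The number of a kind of bundles for a context; it is `0` for the other kinds. -/
def kindNum : Kind L → ℕ
  | .blk b => c.e ⟨_, _, b⟩ + 1
  | _ => 0

/-- The numbering of the templates. -/
noncomputable def numbering : Numbering where
  k := k
  R := c.R
  K := c.nC + 1
  tyOf t := c.kindNum (c.template t).out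
  tyOf_lt t := by
    rcases (c.template t).out with _ | _ | b
    · exact Nat.succ_pos _
    · exact Nat.succ_pos _
    · exact Nat.succ_lt_succ (c.e _).2

theorem template_zero : c.template 0 = .dflt L := by simp [template]

theorem template_opT (f : Γ.Symb) :
    c.template (Numbering.opT (c.code f)) = .opn L f := by
  simp [template, Numbering.opT]

theorem template_leafT (f : Γ.Symb) (j : Fin (Γ.rank f)) :
    c.template (c.numbering.leafT (c.code f) j) = .leaf L f j := by
  have hj : (j : ℕ) < c.R := j.2.trans_le (c.rank_le f)
  have h1 : c.numbering.leafT (c.code f) j = 1 + k + (c.code f * c.R + j) := rfl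
  have h2 : c.numbering.leafT (c.code f) j - 1 - k = c.code f * c.R + j := by omega
  have h3 : (c.code f : ℕ) * c.R + j < k * c.R := by
    have := Nat.mul_le_mul_right c.R (c.code f).2
    rw [Nat.succ_mul] at this
    omega
  have h4 : ((c.code f : ℕ) * c.R + j) / c.R = c.code f := by
    rw [mul_comm, Nat.mul_add_div (by omega), Nat.div_eq_of_lt hj, add_zero]
  have h5 : ((c.code f : ℕ) * c.R + j) % c.R = j := by
    rw [mul_comm, Nat.mul_add_mod, Nat.mod_eq_of_lt hj]
  have key : ∀ (g : Γ.Symb) (i : ℕ), g = f → i = j →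
      (if hj : i < Γ.rank g then Template.leaf L g ⟨i, hj⟩ else .dflt L) = .leaf L f j := by
    rintro g i rfl rfl
    simp
  rw [template, if_neg (by omega), dif_neg (by omega), dif_pos (by omega)]
  refine key _ _ ?_ (by rw [h2, h5])
  rw [Equiv.symm_apply_eq]
  ext
  simp only [h2, h4]

theorem ctx_kindNum {p q : S} (b : Fin (L.count p q)) :
    c.ctx (c.kindNum (.blk b)) = some ⟨p, q, b⟩ := by
  simp [ctx, kindNum]

theorem template_mergeT {p q r : S} {t t' : ℕ} {b : Fin (L.count p q)} {d : Fin (L.count r p)}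
    (h : (c.template t).out = .blk b) (h' : (c.template t').out = .blk d) :
    c.template (c.numbering.mergeT (c.numbering.tyOf t) (c.numbering.tyOf t')) =
      .merge L b d := by
  have hy := c.numbering.tyOf_lt t
  have hz := c.numbering.tyOf_lt t'
  have e1 : c.ctx (c.numbering.tyOf t) = some ⟨p, q, b⟩ := by
    rw [← ctx_kindNum, ← h]; rfl
  have e2 : c.ctx (c.numbering.tyOf t') = some ⟨r, p, d⟩ := by
    rw [← ctx_kindNum, ← h']; rfl
  generalize c.numbering.tyOf t = y at *
  generalize c.numbering.tyOf t' = z at *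
  have hy : y < c.nC + 1 := hy
  have hz : z < c.nC + 1 := hz
  have h1 : c.numbering.mergeT y z = 1 + k + k * c.R + (y * (c.nC + 1) + z) := rfl
  have h2 : c.numbering.mergeT y z - 1 - k - k * c.R = y * (c.nC + 1) + z := by omega
  have h3 : y * (c.nC + 1) + z < (c.nC + 1) * (c.nC + 1) := by nlinarith
  have h4 : (y * (c.nC + 1) + z) / (c.nC + 1) = y := by
    rw [mul_comm, Nat.mul_add_div (by omega), Nat.div_eq_of_lt hz, add_zero]
  have h5 : (y * (c.nC + 1) + z) % (c.nC + 1) = z := by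
    rw [mul_comm, Nat.mul_add_mod, Nat.mod_eq_of_lt hz]
  rw [template, if_neg (by omega), dif_neg (by omega), dif_neg (by omega), h2, if_pos h3, h4, h5,
    e1, e2]
  simp [mergeOf]

theorem template_appT {p q : S} {t : ℕ} {b : Fin (L.count p q)}
    (h : (c.template t).out = .blk b) :
    c.template (c.numbering.appT (c.numbering.tyOf t)) = .app L b := by
  have e1 : c.ctx (c.numbering.tyOf t) = some ⟨p, q, b⟩ := by
    rw [← ctx_kindNum, ← h]; rfl
  generalize c.numbering.tyOf t = y at *
  have h1 : c.numbering.appT y = 1 + k + k * c.R + (c.nC + 1) * (c.nC + 1) + y := rfl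
  rw [template, if_neg (by omega), dif_neg (by omega), dif_neg (by omega), if_neg (by omega),
    show c.numbering.appT y - 1 - k - k * c.R - (c.nC + 1) * (c.nC + 1) = y by omega, e1]
  rfl

end Coding

end

/-! ### The depth of the balanced program -/

theorem MTree.le_height {lv : ℕ → ℕ} {T : MTree} {v : ℕ} (h : T.Mem v) :
    3 * lv v ≤ T.height lv := by
  induction T with
  | leaf u => rw [show u = v from h]; exact le_rfl
  | node l r hl hr =>
    simp only [height]
    rcases h with h | h
    · have := hl h; omega
    · have := hr h; omega

namespace Plan

variable {P : Plan} {I : Instrs}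

theorem exists_end {v : ℕ} (hv : v < P.D.N) (hp : 0 < P.D.paths v) :
    ∃ e, P.D.Above v e ∧ e < P.D.N ∧ 0 < P.D.paths e ∧ P.nx e = 0 := by
  induction hn : P.D.μ v using Nat.strong_induction_on generalizing v with
  | _ n ih =>
    rcases Nat.eq_zero_or_pos (P.nx v) with h | h
    · exact ⟨v, .refl, hv, hp, h⟩
    · obtain ⟨w, hw⟩ := (P.dec.nx_pos_iff hv hp).1 h
      obtain ⟨e, he, h⟩ := ih _ (hn ▸ hw.μ_lt) hw.lt' hw.paths_pos' rfl
      exact ⟨e, .head hw he, h⟩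

/-- The instruction for the value of every node applies its symbol, or the context of a tree, of
which the node is the first leaf. -/
theorem exists_tree (hF : ∀ e < P.D.N, 0 < P.D.paths e → P.nx e = 0 → P.Final I e) {v : ℕ}
    (hv : v < P.D.N) (hp : 0 < P.D.paths v) : ∃ e < P.D.N, 0 < P.D.paths e ∧ P.nx e = 0 ∧
      P.D.nl e = P.D.nl v ∧ P.D.pl e = P.D.pl v ∧ P.IsOp I e ∧ (v = e ∨ ∃ T, T.Mem v ∧
        P.Built I T e ∧ P.IsApp I T.first T e ∧ T.height P.lv ≤ 3 * T.lev P.lv + 3) := by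
  obtain ⟨e, h1, h2, h3, h4⟩ := P.exists_end hv hp
  obtain ⟨h5, h6⟩ := MTree.nl_eq_of_above h1
  have hf := hF e h2 h3 h4
  refine ⟨e, h2, h3, h4, h5, h6, hf.op, or_iff_not_imp_left.2 fun hne => ?_⟩
  rcases hf.tree with h0 | ⟨T, hb, ha, hpv, -, hh⟩
  · rcases Relation.ReflTransGen.cases_tail h1 with e' | ⟨u, -, h7⟩
    · exact absurd e'.symm hne
    · rw [(P.dec.pv_eq_iff h2).2 h7] at h0; omega
  · rcases hb.path.mem_or_above h1 hne with h7 | ⟨h7, h8⟩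
    · exact ⟨T, h7, hb, ha, hh⟩
    · rcases Relation.ReflTransGen.cases_tail h7 with e' | ⟨u, -, h9⟩
      · exact absurd e'.symm h8
      · rw [(P.dec.pv_eq_iff h9.lt').2 h9] at hpv; omega

theorem entry_le_lv {v : ℕ} (hE : 0 < P.E v) : Nat.log 2 (P.E v) + P.D.nl v ≤ P.lv v := by
  refine Nat.le_log_of_pow_le (by omega) (le_trans ?_ (le_max_left _ _))
  rw [pow_add]
  exact Nat.mul_le_mul_right _ (Nat.pow_log_le_self 2 hE.ne')

theorem exit_le_lv {v : ℕ} (hv : v < P.D.N) (hp : 0 < P.D.paths v) :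
    Nat.log 2 (P.X v) + P.D.pl v ≤ P.lv v := by
  refine Nat.le_log_of_pow_le (by omega) (le_trans ?_ (le_max_right _ _))
  rw [pow_add]
  exact Nat.mul_le_mul_right _ (Nat.pow_log_le_self 2 (P.dec.exit v hv hp).pos.ne')

theorem Built.exists_leaf {T : MTree} {m u : ℕ} (hb : P.Built I T m) (hu : T.Mem u) :
    ∃ w, P.D.Nxt u w ∧ P.IsLeaf I u := by
  induction T generalizing m with
  | leaf v => obtain rfl : v = u := hu; exact ⟨m, hb⟩
  | node l r hl hr => exact hu.elim (hl hb.1) (hr hb.2.1)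

/-- The relation bounds the depth of the slots, where all instructions have depth `1`. -/
structure DepthLe (P : Plan) (I : Instrs) (Le : ℕ → ℕ → Prop) : Prop where
  mono : ∀ {q n n'}, Le q n → n ≤ n' → Le q n'
  op : ∀ {v n}, v < P.D.N → 0 < P.D.paths v → P.IsOp I v →
    (∀ j < P.D.deg v, Le (3 * P.D.ch v j) n) → Le (3 * v) (n + 1)
  leaf : ∀ {v m n}, P.D.Nxt v m → P.IsLeaf I v →
    (∀ j < P.D.deg v, j ≠ P.nx v - 1 → Le (3 * P.D.ch v j) n) → Le (3 * v + 1) (n + 1)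
  app : ∀ {T m n}, P.Built I T m → P.IsApp I T.first T m → Le T.slot n → Le (3 * m) n →
    Le (3 * T.first) (n + 1)
  merge : ∀ {l r m n}, P.Built I (.node l r) m → Le l.slot n → Le r.slot n →
    Le (MTree.node l r).slot (n + 1)

namespace DepthLe

variable {Le : ℕ → ℕ → Prop} (H : P.DepthLe I Le) {T : MTree} {m : ℕ} {Y Z : ℕ}
include H

/-- If the depths of the contexts of the leaves `u` are at most `Y - Z + 3 * lv u`, then the depth
of the context of the tree is at most `Y - Z` plus its height. -/
theorem slot (hT : P.Built I T m)
    (hl : ∀ u, T.Mem u → ∃ n, Le (3 * u + 1) n ∧ n + Z ≤ Y + 3 * P.lv u) :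
    ∃ n, Le T.slot n ∧ n + Z ≤ Y + T.height P.lv := by
  induction T generalizing m with
  | leaf v => exact hl v rfl
  | node l r ihl ihr =>
    obtain ⟨n, h1, h2⟩ := ihl hT.1 fun u hu => hl u (.inl hu)
    obtain ⟨n', h3, h4⟩ := ihr hT.2.1 fun u hu => hl u (.inr hu)
    refine ⟨max n n' + 1, H.merge hT (H.mono h1 (le_max_left _ _)) (H.mono h3 (le_max_right _ _)),
      ?_⟩
    simp only [MTree.height]
    omega

/-- A value at the leaf `u` arises by the application of contexts of subtrees that hang off the
branch to `u`. Their number is bounded by the depth of the leaf in the tree, which is at most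
`h - 3 * lv u`, where `h` is the height of the tree. -/
theorem values {b h M : ℕ} (hT : P.Built I T m)
    (hl : ∀ u, T.Mem u → ∃ n, Le (3 * u + 1) n ∧ n + Z ≤ Y + 3 * P.lv u)
    (hb : Y + h ≤ b + Z) (hh : T.height P.lv ≤ h) (hm : Le (3 * m) M)
    (hM : M + T.height P.lv ≤ b + h) {u : ℕ} (hu : T.Mem u) (hne : u ≠ T.first) :
    ∃ n, Le (3 * u) n ∧ n + 3 * P.lv u ≤ b + h := by
  induction T generalizing m M with
  | leaf v => exact absurd hu.symm hne
  | node l r ihl ihr =>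
    obtain ⟨n, h1, h2⟩ := H.slot hT.2.1 fun u hu => hl u (.inr hu)
    have h3 := H.app hT.2.1 hT.2.2.1 (H.mono h1 (le_max_left n M)) (H.mono hm (le_max_right n M))
    have hr := MTree.le_height (lv := P.lv) r.mem_first
    simp only [MTree.height] at hh hM
    rcases hu with hu | hu
    · exact ihl hT.1 (fun u hu => hl u (.inl hu)) (by omega) h3 (by omega) hu hne
    · by_cases e : u = r.first
      · exact ⟨_, e ▸ h3, by rw [e]; omega⟩
      · exact ihr hT.2.1 (fun u hu => hl u (.inr hu)) (by omega) hm (by omega) hu e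

/-- A bound for the depth of the value of a node to which an edge leads that is not central. -/
def bound (P : Plan) (v : ℕ) : ℕ :=
  3 * (P.D.nl v + Nat.log 2 (P.D.μ P.D.root) - Nat.log 2 (P.E v)) +
    21 * (P.D.nl v + Nat.log 2 (P.D.μ P.D.root) - P.D.pl v) + 1

omit H in
/-- Along an edge that is not central, `nl + log |t| - pl` decreases, and the bounds for the child
are compared with the level of `u`. -/
theorem bound_child_le {u j : ℕ} (hu : u < P.D.N) (hp : 0 < P.D.paths u) (hj : j < P.D.deg u)
    (hn : ¬ P.D.SC u j) : 0 < P.E (P.D.ch u j) ∧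
      P.D.nl (P.D.ch u j) + P.D.pl u ≤ P.lv u ∧ P.D.nl (P.D.ch u j) ≤ P.D.nl u ∧
      P.D.pl u ≤ Nat.log 2 (P.E (P.D.ch u j)) ∧
      P.D.nl (P.D.ch u j) + P.D.pl u < P.D.nl u + P.D.pl (P.D.ch u j) := by
  have h1 := P.dec.entry.le u hu hp j hj hn
  have h2 := (P.dec.exit u hu hp).le j hj hn
  have h3 := Nat.le_log_of_pow_le (by omega) h1
  have h4 := Nat.le_log_of_pow_le (by omega) h2
  have h5 := exit_le_lv (P := P) hu hp
  have h6 := P.D.nl_ch_le hu hj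
  have h7 := P.D.pl_le_ch hu hj
  refine ⟨(Nat.two_pow_pos _).trans_le h1, by omega, h6, h3, ?_⟩
  by_contra h8
  exact hn ⟨hu, hp, hj, by omega, by omega⟩

/-- By induction on `nl v + log |t| - pl v`, which decreases along edges that are not central. By
the induction hypothesis, the context of a node `u` on the path of `v` has at most the depth
`3 * lv u`, up to terms that are the same for the whole path. So the value of `v` has at most the
depth `2 * T.height - 3 * lv v`, up to these terms, for the tree `T` of the path. Here the height is
bounded by `nl v + pl v`, and `lv v` is at least `log (E v) + nl v`. The summand of the bound with the factor
`21` pays for the additive constants that arise on each path. -/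
theorem value_le (hF : ∀ e < P.D.N, 0 < P.D.paths e → P.nx e = 0 → P.Final I e) {v : ℕ}
    (hv : v < P.D.N) (hp : 0 < P.D.paths v) (hE : 0 < P.E v) : Le (3 * v) (bound P v) := by
  obtain ⟨L, hL⟩ : ∃ L, L = Nat.log 2 (P.D.μ P.D.root) := ⟨_, rfl⟩
  have hpl : ∀ u < P.D.N, P.D.pl u ≤ L := fun u hu => hL ▸ Nat.log_mono_right (P.D.paths_le hu)
  induction hn : P.D.nl v + (L - P.D.pl v) using Nat.strong_induction_on generalizing v with
  | _ n ih =>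
  obtain ⟨e, he, hpe, hnx, hnl, hple, hop, hT⟩ := P.exists_tree hF hv hp
  -- the children outside the path, to which the induction hypothesis applies
  have hside : ∀ u < P.D.N, 0 < P.D.paths u → P.D.nl u = P.D.nl v → P.D.pl u = P.D.pl v →
      ∀ j < P.D.deg u, ¬ P.D.SC u j → Le (3 * P.D.ch u j) (bound P (P.D.ch u j)) := by
    intro u hu hpu h1 h2 j hj hns
    obtain ⟨h3, -, -, -, h4⟩ := bound_child_le hu hpu hj hns
    have := hpl u hu
    have h5 := P.D.ch_lt u hu j hj
    have := hpl _ h5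
    exact ih _ (by omega) h5 (P.D.paths_ch_pos hu hpu hj) h3 rfl
  have hvL := hpl v hv
  have hEp := Nat.log_mono_right (b := 2) (P.dec.entry.le_paths hv)
  obtain ⟨Λ, hΛ⟩ : ∃ Λ, Λ = P.D.nl v + L - P.D.pl v := ⟨_, rfl⟩
  -- the value of the last node `e` of the path
  have hval : ∃ M, Le (3 * e) M ∧ (M ≤ 1 ∨ (1 ≤ Λ ∧ M ≤ 3 * Λ + 21 * (Λ - 1) + 2)) := by
    have key : ∀ j < P.D.deg e, 1 ≤ Λ ∧ Le (3 * P.D.ch e j) (3 * Λ + 21 * (Λ - 1) + 1) := by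
      intro j hj
      have hns : ¬ P.D.SC e j := fun hs => by
        have := (P.dec.nx_pos_iff he hpe).2 ⟨_, j, hs, rfl⟩; omega
      obtain ⟨-, -, h5, h6, h7⟩ := bound_child_le he hpe hj hns
      have := hpl _ (P.D.ch_lt e he j hj)
      refine ⟨by omega, H.mono (hside e he hpe hnl hple j hj hns) ?_⟩
      rw [bound, ← hL]
      omega
    rcases Nat.eq_zero_or_pos (P.D.deg e) with h0 | h0
    · exact ⟨_, H.op (n := 0) he hpe hop (by omega), .inl le_rfl⟩
    · exact ⟨_, H.op he hpe hop fun j hj => (key j hj).2, .inr ⟨(key 0 h0).1, le_rfl⟩⟩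
  obtain ⟨M, hM, hM'⟩ := hval
  change Nat.log 2 (P.E v) ≤ P.D.pl v at hEp
  rcases hT with rfl | ⟨T, hm, hb, ha, hh⟩
  · refine H.mono hM ?_
    rw [bound, ← hL]
    omega
  · have hlev := MTree.lev_lt P.dec hb.path
    have h1 : 1 ≤ P.D.nl v := by
      have := (hb.path.mem hm).2.2
      have := P.D.μ_pos he
      exact Nat.log_pos (by omega) (by omega)
    -- the contexts of the nodes of the path
    have hleaf : ∀ u, T.Mem u → ∃ n, Le (3 * u + 1) n ∧
        n + 6 * P.D.pl v ≤ 3 * L + 21 * (Λ - 1) + 2 + 3 * P.lv u := by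
      intro u hu
      obtain ⟨hul, hup⟩ := hb.path.mem_lt hu
      obtain ⟨h2, h3⟩ := MTree.nl_eq_of_above (hb.path.mem hu).1
      obtain ⟨w, hw, hI⟩ := hb.exists_leaf hu
      have h4 := exit_le_lv (P := P) hul hup
      refine ⟨_, H.leaf (n := 3 * (P.lv u - P.D.pl v + (L - P.D.pl v)) + 21 * (Λ - 1) + 1) hw hI
        fun j hj hne => ?_, by omega⟩
      have hns : ¬ P.D.SC u j := fun hs => by
        rcases P.dec.nx_cases u hul hup with ⟨-, h5⟩ | ⟨j', e', hs'⟩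
        · exact h5 j hs
        · have := hs.unique_child hs'; omega
      obtain ⟨-, h5, h6, h7, h8⟩ := bound_child_le hul hup hj hns
      have := hpl _ (P.D.ch_lt u hul j hj)
      refine H.mono (hside u hul hup (by omega) (by omega) j hj hns) ?_
      rw [bound, ← hL]
      omega
    have hlv := entry_le_lv (P := P) hE
    obtain ⟨n, hn1, hn2⟩ : ∃ n, Le (3 * v) n ∧ n + 3 * P.lv v ≤
        max (3 * L + 21 * (Λ - 1) + 2 + T.height P.lv - 6 * P.D.pl v) M + T.height P.lv + 1 := by
      by_cases e' : v = T.first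
      · obtain ⟨n, h2, h3⟩ := H.slot hb hleaf
        have h4 := MTree.le_height (lv := P.lv) hm
        exact ⟨_, e' ▸ H.app hb ha (H.mono h2 (le_max_left n M)) (H.mono hM (le_max_right n M)),
          by omega⟩
      · obtain ⟨n, h2, h3⟩ := H.values hb hleaf (b := max (3 * L + 21 * (Λ - 1) + 2 +
          T.height P.lv - 6 * P.D.pl v) M) (by omega) le_rfl hM (by omega) hm e'
        exact ⟨n, h2, by omega⟩
    refine H.mono hn1 ?_
    rw [bound, ← hL]
    change T.lev P.lv < _ at hlev
    omega

end DepthLe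

end Plan

/-! ### The meaning of the instructions -/

section

namespace Plan

variable {P : Plan} {I : Instrs}

variable (P) in
/-- The instructions have been determined for all slots. -/
structure Complete (I : Instrs) : Prop where
  final : ∀ e < P.D.N, 0 < P.D.paths e → P.nx e = 0 → P.Final I e
  inactive : ∀ u < P.D.N, P.D.paths u = 0 → ∀ x < 3, I.tid (3 * u + x) = 0

theorem Built.exists_app {T : MTree} {m u : ℕ} (hb : P.Built I T m) (hu : T.Mem u)
    (hne : u ≠ T.first) : ∃ l r m', P.Built I (.node l r) m' ∧ u = r.first := by
  induction T generalizing m with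
  | leaf v => exact absurd hu.symm hne
  | node l r hl hr =>
    rcases hu with hu | hu
    · exact hl hb.1 hu hne
    · by_cases e : u = r.first
      · exact ⟨l, r, m, hb, e⟩
      · exact hr hb.2.1 hu e

theorem exists_app (hI : P.Complete I) {v : ℕ} (hv : v < P.D.N) (hp : 0 < P.D.paths v) :
    P.IsOp I v ∨ ∃ T m, T.first = v ∧ P.Built I T m ∧ P.IsApp I T.first T m := by
  obtain ⟨e, -, -, -, -, -, hop, rfl | ⟨T, hm, hb, ha, -⟩⟩ := exists_tree hI.final hv hp
  · exact .inl hop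
  · right
    by_cases e' : v = T.first
    · exact ⟨T, e, e'.symm, hb, ha⟩
    · obtain ⟨l, r, m, h, rfl⟩ := hb.exists_app hm e'
      exact ⟨r, m, rfl, h.2.1, h.2.2.1⟩

/-- Induction along the instructions: for values of nodes, and for contexts of trees. -/
theorem Complete.induction (hI : P.Complete I) {PV : ℕ → Prop} {PB : MTree → ℕ → Prop}
    (hop : ∀ v < P.D.N, 0 < P.D.paths v → P.IsOp I v → (∀ j < P.D.deg v, PV (P.D.ch v j)) → PV v)
    (hleaf : ∀ v m, P.D.Nxt v m → P.IsLeaf I v →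
      (∀ j < P.D.deg v, j ≠ P.nx v - 1 → PV (P.D.ch v j)) → PB (.leaf v) m)
    (hmerge : ∀ l r m, P.Built I (.node l r) m → PB l r.first → PB r m → PB (.node l r) m)
    (happ : ∀ T m, P.Built I T m → P.IsApp I T.first T m → PB T m → PV m → PV T.first) :
    (∀ v < P.D.N, 0 < P.D.paths v → PV v) ∧ ∀ T m, P.Built I T m → PB T m := by
  have hB : ∀ n, (∀ v < P.D.N, 0 < P.D.paths v → P.D.μ v < n → PV v) →
      ∀ T m, P.Built I T m → P.D.μ T.first ≤ n → PB T m := by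
    intro n ih T
    induction T with
    | leaf v =>
      intro m hb hn
      have hv : v < P.D.N := hb.1.lt
      refine hleaf v m hb.1 hb.2 fun j hj _ => ih _ (P.D.ch_lt v hv j hj)
        (P.D.paths_ch_pos hv hb.1.paths_pos hj) ((P.D.μ_lt v hv j hj).trans_le hn)
    | node l r hl hr =>
      intro m hb hn
      exact hmerge l r m hb (hl _ hb.1 hn) (hr _ hb.2.1 (hb.1.path.μ_lt.le.trans hn))
  have hV : ∀ n, ∀ v < P.D.N, 0 < P.D.paths v → P.D.μ v < n → PV v := by
    intro n
    induction n with
    | zero => intro v _ _ h; omega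
    | succ n ih =>
      intro v hv hp hn
      rcases exists_app hI hv hp with h | ⟨T, m, rfl, hb, ha⟩
      · exact hop v hv hp h fun j hj => ih _ (P.D.ch_lt v hv j hj) (P.D.paths_ch_pos hv hp hj)
          ((P.D.μ_lt v hv j hj).trans_le (by omega))
      · have h1 := hb.path.lt
        exact happ T m hb ha (hB n ih T m hb (by omega))
          (ih m h1.1 h1.2 (hb.path.μ_lt.trans_le (by omega)))
  exact ⟨fun v hv hp => hV _ v hv hp (Nat.lt_succ_self _), fun T m hb =>
    hB _ (hV _) T m hb le_rfl⟩

/-- The possible roles of a slot. -/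
inductive Role (P : Plan) (I : Instrs) : ℕ → Prop
  | unused {q} (h : I.tid q = 0) : Role P I q
  | op {v} (hv : v < P.D.N) (hp : 0 < P.D.paths v) (h : P.IsOp I v) : Role P I (3 * v)
  | app {T m} (hb : P.Built I T m) (h : P.IsApp I T.first T m) : Role P I (3 * T.first)
  | leaf {v m} (hn : P.D.Nxt v m) (h : P.IsLeaf I v) : Role P I (3 * v + 1)
  | merge {l r m} (hb : P.Built I (.node l r) m) : Role P I (3 * r.first + 2)

/-- Every slot plays one of the roles; in particular, a slot for a composed context is only in use
if a right subtree starts at its node. -/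
theorem Complete.role (hI : P.Complete I) {q : ℕ} (hq : q < 3 * P.D.N) : P.Role I q := by
  obtain ⟨v, x, hx, rfl⟩ : ∃ v x, x < 3 ∧ q = 3 * v + x := ⟨q / 3, q % 3, by omega, by omega⟩
  have hv : v < P.D.N := by omega
  rcases Nat.eq_zero_or_pos (P.D.paths v) with hp | hp
  · exact .unused (hI.inactive v hv hp x hx)
  · obtain ⟨e, he, hpe, hnx, -, -, -, h⟩ := exists_tree hI.final hv hp
    have hf := hI.final e he hpe hnx
    match x, hx with
    | 0, _ =>
      rcases exists_app hI hv hp with h | ⟨T, m, rfl, hb, ha⟩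
      · exact .op hv hp h
      · exact .app hb ha
    | 1, _ =>
      rcases h with rfl | ⟨T, hm, hb, -, -⟩
      · exact .unused hf.unused.1
      · obtain ⟨w, hw, h⟩ := hb.exists_leaf hm
        exact .leaf hw h
    | 2, _ =>
      rcases h with rfl | ⟨T, hm, hb, -, -⟩
      · exact .unused hf.unused.2
      · rcases hf.tree with h0 | ⟨T', hb', ha', hpv, h2, -⟩
        · obtain ⟨u, -, hu⟩ := hb.path.exists_last
          rw [(P.dec.pv_eq_iff he).2 hu] at h0; omega
        · have hm' : T'.Mem v := by
            have h3 := hb.path.mem hm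
            rcases hb'.path.mem_or_above h3.1 (fun e' => by rw [e'] at h3; omega) with h | ⟨h7, h8⟩
            · exact h
            · rcases Relation.ReflTransGen.cases_tail h7 with e' | ⟨u, -, h9⟩
              · exact absurd e'.symm h8
              · rw [(P.dec.pv_eq_iff h9.lt').2 h9] at hpv; omega
          by_cases e' : v = T'.first
          · exact .unused (e' ▸ h2)
          · obtain ⟨l, r, m, h, rfl⟩ := hb'.exists_app hm' e'
            exact .merge h

end Plan

variable {S : Type u} {Γ : Signature.{u, v} S} {A : SortedAlgebra.{u, v, w} Γ} {k : ℕ}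
  {L : Base A}

/-- The bundle `b` is defined by a template, applied to the bundles `g`. -/
def Template.Defines (T : Template L) (g : ℕ → Bundle L) (b : Bundle L) : Prop :=
  ∃ y : (x : T.Arg) → (i : Fin (L.m + 1)) → GroundTerm Γ ((T.kind x).sort i),
    (∀ x, g (T.idx x) = ⟨T.kind x, y x⟩) ∧ b = T.apply y

namespace Coding

variable (c : Coding L k)

/-- The slots of the arguments of an instruction exist, and have the right kinds. -/
def WellKinded (I : Instrs) (Q q : ℕ) : Prop :=
  ∀ x : (c.template (I.tid q)).Arg, I.arg ((c.template (I.tid q)).idx x) q < Q ∧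
    (c.template (I.tid (I.arg ((c.template (I.tid q)).idx x) q))).out =
      (c.template (I.tid q)).kind x

/-- Slot `q'` is an argument of the instruction for slot `q`. -/
def Uses (I : Instrs) (q' q : ℕ) : Prop :=
  ∃ x : (c.template (I.tid q)).Arg, q' = I.arg ((c.template (I.tid q)).idx x) q

/-- Acyclic instructions yield a straight-line program. -/
theorem exists_slp {I : Instrs} {Q start : ℕ} (hs : start < Q)
    (hk : ∀ q < Q, c.WellKinded I Q q) (ha : ∀ q < Q, Acc (c.Uses I) q) :
    ∃ (H : SLP Γ) (bun : ℕ → Bundle L),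
      (∀ q < Q, (c.template (I.tid q)).Defines (fun a => bun (I.arg a q)) (bun q)) ∧
      H.value A = (bun start).value ∧ H.depth ≤ (bun start).depth ∧
      H.size = ∑ q ∈ Finset.range Q, (c.template (I.tid q)).size ∧
      H.encode c.code = Q * (L.m + 1) :: start * (L.m + 1) :: ((List.range Q).map fun q =>
        ((c.template (I.tid q)).items c.code).map
          (Item.eval k (L.m + 1) fun a => I.arg a q)).flatten := by
  let E : System A L :=
    { Q := Q
      T := fun q => c.template (I.tid q)
      arg := fun q x => ⟨I.arg ((c.template (I.tid q)).idx x) q, (hk q q.2 x).1⟩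
      kind_arg := fun q x => (hk q q.2 x).2
      wf := by
        constructor
        rintro ⟨q, hq⟩
        have := ha q hq
        induction this with
        | intro q _ ih =>
          constructor
          rintro _ ⟨x, rfl⟩
          exact ih _ ⟨x, rfl⟩ _
      start := ⟨start, hs⟩ }
  obtain ⟨bun, hb⟩ : ∃ bun : ℕ → Bundle L, ∀ q (h : q < Q), bun q = E.bundle ⟨q, h⟩ :=
    ⟨fun q => if h : q < Q then E.bundle ⟨q, h⟩ else E.bundle ⟨start, hs⟩, fun q h => dif_pos h⟩
  refine ⟨E.slp, bun, fun q hq => ?_, ?_, ?_, ?_, ?_⟩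
  · obtain ⟨y, h1, h2⟩ := E.exists_bundle ⟨q, hq⟩
    refine ⟨y, fun x => ?_, ?_⟩
    · exact (hb _ (hk q hq x).1).trans (h1 x)
    · exact (hb q hq).trans h2
  · exact E.value_slp.trans (congrArg Bundle.value (hb _ hs).symm)
  · exact E.depth_slp_le.trans (congrArg Bundle.depth (hb _ hs)).symm.le
  · rw [Finset.sum_range]; exact E.size_slp
  · refine (E.encode_slp c.code fun q x => rfl).trans ?_
    congr 3
    exact List.ext_getElem (by simp [E]) (by simp [E])

end Coding

end

section

variable {S : Type u} {Γ : Signature.{u, v} S} {A : SortedAlgebra.{u, v, w} Γ} {k : ℕ}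
  {L : Base A}

/-! ### Correctness of the balanced program -/

/-- The nodes of the graph are labelled by symbols, and have values in the algebra. -/
structure Labelling (c : Coding L k) (P : Plan) where
  sym : ℕ → Γ.Symb
  val : ℕ → Σ p, A.carrier p
  num_eq : P.toNumbering = c.numbering
  tok_eq : ∀ u < P.D.N, 0 < P.D.paths u → P.tok u = c.code (sym u)
  deg_eq : ∀ u < P.D.N, 0 < P.D.paths u → P.D.deg u = Γ.rank (sym u)
  val_eq : ∀ u < P.D.N, 0 < P.D.paths u → ∃ x : (j : Fin (Γ.rank (sym u))) →
    A.carrier (Γ.dom (sym u) j),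
      (∀ j : Fin (Γ.rank (sym u)), val (P.D.ch u j) = ⟨Γ.dom (sym u) j, x j⟩) ∧
      val u = ⟨Γ.cod (sym u), A.op (sym u) x⟩

namespace Labelling

variable {c : Coding L k} {P : Plan} (Λ : Labelling c P) {I : Instrs}

theorem template_op {v : ℕ} (hv : v < P.D.N) (hp : 0 < P.D.paths v) (h : P.IsOp I v) :
    c.template (I.tid (3 * v)) = .opn L (Λ.sym v) := by
  rw [h.1, Λ.tok_eq v hv hp, c.template_opT]

theorem template_leaf {v m : ℕ} (hn : P.D.Nxt v m) (h : P.IsLeaf I v) :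
    ∃ j : Fin (Γ.rank (Λ.sym v)), P.nx v - 1 = j ∧ P.D.ch v j = m ∧
      c.template (I.tid (3 * v + 1)) = .leaf L (Λ.sym v) j := by
  obtain ⟨-, h1, h2⟩ := P.dec.ch_nx hn
  refine ⟨⟨P.nx v - 1, by rwa [← Λ.deg_eq v hn.lt hn.paths_pos]⟩, rfl, h2, ?_⟩
  rw [h.1, Λ.tok_eq v hn.lt hn.paths_pos, Λ.num_eq]
  exact c.template_leafT _ ⟨_, _⟩

/-- The kind of a slot. -/
noncomputable def kind (c : Coding L k) (I : Instrs) (q : ℕ) : Kind L := (c.template (I.tid q)).out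

include Λ in
theorem tyOf_eq (t : ℕ) : P.tyOf t = c.numbering.tyOf t := by rw [Λ.num_eq]

include Λ in
theorem template_merge {p q r : S} {l r' : MTree} (h : P.IsMerge I l r')
    {b : Fin (L.count p q)} {d : Fin (L.count r p)} (hb : kind c I l.slot = .blk b)
    (hd : kind c I r'.slot = .blk d) :
    c.template (I.tid (3 * r'.first + 2)) = .merge L b d := by
  rw [h.1, Plan.ty, Plan.ty, Λ.tyOf_eq, Λ.tyOf_eq, Λ.num_eq, c.template_mergeT hb hd]

include Λ in
theorem template_app {p q : S} {v m : ℕ} {T : MTree} (h : P.IsApp I v T m)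
    {b : Fin (L.count p q)} (hb : kind c I T.slot = .blk b) :
    c.template (I.tid (3 * v)) = .app L b := by
  rw [h.1, Plan.ty, Λ.tyOf_eq, Λ.num_eq, c.template_appT hb]

variable (hI : P.Complete I)
include Λ hI

/-- The slots for values have the sorts of the values, and the context of a tree maps values of the
sort of the node behind the tree to values of the sort of its first leaf. -/
theorem kinds : (∀ v < P.D.N, 0 < P.D.paths v → kind c I (3 * v) = .val (Λ.val v).1) ∧
    ∀ T m, P.Built I T m → ∃ b : Fin (L.count (Λ.val m).1 (Λ.val T.first).1),
      kind c I T.slot = .blk b := by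
  refine hI.induction (fun v hv hp h _ => ?_) (fun v m hn h _ => ?_) (fun l r m hb hl hr => ?_)
    (fun T m hb ha hT _ => ?_)
  · obtain ⟨x, -, h1⟩ := Λ.val_eq v hv hp
    rw [kind, Λ.template_op hv hp h, h1]
    rfl
  · obtain ⟨j, -, hj, h1⟩ := Λ.template_leaf hn h
    obtain ⟨x, h2, h3⟩ := Λ.val_eq v hn.lt hn.paths_pos
    have h4 := h2 j
    rw [hj] at h4
    simp only [MTree.first, MTree.slot]
    rw [h4, h3]
    exact ⟨(L.covers (Template.hole (Λ.sym v) j)).choose, congrArg Template.out h1⟩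
  · obtain ⟨b, hb'⟩ := hl
    obtain ⟨d, hd⟩ := hr
    exact ⟨_, congrArg Template.out (Λ.template_merge hb.2.2.2 hb' hd)⟩
  · obtain ⟨b, hb'⟩ := hT
    exact congrArg Template.out (Λ.template_app ha hb')

theorem wellKinded {q : ℕ} (hq : q < 3 * P.D.N) : c.WellKinded I (3 * P.D.N) q := by
  obtain ⟨hV, hB⟩ := Λ.kinds hI
  have slot_lt : ∀ T m, P.Built I T m → T.slot < 3 * P.D.N := by
    intro T m hb
    cases T with
    | leaf v => have : v < P.D.N := hb.1.lt; simp only [MTree.slot]; omega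
    | node l r =>
      have := (hb.2.1.path.mem_lt r.mem_first).1
      simp only [MTree.slot]; omega
  have hch : ∀ v < P.D.N, 0 < P.D.paths v → ∀ j : Fin (Γ.rank (Λ.sym v)),
      3 * P.D.ch v j < 3 * P.D.N ∧ kind c I (3 * P.D.ch v j) = .val (Γ.dom (Λ.sym v) j) := by
    intro v hv hp j
    have hj : (j : ℕ) < P.D.deg v := by rw [Λ.deg_eq v hv hp]; exact j.2
    have h1 := P.D.ch_lt v hv j hj
    obtain ⟨x, h2, -⟩ := Λ.val_eq v hv hp
    refine ⟨by omega, ?_⟩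
    rw [hV _ h1 (P.D.paths_ch_pos hv hp hj), h2]
  rcases hI.role hq with h | @⟨v, hv, hp, h⟩ | @⟨T, m, hb, h⟩ | @⟨v, m, hn, h⟩ | @⟨l, r, m, hb⟩
  · rw [Coding.WellKinded, h, c.template_zero]
    exact fun x => x.elim
  · rw [Coding.WellKinded, Λ.template_op hv hp h]
    intro (j : Fin (Γ.rank (Λ.sym v)))
    have hj : (j : ℕ) < P.D.deg v := by rw [Λ.deg_eq v hv hp]; exact j.2
    change I.arg j _ < _ ∧ kind c I (I.arg j _) = _
    rw [h.2 j hj]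
    exact hch v hv hp j
  · obtain ⟨b, hb'⟩ := hB T m hb
    rw [Coding.WellKinded, Λ.template_app h hb']
    rintro (_ | _)
    · change I.arg 0 _ < _ ∧ kind c I (I.arg 0 _) = _
      rw [h.2.1]
      exact ⟨slot_lt T m hb, hb'⟩
    · change I.arg 1 _ < _ ∧ kind c I (I.arg 1 _) = _
      rw [h.2.2]
      have := hb.path.lt
      exact ⟨by omega, hV m this.1 this.2⟩
  · obtain ⟨j, hj, -, h1⟩ := Λ.template_leaf hn h
    rw [Coding.WellKinded, h1]
    rintro ⟨a, ha⟩
    have ha' : (a : ℕ) < P.D.deg v := by rw [Λ.deg_eq v hn.lt hn.paths_pos]; exact a.2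
    change I.arg a _ < _ ∧ kind c I (I.arg a _) = _
    rw [h.2 a ha']
    exact hch v hn.lt hn.paths_pos a
  · obtain ⟨b, hb'⟩ := hB l _ hb.1
    obtain ⟨d, hd⟩ := hB r m hb.2.1
    rw [Coding.WellKinded, Λ.template_merge hb.2.2.2 hb' hd]
    rintro (_ | _)
    · change I.arg 0 _ < _ ∧ kind c I (I.arg 0 _) = _
      rw [hb.2.2.2.2.1]
      exact ⟨slot_lt l _ hb.1, hb'⟩
    · change I.arg 1 _ < _ ∧ kind c I (I.arg 1 _) = _
      rw [hb.2.2.2.2.2]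
      exact ⟨slot_lt r m hb.2.1, hd⟩

/-- The instructions are acyclic. -/
theorem acc {q : ℕ} (hq : q < 3 * P.D.N) : Acc (c.Uses I) q := by
  obtain ⟨hV, hB⟩ := Λ.kinds hI
  have key : (∀ v < P.D.N, 0 < P.D.paths v → Acc (c.Uses I) (3 * v)) ∧
      ∀ T m, P.Built I T m → Acc (c.Uses I) T.slot := by
    refine hI.induction (PB := fun T _ => Acc (c.Uses I) T.slot) (fun v hv hp h ih => ?_)
      (fun v m hn h ih => ?_) (fun l r m hb hl hr => ?_) (fun T m hb ha hT hm => ?_)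
    · constructor
      intro q' h'
      rw [Coding.Uses, Λ.template_op hv hp h] at h'
      obtain ⟨(j : Fin (Γ.rank (Λ.sym v))), rfl⟩ := h'
      have hj : (j : ℕ) < P.D.deg v := by rw [Λ.deg_eq v hv hp]; exact j.2
      change Acc _ (I.arg j _)
      rw [h.2 j hj]
      exact ih j hj
    · obtain ⟨j, hj, -, h1⟩ := Λ.template_leaf hn h
      constructor
      intro q' h'
      rw [Coding.Uses, MTree.slot, h1] at h'
      obtain ⟨⟨a, ha⟩, rfl⟩ := h'
      have ha' : (a : ℕ) < P.D.deg v := by rw [Λ.deg_eq v hn.lt hn.paths_pos]; exact a.2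
      change Acc _ (I.arg a _)
      rw [h.2 a ha']
      exact ih a ha' fun e => ha (Fin.ext (e.trans hj))
    · obtain ⟨b, hb'⟩ := hB l _ hb.1
      obtain ⟨d, hd⟩ := hB r m hb.2.1
      constructor
      intro q' h'
      rw [Coding.Uses, MTree.slot, Λ.template_merge hb.2.2.2 hb' hd] at h'
      obtain ⟨_ | _, rfl⟩ := h'
      · change Acc _ (I.arg 0 _)
        rw [hb.2.2.2.2.1]
        exact hl
      · change Acc _ (I.arg 1 _)
        rw [hb.2.2.2.2.2]
        exact hr
    · obtain ⟨b, hb'⟩ := hB T m hb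
      constructor
      intro q' h'
      rw [Coding.Uses, Λ.template_app ha hb'] at h'
      obtain ⟨_ | _, rfl⟩ := h'
      · change Acc _ (I.arg 0 _)
        rw [ha.2.1]
        exact hT
      · change Acc _ (I.arg 1 _)
        rw [ha.2.2]
        exact hm
  obtain ⟨hAV, hAB⟩ := key
  rcases hI.role hq with h | @⟨v, hv, hp, h⟩ | @⟨T, m, hb, h⟩ | @⟨v, m, hn, h⟩ | @⟨l, r, m, hb⟩
  · constructor
    intro q' h'
    rw [Coding.Uses, h, c.template_zero] at h'
    obtain ⟨x, -⟩ := h'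
    exact x.elim
  · exact hAV v hv hp
  · have := hb.path.mem_lt T.mem_first
    exact hAV _ this.1 this.2
  · exact hAB (.leaf v) m ⟨hn, h⟩
  · exact hAB (.node l r) m hb

variable {bun : ℕ → Bundle L} (hbun : ∀ q < 3 * P.D.N,
  (c.template (I.tid q)).Defines (fun a => bun (I.arg a q)) (bun q))
include hbun

/-- The slots for values have the values of the nodes, and the context of a tree maps the value of
the node behind the tree to the value of its first leaf. -/
theorem values : (∀ v < P.D.N, 0 < P.D.paths v → (bun (3 * v)).value = Λ.val v) ∧
    ∀ T m, P.Built I T m → (bun T.slot).fn (Λ.val m) = Λ.val T.first := by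
  obtain ⟨hV, hB⟩ := Λ.kinds hI
  refine hI.induction (fun v hv hp h ih => ?_) (fun v m hn h ih => ?_) (fun l r m hb hl hr => ?_)
    (fun T m hb ha hT hm => ?_)
  · have h1 := hbun (3 * v) (by omega)
    rw [Λ.template_op hv hp h] at h1
    obtain ⟨y, h2, h3⟩ := h1
    obtain ⟨x, h4, h5⟩ := Λ.val_eq v hv hp
    rw [h3, Template.value_opn, h5]
    congr 2
    funext j
    have hj : (j : ℕ) < P.D.deg v := by rw [Λ.deg_eq v hv hp]; exact j.2
    have h6 := h2 j
    change bun (I.arg j _) = _ at h6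
    rw [h.2 j hj] at h6
    have h7 := ih j hj
    rw [h6, h4] at h7
    exact eq_of_heq (Sigma.mk.inj h7).2
  · have hv : v < P.D.N := hn.lt
    have h1 := hbun (3 * v + 1) (by omega)
    obtain ⟨j, hj, hjm, h1'⟩ := Λ.template_leaf hn h
    rw [h1'] at h1
    obtain ⟨y, h2, h3⟩ := h1
    obtain ⟨x, h4, h5⟩ := Λ.val_eq v hn.lt hn.paths_pos
    have h8 := h4 j
    rw [hjm] at h8
    simp only [MTree.slot, MTree.first]
    rw [h3, h8, h5]
    refine Template.fn_leaf _ j y x ?_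
    rintro ⟨a, ha⟩
    have ha' : (a : ℕ) < P.D.deg v := by rw [Λ.deg_eq v hn.lt hn.paths_pos]; exact a.2
    have h6 := h2 ⟨a, ha⟩
    change bun (I.arg a _) = _ at h6
    rw [h.2 a ha'] at h6
    have h7 := ih a ha' fun e => ha (Fin.ext (e.trans hj))
    rw [h6, h4] at h7
    exact eq_of_heq (Sigma.mk.inj h7).2
  · obtain ⟨b, hb'⟩ := hB l _ hb.1
    obtain ⟨d, hd⟩ := hB r m hb.2.1
    have hr' := (hb.2.1.path.mem_lt r.mem_first).1
    have h1 := hbun (3 * r.first + 2) (by omega)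
    rw [Λ.template_merge hb.2.2.2 hb' hd] at h1
    obtain ⟨y, h2, h3⟩ := h1
    have h4 := h2 false
    have h5 := h2 true
    change bun (I.arg 0 _) = _ at h4
    change bun (I.arg 1 _) = _ at h5
    rw [hb.2.2.2.2.1] at h4
    rw [hb.2.2.2.2.2] at h5
    rw [h4] at hl
    rw [h5] at hr
    simp only [MTree.slot, MTree.first]
    rw [h3]
    exact (Template.fn_merge b d y _).trans ((congrArg _ hr).trans hl)
  · obtain ⟨b, hb'⟩ := hB T m hb
    have hT' := (hb.path.mem_lt T.mem_first).1
    have h1 := hbun (3 * T.first) (by omega)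
    rw [Λ.template_app ha hb'] at h1
    obtain ⟨y, h2, h3⟩ := h1
    have h4 := h2 false
    have h5 := h2 true
    change bun (I.arg 0 _) = _ at h4
    change bun (I.arg 1 _) = _ at h5
    rw [ha.2.1] at h4
    rw [ha.2.2] at h5
    rw [h4] at hT
    rw [h5] at hm
    rw [h3]
    exact (Template.value_app b y).trans ((congrArg _ hm).trans hT)

end Labelling

end

/-! ### Size and depth of the balanced program -/

section

variable {S : Type u} {Γ : Signature.{u, v} S} {A : SortedAlgebra.{u, v, w} Γ} {k : ℕ}
  {L : Base A}

namespace Template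

theorem size_const {ι : Type} {σ : ι → S} (c : Γ.Symb) (hc : Γ.rank c = 0) :
    (Term.const c hc : Term Γ σ (Γ.cod c)).size = 0 := by
  simp only [Term.const, Term.size, hc, zero_add]
  exact Finset.sum_eq_zero fun j _ => (Fin.cast hc j).elim0

theorem size_dflt : (dflt L).size = 0 :=
  Finset.sum_eq_zero fun _ _ => size_const L.c₀ L.rank_c₀

theorem size_opn (f : Γ.Symb) : (opn L f).size = Γ.rank f := by
  have h : ∑ i : Fin L.m, ((opn L f).tm i.succ).size = 0 :=
    Finset.sum_eq_zero fun _ _ => size_const L.c₀ L.rank_c₀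
  rw [size, Fin.sum_univ_succ, h, add_zero]
  change Γ.rank f + ∑ _j : Fin (Γ.rank f), 0 = _
  simp

end Template

namespace Coding

variable (c : Coding L k)

/-- A bound for the sizes of the templates. -/
noncomputable def sizeBound : ℕ := ∑ t ∈ Finset.range c.numbering.size, (c.template t).size

/-- A bound for the depths of the templates. -/
noncomputable def depthBound : ℕ := ∑ t ∈ Finset.range c.numbering.size, (c.template t).depth

end Coding

theorem sum_range_three_mul (f : ℕ → ℕ) (N : ℕ) : ∑ q ∈ Finset.range (3 * N), f q =
    ∑ u ∈ Finset.range N, ∑ x ∈ Finset.range 3, f (3 * u + x) := by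
  induction N with
  | zero => rfl
  | succ N ih => rw [Finset.sum_range_succ, ← ih, Nat.mul_succ, Finset.sum_range_add]

namespace Labelling

variable {c : Coding L k} {P : Plan} (Λ : Labelling c P) {I : Instrs}

include Λ

theorem tid_lt (hI : P.Complete I) {q : ℕ} (hq : q < 3 * P.D.N) :
    I.tid q < c.numbering.size := by
  have htok : ∀ v < P.D.N, 0 < P.D.paths v → P.tok v < c.numbering.k := fun v hv hp => by
    rw [Λ.tok_eq v hv hp]; exact (c.code _).2
  have hty := fun q => (P.tyOf_lt (I.tid q)).trans_eq (congrArg Numbering.K Λ.num_eq)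
  rcases hI.role hq with h | @⟨v, hv, hp, h⟩ | @⟨T, m, hb, h⟩ | @⟨v, m, hn, h⟩ | @⟨l, r, m, hb⟩
  · rw [h]; simp only [Numbering.size]; omega
  · rw [h.1]; exact c.numbering.opT_lt (htok v hv hp)
  · rw [h.1, Λ.num_eq]; exact c.numbering.appT_lt (hty _)
  · obtain ⟨-, h1, -⟩ := P.dec.ch_nx hn
    rw [h.1, Λ.num_eq]
    refine c.numbering.leafT_lt (htok v hn.lt hn.paths_pos) ?_
    have := P.deg_le v hn.lt
    rw [Λ.num_eq] at this
    omega
  · rw [hb.2.2.2.1, Λ.num_eq]; exact c.numbering.mergeT_lt (hty _) (hty _)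

/-- The slots of a node without children have instructions of size `0`. -/
theorem size_template_le (hI : P.Complete I) {u x : ℕ} (hu : u < P.D.N) (hx : x < 3) :
    (c.template (I.tid (3 * u + x))).size ≤ c.sizeBound * P.D.deg u := by
  have h1 := Finset.single_le_sum (f := fun t => (c.template t).size) (fun _ _ => Nat.zero_le _)
    (Finset.mem_range.2 (Λ.tid_lt hI (q := 3 * u + x) (by omega)))
  rcases Nat.eq_zero_or_pos (P.D.deg u) with h0 | h0
  · have hn : ∀ m, ¬ P.D.Nxt u m := fun m hm => by
      have := (P.dec.ch_nx hm).2.1; omega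
    have key : ∀ q, P.Role I q → q = 3 * u + x → (c.template (I.tid q)).size = 0 := by
      rintro q (h | @⟨v, hv, hp, h⟩ | @⟨T, m, hb, h⟩ | @⟨v, m, hn', h⟩ | @⟨l, r, m, hb⟩) e
      · rw [h, c.template_zero, Template.size_dflt]
      · obtain rfl : v = u := by omega
        rw [Λ.template_op hv hp h, Template.size_opn, ← Λ.deg_eq v hv hp, h0]
      · have e' : T.first = u := by omega
        obtain ⟨w, hw, -⟩ := hb.exists_leaf T.mem_first
        exact absurd (e' ▸ hw) (hn w)
      · obtain rfl : v = u := by omega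
        exact absurd hn' (hn m)
      · have e' : r.first = u := by omega
        obtain ⟨w, hw, -⟩ := hb.2.1.exists_leaf r.mem_first
        exact absurd (e' ▸ hw) (hn w)
    rw [key _ (hI.role (by omega)) rfl]
    omega
  · exact h1.trans (Nat.le_mul_of_pos_right _ h0)

variable {bun : ℕ → Bundle L}

/-- Every template adds at most `depthBound` to the depth of its arguments. -/
theorem depthLe (hI : P.Complete I) (hbun : ∀ q < 3 * P.D.N,
    (c.template (I.tid q)).Defines (fun a => bun (I.arg a q)) (bun q)) :
    P.DepthLe I fun q n => (bun q).depth ≤ c.depthBound * n := by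
  obtain ⟨-, hB⟩ := Λ.kinds hI
  have key : ∀ q < 3 * P.D.N, ∀ D, (∀ x, (bun (I.arg ((c.template (I.tid q)).idx x) q)).depth ≤
      c.depthBound * D) → (bun q).depth ≤ c.depthBound * (D + 1) := by
    intro q hq D h
    obtain ⟨y, h1, h2⟩ := hbun q hq
    have h3 := Finset.single_le_sum (f := fun t => (c.template t).depth) (fun _ _ => Nat.zero_le _)
      (Finset.mem_range.2 (Λ.tid_lt hI hq))
    rw [h2, mul_add, add_comm, mul_one]
    exact ((c.template (I.tid q)).depth_apply_le fun x => (h1 x) ▸ h x).trans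
      (Nat.add_le_add_right h3 _)
  refine ⟨fun h hn => h.trans (Nat.mul_le_mul_left _ hn), fun {v n} hv hp h hc => ?_,
    fun {v m n} hn h hc => ?_, fun {T m n} hb h h1 h2 => ?_, fun {l r m n} hb h1 h2 => ?_⟩
  · refine key _ (by omega) n ?_
    rw [Λ.template_op hv hp h]
    intro (j : Fin (Γ.rank (Λ.sym v)))
    have hj : (j : ℕ) < P.D.deg v := by rw [Λ.deg_eq v hv hp]; exact j.2
    change (bun (I.arg j _)).depth ≤ _
    rw [h.2 j hj]
    exact hc j hj
  · have hv : v < P.D.N := hn.lt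
    obtain ⟨j, hj, -, h1⟩ := Λ.template_leaf hn h
    refine key _ (by omega) n ?_
    rw [h1]
    rintro ⟨a, ha⟩
    have ha' : (a : ℕ) < P.D.deg v := by rw [Λ.deg_eq v hn.lt hn.paths_pos]; exact a.2
    change (bun (I.arg a _)).depth ≤ _
    rw [h.2 a ha']
    exact hc a ha' fun e => ha (Fin.ext (e.trans hj))
  · obtain ⟨b, hb'⟩ := hB T m hb
    have := (hb.path.mem_lt T.mem_first).1
    refine key _ (by omega) n ?_
    rw [Λ.template_app h hb']
    rintro (_ | _)
    · change (bun (I.arg 0 _)).depth ≤ _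
      rwa [h.2.1]
    · change (bun (I.arg 1 _)).depth ≤ _
      rwa [h.2.2]
  · obtain ⟨b, hb'⟩ := hB l _ hb.1
    obtain ⟨d, hd⟩ := hB r m hb.2.1
    have := (hb.2.1.path.mem_lt r.mem_first).1
    refine key (3 * r.first + 2) (by omega) n ?_
    rw [Λ.template_merge hb.2.2.2 hb' hd]
    rintro (_ | _)
    · change (bun (I.arg 0 _)).depth ≤ _
      rwa [hb.2.2.2.2.1]
    · change (bun (I.arg 1 _)).depth ≤ _
      rwa [hb.2.2.2.2.2]

/-- The straight-line program that is described by complete instructions. -/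
theorem exists_slp (hI : P.Complete I) : ∃ H : SLP Γ, H.value A = Λ.val P.D.root ∧
    H.depth ≤ c.depthBound * (48 * Nat.log 2 (P.D.μ P.D.root) + 1) ∧
    H.size ≤ 3 * c.sizeBound * ∑ u ∈ Finset.range P.D.N, P.D.deg u ∧
    H.encode c.code = 3 * P.D.N * (L.m + 1) :: 3 * P.D.root * (L.m + 1) ::
      ((List.range (3 * P.D.N)).map fun q => ((c.template (I.tid q)).items c.code).map
        (Item.eval k (L.m + 1) fun a => I.arg a q)).flatten := by
  have hr := P.D.root_lt
  have hp : 0 < P.D.paths P.D.root := by rw [P.D.paths_root]; exact one_pos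
  obtain ⟨H, bun, hbun, h1, h2, h3, h4⟩ := c.exists_slp (I := I) (start := 3 * P.D.root) (by omega)
    (fun q hq => Λ.wellKinded hI hq) fun q hq => Λ.acc hI hq
  refine ⟨H, h1.trans ((Λ.values hI hbun).1 _ hr hp), h2.trans (((Λ.depthLe hI hbun).value_le
    hI.final hr hp P.dec.entry.root).trans (Nat.mul_le_mul_left _ ?_)), ?_, h4⟩
  · have h5 : P.D.nl P.D.root = Nat.log 2 (P.D.μ P.D.root) := rfl
    rw [Plan.DepthLe.bound, ← h5]
    omega
  · rw [h3, sum_range_three_mul, Finset.mul_sum]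
    refine Finset.sum_le_sum fun u hu => ?_
    refine (Finset.sum_le_sum fun x hx => Λ.size_template_le hI (Finset.mem_range.1 hu)
      (Finset.mem_range.1 hx)).trans ?_
    simp only [Finset.sum_const, Finset.card_range, smul_eq_mul, mul_assoc]
    exact le_rfl

end Labelling

end

/-! ### Output of the balanced program -/

namespace RAM

open Program CircuitBalancing.RAM.Expr State

variable {B V k M : ℕ}

/-- Append a number to the output. -/
def emit (e : Expr) : Program :=
  seq (put .out (rd .out) e) (set .out (rd .out + const 1))

/-- The number that an item denotes, as an expression. -/
def itemExpr (k M : ℕ) : Item → Expr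
  | .lit n => const n
  | .ref a i => const k + (ld (.arg a) (rd .idx) * const M + const i)

/-- Append the numbers that items denote to the output. -/
def emitItems (k M : ℕ) : List Item → Program
  | [] => skip
  | x :: l => seq (emit (itemExpr k M x)) (emitItems k M l)

/-- The output consists of the numbers in a list. -/
def Wrote (s : State) (l : List ℕ) : Prop :=
  s.r .out = l.length ∧ ∀ (i : ℕ) (h : i < l.length), s.m .out i = l[i]

theorem Wrote.congr {s s' : State} {l : List ℕ} (h : Wrote s l) (h1 : s'.r .out = s.r .out)
    (h2 : s'.m .out = s.m .out) : Wrote s' l := by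
  rw [Wrote, h1, h2]; exact h

theorem sat_emit {s : State} {l : List ℕ} (h : Wrote s l) (hl : l.length + 1 ≤ V) {e : Expr}
    (he : e.Tame V s) (hv : e.eval s ≤ V) :
    (emit e).Sat V s fun s' => Wrote s' (l ++ [e.eval s]) := by
  simp only [emit, sat_seq, sat_put, tame_rd, sat_set, tame_add, tame_const, eval_add, eval_rd,
    eval_const, r_setM, h.1, true_and]
  refine ⟨he, hv, hl, by simp, fun i hi => ?_⟩
  simp only [m_setR, m_setM_same, Function.update_apply]
  rcases Nat.lt_succ_iff_lt_or_eq.1 (by simpa using hi) with hi' | rfl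
  · rw [if_neg (by omega), List.getElem_append_left hi']
    exact h.2 i hi'
  · simp

theorem writes_emitItems {l : List Item} {a : Arr} (h : (emitItems k M l).Writes a.num) :
    a = .out := by
  induction l with
  | nil => exact h.elim
  | cons x l ih => simpa [emitItems, emit, or_iff_left_of_imp ih] using h

theorem sets_emitItems {l : List Item} {x : Reg} (h : (emitItems k M l).Sets x.num) :
    x = .out := by
  induction l with
  | nil => exact h.elim
  | cons y l ih => simpa [emitItems, emit, or_iff_left_of_imp ih] using h

/-- The numbers that items denote, in the instruction of a slot. -/
def itemVal (k M : ℕ) (s : State) (q : ℕ) : Item → ℕ := Item.eval k M fun a => s.m (.arg a) q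

theorem sat_emitItems {l : List Item} {s : State} {o : List ℕ} (h : Wrote s o)
    (hl : o.length + l.length ≤ V) (hv : ∀ x ∈ l, itemVal k M s (s.r .idx) x ≤ V) :
    (emitItems k M l).Sat V s fun s' => Wrote s' (o ++ l.map (itemVal k M s (s.r .idx))) := by
  induction l generalizing s o with
  | nil => simpa [emitItems] using h
  | cons x l ih =>
    rw [emitItems, sat_seq]
    have hx := hv x (by simp)
    have he : (itemExpr k M x).eval s = itemVal k M s (s.r .idx) x := by cases x <;> rfl
    have ht : (itemExpr k M x).Tame V s := by
      cases x with
      | lit n => trivial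
      | ref a i =>
        simp only [itemVal, Item.eval] at hx
        simp [itemExpr]; omega
    simp only [List.length_cons] at hl
    refine (sat_emit h (by omega) ht (he ▸ hx)).frame.mono fun s1 h1 => ?_
    have hidx : s1.r .idx = s.r .idx := h1.2.2 _ (by simp [emit])
    have harg : ∀ a, s1.m (.arg a) = s.m (.arg a) := fun a => h1.2.1 _ (by simp [emit])
    have hval : itemVal k M s1 (s1.r .idx) = itemVal k M s (s.r .idx) := by
      funext y; simp only [itemVal, harg, hidx]
    have := ih h1.1 (by simp; omega) (by rw [hval]; exact fun y hy => hv y (by simp [hy]))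
    rw [hval, he] at this
    simpa using this

/-- Append the right-hand sides for a slot to the output. -/
def emitSlot (k M : ℕ) (items : ℕ → List Item) (n : ℕ) : Program :=
  seq (set .val (ld .tid (rd .idx))) <|
  unroll (fun t => branch (rd .val) (const t) skip <|
    branch (const t) (rd .val) skip (emitItems k M (items t))) n

/-- Output a straight-line program, given instructions for all slots. -/
def emitAll (k M : ℕ) (items : ℕ → List Item) (n : ℕ) : Program :=
  seq (seq (set .out (const 0)) <| seq (emit (const 3 * rd .len * const M)) <|
    seq (emit (const 3 * rd .root * const M)) (set .lim (const 3 * rd .len))) <|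
  forTo .idx .lim (emitSlot k M items n)

variable {items : ℕ → List Item} {n : ℕ}

theorem writes_emitSlot {a : Arr} (h : (emitSlot k M items n).Writes a.num) : a = .out := by
  simp only [emitSlot, writes_seq, writes_set, writes_unroll, writes_branch, writes_skip,
    false_or] at h
  obtain ⟨t, -, h⟩ := h
  exact writes_emitItems h

theorem sets_emitSlot {x : Reg} (h : (emitSlot k M items n).Sets x.num) : x = .val ∨ x = .out := by
  simp only [emitSlot, sets_seq, sets_set, sets_unroll, sets_branch, sets_skip, false_or] at h
  exact h.imp id fun ⟨t, _, h⟩ => sets_emitItems h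

theorem sat_emitSlot {s : State} (hs : s.Bd V) {o : List ℕ} (h : Wrote s o) {q : ℕ}
    (hq : s.r .idx = q) (ht : s.m .tid q < n) (hl : o.length + (items (s.m .tid q)).length ≤ V)
    (hv : ∀ x ∈ items (s.m .tid q), itemVal k M s q x ≤ V) :
    (emitSlot k M items n).Sat V s fun s' =>
      Wrote s' (o ++ (items (s.m .tid q)).map (itemVal k M s q)) := by
  obtain ⟨t, htt⟩ : ∃ t, t = s.m .tid q := ⟨_, rfl⟩
  rw [← htt] at ht hl hv ⊢
  have htV : t ≤ V := htt ▸ hs.m _ _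
  simp only [emitSlot, sat_seq, sat_set, tame_ld, tame_rd, eval_ld, eval_rd, hq, ← htt, true_and]
  refine ⟨htV, (sat_unroll (fun j s' => Wrote s' (o ++ if t < j then
    (items t).map (itemVal k M s q) else []) ∧ s'.r .idx = q ∧ s'.r .val = t ∧
      ∀ a, s'.m (.arg a) = s.m (.arg a)) ?_ fun j _ s' _ h1 => ?_).mono
      fun s' h1 => by simpa [ht] using h1.1.1⟩
  · simpa [hq] using h.congr (s' := s.setR .val t) (by simp) (by simp)
  · obtain ⟨h2, h3, h4, h5⟩ := h1
    simp only [sat_branch, tame_rd, tame_const, eval_rd, eval_const, h4, sat_skip, true_and]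
    refine ⟨fun hlt => ⟨?_, h3, h5⟩, fun hge => ⟨fun hlt => ⟨?_, h3, h5⟩, fun hle => ?_⟩⟩
    · rw [if_pos hlt] at h2; rwa [if_pos (by omega)]
    · rw [if_neg (by omega)] at h2; rwa [if_neg (by omega)]
    · obtain rfl : j = t := by omega
      rw [if_neg (by omega), List.append_nil] at h2
      have hval : itemVal k M s' (s'.r .idx) = itemVal k M s q := by
        funext y; simp only [itemVal, h5, h3]
      refine (sat_emitItems (k := k) (M := M) h2 hl (by rwa [hval])).frame.mono fun s2 h6 => ?_
      have h7 : ∀ x : Reg, x ≠ .out → s2.r x = s'.r x := fun x hx =>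
        h6.2.2 x fun h => hx (sets_emitItems h)
      have h8 : ∀ a : Arr, a ≠ .out → s2.m a = s'.m a := fun a ha =>
        h6.2.1 a fun h => ha (writes_emitItems h)
      rw [hval] at h6
      exact ⟨by simpa using h6.1, (h7 _ (by simp)).trans h3, (h7 _ (by simp)).trans h4,
        fun a => (h8 _ (by simp)).trans (h5 a)⟩

theorem reaches_emitAll {N root ℓ : ℕ} (hB : (emitAll k M items n).coef * (V + 1) ≤ B)
    {s : State} (hs : s.Bd V) (hV : 3 * N + 3 * N * M + 2 + 3 * N * ℓ ≤ V) (hroot : root < N)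
    (hl : s.r .len = N) (hr : s.r .root = root) (ht : ∀ q < 3 * N, s.m .tid q < n)
    (hℓ : ∀ t < n, (items t).length ≤ ℓ)
    (hv : ∀ q < 3 * N, ∀ x ∈ items (s.m .tid q), itemVal k M s q x ≤ V) :
    (emitAll k M items n).Reaches B V s ((emitAll k M items n).wcost * (3 * N + 1)) fun s' =>
      Wrote s' (3 * N * M :: 3 * root * M :: ((List.range (3 * N)).map fun q =>
        (items (s.m .tid q)).map (itemVal k M s q)).flatten) := by
  have h1 : 3 * root * M ≤ 3 * N * M := Nat.mul_le_mul_right _ (by omega)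
  refine (Sat.reaches' (Q := fun s' => Wrote s' [3 * N * M, 3 * root * M] ∧ s'.r .lim = 3 * N ∧
    (∀ a, s'.m (.arg a) = s.m (.arg a)) ∧ s'.m .tid = s.m .tid) ?_ hs (coef_seq_left hB) _).seq'
    fun s1 hs1 h2 => ?_
  · rw [sat_seq, sat_set]
    refine ⟨trivial, Nat.zero_le _, ?_⟩
    rw [sat_seq]
    refine (sat_emit (l := []) ⟨by simp, by simp⟩ (by simp; omega) ?_ ?_).frame.mono fun s1 h2 => ?_
    · simp [hl]; omega
    · simp [hl]; omega
    rw [sat_seq]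
    have hr1 : s1.r .root = root := by rw [h2.2.2 _ (by simp [emit])]; simpa using hr
    have hl1 : s1.r .len = N := by rw [h2.2.2 _ (by simp [emit])]; simpa using hl
    refine (sat_emit h2.1 (by simp; omega) ?_ ?_).frame.mono fun s2 h3 => ?_
    · simp [hr1]; omega
    · simp [hr1]; omega
    have hl2 : s2.r .len = N := (h3.2.2 _ (by simp [emit])).trans hl1
    simp only [sat_set, tame_mul, tame_const, tame_rd, eval_mul, eval_const, eval_rd, hl2,
      r_setR_same, m_setR, true_and]
    refine ⟨by omega, by omega, ?_, fun a => ?_, ?_⟩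
    · have h4 := h3.1
      simp only [eval_mul, eval_const, eval_rd, r_setR_ne, ne_eq, reduceCtorEq, not_false_eq_true,
        hl, hr1, List.nil_append, List.cons_append] at h4
      exact h4.congr (by simp) (by simp)
    · rw [h3.2.1 _ (by simp [emit]), h2.2.1 _ (by simp [emit])]; rfl
    · rw [h3.2.1 _ (by simp [emit]), h2.2.1 _ (by simp [emit])]; rfl
  · refine (reaches_forTo (n := 3 * N) (fun i s' => (∃ o, o.length ≤ 2 + i * ℓ ∧ Wrote s' o ∧
      o = [3 * N * M, 3 * root * M] ++ ((List.range i).map fun q =>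
        (items (s.m .tid q)).map (itemVal k M s q)).flatten)) hs1 (coef_seq_right hB) (by omega)
        h2.2.1 ?_ ?_ (by simp) ?_ ?_).mono le_rfl ?_
    · exact fun h => by simpa using sets_emitSlot h
    · exact fun h => by simpa using sets_emitSlot h
    · exact ⟨_, by simp, h2.1.congr (by simp) (by simp), by simp⟩
    · rintro i hi s' hs' hf hidx - ⟨o, ho, hw, rfl⟩
      have hwr : ∀ a : Arr, a ≠ .out → s'.m a = s1.m a := fun a ha =>
        hf.1 a fun h => ha (writes_emitSlot (writes_forTo.1 h))
      have htid : s'.m .tid = s.m .tid := (hwr _ (by simp)).trans h2.2.2.2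
      have harg : ∀ a, s'.m (.arg a) = s.m (.arg a) := fun a =>
        (hwr _ (by simp)).trans (h2.2.2.1 a)
      have hval : itemVal k M s' i = itemVal k M s i := by
        funext y; simp only [itemVal, harg]
      have h3 := hℓ _ (ht i hi)
      have h4 : (i + 1) * ℓ ≤ 3 * N * ℓ := Nat.mul_le_mul_right _ hi
      rw [add_mul, one_mul] at h4
      refine (sat_emitSlot (k := k) (M := M) hs' hw hidx (by rw [htid]; exact ht i hi)
        (by rw [htid]; omega) (by rw [htid, hval]; exact hv i hi)).mono fun s2 h5 => ?_
      rw [htid, hval] at h5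
      refine ⟨_, ?_, h5.congr (by simp) (by simp), ?_⟩
      · rw [List.length_append, List.length_map, add_mul, one_mul]; omega
      · simp [List.range_succ]
    · rintro s' - ⟨⟨o, -, h, rfl⟩, -⟩
      exact h

end RAM

/-! ### Positions in the sequence of tokens -/

namespace Term

variable {S : Type u} {Γ : Signature.{u, v} S} {k : ℕ}

section

variable {ι : Type} {σ : ι → S}

/-- The subterms of a term, in preorder. -/
def subs : {p : S} → Term Γ σ p → List (Σ q, Term Γ σ q)
  | _, var i => [⟨_, var i⟩]
  | _, op f args => ⟨_, op f args⟩ :: (List.ofFn fun j => (args j).subs).flatten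

/-- The number of arguments at the root of a term. -/
def arity : (Σ q, Term Γ σ q) → ℕ
  | ⟨_, var _⟩ => 0
  | ⟨_, op f _⟩ => Γ.rank f

/-- A sequence of subterms consists of `n` terms in preorder, as far as the number of arguments is
concerned. -/
def IsPolish (n : ℕ) (l : List (Σ q, Term Γ σ q)) : Prop :=
  (∀ i < l.length, i < n + ((l.take i).map arity).sum) ∧ n + (l.map arity).sum = l.length

theorem IsPolish.append {n : ℕ} {l l' : List (Σ q, Term Γ σ q)} (h : IsPolish 1 l)
    (h' : IsPolish n l') : IsPolish (n + 1) (l ++ l') := by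
  have h1 := h.2
  have h2 := h'.2
  refine ⟨fun i hi => ?_, by simp; omega⟩
  rcases lt_or_ge i l.length with hl | hl
  · have := h.1 i hl
    rw [List.take_append_of_le_length hl.le]; omega
  · have h3 := h'.1 (i - l.length) (by simp at hi; omega)
    rw [List.take_append, List.take_of_length_le hl, List.map_append, List.sum_append]
    omega

/-- The concatenation of terms in preorder. -/
theorem isPolish_flatten {ls : List (List (Σ q, Term Γ σ q))} (h : ∀ l ∈ ls, IsPolish 1 l) :
    IsPolish ls.length ls.flatten := by
  induction ls with
  | nil => exact ⟨by simp, by simp⟩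
  | cons l ls ih =>
    exact (h l (by simp)).append (ih fun l hl => h l (by simp [hl]))

theorem isPolish_subs {p : S} (t : Term Γ σ p) : IsPolish 1 t.subs := by
  induction t with
  | var i => exact ⟨by simp [subs], by simp [subs, arity]⟩
  | op f args ih =>
    have h := isPolish_flatten (ls := List.ofFn fun j => (args j).subs) (by
      intro l hl
      obtain ⟨j, rfl⟩ := List.mem_ofFn.1 hl
      exact ih j)
    rw [List.length_ofFn] at h
    have h2 := h.2
    refine ⟨fun i hi => ?_, ?_⟩
    · cases i with
      | zero => simp
      | succ i =>
        have := h.1 i (by simpa [subs] using hi)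
        simp only [subs, List.take_succ_cons, List.map_cons, List.sum_cons, arity]
        omega
    · simp only [subs, List.map_cons, List.sum_cons, arity, List.length_cons]
      omega

theorem sum_arity_subs {p : S} (t : Term Γ σ p) : (t.subs.map arity).sum = t.size := by
  induction t with
  | var i => rfl
  | op f args ih =>
    simp only [subs, size, List.map_cons, List.sum_cons, arity, List.map_flatten, List.sum_flatten,
      List.map_ofFn, List.sum_ofFn, Function.comp_apply, ih]

/-- Every entry of the list is followed by its subterms. -/
def IsPreorder (l : List (Σ q, Term Γ σ q)) : Prop :=
  ∀ (i : ℕ) (h : i < l.length), ∃ r, l.drop i = l[i].2.subs ++ r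

theorem IsPreorder.append {l l' : List (Σ q, Term Γ σ q)} (h : IsPreorder l)
    (h' : IsPreorder l') : IsPreorder (l ++ l') := by
  intro i hi
  rcases lt_or_ge i l.length with hl | hl
  · obtain ⟨r, hr⟩ := h i hl
    exact ⟨r ++ l', by rw [List.drop_append_of_le_length hl.le, hr, List.append_assoc,
      List.getElem_append_left hl]⟩
  · obtain ⟨r, hr⟩ := h' (i - l.length) (by simp at hi; omega)
    refine ⟨r, ?_⟩
    rw [List.drop_append, List.drop_of_length_le hl, List.nil_append, hr,
      List.getElem_append_right hl]

theorem isPreorder_flatten {ls : List (List (Σ q, Term Γ σ q))} (h : ∀ l ∈ ls, IsPreorder l) :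
    IsPreorder ls.flatten := by
  induction ls with
  | nil => intro i hi; simp at hi
  | cons l ls ih => exact (h l (by simp)).append (ih fun l hl => h l (by simp [hl]))

theorem isPreorder_subs {p : S} (t : Term Γ σ p) : IsPreorder t.subs := by
  induction t with
  | var i =>
    intro j hj
    obtain rfl : j = 0 := by simpa [subs] using hj
    exact ⟨[], (List.append_nil _).symm⟩
  | op f args ih =>
    intro i hi
    cases i with
    | zero => exact ⟨[], (List.append_nil _).symm⟩
    | succ i =>
      exact isPreorder_flatten (ls := List.ofFn fun j => (args j).subs) (by
        intro l hl
        obtain ⟨j, rfl⟩ := List.mem_ofFn.1 hl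
        exact ih j) i (by simpa [subs] using hi)

theorem subs_eq_cons {p : S} (t : Term Γ σ p) : ∃ l, t.subs = ⟨p, t⟩ :: l := by
  cases t <;> exact ⟨_, rfl⟩

/-- Suppose that the lists `ls` stand one after the other in the list `L`, from position `p` on, and
are followed by `r`. If `ch` starts at `p`, and advances by the length of the list that it has
reached, then the `j`-th list stands at position `ch j`. -/
theorem drop_flatten {L r : List (Σ q, Term Γ σ q)} {ls : List (List (Σ q, Term Γ σ q))} {p : ℕ}
    (h : L.drop p = ls.flatten ++ r) (ch : ℕ → ℕ) (h0 : ch 0 = p)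
    (hs : ∀ (j : ℕ) (hj : j < ls.length),
      L.drop (ch j) = ls[j] ++ ((ls.drop (j + 1)).flatten ++ r) →
        ch (j + 1) = ch j + ls[j].length) {j : ℕ} (hj : j ≤ ls.length) :
    L.drop (ch j) = (ls.drop j).flatten ++ r ∧
      ch j + (ls.drop j).flatten.length = p + ls.flatten.length := by
  induction j with
  | zero => simp [h0, h]
  | succ j ih =>
    obtain ⟨h1, h2⟩ := ih (by omega)
    rw [List.drop_eq_getElem_cons (by omega : j < ls.length), List.flatten_cons] at h1 h2
    rw [List.append_assoc] at h1
    rw [hs j (by omega) h1, ← List.drop_drop, h1, List.drop_left]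
    refine ⟨rfl, ?_⟩
    rw [List.length_append] at h2
    omega

end

/-- The token of the root of a term. -/
def head {n : ℕ} {ρ : Fin n → S} (code : Γ.Symb ≃ Fin k) : (Σ q, Term Γ ρ q) → ℕ
  | ⟨_, var i⟩ => k + i
  | ⟨_, op f _⟩ => code f

theorem tokens_eq_map {n : ℕ} {ρ : Fin n → S} (code : Γ.Symb ≃ Fin k) {p : S} (t : Term Γ ρ p) :
    t.tokens code = t.subs.map (head code) := by
  induction t with
  | var i => rfl
  | op f args ih =>
    simp only [tokens, subs, List.map_cons, head, List.map_flatten, List.map_ofFn, ih]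
    rfl

end Term

namespace SLP

variable {S : Type u} {Γ : Signature.{u, v} S} {k : ℕ} (G : SLP Γ)

/-- All subterms of right-hand sides, in the order of the encoding. -/
def subs : List (Σ q, Term Γ G.sort q) := (List.ofFn fun X => (G.rhs X).subs).flatten

/-- The subterm at a position. -/
def sub (p : ℕ) : Σ q, Term Γ G.sort q := G.subs.getD p ⟨_, .var G.start⟩

/-- The end of the subterm at a position. -/
def fin (p : ℕ) : ℕ := p + (G.sub p).2.subs.length

/-- The position of an argument of the subterm at a position. -/
def child (p : ℕ) : ℕ → ℕ
  | 0 => p + 1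
  | j + 1 => G.fin (child p j)

/-- The position of the right-hand side of a variable. -/
def root : ℕ → ℕ
  | 0 => 0
  | i + 1 => G.fin (root i)

/-- The term `t` stands at position `p`. -/
def At (p : ℕ) {q : S} (t : Term Γ G.sort q) : Prop := ∃ r, G.subs.drop p = t.subs ++ r

variable {G}

theorem At.lt {p : ℕ} {q : S} {t : Term Γ G.sort q} (h : G.At p t) :
    p < G.subs.length ∧ G.sub p = ⟨q, t⟩ ∧ G.fin p = p + t.subs.length ∧
      G.fin p ≤ G.subs.length := by
  obtain ⟨r, hr⟩ := h
  obtain ⟨l, hl⟩ := t.subs_eq_cons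
  have hlt : p < G.subs.length := by
    by_contra hp
    rw [List.drop_of_length_le (by omega), hl] at hr
    simp at hr
  have hs : G.sub p = ⟨q, t⟩ := by
    rw [List.drop_eq_getElem_cons hlt, hl, List.cons_append, List.cons.injEq] at hr
    rw [sub, List.getD_eq_getElem _ _ hlt, hr.1]
  have hf : G.fin p = p + t.subs.length := by rw [fin, hs]
  have := congrArg List.length hr
  simp only [List.length_drop, List.length_append] at this
  exact ⟨hlt, hs, hf, by omega⟩

theorem at_sub {p : ℕ} (hp : p < G.subs.length) : G.At p (G.sub p).2 := by
  have : Term.IsPreorder G.subs := Term.isPreorder_flatten (by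
    intro l hl
    obtain ⟨X, rfl⟩ := List.mem_ofFn.1 hl
    exact Term.isPreorder_subs _)
  obtain ⟨r, hr⟩ := this p hp
  exact ⟨r, by rw [hr, sub, List.getD_eq_getElem _ _ hp]⟩

theorem At.child {p : ℕ} {f : Γ.Symb} {args : (j : Fin (Γ.rank f)) → Term Γ G.sort (Γ.dom f j)}
    (h : G.At p (.op f args)) : (∀ j : Fin (Γ.rank f), G.At (G.child p j) (args j)) ∧
      G.child p (Γ.rank f) = G.fin p ∧ ∀ j : Fin (Γ.rank f), p < G.child p j := by
  obtain ⟨r, hr⟩ := id h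
  have hd : G.subs.drop (p + 1) = (List.ofFn fun j => (args j).subs).flatten ++ r := by
    rw [← List.drop_drop, hr, Term.subs]; simp
  have key := fun j hj => Term.drop_flatten hd (G.child p) rfl (j := j) (fun j hj h => by
    have h1 : G.At (G.child p j) (args ⟨j, by simpa using hj⟩) := ⟨_, by rw [h, List.getElem_ofFn]⟩
    rw [SLP.child, h1.lt.2.2.1, List.getElem_ofFn]) hj
  have hat : ∀ j : Fin (Γ.rank f), G.At (G.child p j) (args j) := fun j => by
    have h1 := (key j (by simp [j.2.le])).1
    have hl : (j : ℕ) < (List.ofFn fun j => (args j).subs).length := by simp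
    rw [List.drop_eq_getElem_cons hl, List.flatten_cons, List.append_assoc] at h1
    exact ⟨_, by rw [h1, List.getElem_ofFn]⟩
  refine ⟨hat, ?_, fun j => ?_⟩
  · have h1 := (key (Γ.rank f) (by simp)).2
    rw [List.drop_of_length_le (by simp)] at h1
    rw [h.lt.2.2.1, Term.subs, List.length_cons]
    simp at h1 ⊢
    omega
  · have : ∀ j, p + 1 ≤ G.child p j := by
      intro j; induction j with
      | zero => exact le_rfl
      | succ j ih => rw [SLP.child, SLP.fin]; omega
    exact this j

theorem at_root (X : Fin G.card) : G.At (G.root X) (G.rhs X) := by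
  have key := fun j hj => Term.drop_flatten (L := G.subs) (p := 0) (r := [])
    (ls := List.ofFn fun X => (G.rhs X).subs) (by simp [subs]) G.root rfl (j := j) (fun j hj h => by
    have h1 : G.At (G.root j) (G.rhs ⟨j, by simpa using hj⟩) := ⟨_, by rw [h, List.getElem_ofFn]⟩
    rw [SLP.root, h1.lt.2.2.1, List.getElem_ofFn]) hj
  have h1 := (key X (by simp [X.2.le])).1
  have hl : (X : ℕ) < (List.ofFn fun X => (G.rhs X).subs).length := by simp
  rw [List.drop_eq_getElem_cons hl, List.flatten_cons, List.append_assoc] at h1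
  exact ⟨_, by rw [h1, List.getElem_ofFn]⟩

end SLP

/-! ### The nodes of a straight-line program -/

section

namespace Term

variable {S : Type u} {Γ : Signature.{u, v} S} {k n : ℕ} {ρ : Fin n → S}

theorem head_lt (code : Γ.Symb ≃ Fin k) (t : Σ q, Term Γ ρ q) : head code t < k + n := by
  rcases t with ⟨_, i | ⟨f, _⟩⟩
  · exact Nat.add_lt_add_left i.2 k
  · exact (code f).2.trans_le (Nat.le_add_right _ _)

end Term

variable {S : Type u} {Γ : Signature.{u, v} S} {k : ℕ}

/-- The number of arguments of the symbol that is denoted by a token. -/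
def tokRank (code : Γ.Symb ≃ Fin k) (t : ℕ) : ℕ :=
  if h : t < k then Γ.rank (code.symm ⟨t, h⟩) else 0

theorem tokRank_head {n : ℕ} {ρ : Fin n → S} (code : Γ.Symb ≃ Fin k) (t : Σ q, Term Γ ρ q) :
    tokRank code (Term.head code t) = Term.arity t := by
  rcases t with ⟨_, i | ⟨f, _⟩⟩ <;> simp [tokRank, Term.head, Term.arity]

namespace SLP

variable (G : SLP Γ) (code : Γ.Symb ≃ Fin k)

/-- The token at a position. -/
def tok (p : ℕ) : ℕ := Term.head code (G.sub p)

/-- The ground term that is derived from the subterm at a position. -/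
def tree (p : ℕ) : Σ q, GroundTerm Γ q := ⟨_, (G.sub p).2.subst G.val⟩

/-- The number of variables that can be reached from a variable. -/
noncomputable def below (X : Fin G.card) : ℕ :=
  {Y | Relation.TransGen (fun Y Z => (G.rhs Y).Occurs Z) X Y}.ncard

/-- A measure that decreases if a variable is replaced by its right-hand side, which does not change
the derived tree. -/
noncomputable def chain : (Σ q, Term Γ G.sort q) → ℕ
  | ⟨_, .var X⟩ => G.below X + 1
  | ⟨_, .op _ _⟩ => 0

theorem below_lt (X : Fin G.card) : G.below X < G.card := by
  have := Set.ncard_lt_card (s := {Y | Relation.TransGen (fun Y Z => (G.rhs Y).Occurs Z) X Y})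
    fun h => G.acyclic X ((Set.eq_univ_iff_forall.1 h) X)
  rwa [Nat.card_eq_fintype_card, Fintype.card_fin] at this

theorem chain_le (t : Σ q, Term Γ G.sort q) : G.chain t ≤ G.card := by
  rcases t with ⟨_, X | _⟩
  · exact G.below_lt X
  · exact Nat.zero_le _

/-- A term whose variables occur in the right-hand side of `X` has a smaller measure than `X`. -/
theorem chain_lt {X : Fin G.card} {q : S} {t : Term Γ G.sort q}
    (h : ∀ Y, t.Occurs Y → (G.rhs X).Occurs Y) : G.chain ⟨q, t⟩ < G.below X + 1 := by
  cases t with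
  | op f args => exact Nat.succ_pos _
  | var Y =>
    have hXY := Relation.TransGen.single (r := fun Y Z => (G.rhs Y).Occurs Z) (h Y rfl)
    exact Nat.succ_lt_succ (Set.ncard_lt_ncard ⟨fun Z hZ => hXY.trans hZ,
      fun h' => G.acyclic Y (h' hXY)⟩ (Set.toFinite _))

variable {G code}

theorem exists_op {p : ℕ} (hp : p < G.subs.length) (h : G.tok code p < k) :
    ∃ (f : Γ.Symb) (args : (j : Fin (Γ.rank f)) → Term Γ G.sort (Γ.dom f j)),
      G.sub p = ⟨_, .op f args⟩ ∧ G.At p (.op f args) ∧ G.tok code p = code f := by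
  have ha := at_sub hp
  rcases e : G.sub p with ⟨q, X | ⟨f, args⟩⟩
  · rw [tok, e, Term.head] at h; omega
  · rw [e] at ha
    exact ⟨f, args, rfl, ha, by rw [tok, e]; rfl⟩

theorem exists_var {p : ℕ} (h : k ≤ G.tok code p) :
    ∃ X : Fin G.card, G.sub p = ⟨_, .var X⟩ ∧ G.tok code p = k + X := by
  rcases e : G.sub p with ⟨q, X | ⟨f, args⟩⟩
  · exact ⟨X, rfl, by rw [tok, e]; rfl⟩
  · rw [tok, e, Term.head] at h
    have := (code f).2
    omega

theorem tree_of_sub {p : ℕ} {q : S} {t : Term Γ G.sort q} (h : G.sub p = ⟨q, t⟩) :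
    G.tree p = ⟨q, t.subst G.val⟩ := by
  rw [tree, h]

theorem tree_root (X : Fin G.card) : G.tree (G.root X) = ⟨_, G.val X⟩ := by
  rw [tree_of_sub (at_root X).lt.2.1, ← G.val_eq]

theorem tree_child {p : ℕ} {f : Γ.Symb} {args : (j : Fin (Γ.rank f)) → Term Γ G.sort (Γ.dom f j)}
    (h : G.At p (.op f args)) (j : Fin (Γ.rank f)) :
    G.tree (G.child p j) = ⟨_, (args j).subst G.val⟩ :=
  tree_of_sub (h.child.1 j).lt.2.1

theorem tree_root_tok {p : ℕ} (h : k ≤ G.tok code p) :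
    G.tree (G.root (G.tok code p - k)) = G.tree p := by
  obtain ⟨X, hX, e⟩ := exists_var h
  rw [e, Nat.add_sub_cancel_left, tree_root, tree_of_sub hX]
  rfl

theorem size_tree_child_lt {p : ℕ} (hp : p < G.subs.length) {j : ℕ}
    (hj : j < tokRank code (G.tok code p)) :
    (G.tree (G.child p j)).2.size < (G.tree p).2.size := by
  have h : G.tok code p < k := by
    by_contra h
    rw [tokRank, dif_neg h] at hj
    omega
  obtain ⟨f, args, hs, ha, e⟩ := exists_op hp h
  rw [tok, tokRank_head, hs] at hj
  change j < Γ.rank f at hj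
  rw [tree_child ha ⟨j, hj⟩, tree_of_sub hs]
  have := Finset.single_le_sum (f := fun j => ((args j).subst G.val).size) (by simp)
    (Finset.mem_univ ⟨j, hj⟩)
  simp only [Term.subst, Term.size] at this ⊢
  omega

theorem isPolish_subs : Term.IsPolish G.card G.subs := by
  have := Term.isPolish_flatten (ls := List.ofFn fun X => (G.rhs X).subs) (by
    intro l hl
    obtain ⟨X, rfl⟩ := List.mem_ofFn.1 hl
    exact Term.isPolish_subs _)
  rwa [List.length_ofFn] at this

theorem length_subs : G.subs.length = G.size + G.card := by
  rw [← isPolish_subs.2, add_comm, subs, size, List.map_flatten, List.sum_flatten]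
  simp only [List.map_ofFn, Function.comp_def, Term.sum_arity_subs, List.sum_ofFn]

theorem sum_tokRank {i : ℕ} (hi : i ≤ G.subs.length) :
    ∑ p ∈ Finset.range i, tokRank code (G.tok code p) = ((G.subs.take i).map Term.arity).sum := by
  induction i with
  | zero => simp
  | succ i ih =>
    rw [Finset.sum_range_succ, ih (by omega), List.take_succ_eq_append_getElem (by omega),
      List.map_append, List.sum_append, tok, tokRank_head, sub, List.getD_eq_getElem _ _ hi]
    rfl

variable (G code)

/-- The sequence of tokens of a straight-line program. -/
noncomputable def source (R : ℕ) : Source k R (tokRank code) where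
  N := G.subs.length
  card := G.card
  start := G.start
  tok := G.tok code
  fin := G.fin
  root := G.root
  μ p := (G.tree p).2.size * (G.card + 1) + G.chain (G.sub p)
  ch := G.child
  tok_lt _ _ := Term.head_lt code _
  pend i hi := by rw [sum_tokRank hi.le]; exact isPolish_subs.1 i hi
  pend_end := by rw [sum_tokRank le_rfl, List.take_length]; exact isPolish_subs.2
  ch_zero _ := rfl
  ch_succ _ _ _ _ := rfl
  fin_eq p hp := by
    rcases lt_or_ge (G.tok code p) k with h | h
    · obtain ⟨f, args, hs, ha, e⟩ := exists_op hp h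
      rw [tok, tokRank_head, hs]
      exact ha.child.2.1.symm
    · obtain ⟨X, hX, e⟩ := exists_var h
      rw [tok, tokRank_head, fin, hX]
      rfl
  fin_le p hp := (at_sub hp).lt.2.2.2
  ch_lt p hp j hj := by
    rcases lt_or_ge (G.tok code p) k with h | h
    · obtain ⟨f, args, hs, ha, e⟩ := exists_op hp h
      rw [tok, tokRank_head, hs] at hj
      exact ⟨ha.child.2.2 ⟨j, hj⟩, (ha.child.1 ⟨j, hj⟩).lt.1⟩
    · rw [tokRank, dif_neg h.not_gt] at hj
      omega
  root_zero := rfl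
  root_succ _ _ := rfl
  root_lt i hi := (at_root ⟨i, hi⟩).lt.1
  μ_ch p hp j hj := by
    have h1 := size_tree_child_lt hp hj
    have h2 := G.chain_le (G.sub (G.child p j))
    have h3 := Nat.mul_le_mul_right (G.card + 1) h1
    rw [Nat.succ_mul] at h3
    omega
  μ_root p hp h := by
    rw [tree_root_tok h]
    obtain ⟨X, hX, e⟩ := exists_var h
    rw [e, Nat.add_sub_cancel_left, hX, (at_root X).lt.2.1]
    exact Nat.add_lt_add_left (G.chain_lt fun _ h => h) _

theorem encode_eq : G.encode code = G.card :: G.start :: G.subs.map (Term.head code) := by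
  simp only [encode, subs, List.map_flatten, List.map_ofFn, Function.comp_def, Term.tokens_eq_map]

theorem lt_of_mem_encode {x : ℕ} (h : x ∈ G.encode code) : x < k + G.card + 1 := by
  rw [encode_eq, List.mem_cons, List.mem_cons, List.mem_map] at h
  rcases h with rfl | rfl | ⟨y, -, rfl⟩
  · omega
  · have := G.start.2; omega
  · have := Term.head_lt code y; omega

theorem source_isInput (R : ℕ) :
    (G.source code R).IsInput ((RAM.State.init (G.encode code)).mem 0) := by
  rw [encode_eq]
  refine ⟨rfl, rfl, fun p hp => ?_⟩
  change p < G.subs.length at hp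
  simp [RAM.State.init, source, tok, sub, List.getElem?_eq_getElem hp]

end SLP

end

/-! ### The graph of a straight-line program -/

section

variable {S : Type u} {Γ : Signature.{u, v} S} {A : SortedAlgebra.{u, v, w} Γ} {k : ℕ}

namespace SLP

variable (G : SLP Γ) (code : Γ.Symb ≃ Fin k)

/-- The graph that results from the replacement of variables by the nodes they stand for: the node
`u`, which comes at some place `a` in the topological order `q`, is replaced by the node `rep u`,
the nodes for variables have no children, and the other nodes have the children `ch u j`. -/
structure IsResolved (R : ℕ) (q deg rep : ℕ → ℕ) (ch : ℕ → ℕ → ℕ) : Prop where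
  order : (G.source code R).graph.IsOrder q
  node : ∀ a < G.subs.length, deg (q a) = tokRank code (G.tok code (q a)) ∧
    (∃ b, a ≤ b ∧ b < G.subs.length ∧ q b = rep (q a)) ∧ G.tok code (rep (q a)) < k ∧
    G.tree (rep (q a)) = G.tree (q a) ∧
    ∀ j < deg (q a), (G.source code R).Replaces G.tree q a (ch (q a) j)
      ((G.source code R).child (q a) j)

namespace IsResolved

variable {G code} {R : ℕ} {q deg rep : ℕ → ℕ} {ch : ℕ → ℕ → ℕ}
  (h : G.IsResolved code R q deg rep ch)

include h

theorem exists_index {u : ℕ} (hu : u < G.subs.length) : ∃ a < G.subs.length, q a = u :=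
  Graph.surj_of_inj h.order.lt h.order.inj hu

theorem deg_eq {u : ℕ} (hu : u < G.subs.length) : deg u = tokRank code (G.tok code u) := by
  obtain ⟨a, ha, rfl⟩ := h.exists_index hu
  exact (h.node a ha).1

theorem lt_of_lt_deg {u j : ℕ} (hu : u < G.subs.length) (hj : j < deg u) : G.tok code u < k := by
  by_contra hk
  rw [h.deg_eq hu, tokRank, dif_neg hk] at hj
  omega

theorem rep_spec {u : ℕ} (hu : u < G.subs.length) :
    rep u < G.subs.length ∧ G.tok code (rep u) < k ∧ G.tree (rep u) = G.tree u := by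
  obtain ⟨a, ha, rfl⟩ := h.exists_index hu
  obtain ⟨-, ⟨b, -, hb, e⟩, h1, h2, -⟩ := h.node a ha
  exact ⟨e ▸ h.order.lt b hb, h1, h2⟩

theorem ch_spec {u j : ℕ} (hu : u < G.subs.length) (hj : j < deg u) :
    ch u j < G.subs.length ∧ G.tok code (ch u j) < k ∧ G.tree (ch u j) = G.tree (G.child u j) := by
  have hk := h.lt_of_lt_deg hu hj
  obtain ⟨a, ha, rfl⟩ := h.exists_index hu
  obtain ⟨h1, h2, b, -, hb, e⟩ := (h.node a ha).2.2.2.2 j hj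
  rw [Source.child, if_pos (show (G.source code R).tok (q a) < k from hk)] at h2
  exact ⟨e ▸ h.order.lt b hb, h1, h2⟩

/-- The derivation tree at a node for a symbol. -/
theorem tree_op {u : ℕ} (hu : u < G.subs.length) (hk : G.tok code u < k) :
    ∃ (f : Γ.Symb) (t : (j : Fin (Γ.rank f)) → GroundTerm Γ (Γ.dom f j)),
      G.tok code u = code f ∧ deg u = Γ.rank f ∧ G.tree u = ⟨_, .op f t⟩ ∧
      ∀ j : Fin (Γ.rank f), G.tree (ch u j) = ⟨_, t j⟩ := by
  obtain ⟨f, args, hs, ha, e⟩ := exists_op hu hk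
  have hd : deg u = Γ.rank f := by rw [h.deg_eq hu, tok, tokRank_head, hs]; rfl
  exact ⟨f, fun j => (args j).subst G.val, e, hd, tree_of_sub hs, fun j => by
    rw [(h.ch_spec hu (j.2.trans_eq hd.symm)).2.2, tree_child ha]⟩

/-- The graph; it unfolds into the derivation trees. -/
noncomputable def dag : Dag where
  N := G.subs.length
  deg := deg
  ch := ch
  μ u := if G.tok code u < k then (G.tree u).2.size + 1 else 1
  ch_lt u hu j hj := (h.ch_spec hu hj).1
  μ_lt u hu j hj := by
    obtain ⟨-, h1, h2⟩ := h.ch_spec hu hj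
    rw [if_pos h1, if_pos (h.lt_of_lt_deg hu hj), h2]
    exact Nat.succ_lt_succ (size_tree_child_lt hu (h.deg_eq hu ▸ hj))
  root := rep (G.root G.start)
  root_lt := (h.rep_spec (at_root G.start).lt.1).1
  μ_eq u hu := by
    split_ifs with hk
    · obtain ⟨f, t, -, hd, ht, hc⟩ := h.tree_op hu hk
      rw [ht, hd, Finset.sum_range, Term.size]
      have : ∀ j : Fin (Γ.rank f), (if G.tok code (ch u j) < k then
          (G.tree (ch u j)).2.size + 1 else 1) = (t j).size + 1 := fun j => by
        rw [if_pos (h.ch_spec hu (j.2.trans_eq hd.symm)).2.1, hc j]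
      simp only [this, Finset.sum_add_distrib, Finset.sum_const, Finset.card_univ, Fintype.card_fin,
        smul_eq_mul, mul_one]
      omega
    · rw [h.deg_eq hu, tokRank, dif_neg hk]
      rfl

theorem tree_dag_root : G.tree h.dag.root = ⟨_, G.derivationTree⟩ :=
  (h.rep_spec (at_root G.start).lt.1).2.2.trans (tree_root G.start)

theorem μ_dag_root : h.dag.μ h.dag.root = G.derivationTree.size + 1 := by
  have h1 : h.dag.μ h.dag.root = (G.tree h.dag.root).2.size + 1 :=
    if_pos (h.rep_spec (at_root G.start).lt.1).2.1
  rw [h1, h.tree_dag_root]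

theorem isOrder_dag : h.dag.IsOrder q where
  lt := h.order.lt
  inj := h.order.inj
  topo a ha j hj := (((h.node a ha).2.2.2.2 j hj).2.2)

/-- Only nodes for symbols can be reached from the root. -/
theorem tok_lt_of_paths_pos {u : ℕ} (hp : 0 < h.dag.paths u) : G.tok code u < k := by
  rw [h.dag.paths_eq] at hp
  by_cases hr : h.dag.root = u
  · exact hr ▸ (h.rep_spec (at_root G.start).lt.1).2.1
  · rw [if_neg hr, zero_add] at hp
    obtain ⟨v, hv, h0⟩ := Finset.exists_ne_zero_of_sum_ne_zero hp.ne'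
    obtain ⟨j, hj, rfl⟩ := h.dag.edges_ne_zero.1 (right_ne_zero_of_mul h0)
    exact (h.ch_spec (Finset.mem_range.1 hv) hj).2.1

theorem sum_deg : ∑ u ∈ Finset.range h.dag.N, h.dag.deg u = G.size := by
  have h1 := (G.source code R).pend_end
  have h2 := G.length_subs
  change G.card + ∑ p ∈ Finset.range G.subs.length, tokRank code (G.tok code p) =
    G.subs.length at h1
  change ∑ u ∈ Finset.range G.subs.length, deg u = G.size
  rw [Finset.sum_congr rfl fun u hu => h.deg_eq (Finset.mem_range.1 hu)]
  omega

theorem deg_le (hR : ∀ f, Γ.rank f ≤ R) {u : ℕ} (hu : u < G.subs.length) : deg u ≤ R := by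
  rw [h.deg_eq hu, tokRank]
  split_ifs
  · exact hR _
  · exact Nat.zero_le _

variable {L : Base A} (c : Coding L k)

/-- The centroid decomposition of the graph. -/
noncomputable def plan (hR : c.R = R) {nx pv E X : ℕ → ℕ}
    (hd : h.dag.Decomp nx pv E X) : Plan where
  toNumbering := c.numbering
  D := h.dag
  tok := G.tok code
  nx := nx
  pv := pv
  E := E
  X := X
  dec := hd
  tok_lt _ _ hp := h.tok_lt_of_paths_pos hp
  deg_le _ hu := hR ▸ h.deg_le (fun f => hR ▸ c.rank_le f) hu

open Classical in
/-- The nodes are labelled by their symbols and by the values of their derivation trees. -/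
noncomputable def labelling (hc : c.code = code) (hR : c.R = R) {nx pv E X : ℕ → ℕ}
    (hd : h.dag.Decomp nx pv E X) : Labelling c (h.plan c hR hd) where
  sym u := if hu : G.tok code u < k then code.symm ⟨_, hu⟩ else L.c₀
  val u := ⟨_, (G.tree u).2.groundEval A⟩
  num_eq := rfl
  tok_eq u hu hp := by
    rw [dif_pos (h.tok_lt_of_paths_pos hp), hc, Equiv.apply_symm_apply]
    rfl
  deg_eq u hu hp := by
    have hk := h.tok_lt_of_paths_pos hp
    rw [dif_pos hk]
    exact (h.deg_eq hu).trans (dif_pos hk)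
  val_eq u hu hp := by
    have hk := h.tok_lt_of_paths_pos hp
    obtain ⟨f, t, e, -, ht, hc⟩ := h.tree_op hu hk
    have hf : code.symm ⟨_, hk⟩ = f := by
      rw [Equiv.symm_apply_eq]; exact Fin.ext e
    rw [dif_pos hk, hf]
    refine ⟨fun j => (t j).groundEval A, fun j => ?_, ?_⟩
    · change (⟨_, (G.tree (ch u j)).2.groundEval A⟩ : Σ p, A.carrier p) = _
      rw [hc j]
    · rw [ht]; rfl

end IsResolved

end SLP

end

/-! ### From the input to the graph -/

namespace RAM

open Program CircuitBalancing.RAM.Expr State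

variable {S : Type u} {Γ : Signature.{u, v} S} {B V k R : ℕ}

/-- Store two tables, parse the input, and replace variables by the nodes they stand for. -/
def buildGraph (k R : ℕ) (rank f : ℕ → ℕ) (n : ℕ) : Program :=
  seq (fillTable .rank rank k) <| seq (fillTable .tyOf f n) <| seq scan <| seq (parse R) <|
    seq findRoots <| seq (link k R) <| seq initQueue <| seq (topSort R) (resolve k R)

theorem reaches_buildGraph (G : SLP Γ) (code : Γ.Symb ≃ Fin k) (hR : ∀ f, Γ.rank f ≤ R)
    (hR1 : 1 ≤ R) {f : ℕ → ℕ} {n : ℕ} (hf : ∀ t < n, f t ≤ V)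
    (hV : G.subs.length * (R + 1) + R ≤ V)
    (hB : (buildGraph k R (tokRank code) f n).coef * (V + 1) ≤ B)
    (hs : (State.init (G.encode code)).Bd V) :
    (buildGraph k R (tokRank code) f n).Reaches B V (State.init (G.encode code))
      ((buildGraph k R (tokRank code) f n).wcost * (G.subs.length + 1)) fun s =>
        s.r .len = G.subs.length ∧ (∀ t < n, s.m .tyOf t = f t) ∧
        (∀ i < G.card, s.m .root i = G.root i) ∧
        G.IsResolved code R (s.m .queue) (s.m .deg) (s.m .rep) fun u j => s.m (.ch j) u := by
  have hrank : ∀ t, tokRank code t ≤ R := fun t => by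
    rw [tokRank]; split_ifs
    exacts [hR _, Nat.zero_le _]
  have hNV : G.subs.length + R ≤ V := by nlinarith
  have hdegR : ∀ p < G.subs.length, (G.source code R).deg p ≤ R := fun p _ => by
    rw [Source.deg]; split_ifs
    exacts [hrank _, hR1]
  have hin := G.source_isInput code R
  have hz : ∀ a : Arr, a.num ≠ 0 → ∀ i, (State.init (G.encode code)).m a i = 0 :=
    fun a ha i => if_neg ha
  refine ((sat_fillTable .rank _ k (fun t _ => (hrank t).trans (by omega))
    (hz _ (by simp [Arr.num])))
    |>.reaches' hs (coef_seq_left hB) _).seq' fun s1 b1 ⟨h1, f1⟩ => ?_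
  replace hB := coef_seq_right hB
  have r1 : ∀ t, s1.m .rank t = tokRank code t := fun t => by
    rw [h1]; split_ifs with h
    exacts [rfl, by rw [tokRank, dif_neg h]]
  have z1 : ∀ a : Arr, a.num ≠ 0 → a ≠ .rank → ∀ i, s1.m a i = 0 := fun a h0 ha i => by
    rw [f1.1 a (by simp [fillTable, ha]), hz a h0]
  rw [← show s1.m .tok = (State.init (G.encode code)).mem 0 from
    f1.1 _ (by simp [fillTable])] at hin
  clear h1 f1 hz hs
  refine ((sat_fillTable .tyOf f n hf (z1 _ (by simp [Arr.num]) (by simp))).reaches' b1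
    (coef_seq_left hB) _).seq' fun s2 b2 ⟨h2, f2⟩ => ?_
  replace hB := coef_seq_right hB
  have t2 : ∀ t < n, s2.m .tyOf t = f t := fun t ht => by rw [h2, if_pos ht]
  rw [← show s2.m .tok = s1.m .tok from f2.1 _ (by simp [fillTable])] at hin
  rw [← show s2.m .rank = s1.m .rank from f2.1 _ (by simp [fillTable])] at r1
  have z2 : ∀ i, s2.m .ind i = 0 := fun i => by
    rw [f2.1 _ (by simp [fillTable]), z1 _ (by simp [Arr.num]) (by simp)]
  clear h2 f2 z1 b1
  refine (reaches_scan (G.source code R) (coef_seq_left hB) (show G.subs.length ≤ V by omega) b2 hin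
    r1).frame.seq' fun s3 b3 ⟨⟨l3, c3⟩, f3⟩ => ?_
  replace hB := coef_seq_right hB
  have m3 : s3.m = s2.m := funext fun a => f3.1 a (by simp [scan])
  rw [← m3] at hin r1 t2 z2
  clear f3 m3 b2
  refine (reaches_parse (G.source code R) (coef_seq_left hB) hNV hrank b3 hin r1 l3).seq'
    fun s4 b4 ⟨h4, f4⟩ => ?_
  replace hB := coef_seq_right hB
  rw [← show s4.m .tok = s3.m .tok from f4.1 _ (by simp [parse])] at hin
  rw [← show s4.m .tyOf = s3.m .tyOf from f4.1 _ (by simp [parse])] at t2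
  rw [← show s4.m .ind = s3.m .ind from f4.1 _ (by simp [parse])] at z2
  rw [← show s4.r .len = s3.r .len from f4.2 _ (by simp [parse])] at l3
  rw [← show s4.r .card = s3.r .card from f4.2 _ (by simp [parse])] at c3
  clear f4 b3 r1
  refine (reaches_findRoots (G.source code R) (coef_seq_left hB)
    (show G.subs.length ≤ V by omega) b4
    (fun p hp => (h4 p hp).1) c3).frame.seq' fun s5 b5 ⟨h5, f5⟩ => ?_
  replace hB := coef_seq_right hB
  have m5 : ∀ a : Arr, a ≠ .root → s5.m a = s4.m a := fun a ha => f5.1 a (by simp [findRoots, ha])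
  rw [← m5 _ (by simp)] at hin t2 z2
  rw [← show s5.r .len = s4.r .len from f5.2 _ (by simp [findRoots])] at l3
  refine (reaches_link (G.source code R) (coef_seq_left hB) hV hrank hR1 b5 hin l3
    (fun p hp => by rw [m5 _ (by simp)]; exact (h4 p hp).2.1)
    (fun p hp j hj => by rw [m5 _ (by simp)]; exact (h4 p hp).2.2 j hj) h5 z2).frame.seq'
    fun s6 b6 ⟨⟨h6, i6⟩, f6⟩ => ?_
  replace hB := coef_seq_right hB
  rw [← show s6.m .tok = s5.m .tok from f6.1 _ (by simp [link])] at hin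
  rw [← show s6.m .tyOf = s5.m .tyOf from f6.1 _ (by simp [link])] at t2
  rw [← show s6.m .root = s5.m .root from f6.1 _ (by simp [link])] at h5
  rw [← show s6.r .len = s5.r .len from f6.2 _ (by simp [link])] at l3
  clear f6 m5 f5 h4 c3 b4 b5 z2
  refine (reaches_initQueue (G.source code R).graph (coef_seq_left hB)
    (show G.subs.length ≤ V by omega) b6 l3 i6).frame.seq' fun s7 b7 ⟨h7, f7⟩ => ?_
  replace hB := coef_seq_right hB
  have m7 : ∀ a : Arr, a ≠ .queue → s7.m a = s6.m a := fun a ha => f7.1 a (by simp [initQueue, ha])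
  rw [← m7 _ (by simp)] at hin t2 h5
  rw [← show s7.r .len = s6.r .len from f7.2 _ (by simp [initQueue])] at l3
  have h7' : ∀ p < G.subs.length, s7.m .deg p = (G.source code R).deg p ∧
      ∀ j < (G.source code R).deg p, s7.m (.ch j) p = (G.source code R).child p j := fun p hp => by
    rw [m7 _ (by simp)]
    exact ⟨(h6 p hp).1, fun j hj => by rw [m7 _ (by simp)]; exact (h6 p hp).2 j hj⟩
  clear f7 m7 i6 b6 h6
  refine (reaches_topSort (G.source code R).graph (coef_seq_left hB) hV hdegR b7 l3
    (fun p hp => (h7' p hp).1) (fun p hp j hj => (h7' p hp).2 j hj) h7).frame.seq'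
    fun s8 b8 ⟨h8, f8⟩ => ?_
  replace hB := coef_seq_right hB
  have m8 : ∀ a : Arr, a ≠ .queue → a ≠ .ind → s8.m a = s7.m a := fun a ha hb =>
    f8.1 a (by simp [topSort, ha, hb])
  rw [← m8 _ (by simp) (by simp)] at hin t2 h5
  rw [← show s8.r .len = s7.r .len from f8.2 _ (by simp [topSort])] at l3
  refine (reaches_resolve (G.source code R) G.tree
    (fun p hp hk => ?_) hB hNV hdegR b8 hin l3
    (fun p hp => by rw [m8 _ (by simp) (by simp)]; exact (h7' p hp).1)
    (fun p hp j hj => by rw [m8 _ (by simp) (by simp)]; exact (h7' p hp).2 j hj)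
    h8).frame.mono le_rfl
    fun s9 b9 ⟨h9, f9⟩ => ?_
  · rw [Source.child, if_neg hk.not_gt]
    exact SLP.tree_root_tok hk
  · rw [← show s9.m .tyOf = s8.m .tyOf from f9.1 _ (by simp [resolve])] at t2
    rw [← show s9.m .root = s8.m .root from f9.1 _ (by simp [resolve])] at h5
    rw [← show s9.r .len = s8.r .len from f9.2 _ (by simp [resolve])] at l3
    rw [← show s9.m .queue = s8.m .queue from f9.1 _ (by simp [resolve])] at h8 h9
    refine ⟨l3, t2, h5, h8, fun a ha => ?_⟩
    obtain ⟨e, h⟩ := h9 a ha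
    refine ⟨e.trans ?_, h⟩
    change (if G.tok code (s9.m .queue a) < k then _ else _) = _
    split_ifs with hk
    exacts [rfl, by rw [tokRank, dif_neg hk]]

end RAM

/-! ### The balancing program -/

namespace RAM

open Program CircuitBalancing.RAM.Expr State

variable {S : Type u} {Γ : Signature.{u, v} S} {A : SortedAlgebra.{u, v, w} Γ} {k : ℕ}
  {L : Base A} {B V : ℕ} (c : Coding L k)

/-- The program that balances straight-line programs. -/
noncomputable def balance : Program :=
  seq (buildGraph k c.R (tokRank c.code) c.numbering.tyOf c.numbering.size) <|
    seq (countPaths c.R) <| seq (decompose c.R) <| seq (mergePaths c.numbering)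
      (emitAll k (L.m + 1) (fun t => (c.template t).items c.code) c.numbering.size)

/-- A bound for the length of the text of a template. -/
noncomputable def maxItems : ℕ :=
  ∑ t ∈ Finset.range c.numbering.size, ((c.template t).items c.code).length

theorem writes_buildGraph {R n : ℕ} {rank f : ℕ → ℕ} {a : Arr}
    (h : (buildGraph k R rank f n).Writes a.num) : a ≠ .tok ∧ a ≠ .pi ∧ a ≠ .pp ∧ a ≠ .ent ∧
      a ≠ .pv ∧ a ≠ .tid := by
  simp only [buildGraph, fillTable, scan, parse, findRoots, link, initQueue, topSort, resolve,
    writes_seq, writes_unroll, writes_upTo, writes_forTo, writes_put, writes_set, writes_loop,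
    writes_branch, writes_skip] at h
  aesop

/-- The number of steps of the balancing program per node. -/
noncomputable def balanceCost : ℕ :=
  (buildGraph k c.R (tokRank c.code) c.numbering.tyOf c.numbering.size).wcost +
    (countPaths c.R).wcost + (decompose c.R).wcost + mergeCost c.numbering +
      3 * (emitAll k (L.m + 1) (fun t => (c.template t).items c.code) c.numbering.size).wcost

/-- The parts of the program are composed; `V` bounds all words that they store. -/
theorem reaches_balance (hR1 : 1 ≤ c.R) (G : SLP Γ)
    (hV : G.subs.length * (c.R + 3 * (L.m + 1) + 3 * maxItems c + 4) + 8 * G.derivationTree.size +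
      (c.R + c.numbering.size + c.nC + k + 18) ≤ V)
    (hB : (balance c).coef * (V + 1) ≤ B) :
    (balance c).Reaches B V (State.init (G.encode c.code))
      (balanceCost c * (G.subs.length + 1)) fun s => ∃ H : SLP Γ, s.Outputs (H.encode c.code) ∧
        H.value A = G.value A ∧ H.size ≤ 3 * c.sizeBound * G.size ∧
        H.depth ≤ c.depthBound * (48 * Nat.log 2 (G.derivationTree.size + 1) + 1) := by
  obtain ⟨N, hN⟩ : ∃ N, N = G.subs.length := ⟨_, rfl⟩
  have hcard : G.card ≤ N := by have := G.length_subs; omega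
  have hV1 : N * (c.R + 1) + N * (3 * (L.m + 1)) + N * (3 * maxItems c) + 3 * N +
      8 * G.derivationTree.size + (c.R + c.numbering.size + c.nC + k + 18) ≤ V := by
    rw [← hN] at hV; linarith
  have hNR : N ≤ N * (c.R + 1) := Nat.le_mul_of_pos_right _ (by omega)
  have hs : (State.init (G.encode c.code)).Bd V := by
    refine ⟨fun x => Nat.zero_le _, fun a i => ?_⟩
    simp only [State.init]
    split_ifs
    · rcases lt_or_ge i (G.encode c.code).length with hi | hi
      · rw [List.getD_eq_getElem _ _ hi]
        have := G.lt_of_mem_encode c.code (List.getElem_mem hi)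
        omega
      · rw [List.getD_eq_default _ _ hi]; exact Nat.zero_le _
    · exact Nat.zero_le _
  have key := (reaches_buildGraph G c.code c.rank_le hR1 (f := c.numbering.tyOf)
    (n := c.numbering.size) (V := V) (B := B) (fun t _ => (c.numbering.tyOf_lt t).le.trans (by
      change c.nC + 1 ≤ V; omega)) (by rw [← hN]; omega) (coef_seq_left hB) hs).frame
  have fin := key.seq (P' := seq (countPaths c.R) <| seq (decompose c.R) <|
    seq (mergePaths c.numbering)
      (emitAll k (L.m + 1) (fun t => (c.template t).items c.code) c.numbering.size))
    (t' := (countPaths c.R).wcost * (G.subs.length + 1) + ((decompose c.R).wcost *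
      (G.subs.length + 1) + (mergeCost c.numbering * (G.subs.length + 1) + (emitAll k (L.m + 1)
        (fun t => (c.template t).items c.code) c.numbering.size).wcost * (3 * N + 1))))
    (R := fun s => ∃ H : SLP Γ, s.Outputs (H.encode c.code) ∧
        H.value A = G.value A ∧ H.size ≤ 3 * c.sizeBound * G.size ∧
        H.depth ≤ c.depthBound * (48 * Nat.log 2 (G.derivationTree.size + 1) + 1)) ?_
  · refine fin.mono ?_ fun s _ h => h
    have := Nat.mul_le_mul_left (emitAll k (L.m + 1) (fun t => (c.template t).items c.code)
      c.numbering.size).wcost (show 3 * N + 1 ≤ 3 * (N + 1) by omega)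
    rw [← hN, balanceCost]
    linarith
  replace hB := coef_seq_right hB
  rintro s1 b1 ⟨⟨l1, t1, r1, h1⟩, f1⟩
  have w1 : ∀ a : Arr, (a = .tok ∨ a = .pi ∨ a = .pp ∨ a = .ent ∨ a = .pv ∨ a = .tid) →
      s1.m a = (State.init (G.encode c.code)).m a := fun a ha => f1.1 a fun h => by
    have := writes_buildGraph h; tauto
  have z1 : ∀ a : Arr, (a = .pi ∨ a = .pp ∨ a = .ent ∨ a = .pv ∨ a = .tid) →
      ∀ i, s1.m a i = 0 := fun a ha i => by
    rw [w1 a (.inr ha)]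
    exact if_neg (by rcases ha with rfl | rfl | rfl | rfl | rfl <;> simp [Arr.num])
  have in1 : (G.source c.code c.R).IsInput (s1.m .tok) := by
    rw [w1 _ (by simp)]; exact G.source_isInput c.code c.R
  have hDN : h1.dag.N = N := hN.symm
  have hDR : ∀ u < h1.dag.N, h1.dag.deg u ≤ c.R := fun u hu => h1.deg_le c.rank_le hu
  have hDV : h1.dag.N + c.R + h1.dag.μ h1.dag.root ≤ V := by rw [hDN, h1.μ_dag_root]; omega
  have order := h1.isOrder_dag
  rw [← hN] at l1
  clear f1 w1 hs key
  refine (reaches_countPaths h1.dag (coef_seq_left hB) hDV hDR b1 (l1.trans hN)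
    (by rw [in1.2.1]; exact congrArg _ (r1 _ G.start.2)) (fun _ _ => rfl) (fun _ _ _ _ => rfl) order
    (z1 _ (by simp)) (z1 _ (by simp)) (z1 _ (by simp))).frame.seq fun s2 b2 ⟨⟨r2, p2, e2⟩, f2⟩ => ?_
  replace hB := coef_seq_right hB
  have m2 : ∀ a : Arr, a ≠ .pi → a ≠ .pp → a ≠ .ent → s2.m a = s1.m a := fun a ha hb hc =>
    f2.1 a (by simp [countPaths, accum, ha, hb, hc])
  have l2 : s2.r .len = N := (f2.2 _ (by simp [countPaths, accum])).trans l1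
  replace order : h1.dag.IsOrder (s2.m .queue) := by
    rw [m2 _ (by simp) (by simp) (by simp)]; exact order
  refine (reaches_decompose h1.dag (coef_seq_left hB) hDV hDR b2 (l2.trans hN)
    (fun u _ => by rw [m2 _ (by simp) (by simp) (by simp)]; rfl)
    (fun u _ j _ => by rw [m2 _ (by simp) (by simp) (by simp)]; rfl) order p2 e2
    (fun v => by rw [m2 _ (by simp) (by simp) (by simp), z1 _ (by simp)])).seq
    fun s3 b3 ⟨⟨n3, d3⟩, f3⟩ => ?_
  replace hB := coef_seq_right hB
  have m3 : ∀ a : Arr, (a ≠ .n ∧ a ≠ .pn ∧ a ≠ .ext ∧ a ≠ .ent ∧ a ≠ .nx ∧ a ≠ .pv) →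
      s3.m a = s2.m a := fun a ha => f3.1 a fun h => by have := writes_decompose h; tauto
  have l3 : s3.r .len = N := (f3.2 _ fun h => by simpa using sets_decompose h).trans l2
  have r3 : s3.r .root = h1.dag.root := (f3.2 _ fun h => by simpa using sets_decompose h).trans r2
  replace order : h1.dag.IsOrder (s3.m .queue) := by rw [m3 _ (by simp)]; exact order
  have m31 : ∀ a : Arr, (a ≠ .n ∧ a ≠ .pn ∧ a ≠ .ext ∧ a ≠ .ent ∧ a ≠ .nx ∧ a ≠ .pv) → a ≠ .pi →
    a ≠ .pp → s3.m a = s1.m a := fun a ha h h' => (m3 a ha).trans (m2 a h h' ha.2.2.2.1)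
  let P := h1.plan c rfl d3
  let Λ := h1.labelling c rfl rfl d3
  have hP : P.bound ≤ V := by
    have : P.bound = 3 * N + c.R + c.numbering.size + 8 * (G.derivationTree.size + 1) + 8 := by
      rw [← h1.μ_dag_root, hN]; rfl
    omega
  have hL : Loaded P s3 :=
    { tyOf := fun t ht => by rw [m31 _ (by simp) (by simp) (by simp)]; exact t1 t ht
      tok := fun u hu _ => by rw [m31 _ (by simp) (by simp) (by simp)]; exact in1.2.2 u hu
      deg := fun u _ => by rw [m31 _ (by simp) (by simp) (by simp)]; rfl
      ch := fun u _ j _ => by rw [m31 _ (by simp) (by simp) (by simp)]; rfl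
      pi := fun u hu => by rw [m3 _ (by simp)]; exact (p2 u hu).1
      pp := fun u hu hp => by rw [m3 _ (by simp), (p2 u hu).2]; exact Dag.fl_of_pos hp
      pn := n3
      nx := rfl
      pv := rfl
      ent := rfl
      ext := rfl }
  refine (amort_mergePaths (P := P) hP (coef_seq_left hB) b3 hL (l3.trans hN) order
    (fun q => by rw [m31 _ (by simp) (by simp) (by simp), z1 _ (by simp)])).seq
    fun s4 b4 ⟨⟨h4, h4'⟩, f4⟩ => ?_
  replace hB := coef_seq_right hB
  have hI : P.Complete s4.instrs := ⟨h4, h4'⟩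
  have hset : ∀ x : Reg, (x = .len ∨ x = .root) → s4.r x = s3.r x := fun x hx => f4.2 x fun h => by
    rw [mergePaths, sets_forTo] at h
    rcases h with rfl | h
    · simp at hx
    · have := sets_processNode h; tauto
  obtain ⟨H, v1, v2, v3, v4⟩ := Λ.exists_slp hI
  replace v4 : H.encode c.code = 3 * N * (L.m + 1) :: 3 * h1.dag.root * (L.m + 1) ::
      ((List.range (3 * N)).map fun q => ((c.template (s4.m .tid q)).items c.code).map
        (itemVal k (L.m + 1) s4 q)).flatten := by rw [hN]; exact v4
  have e1 : 3 * N * (L.m + 1) = N * (3 * (L.m + 1)) := by ring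
  have e2 : 3 * N * maxItems c = N * (3 * maxItems c) := by ring
  have hHc : H.card = 3 * N * (L.m + 1) := (List.cons.inj v4).1
  refine (reaches_emitAll (N := N) (root := h1.dag.root) (ℓ := maxItems c) hB b4
    (by rw [e1, e2]; omega) (hDN ▸ h1.dag.root_lt) ((hset _ (by simp)).trans l3)
    ((hset _ (by simp)).trans r3)
    (fun q hq => Λ.tid_lt hI (by rw [hN] at hq; exact hq))
    (fun t ht => Finset.single_le_sum (f := fun t => ((c.template t).items c.code).length)
      (by simp) (Finset.mem_range.2 ht)) fun q hq x hx => ?_).mono le_rfl fun s5 b5 h5 => ?_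
  · have hm : itemVal k (L.m + 1) s4 q x ∈ H.encode c.code := by
      rw [v4]
      refine List.mem_cons_of_mem _ (List.mem_cons_of_mem _ (List.mem_flatten.2 ⟨_,
        List.mem_map.2 ⟨q, List.mem_range.2 hq, rfl⟩, List.mem_map.2 ⟨x, hx, rfl⟩⟩))
    have := H.lt_of_mem_encode c.code hm
    rw [hHc, e1] at this
    omega
  · have hv : G.value A = ⟨_, (G.tree h1.dag.root).2.groundEval A⟩ := by
      rw [h1.tree_dag_root]; rfl
    refine ⟨H, fun i hi => ?_, v1.trans hv.symm, ?_, ?_⟩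
    · simp only [v4] at hi ⊢
      exact h5.2 i hi
    · rw [← h1.sum_deg]; exact v3
    · rw [← h1.μ_dag_root]; exact v2

end RAM

end CircuitBalancing

open CircuitBalancing

theorem mainTheorem2 {S : Type*} [Finite S] (Γ : Signature S) {k : ℕ} (code : Γ.Symb ≃ Fin k)
    (A : SortedAlgebra Γ) (hA : HasFiniteSubsumptionBase A) :
    ∃ (P : RAM.Program) (C : ℕ), ∀ G : SLP Γ, ∃ (H : SLP Γ) (T : ℕ) (s : RAM.State),
      RAM.Exec (C * (G.derivationTree.size + G.size + G.card)) P
        (RAM.State.init (G.encode code)) T s ∧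
      T ≤ C * (G.size + G.card) ∧
      s.Outputs (H.encode code) ∧
      H.value A = G.value A ∧
      H.size ≤ C * G.size ∧
      H.depth ≤ C * Nat.log 2 (G.derivationTree.size + 2) := by
  by_cases hc : ∃ f, Γ.rank f = 0
  swap
  · -- without constants there are no ground terms, hence no straight-line programs
    have key : ∀ p, GroundTerm Γ p → ∃ f, Γ.rank f = 0 := fun p t => by
      induction t with
      | var i => exact i.elim0
      | op f args ih =>
        rcases Nat.eq_zero_or_pos (Γ.rank f) with h | h
        exacts [⟨f, h⟩, ih ⟨0, h⟩]
    exact ⟨.skip, 0, fun G => (hc (key _ G.derivationTree)).elim⟩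
  obtain ⟨f, hf⟩ := hc
  obtain ⟨L⟩ := hA.nonempty_base f hf
  obtain ⟨c, hR1, rfl⟩ := nonempty_coding L code
  obtain ⟨a, ha⟩ : ∃ a, a = c.R + 3 * (L.m + 1) + 3 * RAM.maxItems c + 4 := ⟨_, rfl⟩
  obtain ⟨b, hb⟩ : ∃ b, b = c.R + c.numbering.size + c.nC + k + 18 := ⟨_, rfl⟩
  refine ⟨RAM.balance c, (RAM.balance c).coef * (a + b + 9) + 2 * RAM.balanceCost c +
    3 * c.sizeBound + 49 * c.depthBound, fun G => ?_⟩
  have hl := G.length_subs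
  have hpos : 0 < G.card := G.start.pos
  -- `V` bounds all words that are stored; the coefficients of the program account for the
  -- intermediate results, which `B` bounds
  obtain ⟨T, hT, s, hE, -, H, h1, h2, h3, h4⟩ := RAM.reaches_balance c hR1 G
    (V := G.subs.length * a + 8 * G.derivationTree.size + b)
    (B := ((RAM.balance c).coef * (a + b + 9) + 2 * RAM.balanceCost c +
      3 * c.sizeBound + 49 * c.depthBound) * (G.derivationTree.size + G.size + G.card))
    (by rw [ha, hb]) (by
      have : G.subs.length * a + 8 * G.derivationTree.size + b + 1 ≤
          (a + b + 9) * (G.derivationTree.size + G.size + G.card) := by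
        rw [hl]; nlinarith [Nat.zero_le (a * G.derivationTree.size),
          Nat.zero_le (b * (G.derivationTree.size + G.size))]
      calc _ ≤ (RAM.balance c).coef *
            ((a + b + 9) * (G.derivationTree.size + G.size + G.card)) := Nat.mul_le_mul_left _ this
        _ ≤ _ := by rw [← mul_assoc]; exact Nat.mul_le_mul_right _ (by omega))
  refine ⟨H, T, s, hE, hT.trans ?_, h1, h2, h3.trans (Nat.mul_le_mul_right _ (by omega)),
    h4.trans ?_⟩
  · calc _ ≤ RAM.balanceCost c * (2 * (G.size + G.card)) := Nat.mul_le_mul_left _ (by omega)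
      _ = 2 * RAM.balanceCost c * (G.size + G.card) := by ring
      _ ≤ _ := Nat.mul_le_mul_right _ (by omega)
  · -- the logarithm is positive, hence it absorbs the additive constant
    have h5 : Nat.log 2 (G.derivationTree.size + 1) ≤ Nat.log 2 (G.derivationTree.size + 2) :=
      Nat.log_mono_right (by omega)
    have h6 : 1 ≤ Nat.log 2 (G.derivationTree.size + 2) := Nat.log_pos one_lt_two (by omega)
    calc _ ≤ c.depthBound * (49 * Nat.log 2 (G.derivationTree.size + 2)) :=
          Nat.mul_le_mul_left _ (by omega)
      _ = 49 * c.depthBound * Nat.log 2 (G.derivationTree.size + 2) := by ring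
      _ ≤ _ := Nat.mul_le_mul_right _ (by omega)
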